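/- Machine model: a RAM with $b$-bit words and unit-cost word operations ($+,-,\times,\mathrm{div}$, shifts, bitwise operations, most significant bit, comparison, indirect addressing), whose memory is zero outside the input. A real $\epsilon>0$ is given to programs as two words, its integer part (at most $2^b-1$) and the first $b$ binary digits of its fractional part. A multiplicatively $(1+\epsilon)$-approximate van Emde Boas structure on $\{0,\dots,U\}$ maintains an ordered multiset of elements with data items under Insert, Delete, Search, Minimum, Maximum, Predecessor, Successor, Data and Element, such that its answers are those of an exact structure operating on the elements after they are mapped by a fixed monotone function $f$ with $f(x)<f(y)$ whenever $x<y$ and $(1+\epsilon)x\le y$. Theorem. There are a program (uniform in all parameters) for this structure and constants $\kappa, C$ such that the following hold. (a) On words of $b\ge\kappa\log_2(n+U+2)$ bits and for every real $\epsilon>0$, the program implements a multiplicatively $(1+\epsilon)$-approximate van Emde Boas structure on $\{0,\dots,U\}$ for up to $n$ simultaneous entries. Instantiation and every operation take at most $C\log\bigl(2+\frac{\log(2+\log(2+U)/\epsilon)}{\log(2+b)}\bigr)$ steps. (b) Let $G$ be a connected graph with $n$ nodes and $m$ edges, given as a list of its edges with integer weights in $\{0,\dots,U\}$, let $\epsilon>0$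 be real, and let $b\ge\kappa\log_2(n+U+2)$. Then Prim's algorithm, with this structure as its priority queue, outputs a spanning tree of $G$ of weight at most $(1+\epsilon)$ times the minimum weight of a spanning tree, after at most $$C\,(n+m)\,\log\Bigl(2+\frac{\log(1+1/\epsilon)}{\log\log(nU+16)}\Bigr)$$ steps. (c) In particular, for every natural number $c$ there is a constant $C'$ such that the algorithm takes at most $C'(n+m)$ steps on all inputs as in (b) with $1/\epsilon\le c\,(1+\log(nU+1))^c$. -/

import Mathlib

namespace WordRAM

/-! ## A random access machine with words of `b` bits

Programs are finite structured programs over word-valued registers and a word-addressed memory.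
The word size `b` is a parameter of the execution, not of the program. -/

/-- A register of the machine. -/
structure Reg where
  idx : ℕ
deriving DecidableEq

/-- The binary machine operations. -/
inductive BinOp
  | add | sub | mul | div | shl | shr | band | bor | bxor | lt | eq

/-- The result of a binary operation on two `b`-bit words. -/
def BinOp.eval (b : ℕ) : BinOp → ℕ → ℕ → ℕ
  | .add, x, y => (x + y) % 2 ^ b
  | .sub, x, y => (x + 2 ^ b - y) % 2 ^ b
  | .mul, x, y => (x * y) % 2 ^ b
  | .div, x, y => x / y
  | .shl, x, y => (x * 2 ^ y) % 2 ^ b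
  | .shr, x, y => x / 2 ^ y
  | .band, x, y => x &&& y
  | .bor, x, y => x ||| y
  | .bxor, x, y => x ^^^ y
  | .lt, x, y => if x < y then 1 else 0
  | .eq, x, y => if x = y then 1 else 0

/-- Expressions: literals, registers, memory reads, the index of the most significant bit, and
the binary operations. -/
inductive Expr
  | lit (c : ℕ)
  | reg (r : Reg)
  | load (a : Expr)
  | msb (e : Expr)
  | bin (o : BinOp) (e₁ e₂ : Expr)

/-- A configuration: the contents of the registers and of the memory. -/
@[ext] structure State where
  regs : Reg → ℕ
  mem : ℕ → ℕ

/-- The value of an expression. -/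
def Expr.eval (b : ℕ) (s : State) : Expr → ℕ
  | .lit c => c % 2 ^ b
  | .reg r => s.regs r
  | .load a => s.mem (a.eval b s)
  | .msb e => Nat.log 2 (e.eval b s)
  | .bin o e₁ e₂ => o.eval b (e₁.eval b s) (e₂.eval b s)

/-- The number of machine steps that evaluate an expression: one for each node. -/
def Expr.cost : Expr → ℕ
  | .lit _ => 1
  | .reg _ => 1
  | .load a => a.cost + 1
  | .msb e => e.cost + 1
  | .bin _ e₁ e₂ => e₁.cost + e₂.cost + 1

instance (c : ℕ) : OfNat Expr c := ⟨.lit c⟩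
instance : Coe Reg Expr := ⟨.reg⟩
instance : Add Expr := ⟨.bin .add⟩
instance : Sub Expr := ⟨.bin .sub⟩
instance : Mul Expr := ⟨.bin .mul⟩
instance : Div Expr := ⟨.bin .div⟩

/-- Programs. `ite` and `while` test whether a word is non-zero. `call r body args` runs `body`
with private registers, the first of which hold the arguments, on the common memory, and puts the
final content of the first private register into `r`. -/
inductive Cmd
  | skip
  | assign (r : Reg) (e : Expr)
  | store (a e : Expr)
  | seq (c₁ c₂ : Cmd)
  | ite (e : Expr) (c₁ c₂ : Cmd)
  | while (e : Expr) (c : Cmd)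
  | call (r : Reg) (body : Cmd) (args : List Expr)

infixr:60 " ;; " => Cmd.seq
infix:61 " ::= " => Cmd.assign

/-- The private registers at the start of a procedure with the given arguments. -/
def argRegs (args : List ℕ) : Reg → ℕ := fun r => args.getD r.idx 0

/-- `Exec b c s t s'`: on words of `b` bits, the program `c` started in the configuration `s`
halts after exactly `t` steps in the configuration `s'`. -/
inductive Exec (b : ℕ) : Cmd → State → ℕ → State → Prop
  | skip (s : State) : Exec b .skip s 1 s
  | assign (s : State) (r : Reg) (e : Expr) :
      Exec b (.assign r e) s (e.cost + 1) ⟨Function.update s.regs r (e.eval b s), s.mem⟩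
  | store (s : State) (a e : Expr) :
      Exec b (.store a e) s (a.cost + e.cost + 1)
        ⟨s.regs, Function.update s.mem (a.eval b s) (e.eval b s)⟩
  | seq {s s₁ s₂ : State} {t₁ t₂ : ℕ} {c₁ c₂ : Cmd} :
      Exec b c₁ s t₁ s₁ → Exec b c₂ s₁ t₂ s₂ → Exec b (.seq c₁ c₂) s (t₁ + t₂) s₂
  | ite_true {s s' : State} {t : ℕ} {e : Expr} {c₁ c₂ : Cmd} :
      e.eval b s ≠ 0 → Exec b c₁ s t s' → Exec b (.ite e c₁ c₂) s (e.cost + 1 + t) s'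
  | ite_false {s s' : State} {t : ℕ} {e : Expr} {c₁ c₂ : Cmd} :
      e.eval b s = 0 → Exec b c₂ s t s' → Exec b (.ite e c₁ c₂) s (e.cost + 1 + t) s'
  | while_true {s s₁ s₂ : State} {t₁ t₂ : ℕ} {e : Expr} {c : Cmd} :
      e.eval b s ≠ 0 → Exec b c s t₁ s₁ → Exec b (.while e c) s₁ t₂ s₂ →
      Exec b (.while e c) s (e.cost + 1 + t₁ + t₂) s₂
  | while_false {s : State} {e : Expr} {c : Cmd} :
      e.eval b s = 0 → Exec b (.while e c) s (e.cost + 1) s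
  | call {s s' : State} {t : ℕ} {r : Reg} {body : Cmd} {args : List Expr} :
      Exec b body ⟨argRegs (args.map (Expr.eval b s)), s.mem⟩ t s' →
      Exec b (.call r body args) s ((args.map Expr.cost).sum + 1 + t)
        ⟨Function.update s.regs r (s'.regs ⟨0⟩), s'.mem⟩

/-- `Runs b body args mem t r mem'`: the procedure `body`, applied to `args` in memory `mem`,
returns the word `r` and leaves the memory `mem'`, after exactly `t` steps. -/
def Runs (b : ℕ) (body : Cmd) (args : List ℕ) (mem : ℕ → ℕ) (t r : ℕ) (mem' : ℕ → ℕ) : Prop :=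
  ∃ regs' : Reg → ℕ, Exec b body ⟨argRegs args, mem⟩ t ⟨regs', mem'⟩ ∧ regs' ⟨0⟩ = r

/-- The integer part of `ε ≥ 0` as a machine word (the largest word if it does not fit). -/
noncomputable def intWord (b : ℕ) (ε : ℝ) : ℕ := min ⌊ε⌋₊ (2 ^ b - 1)

/-- The fractional part of `ε ≥ 0`, truncated to `b` binary digits, as a machine word. Thus a
real `ε` is represented by the number `i + j / 2 ^ b` with `i = intWord b ε` and
`j = fracWord b ε`. -/
noncomputable def fracWord (b : ℕ) (ε : ℝ) : ℕ := ⌊Int.fract ε * 2 ^ b⌋₊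

/-! ## Multiplicatively approximate van Emde Boas structures -/

/-- The procedures of a van Emde Boas data structure. Every one of them takes as its first
argument the address at which the storage of the structure begins. -/
structure VEBCode where
  /-- `new (q, U, i, j)`: instantiate on the universe `{0, …, U}` with error `i + j / 2 ^ b`. -/
  new : Cmd
  /-- `insert (q, x, d)`: insert the element `x` with data item `d` and return its name. -/
  insert : Cmd
  /-- `delete (q, N)` -/
  delete : Cmd
  /-- `search (q, x)` -/
  search : Cmd
  /-- `minimum (q)` -/
  minimum : Cmd
  /-- `maximum (q)` -/
  maximum : Cmd
  /-- `predecessor (q, N)` -/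
  predecessor : Cmd
  /-- `successor (q, N)` -/
  successor : Cmd
  /-- `data (q, N)` -/
  data : Cmd
  /-- `element (q, N)` -/
  element : Cmd

/-- An entry of the structure: a name, an element and a data item. -/
structure Item where
  name : ℕ
  elem : ℕ
  data : ℕ

/-- The operations with their arguments. -/
inductive Op
  | insert (x d : ℕ)
  | delete (N : ℕ)
  | search (x : ℕ)
  | minimum
  | maximum
  | predecessor (N : ℕ)
  | successor (N : ℕ)
  | data (N : ℕ)
  | element (N : ℕ)

/-- The procedure that carries out an operation. -/
def Op.code (V : VEBCode) : Op → Cmd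
  | .insert _ _ => V.insert
  | .delete _ => V.delete
  | .search _ => V.search
  | .minimum => V.minimum
  | .maximum => V.maximum
  | .predecessor _ => V.predecessor
  | .successor _ => V.successor
  | .data _ => V.data
  | .element _ => V.element

/-- The arguments of an operation. -/
def Op.args : Op → List ℕ
  | .insert x d => [x, d]
  | .delete N => [N]
  | .search x => [x]
  | .minimum => []
  | .maximum => []
  | .predecessor N => [N]
  | .successor N => [N]
  | .data N => [N]
  | .element N => [N]

/-- The operation may be applied to a structure that holds the list `L`: elements belong to
`{0, …, U}`, data items are words, at most `n` entries are held at any time, and operations on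
names refer to names in use. -/
def Op.Valid (b U n : ℕ) (L : List Item) : Op → Prop
  | .insert x d => x ≤ U ∧ d < 2 ^ b ∧ L.length < n
  | .search x => x ≤ U
  | .minimum => True
  | .maximum => True
  | .delete N | .predecessor N | .successor N | .data N | .element N => ∃ it ∈ L, it.name = N

/-- The name of an entry, if there is one; `0` is never a name and stands for "nil". -/
def nameOrNil (o : Option Item) : ℕ := (o.map Item.name).getD 0

/-- The contents of a structure, in the order of its list: the names are distinct and not nil, and
the list is ordered by the elements after they are mapped by `f`. -/
def Consistent (f : ℕ → ℕ) (L : List Item) : Prop :=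
  (L.map Item.name).Nodup ∧ (∀ it ∈ L, it.name ≠ 0) ∧ L.Pairwise (fun p q => f p.elem ≤ f q.elem)

/-- The effect of an operation on a structure with contents `L` (result `r`, new contents `L'`):
that of the exact data structure which operates on the elements after they are mapped by `f`. -/
def Op.Effect (f : ℕ → ℕ) (L : List Item) (r : ℕ) (L' : List Item) : Op → Prop
  | .insert x d => ∃ L₁ L₂, L = L₁ ++ L₂ ∧ L' = L₁ ++ ⟨r, x, d⟩ :: L₂
  | .delete N => L' = L.filter (fun it => it.name ≠ N)
  | .search x => L' = L ∧
      ((r = 0 ∧ ∀ it ∈ L, f x < f it.elem) ∨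
        ∃ it ∈ L, it.name = r ∧ f it.elem ≤ f x ∧
          ∀ it' ∈ L, f it'.elem ≤ f x → f it'.elem ≤ f it.elem)
  | .minimum => L' = L ∧ r = nameOrNil L.head?
  | .maximum => L' = L ∧ r = nameOrNil L.getLast?
  | .predecessor N => L' = L ∧
      ∃ L₁ it L₂, L = L₁ ++ it :: L₂ ∧ it.name = N ∧ r = nameOrNil L₁.getLast?
  | .successor N => L' = L ∧
      ∃ L₁ it L₂, L = L₁ ++ it :: L₂ ∧ it.name = N ∧ r = nameOrNil L₂.head?
  | .data N => L' = L ∧ ∃ it ∈ L, it.name = N ∧ r = it.data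
  | .element N => L' = L ∧ ∃ it ∈ L, it.name = N ∧ r = it.elem

/-- On `{0, …, U}`, the map `f` is monotone and preserves the strict order of any two elements
that differ by at least a factor of `1 + ε`. -/
def PreservesOrder (f : ℕ → ℕ) (U : ℕ) (ε : ℝ) : Prop :=
  (∀ x y, x ≤ y → y ≤ U → f x ≤ f y) ∧
  (∀ x y, x < y → y ≤ U → (1 + ε) * (x : ℝ) ≤ (y : ℝ) → f x < f y)

/-- The time per operation, `log log_b ((log U) / ε)`, with the arguments of the logarithms
increased by constants so that it is defined and bounded below for all parameters. -/
noncomputable def vebTime (b U : ℕ) (ε : ℝ) : ℝ :=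
  Real.log (2 + Real.log (2 + Real.log (2 + U) / ε) / Real.log (2 + b))

/-- `V` is a multiplicatively `(1 + ε)`-approximate van Emde Boas structure with
`C * vebTime b U ε` time per operation, on machines with `b ≥ κ * log₂ (n + U + 2)` bits per word.
There is a fixed map `f` on the universe such that, in all the storage from an
address `q` in the lower half of the memory on, initially zero, the procedures maintain a
representation (`Rep mem L`: the memory `mem` represents the contents `L`) of a list ordered
by `f`. They do not change the memory below `q` and do not depend on it. -/
def IsApproxVEB (V : VEBCode) (κ : ℕ) (C : ℝ) : Prop :=
  ∀ (b U : ℕ) (ε : ℝ), 0 < ε → ∃ f : ℕ → ℕ, PreservesOrder f U ε ∧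
    ∀ n q : ℕ, (n + U + 2) ^ κ ≤ 2 ^ b → 2 * q ≤ 2 ^ b →
      ∃ Rep : (ℕ → ℕ) → List Item → Prop,
        (∀ mem L, Rep mem L → Consistent f L) ∧
        (∀ mem mem' L, (∀ a, q ≤ a → mem' a = mem a) → Rep mem L → Rep mem' L) ∧
        (∀ mem, (∀ a, q ≤ a → mem a = 0) → ∃ t r mem',
          Runs b V.new [q, U, intWord b ε, fracWord b ε] mem t r mem' ∧
          (t : ℝ) ≤ C * vebTime b U ε ∧ (∀ a, a < q → mem' a = mem a) ∧ Rep mem' []) ∧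
        (∀ (op : Op) mem L, Rep mem L → op.Valid b U n L → ∃ t r mem' L',
          Runs b (op.code V) (q :: op.args) mem t r mem' ∧
          (t : ℝ) ≤ C * vebTime b U ε ∧ (∀ a, a < q → mem' a = mem a) ∧
          op.Effect f L r L' ∧ Rep mem' L')

/-! ## Prim's algorithm

On input, the first five registers hold `n`, `m`, `U` and the two words of `ε`; the `i`-th edge is
stored in the cells `3 i`, `3 i + 1` (end points) and `3 i + 2` (weight). -/

namespace Prim

def n : Reg := ⟨0⟩
def m : Reg := ⟨1⟩
def U : Reg := ⟨2⟩
def epsInt : Reg := ⟨3⟩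
def epsFrac : Reg := ⟨4⟩
/-- `mem[head + v]`: the first half-edge at the vertex `v`, plus one (zero if there is none). The
half-edges of the edge `i` are `2 i` (at its first end point) and `2 i + 1` (at its second). -/
def head : Reg := ⟨5⟩
/-- `mem[next + h]`: the half-edge after the half-edge `h` in the list of its vertex, plus one. -/
def next : Reg := ⟨6⟩
/-- `mem[status + v]`: `0` if `v` is not reached, `1` if it is queued, `2` if it is in the tree. -/
def status : Reg := ⟨7⟩
/-- `mem[name + v]`: the name of `v` in the queue. -/
def name : Reg := ⟨8⟩
/-- `mem[key + v]`: the least weight of an edge between `v` and the tree. -/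
def key : Reg := ⟨9⟩
/-- `mem[edge + v]`: an edge of that weight. -/
def edge : Reg := ⟨10⟩
/-- The address of the queue. -/
def q : Reg := ⟨11⟩
def i : Reg := ⟨12⟩
def v : Reg := ⟨13⟩
def N : Reg := ⟨14⟩
def h : Reg := ⟨15⟩
def e : Reg := ⟨16⟩
def u : Reg := ⟨17⟩
def x : Reg := ⟨18⟩

open WordRAM.Expr WordRAM.Cmd

/-- Lay out the arrays. -/
def layout : Cmd :=
  head ::= 3 * m ;;
  next ::= head + n ;;
  status ::= next + 2 * m ;;
  name ::= status + n ;;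
  key ::= name + n ;;
  edge ::= key + n ;;
  q ::= edge + n

/-- Build the adjacency lists. -/
def adjacency : Cmd :=
  i ::= 0 ;;
  .while (bin .lt i m) (
    v ::= load (3 * i) ;;
    store (next + 2 * i) (load (head + v)) ;;
    store (head + v) (2 * i + 1) ;;
    v ::= load (3 * i + 1) ;;
    store (next + 2 * i + 1) (load (head + v)) ;;
    store (head + v) (2 * i + 2) ;;
    i ::= i + 1)

/-- Examine the edge `e` of weight `x` from the tree to `u`. If `u` is queued with a larger
key, it is deleted from the queue; if it then is not queued, it is inserted with the key `x`. -/
def relax (V : VEBCode) : Cmd :=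
  ite (bin .band (bin .eq (load (status + u)) 1) (bin .lt x (load (key + u))))
    (call N V.delete [q, load (name + u)] ;;
      store (status + u) 0)
    skip ;;
  ite (bin .eq (load (status + u)) 0)
    (store (status + u) 1 ;;
      store (key + u) x ;;
      store (edge + u) e ;;
      call N V.insert [q, x, u] ;;
      store (name + u) N)
    skip

/-- Move a vertex with minimum key from the queue to the tree, and examine its edges. -/
def scan (V : VEBCode) : Cmd :=
  call v V.data [q, N] ;;
  call N V.delete [q, N] ;;
  store (status + v) 2 ;;
  h ::= load (head + v) ;;
  .while h (
    e ::= (h - 1) / 2 ;;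
    u ::= load (3 * e + bin .band h 1) ;;
    x ::= load (3 * e + 2) ;;
    relax V ;;
    h ::= load (next + h - 1))

/-- Prim's algorithm, grown from the vertex `0`, with `V` as its priority queue. -/
def prim (V : VEBCode) : Cmd :=
  layout ;;
  adjacency ;;
  call N V.new [q, U, epsInt, epsFrac] ;;
  store status 1 ;;
  call N V.insert [q, 0, 0] ;;
  store name N ;;
  call N V.minimum [q] ;;
  .while N (
    scan V ;;
    call N V.minimum [q])

end Prim

/-- The list `es` contains every edge of `G` exactly once, in one of its two orientations. -/
def IsEdgeList {n : ℕ} (G : SimpleGraph (Fin n)) (es : List (Fin n × Fin n)) : Prop :=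
  (es.map (fun p => s(p.1, p.2))).Nodup ∧ ∀ e, e ∈ es.map (fun p => s(p.1, p.2)) ↔ e ∈ G.edgeSet

/-- The initial configuration. All the memory outside the list of edges is zero. -/
noncomputable def input (b : ℕ) {n : ℕ} (es : List (Fin n × Fin n)) (w : Sym2 (Fin n) → ℕ) (U : ℕ)
    (ε : ℝ) : State where
  regs := argRegs [n, es.length, U, intWord b ε, fracWord b ε]
  mem := fun a => match es[a / 3]? with
    | none => 0
    | some p => if a % 3 = 0 then p.1 else if a % 3 = 1 then p.2 else w s(p.1, p.2)

/-- The output: the graph whose edges are those recorded for the vertices other than `0`. -/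
def outputTree {n : ℕ} (es : List (Fin n × Fin n)) (s : State) : SimpleGraph (Fin n) :=
  SimpleGraph.fromEdgeSet {e | ∃ (v : Fin n) (p : Fin n × Fin n), v.val ≠ 0 ∧
    es[s.mem (s.regs Prim.edge + v)]? = some p ∧ e = s(p.1, p.2)}

open Classical in
/-- The total weight of the edges of `T`. -/
noncomputable def weight {n : ℕ} (w : Sym2 (Fin n) → ℕ) (T : SimpleGraph (Fin n)) : ℕ :=
  ∑ e ∈ T.edgeFinset, w e

/-- `T` is a spanning tree of `G`. -/
def IsSpanningTree {n : ℕ} (G T : SimpleGraph (Fin n)) : Prop := T ≤ G ∧ T.IsTree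

/-- `T` is a spanning tree of `G` of weight at most `1 + ε` times the minimum. -/
def IsApproxMST {n : ℕ} (G : SimpleGraph (Fin n)) (w : Sym2 (Fin n) → ℕ) (ε : ℝ)
    (T : SimpleGraph (Fin n)) : Prop :=
  IsSpanningTree G T ∧
    ∀ T', IsSpanningTree G T' → (weight w T : ℝ) ≤ (1 + ε) * (weight w T' : ℝ)

/-- On words of `b` bits, Prim's algorithm with the priority queue `V` halts after at most `time`
steps, and its output is a `(1 + ε)`-approximate minimum spanning tree of `G`. -/
def PrimSolves (V : VEBCode) (b : ℕ) {n : ℕ} (G : SimpleGraph (Fin n)) (w : Sym2 (Fin n) → ℕ)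
    (es : List (Fin n × Fin n)) (U : ℕ) (ε time : ℝ) : Prop :=
  ∃ (t : ℕ) (s : State), Exec b (Prim.prim V) (input b es w U ε) t s ∧
    (t : ℝ) ≤ time ∧ IsApproxMST G w ε (outputTree es s)

end WordRAM

open WordRAM

/-!
A van Emde Boas structure whose error is a factor `1 + ε` need not tell apart all the elements of
`{0, …, U}`. It orders them by their *keys* `trunc k x`: the element is rounded down to a floating
point number with `k` bits after the leading one, and the key is the rank of that number. The key is
monotone in `x`, and if `2 ^ k` is at least about `1 / ε`, then a factor of `1 + ε` separates keys
(`preservesOrder_trunc`). The two words of `ε` determine such a `k` with `2 ^ k = O(1 / ε)`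
(`precision_spec`), so that the greatest key is `O(log U / ε)` (`trunc_le_mul`).

The set of keys in use is held by a van Emde Boas tree (`Holds`). Every node stores the least and
the greatest element of its set, and only the elements between them, its `inner` elements, are
passed on to a summary (their high halves) and to clusters (their low halves). As both ends are kept
out of the recursion, an update goes on in exactly one subtree: when a cluster becomes non-empty or
empty, this takes constant time at its root, and the update continues in the summary. An insertion
or deletion is therefore a plain loop with one iteration per level (`halts_insertLoop`,
`halts_deleteLoop`), and the search for a predecessor goes down and up once (`halts_pred`). A leaf
is a bitmap in a single word, on which word operations replace the recursion; its elements have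
`log₂ b` bits. Since each level halves the number of bits, a universe of `log (log U / ε)` bits
takes `O(log (log (log U / ε) / log b))` levels (`height_le`). The memory is zero at first, which is
the empty tree, so no time is spent on initialization; and as `trunc k U ≤ U`, all addresses fit
into a word.

The entries form a doubly linked list in the order of their keys, and each key points to the last
entry that has it (`Rep`). An element is located by at most one predecessor search among the keys,
which also yields the place of a new entry; a deletion changes the set of keys only if the key loses
its only entry. All other operations read a single cell. Names of deleted entries are kept in a list
and used again (`NameSupply`), so that the storage is bounded by the number of simultaneous entries.

Prim's algorithm with such a queue adds an edge that is least among those that leave the tree *after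
weights are mapped by a map that separates a factor of `1 + ε`*; its weight is thus at most `1 + ε`
times that of any other edge that leaves the tree. Any spanning tree can be turned into one that
contains the edges chosen so far by exchanging, at each choice, an edge across the same cut
(`exists_exchange`), and each exchange costs at most a factor `1 + ε` on the edge that is given up,
which is why the total is within a factor `1 + ε` (`IsGoodTree.insert`). Each vertex is extracted
once and each half-edge examined once, so that there are `O(n + m)` queue operations
(`halts_primLoop`, `halts_prim`). Finally, a word has at least `log (n * U)` bits, so `log (log U /
ε) / log b` is at most a constant plus `log (1 + 1 / ε) / log b`, where `log b` is at least `log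
(log (n * U))` up to a constant, and the time per operation is as claimed (`vebTime_le`); if `1 / ε`
is polylogarithmic in `n * U`, it is bounded (`log_le_of_polylog`).
-/

set_option linter.unusedSimpArgs false
set_option linter.unusedSectionVars false

open WordRAM

namespace WordRAM

open Function

/-! ### Total correctness of commands -/

/-- Started in `s`, the command `c` halts within `T` steps in a configuration that satisfies `P`. -/
def Halts (b : ℕ) (c : Cmd) (s : State) (T : ℕ) (P : State → Prop) : Prop :=
  ∃ t s', Exec b c s t s' ∧ t ≤ T ∧ P s'

/-- The procedure `body`, applied to `args` in memory `mem`, halts within `T` steps, and its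
result and the final memory satisfy `P`. -/
def Returns (b : ℕ) (body : Cmd) (args : List ℕ) (mem : ℕ → ℕ) (T : ℕ)
    (P : ℕ → (ℕ → ℕ) → Prop) : Prop :=
  Halts b body ⟨argRegs args, mem⟩ T (fun s => P (s.regs ⟨0⟩) s.mem)

/-- Commands without loops. -/
def Cmd.LoopFree : Cmd → Prop
  | .skip => True
  | .assign _ _ => True
  | .store _ _ => True
  | .seq c₁ c₂ => c₁.LoopFree ∧ c₂.LoopFree
  | .ite _ c₁ c₂ => c₁.LoopFree ∧ c₂.LoopFree
  | .while _ _ => False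
  | .call _ body _ => body.LoopFree

/-- The final configuration of a command without loops (loops are skipped). -/
def Cmd.run (b : ℕ) : Cmd → State → State
  | .skip, s => s
  | .assign r e, s => ⟨update s.regs r (e.eval b s), s.mem⟩
  | .store a e, s => ⟨s.regs, update s.mem (a.eval b s) (e.eval b s)⟩
  | .seq c₁ c₂, s => c₂.run b (c₁.run b s)
  | .ite e c₁ c₂, s => if e.eval b s = 0 then c₂.run b s else c₁.run b s
  | .while _ _, s => s
  | .call r body args, s =>
      ⟨update s.regs r ((body.run b ⟨argRegs (args.map (Expr.eval b s)), s.mem⟩).regs ⟨0⟩),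
        (body.run b ⟨argRegs (args.map (Expr.eval b s)), s.mem⟩).mem⟩

/-- A bound for the running time of a command without loops. -/
def Cmd.len : Cmd → ℕ
  | .skip => 1
  | .assign _ e => e.cost + 1
  | .store a e => a.cost + e.cost + 1
  | .seq c₁ c₂ => c₁.len + c₂.len
  | .ite e c₁ c₂ => e.cost + 1 + (c₁.len + c₂.len)
  | .while _ _ => 0
  | .call _ body args => (args.map Expr.cost).sum + 1 + body.len

theorem exec_run (b : ℕ) (c : Cmd) (hc : c.LoopFree) (s : State) :
    ∃ t, Exec b c s t (c.run b s) ∧ t ≤ c.len := by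
  induction c generalizing s with
  | skip => exact ⟨_, .skip s, le_rfl⟩
  | assign r e => exact ⟨_, .assign s r e, le_rfl⟩
  | store a e => exact ⟨_, .store s a e, le_rfl⟩
  | seq c₁ c₂ h₁ h₂ =>
    obtain ⟨t₁, e₁, l₁⟩ := h₁ hc.1 s
    obtain ⟨t₂, e₂, l₂⟩ := h₂ hc.2 (c₁.run b s)
    exact ⟨_, .seq e₁ e₂, Nat.add_le_add l₁ l₂⟩
  | ite e c₁ c₂ h₁ h₂ =>
    by_cases h : e.eval b s = 0
    · obtain ⟨t₂, e₂, l₂⟩ := h₂ hc.2 s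
      exact ⟨e.cost + 1 + t₂, by rw [Cmd.run, if_pos h]; exact .ite_false h e₂,
        by simp only [Cmd.len]; omega⟩
    · obtain ⟨t₂, e₂, l₂⟩ := h₁ hc.1 s
      exact ⟨e.cost + 1 + t₂, by rw [Cmd.run, if_neg h]; exact .ite_true h e₂,
        by simp only [Cmd.len]; omega⟩
  | call r body args h =>
    obtain ⟨t, e, l⟩ := h hc ⟨argRegs (args.map (Expr.eval b s)), s.mem⟩
    exact ⟨_, .call e, by simp only [Cmd.len]; omega⟩
  -- Only loops remain.
  | _ => exact hc.elim

section

variable {b : ℕ} {c c₁ c₂ : Cmd} {s : State} {T T₁ T₂ T' : ℕ} {P Q : State → Prop} {e : Expr}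

theorem Halts.mono (h : Halts b c s T P) (hT : T ≤ T') (hP : ∀ s, P s → Q s) :
    Halts b c s T' Q := by
  obtain ⟨t, s', e, l, p⟩ := h
  exact ⟨t, s', e, l.trans hT, hP _ p⟩

theorem Halts.of_run (hc : c.LoopFree) (hP : P (c.run b s)) : Halts b c s c.len P := by
  obtain ⟨t, e, l⟩ := exec_run b c hc s
  exact ⟨t, _, e, l, hP⟩

theorem Halts.seq (h : Halts b c₁ s T₁ (fun s' => Halts b c₂ s' T₂ P)) :
    Halts b (.seq c₁ c₂) s (T₁ + T₂) P := by
  obtain ⟨t₁, s₁, e₁, l₁, t₂, s₂, e₂, l₂, p⟩ := h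
  exact ⟨_, _, .seq e₁ e₂, Nat.add_le_add l₁ l₂, p⟩

theorem Halts.run_seq (hc : c₁.LoopFree) (h : Halts b c₂ (c₁.run b s) T P) :
    Halts b (.seq c₁ c₂) s (c₁.len + T) P :=
  .seq (.of_run hc h)

theorem Halts.ite (h₁ : e.eval b s ≠ 0 → Halts b c₁ s T P)
    (h₂ : e.eval b s = 0 → Halts b c₂ s T P) : Halts b (.ite e c₁ c₂) s (e.cost + 1 + T) P := by
  by_cases h : e.eval b s = 0
  · obtain ⟨t, s', e, l, p⟩ := h₂ h
    exact ⟨_, _, .ite_false h e, by omega, p⟩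
  · obtain ⟨t, s', e, l, p⟩ := h₁ h
    exact ⟨_, _, .ite_true h e, by omega, p⟩

theorem Halts.while_false (h : e.eval b s = 0) (hP : P s) :
    Halts b (.while e c) s (e.cost + 1) P :=
  ⟨_, _, .while_false h, le_rfl, hP⟩

theorem Halts.while_true (h : e.eval b s ≠ 0)
    (hP : Halts b c s T₁ (fun s' => Halts b (.while e c) s' T₂ P)) :
    Halts b (.while e c) s (e.cost + 1 + T₁ + T₂) P := by
  obtain ⟨t₁, s₁, e₁, l₁, t₂, s₂, e₂, l₂, p⟩ := hP
  exact ⟨_, _, .while_true h e₁ e₂, by omega, p⟩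

theorem Halts.while_run (h : e.eval b s ≠ 0) (hc : c.LoopFree)
    (hP : Halts b (.while e c) (c.run b s) T P) :
    Halts b (.while e c) s (e.cost + 1 + c.len + T) P :=
  .while_true h (.of_run hc hP)

theorem Halts.call {r : Reg} {args : List Expr} {R : ℕ → (ℕ → ℕ) → Prop}
    (h : Returns b c (args.map (Expr.eval b s)) s.mem T R)
    (hP : ∀ v mem', R v mem' → P ⟨update s.regs r v, mem'⟩) :
    Halts b (.call r c args) s ((args.map Expr.cost).sum + 1 + T) P := by
  obtain ⟨t, s', e, l, p⟩ := h
  exact ⟨_, _, .call e, by omega, hP _ _ p⟩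

theorem Returns.mono {args : List ℕ} {mem : ℕ → ℕ} {R R' : ℕ → (ℕ → ℕ) → Prop}
    (h : Returns b c args mem T R) (hT : T ≤ T') (hP : ∀ v mem', R v mem' → R' v mem') :
    Returns b c args mem T' R' :=
  Halts.mono h hT fun _ p => hP _ _ p

theorem Returns.exists_runs {args : List ℕ} {mem : ℕ → ℕ} {R : ℕ → (ℕ → ℕ) → Prop}
    (h : Returns b c args mem T R) :
    ∃ t r mem', Runs b c args mem t r mem' ∧ t ≤ T ∧ R r mem' := by
  obtain ⟨t, s', e, l, p⟩ := h
  exact ⟨t, _, _, ⟨s'.regs, e, rfl⟩, l, p⟩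

theorem Returns.of_runs {args : List ℕ} {mem mem' : ℕ → ℕ} {R : ℕ → (ℕ → ℕ) → Prop} {t r : ℕ}
    (h : Runs b c args mem t r mem') (hT : t ≤ T) (hP : R r mem') :
    Returns b c args mem T R := by
  obtain ⟨regs, e, rfl⟩ := h
  exact ⟨t, _, e, hT, hP⟩

end

/-! ### Van Emde Boas trees: the sets they represent -/

/-- The size of the universe of a van Emde Boas tree of height `ℓ` over leaves of `2 ^ g` bits. -/
def univ (g ℓ : ℕ) : ℕ := 2 ^ (g * 2 ^ ℓ)

theorem univ_pos (g ℓ : ℕ) : 0 < univ g ℓ := Nat.two_pow_pos _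

theorem univ_succ (g ℓ : ℕ) : univ g (ℓ + 1) = univ g ℓ * univ g ℓ := by
  rw [univ, univ, ← pow_add]; congr 1; ring

/-- The elements of `A` that are neither least nor greatest. -/
def inner (A : Set ℕ) : Set ℕ := {y | y ∈ A ∧ (∃ a ∈ A, a < y) ∧ ∃ c ∈ A, y < c}

/-- The high halves of the elements of `R`, as numbers in base `Q`. -/
def highs (Q : ℕ) (R : Set ℕ) : Set ℕ := {h | ∃ l < Q, h * Q + l ∈ R}

/-- The low halves of the elements of `R` with high half `h`. -/
def lows (Q : ℕ) (R : Set ℕ) (h : ℕ) : Set ℕ := {l | l < Q ∧ h * Q + l ∈ R}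

theorem inner_empty : inner ∅ = ∅ := by ext; simp [inner]

theorem inner_singleton (a : ℕ) : inner {a} = ∅ := by
  ext y
  simp only [Set.mem_empty_iff_false, iff_false]
  rintro ⟨rfl, ⟨_, rfl, h⟩, _⟩
  exact h.false

theorem inner_pair (a c : ℕ) : inner {a, c} = ∅ := by
  ext y
  simp only [Set.mem_empty_iff_false, iff_false]
  rintro ⟨rfl | rfl, ⟨_, rfl | rfl, _⟩, _, rfl | rfl, _⟩ <;> omega

theorem mem_inner_iff {A : Set ℕ} {a c y : ℕ} (ha : IsLeast A a) (hc : IsGreatest A c) :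
    y ∈ inner A ↔ y ∈ A ∧ a < y ∧ y < c := by
  constructor
  · rintro ⟨h, ⟨a', ha', h₁⟩, c', hc', h₂⟩
    exact ⟨h, (ha.2 ha').trans_lt h₁, h₂.trans_le (hc.2 hc')⟩
  · rintro ⟨h, h₁, h₂⟩
    exact ⟨h, ⟨a, ha.1, h₁⟩, c, hc.1, h₂⟩

theorem eq_singleton_of_ends {A : Set ℕ} {a : ℕ} (ha : IsLeast A a) (hc : IsGreatest A a) :
    A = {a} := by
  ext y
  exact ⟨fun h => le_antisymm (hc.2 h) (ha.2 h), fun h => h ▸ ha.1⟩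

theorem eq_pair_of_inner_eq_empty {A : Set ℕ} {a c : ℕ} (ha : IsLeast A a) (hc : IsGreatest A c)
    (h : inner A = ∅) : A = {a, c} := by
  ext y
  constructor
  · intro hy
    have h₁ := ha.2 hy
    have h₂ := hc.2 hy
    have : y ∉ inner A := by simp [h]
    rw [mem_inner_iff ha hc] at this
    simp only [Set.mem_insert_iff, Set.mem_singleton_iff]
    have h₃ : ¬ (a < y ∧ y < c) := fun h => this ⟨hy, h⟩
    omega
  · rintro (rfl | rfl)
    exacts [ha.1, hc.1]

/-- An insertion adds the median of the new element and the two ends to the inner elements. -/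
theorem inner_insert {A : Set ℕ} {a c y m : ℕ} (ha : IsLeast A a) (hc : IsGreatest A c)
    (hac : a ≠ c) (hy : y ∉ A) (hm : m + min y a + max y c = y + a + c) :
    inner (insert y A) = insert m (inner A) ∧ m ∉ inner A := by
  have hya : y ≠ a := fun h => hy (h ▸ ha.1)
  have hyc : y ≠ c := fun h => hy (h ▸ hc.1)
  have hac' : a < c := lt_of_le_of_ne (ha.2 hc.1) hac
  constructor
  · ext z
    rw [mem_inner_iff (ha.insert y) (hc.insert y), Set.mem_insert_iff, Set.mem_insert_iff,
      mem_inner_iff ha hc]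
    constructor
    · rintro ⟨rfl | hz, h₁, h₂⟩
      · left; omega
      · by_cases h : z = m
        · exact .inl h
        · have := ha.2 hz
          have := hc.2 hz
          exact .inr ⟨hz, by omega, by omega⟩
    · rintro (rfl | ⟨hz, h₁, h₂⟩)
      · refine ⟨?_, by omega, by omega⟩
        rcases lt_or_ge y a with h | h
        · right; convert ha.1 using 1; omega
        · rcases lt_or_ge c y with h' | h'
          · right; convert hc.1 using 1; omega
          · left; omega
      · exact ⟨.inr hz, by omega, by omega⟩
  · rw [mem_inner_iff ha hc]
    rintro ⟨hz, h₁, h₂⟩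
    have : m = y := by omega
    exact hy (this ▸ hz)

/-- If the least element is erased, the least inner element takes its place. -/
theorem erase_least {A : Set ℕ} {a c m : ℕ} (ha : IsLeast A a) (hc : IsGreatest A c)
    (hm : IsLeast (inner A) m) :
    IsLeast (A \ {a}) m ∧ IsGreatest (A \ {a}) c ∧ inner (A \ {a}) = inner A \ {m} := by
  have hm' := (mem_inner_iff ha hc).1 hm.1
  have h₁ : IsLeast (A \ {a}) m := by
    refine ⟨⟨hm'.1, by simp; omega⟩, fun z hz => ?_⟩
    have h₂ := ha.2 hz.1
    have h₃ := hc.2 hz.1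
    have h₄ : z ≠ a := by simpa using hz.2
    by_cases h₅ : z = c
    · omega
    · exact hm.2 ((mem_inner_iff ha hc).2 ⟨hz.1, by omega, by omega⟩)
  have h₂ : IsGreatest (A \ {a}) c :=
    ⟨⟨hc.1, by simp; omega⟩, fun z hz => hc.2 hz.1⟩
  refine ⟨h₁, h₂, ?_⟩
  ext z
  rw [mem_inner_iff h₁ h₂, Set.mem_sdiff, Set.mem_sdiff, mem_inner_iff ha hc]
  simp only [Set.mem_singleton_iff]
  constructor
  · rintro ⟨⟨h, h'⟩, h₃, h₄⟩
    exact ⟨⟨h, by omega, h₄⟩, by omega⟩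
  · rintro ⟨⟨h, h₃, h₄⟩, h₅⟩
    have := hm.2 ((mem_inner_iff ha hc).2 ⟨h, h₃, h₄⟩)
    exact ⟨⟨h, by omega⟩, by omega, h₄⟩

/-- If the greatest element is erased, the greatest inner element takes its place. -/
theorem erase_greatest {A : Set ℕ} {a c m : ℕ} (ha : IsLeast A a) (hc : IsGreatest A c)
    (hm : IsGreatest (inner A) m) :
    IsLeast (A \ {c}) a ∧ IsGreatest (A \ {c}) m ∧ inner (A \ {c}) = inner A \ {m} := by
  have hm' := (mem_inner_iff ha hc).1 hm.1
  have h₁ : IsGreatest (A \ {c}) m := by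
    refine ⟨⟨hm'.1, by simp; omega⟩, fun z hz => ?_⟩
    have h₂ := ha.2 hz.1
    have h₃ := hc.2 hz.1
    have h₄ : z ≠ c := by simpa using hz.2
    by_cases h₅ : z = a
    · omega
    · exact hm.2 ((mem_inner_iff ha hc).2 ⟨hz.1, by omega, by omega⟩)
  have h₂ : IsLeast (A \ {c}) a :=
    ⟨⟨ha.1, by simp; omega⟩, fun z hz => ha.2 hz.1⟩
  refine ⟨h₂, h₁, ?_⟩
  ext z
  rw [mem_inner_iff h₂ h₁, Set.mem_sdiff, Set.mem_sdiff, mem_inner_iff ha hc]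
  simp only [Set.mem_singleton_iff]
  constructor
  · rintro ⟨⟨h, h'⟩, h₃, h₄⟩
    exact ⟨⟨h, h₃, by omega⟩, by omega⟩
  · rintro ⟨⟨h, h₃, h₄⟩, h₅⟩
    have := hm.2 ((mem_inner_iff ha hc).2 ⟨h, h₃, h₄⟩)
    exact ⟨⟨h, by omega⟩, h₃, by omega⟩

theorem erase_inner {A : Set ℕ} {a c y : ℕ} (ha : IsLeast A a) (hc : IsGreatest A c)
    (hya : y ≠ a) (hyc : y ≠ c) :
    IsLeast (A \ {y}) a ∧ IsGreatest (A \ {y}) c ∧ inner (A \ {y}) = inner A \ {y} := by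
  have h₂ : IsLeast (A \ {y}) a := ⟨⟨ha.1, by simpa using hya.symm⟩, fun z hz => ha.2 hz.1⟩
  have h₁ : IsGreatest (A \ {y}) c := ⟨⟨hc.1, by simpa using hyc.symm⟩, fun z hz => hc.2 hz.1⟩
  refine ⟨h₂, h₁, ?_⟩
  ext z
  rw [mem_inner_iff h₂ h₁, Set.mem_sdiff, Set.mem_sdiff, mem_inner_iff ha hc]
  tauto

section halves

variable {Q : ℕ} {R : Set ℕ}

theorem highs_empty : highs Q ∅ = ∅ := by ext; simp [highs]

theorem lows_empty (h : ℕ) : lows Q ∅ h = ∅ := by ext; simp [lows]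

theorem halves_inj {h l h' l' : ℕ} (hl : l < Q) (hl' : l' < Q) :
    h * Q + l = h' * Q + l' ↔ h = h' ∧ l = l' := by
  constructor
  · intro e
    have h₁ : (h * Q + l) / Q = h := by
      rw [mul_comm, Nat.mul_add_div (by omega), Nat.div_eq_of_lt hl, add_zero]
    have h₂ : (h' * Q + l') / Q = h' := by
      rw [mul_comm, Nat.mul_add_div (by omega), Nat.div_eq_of_lt hl', add_zero]
    have h₃ : h = h' := by rw [← h₁, ← h₂, e]
    subst h₃
    exact ⟨rfl, by omega⟩
  · rintro ⟨rfl, rfl⟩; rfl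

theorem highs_insert {h l : ℕ} (hl : l < Q) :
    highs Q (insert (h * Q + l) R) = insert h (highs Q R) := by
  ext z
  simp only [highs, Set.mem_insert_iff, Set.mem_ofPred_eq]
  constructor
  · rintro ⟨l', hl', h' | h'⟩
    · exact .inl ((halves_inj hl' hl).1 h').1
    · exact .inr ⟨l', hl', h'⟩
  · rintro (rfl | ⟨l', hl', h'⟩)
    · exact ⟨l, hl, .inl rfl⟩
    · exact ⟨l', hl', .inr h'⟩

theorem lows_insert {h l : ℕ} (hl : l < Q) :
    lows Q (insert (h * Q + l) R) h = insert l (lows Q R h) := by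
  ext z
  simp only [lows, Set.mem_insert_iff, Set.mem_ofPred_eq]
  constructor
  · rintro ⟨hz, h' | h'⟩
    · exact .inl ((halves_inj hz hl).1 h').2
    · exact .inr ⟨hz, h'⟩
  · rintro (rfl | ⟨hz, h'⟩)
    · exact ⟨hl, .inl rfl⟩
    · exact ⟨hz, .inr h'⟩

theorem lows_insert_of_ne {h h' l : ℕ} (hl : l < Q) (hh : h' ≠ h) :
    lows Q (insert (h * Q + l) R) h' = lows Q R h' := by
  ext z
  simp only [lows, Set.mem_insert_iff, Set.mem_ofPred_eq]
  constructor
  · rintro ⟨hz, h' | h'⟩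
    · exact (hh ((halves_inj hz hl).1 h').1).elim
    · exact ⟨hz, h'⟩
  · rintro ⟨hz, h'⟩
    exact ⟨hz, .inr h'⟩

theorem lows_erase {h l : ℕ} (hl : l < Q) :
    lows Q (R \ {h * Q + l}) h = lows Q R h \ {l} := by
  ext z
  simp only [lows, Set.mem_sdiff, Set.mem_ofPred_eq, Set.mem_singleton_iff]
  constructor
  · rintro ⟨hz, h₁, h₂⟩
    exact ⟨⟨hz, h₁⟩, fun e => h₂ (by rw [e])⟩
  · rintro ⟨⟨hz, h₁⟩, h₂⟩
    exact ⟨hz, h₁, fun e => h₂ ((halves_inj hz hl).1 e).2⟩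

theorem lows_erase_of_ne {h h' l : ℕ} (hl : l < Q) (hh : h' ≠ h) :
    lows Q (R \ {h * Q + l}) h' = lows Q R h' := by
  ext z
  simp only [lows, Set.mem_sdiff, Set.mem_ofPred_eq, Set.mem_singleton_iff]
  constructor
  · rintro ⟨hz, h₁, h₂⟩
    exact ⟨hz, h₁⟩
  · rintro ⟨hz, h₁⟩
    exact ⟨hz, h₁, fun e => hh ((halves_inj hz hl).1 e).1⟩

theorem mem_highs_iff {h : ℕ} : h ∈ highs Q R ↔ (lows Q R h).Nonempty := Iff.rfl

/-- Removing an element removes its high half if and only if its low half was the only one. -/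
theorem highs_erase_of_lows_eq {h l : ℕ} (hl : l < Q) (hR : lows Q R h = {l}) :
    highs Q (R \ {h * Q + l}) = highs Q R \ {h} := by
  ext z
  rw [Set.mem_sdiff, Set.mem_singleton_iff, mem_highs_iff, mem_highs_iff]
  by_cases hz : z = h
  · subst hz; rw [lows_erase hl, hR]; simp
  · rw [lows_erase_of_ne hl hz]; simp [hz]

theorem highs_erase_of_lows_ne {h l l' : ℕ} (hl : l < Q) (hl' : l' ∈ lows Q R h) (hne : l' ≠ l) :
    highs Q (R \ {h * Q + l}) = highs Q R := by
  ext z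
  rw [mem_highs_iff, mem_highs_iff]
  by_cases hz : z = h
  · subst hz; rw [lows_erase hl]
    exact ⟨fun ⟨x, hx⟩ => ⟨x, hx.1⟩, fun _ => ⟨l', hl', by simpa using hne⟩⟩
  · rw [lows_erase_of_ne hl hz]

theorem isLeast_halves {h l : ℕ} (hh : IsLeast (highs Q R) h) (hl : IsLeast (lows Q R h) l)
    (hQ : 0 < Q) : IsLeast R (h * Q + l) := by
  refine ⟨hl.1.2, fun z hz => ?_⟩
  have hz' : z / Q * Q + z % Q = z := Nat.div_add_mod' z Q
  have hm := Nat.mod_lt z hQ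
  have h₁ : h ≤ z / Q := hh.2 ⟨z % Q, hm, by rwa [hz']⟩
  rcases h₁.eq_or_lt with rfl | h₁
  · have : l ≤ z % Q := hl.2 ⟨hm, by rwa [hz']⟩
    omega
  · have := Nat.mul_le_mul_right Q (Nat.succ_le_of_lt h₁)
    rw [Nat.succ_mul] at this
    have := hl.1.1
    omega

theorem isGreatest_halves {h l : ℕ} (hh : IsGreatest (highs Q R) h)
    (hl : IsGreatest (lows Q R h) l) (hQ : 0 < Q) : IsGreatest R (h * Q + l) := by
  refine ⟨hl.1.2, fun z hz => ?_⟩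
  have hz' : z / Q * Q + z % Q = z := Nat.div_add_mod' z Q
  have hm := Nat.mod_lt z hQ
  have h₁ : z / Q ≤ h := hh.2 ⟨z % Q, hm, by rwa [hz']⟩
  rcases h₁.eq_or_lt with rfl | h₁
  · have : z % Q ≤ l := hl.2 ⟨hm, by rwa [hz']⟩
    omega
  · have := Nat.mul_le_mul_right Q (Nat.succ_le_of_lt h₁)
    rw [Nat.succ_mul] at this
    omega

/-- The predecessor of `h * Q + l` if the low halves with high half `h` include one below `l`. -/
theorem pred_halves_low {h l r : ℕ} (hl : l < Q)
    (hr : IsGreatest {a ∈ lows Q R h | a < l} r) :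
    IsGreatest {a ∈ R | a < h * Q + l} (h * Q + r) := by
  have hQ : 0 < Q := by omega
  refine ⟨⟨hr.1.1.2, by have := hr.1.2; omega⟩, fun z hz => ?_⟩
  have hz' : z / Q * Q + z % Q = z := Nat.div_add_mod' z Q
  have hm := Nat.mod_lt z hQ
  have hz₂ := hz.2
  rcases lt_trichotomy (z / Q) h with h₁ | h₁ | h₁
  · have := Nat.mul_le_mul_right Q (Nat.succ_le_of_lt h₁)
    rw [Nat.succ_mul] at this
    omega
  · rw [h₁] at hz'
    have : z % Q ≤ r := hr.2 ⟨⟨hm, by rw [hz']; exact hz.1⟩, by omega⟩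
    omega
  · have := Nat.mul_le_mul_right Q (Nat.succ_le_of_lt h₁)
    rw [Nat.succ_mul] at this
    omega

/-- The predecessor of `h * Q + l` if no low half with high half `h` is below `l`. -/
theorem pred_halves_high {h l h' l' : ℕ} (hl : l < Q) (hno : ∀ a ∈ lows Q R h, l ≤ a)
    (hh' : IsGreatest {a ∈ highs Q R | a < h} h') (hl' : IsGreatest (lows Q R h') l') :
    IsGreatest {a ∈ R | a < h * Q + l} (h' * Q + l') := by
  have hQ : 0 < Q := by omega
  have hlt : h' < h := hh'.1.2
  refine ⟨⟨hl'.1.2, ?_⟩, fun z hz => ?_⟩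
  · have := Nat.mul_le_mul_right Q (Nat.succ_le_of_lt hlt)
    rw [Nat.succ_mul] at this
    have := hl'.1.1
    change h' * Q + l' < h * Q + l
    omega
  have hz' : z / Q * Q + z % Q = z := Nat.div_add_mod' z Q
  have hm := Nat.mod_lt z hQ
  have hz₂ := hz.2
  rcases lt_trichotomy (z / Q) h with h₁ | h₁ | h₁
  · have h₂ : z / Q ≤ h' := hh'.2 ⟨⟨z % Q, hm, by rw [hz']; exact hz.1⟩, h₁⟩
    rcases h₂.eq_or_lt with h₂ | h₂
    · rw [h₂] at hz'
      have : z % Q ≤ l' := hl'.2 ⟨hm, by rw [hz']; exact hz.1⟩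
      omega
    · have := Nat.mul_le_mul_right Q (Nat.succ_le_of_lt h₂)
      rw [Nat.succ_mul] at this
      omega
  · rw [h₁] at hz'
    have : l ≤ z % Q := hno _ ⟨hm, by rw [hz']; exact hz.1⟩
    omega
  · have := Nat.mul_le_mul_right Q (Nat.succ_le_of_lt h₁)
    rw [Nat.succ_mul] at this
    omega

/-- There is no predecessor of `h * Q + l` if there is none in either half. -/
theorem no_pred_halves {h l : ℕ} (hl : l < Q) (hno : ∀ a ∈ lows Q R h, l ≤ a)
    (hno' : ∀ a ∈ highs Q R, h ≤ a) : ∀ z ∈ R, h * Q + l ≤ z := by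
  intro z hz
  have hQ : 0 < Q := by omega
  have hz' : z / Q * Q + z % Q = z := Nat.div_add_mod' z Q
  have hm := Nat.mod_lt z hQ
  have h₁ : h ≤ z / Q := hno' _ ⟨z % Q, hm, by rwa [hz']⟩
  rcases h₁.eq_or_lt with h₁ | h₁
  · rw [← h₁] at hz'
    have : l ≤ z % Q := hno _ ⟨hm, by rwa [hz']⟩
    omega
  · have := Nat.mul_le_mul_right Q (Nat.succ_le_of_lt h₁)
    rw [Nat.succ_mul] at this
    omega

end halves

/-! ### Van Emde Boas trees: representation in memory -/

/-- The fields `2` and `3` of the node `i` hold the least and the greatest element of `A`, plus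
one; field `2` is zero if `A` is empty. -/
def Ends (σ : ℕ → ℕ → ℕ) (i : ℕ) (A : Set ℕ) : Prop :=
  (σ 2 i = 0 ∧ A = ∅) ∨
    ∃ a c, σ 2 i = a + 1 ∧ σ 3 i = c + 1 ∧ IsLeast A a ∧ IsGreatest A c

/-- The tree of height `ℓ` at the node `i` represents the set `R` apart from the fields `2` and
`3` of its root. At a leaf, `R` is the bitmap in field `4`. Otherwise, the high halves of the
elements of `R` (the summary) are stored in a tree of height `ℓ - 1` at `i + 1`, and the low halves
that belong to `h` in one (the cluster of `h`) at `i + 1 + (h + 1) * Q`, where `Q = univ g ℓ` is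
the number of nodes that are reserved for a tree of height `ℓ - 1`. In each of these trees, only
the inner elements are passed on to the next level. -/
def Rest (g : ℕ) (σ : ℕ → ℕ → ℕ) : ℕ → ℕ → Set ℕ → Prop
  | 0, i, R => ∀ j, (σ 4 i).testBit j = true ↔ j ∈ R
  | ℓ + 1, i, R =>
    (Ends σ (i + 1) (highs (univ g ℓ) R) ∧
      Rest g σ ℓ (i + 1) (inner (highs (univ g ℓ) R))) ∧
    ∀ h < univ g ℓ,
      Ends σ (i + 1 + (h + 1) * univ g (ℓ + 1)) (lows (univ g ℓ) R h) ∧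
      Rest g σ ℓ (i + 1 + (h + 1) * univ g (ℓ + 1)) (inner (lows (univ g ℓ) R h))

/-- The tree of height `ℓ` at the node `i` represents the set `A`. -/
def Holds (g : ℕ) (σ : ℕ → ℕ → ℕ) (ℓ i : ℕ) (A : Set ℕ) : Prop :=
  Ends σ i A ∧ Rest g σ ℓ i (inner A)

theorem rest_succ {g : ℕ} {σ : ℕ → ℕ → ℕ} {ℓ i : ℕ} {R : Set ℕ} :
    Rest g σ (ℓ + 1) i R ↔ Holds g σ ℓ (i + 1) (highs (univ g ℓ) R) ∧
      ∀ h < univ g ℓ, Holds g σ ℓ (i + 1 + (h + 1) * univ g (ℓ + 1)) (lows (univ g ℓ) R h) :=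
  Iff.rfl

theorem Ends.congr {σ σ' : ℕ → ℕ → ℕ} {i : ℕ} {A : Set ℕ} (h : Ends σ i A)
    (h₂ : σ' 2 i = σ 2 i) (h₃ : σ' 3 i = σ 3 i) : Ends σ' i A := by
  unfold Ends
  rw [h₂, h₃]
  exact h

/-- The block of a tree contains those of its summary and its clusters. -/
theorem block_le {g ℓ h : ℕ} (hg : 1 ≤ g) (hh : h < univ g ℓ) :
    1 + (h + 1) * univ g (ℓ + 1) + univ g (ℓ + 1) ≤ univ g (ℓ + 2) := by
  have h₁ : 2 ≤ univ g ℓ := by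
    have : (2 : ℕ) ^ 1 ≤ univ g ℓ :=
      Nat.pow_le_pow_right (by norm_num) (Nat.mul_pos hg (Nat.two_pow_pos ℓ))
    simpa using this
  rw [univ_succ g (ℓ + 1), univ_succ g ℓ]
  generalize univ g ℓ = Q at *
  have h₂ : (h + 1) * (Q * Q) ≤ Q * (Q * Q) := Nat.mul_le_mul_right _ hh
  nlinarith [Nat.mul_le_mul h₁ h₁, Nat.mul_le_mul_right (Q * Q) (Nat.mul_le_mul h₁ h₁),
    Nat.mul_le_mul h₁ (le_refl (Q * Q))]

theorem Rest.congr {g : ℕ} (hg : 1 ≤ g) {σ σ' : ℕ → ℕ → ℕ} {ℓ i : ℕ} {R : Set ℕ}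
    (h : Rest g σ ℓ i R) (h₄ : σ' 4 i = σ 4 i)
    (hσ : ∀ c ∈ [2, 3, 4], ∀ j, i < j → j < i + univ g (ℓ + 1) → σ' c j = σ c j) :
    Rest g σ' ℓ i R := by
  induction ℓ generalizing i R with
  | zero => simpa only [Rest, h₄] using h
  | succ ℓ ih =>
    have hb : ∀ k < univ g ℓ, _ := fun k hk => block_le hg hk
    have hpos := univ_pos g (ℓ + 1)
    rw [show ℓ + 1 + 1 = ℓ + 2 from rfl] at hσ
    have h0 := hb 0 (univ_pos g ℓ)
    have aux : ∀ j A, Holds g σ ℓ j A → i < j → j + univ g (ℓ + 1) ≤ i + univ g (ℓ + 2) →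
        Holds g σ' ℓ j A := by
      intro j A hA h₁ h₂
      exact ⟨hA.1.congr (hσ 2 (by simp) j h₁ (by omega)) (hσ 3 (by simp) j h₁ (by omega)),
        ih hA.2 (hσ 4 (by simp) j h₁ (by omega))
          fun c hc j' h₃ h₄ => hσ c hc j' (by omega) (by omega)⟩
    rw [rest_succ] at h ⊢
    refine ⟨aux _ _ h.1 (by omega) (by omega), fun k hk => aux _ _ (h.2 k hk) (by omega) ?_⟩
    have := hb k hk
    omega

theorem Holds.congr {g : ℕ} (hg : 1 ≤ g) {σ σ' : ℕ → ℕ → ℕ} {ℓ i : ℕ} {A : Set ℕ}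
    (h : Holds g σ ℓ i A)
    (hσ : ∀ c ∈ [2, 3, 4], ∀ j, i ≤ j → j < i + univ g (ℓ + 1) → σ' c j = σ c j) :
    Holds g σ' ℓ i A := by
  have := univ_pos g (ℓ + 1)
  exact ⟨h.1.congr (hσ 2 (by simp) i le_rfl (by omega)) (hσ 3 (by simp) i le_rfl (by omega)),
    h.2.congr hg (hσ 4 (by simp) i le_rfl (by omega))
      fun c hc j h₁ h₂ => hσ c hc j h₁.le h₂⟩

/-- Zero memory represents the empty set. -/
theorem holds_empty {g : ℕ} {σ : ℕ → ℕ → ℕ} (h : ∀ c ∈ [2, 3, 4], ∀ j, σ c j = 0) (ℓ i : ℕ) :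
    Holds g σ ℓ i ∅ := by
  induction ℓ generalizing i with
  | zero =>
    exact ⟨.inl ⟨h 2 (by simp) i, rfl⟩, fun j => by simp [h 4 (by simp) i, inner_empty]⟩
  | succ ℓ ih =>
    refine ⟨.inl ⟨h 2 (by simp) i, rfl⟩, ?_⟩
    rw [rest_succ, inner_empty]
    exact ⟨by rw [highs_empty]; exact ih _, fun k _ => by rw [lows_empty]; exact ih _⟩

/-- Replacing the cluster of `h` or the summary. -/
theorem Rest.replace {g : ℕ} (hg : 1 ≤ g) {σ σ' : ℕ → ℕ → ℕ} {ℓ i h : ℕ} {R R' : Set ℕ}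
    (hR : Rest g σ (ℓ + 1) i R)
    (hh : h < univ g ℓ)
    (hσ : ∀ c ∈ [2, 3, 4], ∀ j, i + 1 + univ g (ℓ + 1) ≤ j →
      ¬ (i + 1 + (h + 1) * univ g (ℓ + 1) ≤ j ∧
        j < i + 1 + (h + 1) * univ g (ℓ + 1) + univ g (ℓ + 1)) → σ' c j = σ c j)
    (hs : Holds g σ' ℓ (i + 1) (highs (univ g ℓ) R'))
    (hc : Holds g σ' ℓ (i + 1 + (h + 1) * univ g (ℓ + 1)) (lows (univ g ℓ) R' h))
    (hne : ∀ k, k ≠ h → lows (univ g ℓ) R' k = lows (univ g ℓ) R k) :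
    Rest g σ' (ℓ + 1) i R' := by
  rw [rest_succ] at hR ⊢
  refine ⟨hs, fun k hk => ?_⟩
  by_cases hkh : k = h
  · subst hkh; exact hc
  · rw [hne k hkh]
    refine (hR.2 k hk).congr hg fun c hc' j h₁ h₂ => hσ c hc' j ?_ ?_
    · have := Nat.mul_le_mul_right (univ g (ℓ + 1)) (Nat.le_add_left 1 k)
      omega
    · rintro ⟨h₃, h₄⟩
      rcases lt_or_gt_of_ne hkh with h' | h'
      · have := Nat.mul_le_mul_right (univ g (ℓ + 1)) (show k + 1 + 1 ≤ h + 1 by omega)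
        rw [Nat.add_mul (k + 1)] at this
        omega
      · have := Nat.mul_le_mul_right (univ g (ℓ + 1)) (show h + 1 + 1 ≤ k + 1 by omega)
        rw [Nat.add_mul (h + 1)] at this
        omega

/-! ### Storage: sixteen interleaved arrays -/

/-- The array `c` of a storage that begins at the address `q`. -/
def arr (mem : ℕ → ℕ) (q c i : ℕ) : ℕ := mem (q + (16 * i + c))

/-- The memories `mem` and `mem'` agree outside the cells `lo`, …, `hi - 1` of the arrays in `cs`. -/
def Unchanged (q : ℕ) (cs : List ℕ) (lo hi : ℕ) (mem mem' : ℕ → ℕ) : Prop :=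
  ∀ a, (∀ c ∈ cs, ∀ j, lo ≤ j → j < hi → a ≠ q + (16 * j + c)) → mem' a = mem a

theorem Unchanged.refl {q : ℕ} {cs : List ℕ} {lo hi : ℕ} (mem : ℕ → ℕ) :
    Unchanged q cs lo hi mem mem := fun _ _ => rfl

theorem Unchanged.trans {q : ℕ} {cs : List ℕ} {lo hi : ℕ} {m₁ m₂ m₃ : ℕ → ℕ}
    (h : Unchanged q cs lo hi m₁ m₂) (h' : Unchanged q cs lo hi m₂ m₃) :
    Unchanged q cs lo hi m₁ m₃ := fun a ha => (h' a ha).trans (h a ha)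

theorem Unchanged.mono {q : ℕ} {cs cs' : List ℕ} {lo hi lo' hi' : ℕ} {m₁ m₂ : ℕ → ℕ}
    (h : Unchanged q cs lo hi m₁ m₂) (hc : cs ⊆ cs') (hl : lo' ≤ lo) (hh : hi ≤ hi') :
    Unchanged q cs' lo' hi' m₁ m₂ :=
  fun a ha => h a fun c hc' j h₁ h₂ => ha c (hc hc') j (by omega) (by omega)

theorem Unchanged.store {q : ℕ} {cs : List ℕ} {lo hi c j v : ℕ} {m₁ m₂ : ℕ → ℕ}
    (h : Unchanged q cs lo hi m₁ m₂) (hc : c ∈ cs) (hl : lo ≤ j) (hh : j < hi) :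
    Unchanged q cs lo hi m₁ (update m₂ (q + (16 * j + c)) v) := by
  intro a ha
  rw [update_of_ne (ha c hc j hl hh), h a ha]

theorem Unchanged.of_lt {q : ℕ} {cs : List ℕ} {lo hi : ℕ} {m₁ m₂ : ℕ → ℕ}
    (h : Unchanged q cs lo hi m₁ m₂) {a : ℕ} (ha : a < q) : m₂ a = m₁ a :=
  h a fun c _ j _ _ => by omega

theorem Unchanged.arr_eq {q : ℕ} {cs : List ℕ} {lo hi : ℕ} {m₁ m₂ : ℕ → ℕ}
    (h : Unchanged q cs lo hi m₁ m₂) (hcs : ∀ c ∈ cs, c < 16) {c j : ℕ} (hc : c < 16)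
    (hj : c ∈ cs → j < lo ∨ hi ≤ j) : arr m₂ q c j = arr m₁ q c j := by
  refine h _ fun c' hc' j' h₁ h₂ e => ?_
  have := hcs c' hc'
  obtain rfl : c = c' := by omega
  have := hj hc'
  omega

theorem arr_update {mem : ℕ → ℕ} {q c i v c' i' : ℕ} (hc : c < 16) (hc' : c' < 16) :
    arr (update mem (q + (16 * i + c)) v) q c' i' =
      if c' = c ∧ i' = i then v else arr mem q c' i' := by
  rw [arr, update_apply]
  by_cases h : c' = c ∧ i' = i
  · rw [if_pos h, if_pos (by rw [h.1, h.2])]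
  · rw [if_neg h, if_neg (by omega)]; rfl

/-! ### Evaluation without overflow -/

theorem eval_add {b x y : ℕ} (h : x + y < 2 ^ b) : BinOp.eval b .add x y = x + y :=
  Nat.mod_eq_of_lt h

theorem eval_mul {b x y : ℕ} (h : x * y < 2 ^ b) : BinOp.eval b .mul x y = x * y :=
  Nat.mod_eq_of_lt h

theorem eval_shl {b x y : ℕ} (h : x * 2 ^ y < 2 ^ b) : BinOp.eval b .shl x y = x * 2 ^ y :=
  Nat.mod_eq_of_lt h

theorem eval_sub {b x y : ℕ} (h : y ≤ x) (h' : x - y < 2 ^ b) : BinOp.eval b .sub x y = x - y := by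
  rw [BinOp.eval, show x + 2 ^ b - y = x - y + 2 ^ b by omega, Nat.add_mod_right,
    Nat.mod_eq_of_lt h']

theorem eval_lit {b c : ℕ} {s : State} (h : c < 2 ^ b) : Expr.eval b s (.lit c) = c :=
  Nat.mod_eq_of_lt h

theorem eval_lt_pos {b x y : ℕ} (h : x < y) : BinOp.eval b .lt x y = 1 := if_pos h

theorem eval_lt_neg {b x y : ℕ} (h : y ≤ x) : BinOp.eval b .lt x y = 0 := if_neg h.not_gt

theorem eval_eq_pos {b x y : ℕ} (h : x = y) : BinOp.eval b .eq x y = 1 := if_pos h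

theorem eval_eq_neg {b x y : ℕ} (h : x ≠ y) : BinOp.eval b .eq x y = 0 := if_neg h

theorem eval_min {b x y : ℕ} (h : x < 2 ^ b) :
    BinOp.eval b .sub x (BinOp.eval b .mul (BinOp.eval b .sub x y) (BinOp.eval b .lt y x)) =
      min x y := by
  rcases lt_or_ge y x with h' | h'
  · rw [eval_lt_pos h', eval_sub (x := x) (y := y) (by omega) (by omega), eval_mul (by omega),
      eval_sub (by omega) (by omega)]
    omega
  · rw [eval_lt_neg h', eval_mul (by simp), eval_sub (by omega) (by omega)]
    omega

theorem eval_max {b x y : ℕ} (hx : x < 2 ^ b) (hy : y < 2 ^ b) :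
    BinOp.eval b .add y (BinOp.eval b .mul (BinOp.eval b .sub x y) (BinOp.eval b .lt y x)) =
      max x y := by
  rcases lt_or_ge y x with h' | h'
  · rw [eval_lt_pos h', eval_sub (by omega) (by omega), eval_mul (by omega),
      eval_add (by omega)]
    omega
  · rw [eval_lt_neg h', eval_mul (by simp), eval_add (by omega)]
    omega

theorem update_reg (f : Reg → ℕ) (r r' v : ℕ) :
    update f ⟨r⟩ v ⟨r'⟩ = if r' = r then v else f ⟨r'⟩ := by
  simp [update_apply]

theorem update_mem_of_ne {f : ℕ → ℕ} {a a' v : ℕ} (h : a' ≠ a) : update f a v a' = f a' :=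
  update_of_ne h _ _

/-- The rules that evaluate expressions, up to the arithmetic operations, which have their own
rules with the condition that no overflow occurs. -/
theorem eval_rules (b : ℕ) (s : State) :
    (∀ c, Expr.eval b s (no_index (OfNat.ofNat c)) = Expr.eval b s (.lit (OfNat.ofNat c))) ∧
    (∀ r, Expr.eval b s (.reg r) = s.regs r) ∧
    (∀ a, Expr.eval b s (.load a) = s.mem (a.eval b s)) ∧
    (∀ a, Expr.eval b s (.msb a) = Nat.log 2 (a.eval b s)) ∧
    (∀ o x y, Expr.eval b s (.bin o x y) = o.eval b (x.eval b s) (y.eval b s)) ∧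
    (∀ x y, Expr.eval b s (x + y) = BinOp.eval b .add (x.eval b s) (y.eval b s)) ∧
    (∀ x y, Expr.eval b s (x - y) = BinOp.eval b .sub (x.eval b s) (y.eval b s)) ∧
    (∀ x y, Expr.eval b s (x * y) = BinOp.eval b .mul (x.eval b s) (y.eval b s)) ∧
    (∀ x y, Expr.eval b s (x / y) = x.eval b s / y.eval b s) :=
  ⟨fun _ => rfl, fun _ => rfl, fun _ => rfl, fun _ => rfl, fun _ _ _ => rfl, fun _ _ => rfl,
    fun _ _ => rfl, fun _ _ => rfl, fun _ _ => rfl⟩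

theorem eval_binOp_rules (b : ℕ) :
    (∀ x y, BinOp.eval b .shr x y = x / 2 ^ y) ∧
    (∀ x y, BinOp.eval b .div x y = x / y) ∧
    (∀ x y, BinOp.eval b .band x y = x &&& y) ∧
    (∀ x y, BinOp.eval b .bor x y = x ||| y) ∧
    (∀ x y, BinOp.eval b .bxor x y = x ^^^ y) :=
  ⟨fun _ _ => rfl, fun _ _ => rfl, fun _ _ => rfl, fun _ _ => rfl, fun _ _ => rfl⟩

/-! ### Code for van Emde Boas trees -/

namespace Code

/-- The address of the storage. -/
abbrev q : Reg := ⟨0⟩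
/-- The element, in the universe of the current tree. -/
abbrev y : Reg := ⟨1⟩
/-- The root of the current tree. -/
abbrev i : Reg := ⟨2⟩
/-- The number of bits of the elements of the current tree. -/
abbrev bits : Reg := ⟨3⟩
/-- The number of bits of the elements of a leaf. -/
abbrev leaf : Reg := ⟨4⟩
/-- Non-zero as long as the loop is to continue. -/
abbrev go : Reg := ⟨5⟩
/-- Field `2` of the current node: its least element plus one, or zero. -/
abbrev lo : Reg := ⟨6⟩
/-- Field `3` of the current node: its greatest element plus one. -/
abbrev hi : Reg := ⟨7⟩
/-- The element, plus one. -/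
abbrev z : Reg := ⟨8⟩
/-- The least element after an insertion, plus one. -/
abbrev newLo : Reg := ⟨9⟩
/-- The greatest element after an insertion, plus one. -/
abbrev newHi : Reg := ⟨10⟩
/-- Half the number of bits of the elements. -/
abbrev half : Reg := ⟨11⟩
/-- The high half of the element. -/
abbrev h : Reg := ⟨12⟩
/-- The low half of the element. -/
abbrev l : Reg := ⟨13⟩
/-- The root of the cluster of `h`. -/
abbrev clu : Reg := ⟨14⟩
/-- A temporary value. -/
abbrev e : Reg := ⟨15⟩
/-- The number of frames on the stack. -/
abbrev depth : Reg := ⟨16⟩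
/-- The result of a query. -/
abbrev res : Reg := ⟨17⟩

open WordRAM.Expr WordRAM.Cmd

/-- The address of the cell `j` of the array `c`. -/
def addr (c : ℕ) (j : Expr) : Expr := q + (16 * j + lit c)
/-- Read the cell `j` of the array `c`. -/
def ld (c : ℕ) (j : Expr) : Expr := load (addr c j)
/-- Write to the cell `j` of the array `c`. -/
def st (c : ℕ) (j e : Expr) : Cmd := store (addr c j) e

/-- The minimum, without a branch. The difference may wrap around, but then its factor is zero. -/
def emin (x y : Expr) : Expr := x - (x - y) * bin .lt y x

/-- The maximum, without a branch. -/
def emax (x y : Expr) : Expr := y + (x - y) * bin .lt y x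

/-- Split `y` into its halves `h` and `l`, and find the cluster of `h`. -/
def split : Cmd :=
  half ::= bits / 2 ;;
  h ::= bin .shr y half ;;
  l ::= y - bin .shl h half ;;
  clu ::= i + 1 + bin .shl (h + 1) bits ;;
  bits ::= half

/-- One step down of an insertion. The new ends are the extremes of the old ends and `y`, and the
median of the three is the element that is to be inserted into the subtrees. If its cluster is
empty, it becomes the only element of the cluster, and the high half goes into the summary;
otherwise the low half goes into the cluster. -/
def insertStep : Cmd :=
  lo ::= ld 2 i ;;
  hi ::= ld 3 i ;;
  z ::= y + 1 ;;
  ite (bin .eq lo 0) (st 2 i z ;; st 3 i z ;; go ::= 0)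
    (newLo ::= emin lo z ;;
      newHi ::= emax z hi ;;
      st 2 i newLo ;;
      st 3 i newHi ;;
      y ::= lo + hi + z - newLo - newHi - 1 ;;
      ite (bin .eq lo hi) (go ::= 0)
        (ite (bin .eq bits leaf) (st 4 i (bin .bor (ld 4 i) (bin .shl 1 y)) ;; go ::= 0)
          (split ;;
            ite (bin .eq (ld 2 clu) 0)
              (st 2 clu (l + 1) ;; st 3 clu (l + 1) ;; i ::= i + 1 ;; y ::= h)
              (i ::= clu ;; y ::= l))))

/-- Insert `y` into the tree at `i`. -/
def insertLoop : Cmd := .while go insertStep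

end Code

theorem univ_le_succ (g ℓ : ℕ) : univ g ℓ ≤ univ g (ℓ + 1) := by
  rw [univ_succ]; exact Nat.le_mul_of_pos_left _ (univ_pos g ℓ)

theorem bits_half (g ℓ : ℕ) : g * 2 ^ (ℓ + 1) / 2 = g * 2 ^ ℓ := by
  rw [pow_succ, ← mul_assoc, Nat.mul_div_cancel _ two_pos]

theorem bits_ne {g : ℕ} (hg : 1 ≤ g) (ℓ : ℕ) : g * 2 ^ (ℓ + 1) ≠ g := by
  intro h
  have h' : 2 ^ (ℓ + 1) = 1 := Nat.eq_of_mul_eq_mul_left hg (by omega)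
  rw [pow_succ] at h'
  have := Nat.two_pow_pos ℓ
  omega

/-! ### One step of an insertion -/

section insertStep

variable {b q i y a c m B : ℕ} {s : State}

theorem run_insertStep_empty (hb : 64 < 2 ^ b) (hq : s.regs Code.q = q) (hi : s.regs Code.i = i)
    (hy : s.regs Code.y = y) (hblock : q + 16 * (i + 1) ≤ 2 ^ b) (hyb : y + 1 < 2 ^ b)
    (h₂ : s.mem (q + (16 * i + 2)) = 0) :
    (Code.insertStep.run b s).regs Code.go = 0 ∧
    (Code.insertStep.run b s).mem =
      update (update s.mem (q + (16 * i + 2)) (y + 1)) (q + (16 * i + 3)) (y + 1) := by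
  simp (disch := omega) only [Code.insertStep, Code.st, Code.ld, Code.addr, Code.emin, Code.emax,
    Code.split, Cmd.run, eval_rules, eval_binOp_rules, eval_lit, eval_add, eval_sub, eval_mul, eval_shl,
    eval_lt_pos, eval_lt_neg, eval_eq_pos, eval_eq_neg, eval_min, eval_max, update_reg, update_self,
    update_mem_of_ne, ↓reduceIte, Nat.reduceEqDiff, OfNat.ofNat_ne_zero, OfNat.zero_ne_ofNat,
    OfNat.ofNat_ne_one, OfNat.one_ne_ofNat, one_ne_zero, zero_ne_one, and_self, hq, hi, hy, h₂]

theorem run_insertStep_singleton (hb : 64 < 2 ^ b) (hq : s.regs Code.q = q)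
    (hi : s.regs Code.i = i) (hy : s.regs Code.y = y) (hblock : q + 16 * (i + 1) ≤ 2 ^ b)
    (hover : a + a + y + 3 < 2 ^ b) 
    (h₂ : s.mem (q + (16 * i + 2)) = a + 1) (h₃ : s.mem (q + (16 * i + 3)) = a + 1) :
    (Code.insertStep.run b s).regs Code.go = 0 ∧
    (Code.insertStep.run b s).mem = update (update s.mem (q + (16 * i + 2)) (min y a + 1))
      (q + (16 * i + 3)) (max y a + 1) := by
  have e₁ : min (a + 1) (y + 1) = min y a + 1 := by omega
  have e₂ : max (y + 1) (a + 1) = max y a + 1 := by omega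
  simp (disch := omega) only [Code.insertStep, Code.st, Code.ld, Code.addr, Code.emin, Code.emax,
    Code.split, Cmd.run, eval_rules, eval_binOp_rules, eval_lit, eval_add, eval_sub, eval_mul, eval_shl,
    eval_lt_pos, eval_lt_neg, eval_eq_pos, eval_eq_neg, eval_min, eval_max, update_reg, update_self,
    update_mem_of_ne, ↓reduceIte, Nat.reduceEqDiff, OfNat.ofNat_ne_zero, OfNat.zero_ne_ofNat,
    OfNat.ofNat_ne_one, OfNat.one_ne_ofNat, one_ne_zero, zero_ne_one, and_self, hq, hi, hy, h₂, h₃, e₁, e₂]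

variable (hb : 64 < 2 ^ b) (hq : s.regs Code.q = q)
    (hi : s.regs Code.i = i) (hy : s.regs Code.y = y) (hblock : q + 16 * (i + 1) ≤ 2 ^ b)
    (hac : a ≠ c) (hover : a + c + y + 3 < 2 ^ b) (hm : m + min y a + max y c = y + a + c)
    (h₂ : s.mem (q + (16 * i + 2)) = a + 1) (h₃ : s.mem (q + (16 * i + 3)) = c + 1)
include hb hq hi hy hblock hac hover hm h₂ h₃

theorem run_insertStep_leaf (hbits : s.regs Code.bits = B) (hleaf : s.regs Code.leaf = B)
    (hmb : 2 ^ m < 2 ^ b) :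
    (Code.insertStep.run b s).regs Code.go = 0 ∧
    (Code.insertStep.run b s).mem = update (update (update s.mem (q + (16 * i + 2)) (min y a + 1))
      (q + (16 * i + 3)) (max y c + 1)) (q + (16 * i + 4)) (s.mem (q + (16 * i + 4)) ||| 2 ^ m) := by
  have e₁ : min (a + 1) (y + 1) = min y a + 1 := by omega
  have e₂ : max (y + 1) (c + 1) = max y c + 1 := by omega
  have e₃ : a + 1 + (c + 1) + (y + 1) - (min y a + 1) - (max y c + 1) - 1 = m := by omega
  simp (disch := omega) only [Code.insertStep, Code.st, Code.ld, Code.addr, Code.emin, Code.emax,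
    Code.split, Cmd.run, eval_rules, eval_binOp_rules, eval_lit, eval_add, eval_sub, eval_mul, eval_shl,
    eval_lt_pos, eval_lt_neg, eval_eq_pos, eval_eq_neg, eval_min, eval_max, update_reg, update_self,
    update_mem_of_ne, ↓reduceIte, Nat.reduceEqDiff, OfNat.ofNat_ne_zero, OfNat.zero_ne_ofNat,
    OfNat.ofNat_ne_one, OfNat.one_ne_ofNat, one_ne_zero, zero_ne_one, and_self, hq, hi, hy, h₂, h₃, e₁, e₂, e₃, hbits, hleaf, one_mul]

variable {B' G H L C : ℕ} (hbits : s.regs Code.bits = B) (hleaf : s.regs Code.leaf = G)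
    (hBG : B ≠ G) (hB : B / 2 = B') (hH : m / 2 ^ B' = H) (hL : m - H * 2 ^ B' = L)
    (hC : i + 1 + (H + 1) * 2 ^ B = C) (hHm : H * 2 ^ B' ≤ m)
    (hHb : H + 1 < 2 ^ b) (hCb : q + 16 * (C + 1) ≤ 2 ^ b)
include hbits hleaf hBG hB hH hL hC hHm hHb hCb

theorem run_insertStep_summary (hne : s.mem (q + (16 * C + 2)) = 0) (hiC : i < C) :
    (Code.insertStep.run b s).regs Code.q = q ∧
    (Code.insertStep.run b s).regs Code.i = i + 1 ∧
    (Code.insertStep.run b s).regs Code.y = H ∧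
    (Code.insertStep.run b s).regs Code.bits = B' ∧
    (Code.insertStep.run b s).regs Code.leaf = G ∧
    (Code.insertStep.run b s).regs Code.go = s.regs Code.go ∧
    (Code.insertStep.run b s).mem = update (update (update (update s.mem
      (q + (16 * i + 2)) (min y a + 1)) (q + (16 * i + 3)) (max y c + 1))
      (q + (16 * C + 2)) (L + 1)) (q + (16 * C + 3)) (L + 1) := by
  have e₁ : min (a + 1) (y + 1) = min y a + 1 := by omega
  have e₂ : max (y + 1) (c + 1) = max y c + 1 := by omega
  have e₃ : a + 1 + (c + 1) + (y + 1) - (min y a + 1) - (max y c + 1) - 1 = m := by omega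
  simp (disch := omega) only [Code.insertStep, Code.st, Code.ld, Code.addr, Code.emin, Code.emax,
    Code.split, Cmd.run, eval_rules, eval_binOp_rules, eval_lit, eval_add, eval_sub, eval_mul, eval_shl,
    eval_lt_pos, eval_lt_neg, eval_eq_pos, eval_eq_neg, eval_min, eval_max, update_reg, update_self,
    update_mem_of_ne, ↓reduceIte, Nat.reduceEqDiff, OfNat.ofNat_ne_zero, OfNat.zero_ne_ofNat,
    OfNat.ofNat_ne_one, OfNat.one_ne_ofNat, one_ne_zero, zero_ne_one, and_self, hq, hi, hy, h₂, h₃, e₁, e₂, e₃, hbits, hleaf, hB, hH, hL, hC, hne]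

theorem run_insertStep_cluster (hne : s.mem (q + (16 * C + 2)) ≠ 0) (hiC : i < C) :
    (Code.insertStep.run b s).regs Code.q = q ∧
    (Code.insertStep.run b s).regs Code.i = C ∧
    (Code.insertStep.run b s).regs Code.y = L ∧
    (Code.insertStep.run b s).regs Code.bits = B' ∧
    (Code.insertStep.run b s).regs Code.leaf = G ∧
    (Code.insertStep.run b s).regs Code.go = s.regs Code.go ∧
    (Code.insertStep.run b s).mem = update (update s.mem
      (q + (16 * i + 2)) (min y a + 1)) (q + (16 * i + 3)) (max y c + 1) := by
  have e₁ : min (a + 1) (y + 1) = min y a + 1 := by omega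
  have e₂ : max (y + 1) (c + 1) = max y c + 1 := by omega
  have e₃ : a + 1 + (c + 1) + (y + 1) - (min y a + 1) - (max y c + 1) - 1 = m := by omega
  simp (disch := omega) only [Code.insertStep, Code.st, Code.ld, Code.addr, Code.emin, Code.emax,
    Code.split, Cmd.run, eval_rules, eval_binOp_rules, eval_lit, eval_add, eval_sub, eval_mul, eval_shl,
    eval_lt_pos, eval_lt_neg, eval_eq_pos, eval_eq_neg, eval_min, eval_max, update_reg, update_self,
    update_mem_of_ne, ↓reduceIte, Nat.reduceEqDiff, OfNat.ofNat_ne_zero, OfNat.zero_ne_ofNat,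
    OfNat.ofNat_ne_one, OfNat.one_ne_ofNat, one_ne_zero, zero_ne_one, and_self, hq, hi, hy, h₂, h₃, e₁, e₂, e₃, hbits, hleaf, hB, hH, hL, hC]

end insertStep

/-! ### Insertion into a van Emde Boas tree -/

/-- A bound for the steps of one iteration of an insertion. -/
def insertStepTime : ℕ := 2 + Code.insertStep.len

theorem loopFree_insertStep : Code.insertStep.LoopFree := by
  simp [Code.insertStep, Code.split, Code.st, Cmd.LoopFree]

theorem Ends.congr_arr {mem mem' : ℕ → ℕ} {q i : ℕ} {A : Set ℕ} (h : Ends (arr mem q) i A)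
    (h' : ∀ c ∈ [2, 3], arr mem' q c i = arr mem q c i) : Ends (arr mem' q) i A :=
  h.congr (h' 2 (by simp)) (h' 3 (by simp))

theorem lt_univ_of_mem_highs {g ℓ h : ℕ} {R : Set ℕ} (hR : ∀ x ∈ R, x < univ g (ℓ + 1))
    (hh : h ∈ highs (univ g ℓ) R) : h < univ g ℓ := by
  obtain ⟨l, -, h'⟩ := hh
  have h₁ := hR _ h'
  rw [univ_succ] at h₁
  exact lt_of_mul_lt_mul_right ((Nat.le_add_right _ _).trans_lt h₁) (Nat.zero_le _)

/-- Arithmetic of the halves of an element of a tree of height `ℓ + 1` at the node `i`. -/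
theorem split_spec {g ℓ m H L C i : ℕ} (hg : 1 ≤ g) (hm : m < univ g (ℓ + 1))
    (hH : m / univ g ℓ = H) (hL : m - H * univ g ℓ = L)
    (hC : i + 1 + (H + 1) * univ g (ℓ + 1) = C) :
    H * univ g ℓ + L = m ∧ H < univ g ℓ ∧ L < univ g ℓ ∧ i + 1 + univ g (ℓ + 1) ≤ C ∧
      C + univ g (ℓ + 1) ≤ i + univ g (ℓ + 2) := by
  subst hH
  have h₁ := Nat.div_add_mod' m (univ g ℓ)
  have h₂ := Nat.mod_lt m (univ_pos g ℓ)
  have h₃ : m / univ g ℓ < univ g ℓ := by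
    rw [univ_succ] at hm
    exact Nat.div_lt_of_lt_mul hm
  have h₄ := block_le hg h₃
  have h₅ := Nat.mul_le_mul_right (univ g (ℓ + 1)) (Nat.le_add_left 1 (m / univ g ℓ))
  omega

theorem Unchanged.arr_field {q lo hi : ℕ} {m₁ m₂ : ℕ → ℕ} (h : Unchanged q [2, 3, 4] lo hi m₁ m₂)
    {c j : ℕ} (hc : c ∈ [2, 3, 4]) (hj : j < lo ∨ hi ≤ j) : arr m₂ q c j = arr m₁ q c j :=
  h.arr_eq (by simp) (by simp at hc; omega) fun _ => hj

theorem arr_update_of_ne {mem : ℕ → ℕ} {q c i v c' j : ℕ} (hc : c < 16) (hc' : c' ∈ [2, 3, 4])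
    (h : j ≠ i) : arr (update mem (q + (16 * i + c)) v) q c' j = arr mem q c' j := by
  rw [arr_update hc (by simp at hc'; omega), if_neg fun e => h e.2]

theorem Ends.of_update {mem : ℕ → ℕ} {q i x z : ℕ} {A : Set ℕ} (hx : IsLeast A x)
    (hz : IsGreatest A z) :
    Ends (arr (update (update mem (q + (16 * i + 2)) (x + 1)) (q + (16 * i + 3)) (z + 1)) q) i A :=
  .inr ⟨x, z, by simp [arr_update], by simp [arr_update], hx, hz⟩

theorem Rest.store_ends {mem : ℕ → ℕ} {q g ℓ i u v : ℕ} {R : Set ℕ} (hg : 1 ≤ g)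
    (hR : Rest g (arr mem q) ℓ i R) :
    Rest g (arr (update (update mem (q + (16 * i + 2)) u)
      (q + (16 * i + 3)) v) q) ℓ i R := by
  refine hR.congr hg (by simp [arr_update]) fun c hc j h₁ _ => ?_
  rw [arr_update_of_ne (by simp) hc (by omega), arr_update_of_ne (by simp) hc (by omega)]

/-- Replacing the two ends of a tree whose inner elements remain the same. -/
theorem Holds.store_ends {mem : ℕ → ℕ} {q g ℓ i x z : ℕ} {A A' : Set ℕ} (hg : 1 ≤ g)
    (hA : Holds g (arr mem q) ℓ i A) (hx : IsLeast A' x) (hz : IsGreatest A' z)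
    (h : inner A' = inner A) :
    Holds g (arr (update (update mem (q + (16 * i + 2)) (x + 1)) (q + (16 * i + 3)) (z + 1)) q)
      ℓ i A' :=
  ⟨.of_update hx hz, by rw [h]; exact hA.2.store_ends hg⟩

theorem Unchanged.store_ends (mem : ℕ → ℕ) {q i u v lo hi : ℕ} (h₁ : lo ≤ i) (h₂ : i < hi) :
    Unchanged q [2, 3, 4] lo hi mem
      (update (update mem (q + (16 * i + 2)) u) (q + (16 * i + 3)) v) :=
  ((Unchanged.refl _).store (by simp) h₁ h₂).store (by simp) h₁ h₂

/-- An insertion keeps both ends of a tree out of the recursion, so that it goes on in only one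
subtree: in the summary if the cluster was empty, and in the cluster otherwise. -/
theorem halts_insertLoop {b q g : ℕ} (hg : 1 ≤ g) (hgb : 2 ^ g ≤ b) (hb : 64 < 2 ^ b) {ℓ : ℕ}
    {s : State} {i y : ℕ} {A : Set ℕ} (hq : s.regs Code.q = q) (hi : s.regs Code.i = i)
    (hy : s.regs Code.y = y) (hbits : s.regs Code.bits = g * 2 ^ ℓ) (hleaf : s.regs Code.leaf = g)
    (hgo : s.regs Code.go = 1) (hblock : q + 16 * (i + univ g (ℓ + 1)) ≤ 2 ^ b)
    (hA : Holds g (arr s.mem q) ℓ i A) (hyA : y ∉ A) (hyu : y < univ g ℓ)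
    (hAu : ∀ x ∈ A, x < univ g ℓ) :
    Halts b Code.insertLoop s ((ℓ + 1) * insertStepTime + 2) (fun s' =>
      Holds g (arr s'.mem q) ℓ i (insert y A) ∧
      Unchanged q [2, 3, 4] i (i + univ g (ℓ + 1)) s.mem s'.mem) := by
  induction ℓ using Nat.strong_induction_on generalizing s i y A with
  | _ ℓ ih =>
  have hu := univ_le_succ g ℓ
  have hup := univ_pos g ℓ
  rw [show (ℓ + 1) * insertStepTime + 2 =
    1 + 1 + Code.insertStep.len + (ℓ * insertStepTime + 2) by rw [insertStepTime]; ring]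
  refine Halts.while_run (by simp [Expr.eval, hgo]) loopFree_insertStep ?_
  rcases hA.1 with ⟨h₂, rfl⟩ | ⟨a, c, h₂, h₃, ha, hc⟩
  · obtain ⟨hgo', hmem⟩ := run_insertStep_empty hb hq hi hy (by omega) (by omega) h₂
    refine (Halts.while_false (e := .reg Code.go) hgo' ?_).mono (Nat.le_add_left _ _) fun _ => id
    rw [hmem]
    exact ⟨hA.store_ends hg (by simp) (by simp) (by simp [inner_empty, inner_singleton]),
      .store_ends _ le_rfl (by omega)⟩
  have hau := hAu a ha.1
  have hcu := hAu c hc.1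
  by_cases hac : a = c
  · subst hac
    obtain ⟨hgo', hmem⟩ := run_insertStep_singleton hb hq hi hy (by omega) (by omega) h₂ h₃
    refine (Halts.while_false (e := .reg Code.go) hgo' ?_).mono (Nat.le_add_left _ _) fun _ => id
    rw [hmem]
    refine ⟨hA.store_ends hg (ha.insert y) (hc.insert y) ?_, .store_ends _ le_rfl (by omega)⟩
    rw [eq_singleton_of_ends ha hc, inner_pair, inner_singleton]
  obtain ⟨m, hm⟩ : ∃ m, m + min y a + max y c = y + a + c := ⟨y + a + c - min y a - max y c, by omega⟩
  obtain ⟨hin, hmin⟩ := inner_insert ha hc hac hyA hm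
  have hmu : m < univ g ℓ := by omega
  rcases ℓ with - | ℓ
  · have hmb : m < b := lt_of_lt_of_le (by simpa [univ] using hmu) hgb
    obtain ⟨hgo', hmem⟩ := run_insertStep_leaf hb hq hi hy (by omega) hac (by omega) hm h₂ h₃ hbits
      (by simpa using hleaf) (Nat.pow_lt_pow_right (by norm_num) hmb)
    refine (Halts.while_false (e := .reg Code.go) hgo' ?_).mono (Nat.le_add_left _ _) fun _ => id
    rw [hmem]
    refine ⟨⟨(Ends.of_update (mem := s.mem) (ha.insert y) (hc.insert y)).congr_arr fun c hc => ?_,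
      fun j => ?_⟩, ?_⟩
    · simp only [List.mem_cons, List.not_mem_nil, or_false] at hc
      rcases hc with rfl | rfl <;> simp [arr_update]
    · have h := hA.2 j
      rw [hin, Set.mem_insert_iff, ← h]
      simp [arr_update, Nat.testBit_two_pow]
      rw [arr, or_comm, eq_comm (a := m)]
    · exact (Unchanged.store_ends _ le_rfl (by omega)).store (by simp) le_rfl (by omega)
  obtain ⟨H, hH⟩ : ∃ H, m / univ g ℓ = H := ⟨_, rfl⟩
  obtain ⟨L, hL⟩ : ∃ L, m - H * univ g ℓ = L := ⟨_, rfl⟩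
  obtain ⟨C, hC⟩ : ∃ C, i + 1 + (H + 1) * univ g (ℓ + 1) = C := ⟨_, rfl⟩
  obtain ⟨hHL, hHu, hLu, hC₁, hC₂⟩ := split_spec hg hmu hH hL hC
  rw [show ℓ + 1 + 1 = ℓ + 2 from rfl] at *
  have hu' := univ_le_succ g ℓ
  have hup' := univ_pos g ℓ
  have hR : Rest g (arr s.mem q) (ℓ + 1) i (inner A) := hA.2
  have hRu : ∀ x ∈ inner A, x < univ g (ℓ + 1) := fun x hx => hAu x hx.1
  by_cases hne : s.mem (q + (16 * C + 2)) = 0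
  · obtain ⟨hq', hi', hy', hbits', hleaf', hgo', hmem⟩ :=
      run_insertStep_summary hb hq hi hy (by omega) hac (by omega) hm h₂ h₃ hbits hleaf
        (bits_ne hg ℓ) (bits_half g ℓ) hH hL hC (by change H * univ g ℓ ≤ m; omega) (by omega) (by omega) hne (by omega)
    have hlow : lows (univ g ℓ) (inner A) H = ∅ := by
      rcases ((rest_succ.1 hR).2 H hHu).1 with ⟨-, h⟩ | ⟨x, -, h, -⟩
      · exact h
      · rw [hC, arr, hne] at h; omega
    have hsum : Holds g (arr (Code.insertStep.run b s).mem q) ℓ (i + 1) (highs (univ g ℓ) (inner A)) := by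
      refine (rest_succ.1 hR).1.congr hg fun c hc j h₁ h₂ => ?_
      rw [hmem]
      simp (disch := first | omega | assumption) only [arr_update_of_ne]
    refine (ih ℓ (by omega) hq' hi' hy' hbits' hleaf' (hgo'.trans hgo) (by omega) hsum ?_ hHu
      fun x hx => lt_univ_of_mem_highs hRu hx).mono le_rfl ?_
    · rw [mem_highs_iff, hlow]; simp
    rintro s' ⟨hs', hU⟩
    have harr : ∀ c ∈ [2, 3, 4], ∀ j, i + 1 + univ g (ℓ + 1) ≤ j → j ≠ C → arr s'.mem q c j = arr s.mem q c j := by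
      intro c hc j h₁ h₂
      rw [hU.arr_field hc (by omega), hmem]
      simp (disch := first | omega | assumption) only [arr_update_of_ne]
    refine ⟨⟨(Ends.of_update (mem := s.mem) (ha.insert y) (hc.insert y)).congr_arr fun c hc => ?_, ?_⟩, ?_⟩
    · have hc' : c ∈ [2, 3, 4] := by simp at hc ⊢; omega
      rw [hU.arr_field hc' (by omega), hmem]
      simp (disch := first | omega | assumption) only [arr_update_of_ne]
    · rw [hin]
      refine hR.replace hg hHu (fun c hc j h₁ h₂ => ?_) ?_ ?_ ?_ (h := H)
      · exact harr c hc j h₁ (by omega)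
      · rwa [← hHL, highs_insert hLu]
      · rw [← hHL, lows_insert hLu, hlow, hC]
        have hclu := (rest_succ.1 hR).2 H hHu
        rw [hC, hlow] at hclu
        have := hclu.store_ends hg (A' := {L}) (x := L) (z := L) (by simp) (by simp)
          (by rw [inner_empty, inner_singleton])
        simp only [insert_empty_eq]
        refine this.congr hg fun c hc j h₁ h₂ => ?_
        rw [hU.arr_field hc (by omega), hmem]
        by_cases hj : j = C
        · subst hj
          simp only [List.mem_cons, List.not_mem_nil, or_false] at hc
          have : i ≠ j := by omega
          rcases hc with rfl | rfl | rfl <;> simp [arr_update, this.symm]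
        · simp (disch := first | omega | assumption) only [arr_update_of_ne]
      · intro k hk
        rw [← hHL, lows_insert_of_ne hLu hk]
    · refine Unchanged.trans ?_ (hU.mono (by simp) (by omega) (by omega))
      rw [hmem]
      exact ((Unchanged.store_ends _ le_rfl (by omega)).store (by simp) (by omega) (by omega)).store
        (by simp) (by omega) (by omega)
  · obtain ⟨hq', hi', hy', hbits', hleaf', hgo', hmem⟩ :=
      run_insertStep_cluster hb hq hi hy (by omega) hac (by omega) hm h₂ h₃ hbits hleaf
        (bits_ne hg ℓ) (bits_half g ℓ) hH hL hC (by change H * univ g ℓ ≤ m; omega) (by omega) (by omega) hne (by omega)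
    have hclu := (rest_succ.1 hR).2 H hHu
    rw [hC] at hclu
    have hlow : (lows (univ g ℓ) (inner A) H).Nonempty := by
      rcases hclu.1 with ⟨h, -⟩ | ⟨x, -, -, -, h, -⟩
      · exact (hne h).elim
      · exact ⟨x, h.1⟩
    have hclu' : Holds g (arr (Code.insertStep.run b s).mem q) ℓ C (lows (univ g ℓ) (inner A) H) := by
      refine hclu.congr hg fun c hc j h₁ h₂ => ?_
      rw [hmem]
      simp (disch := first | omega | assumption) only [arr_update_of_ne]
    refine (ih ℓ (by omega) hq' hi' hy' hbits' hleaf' (hgo'.trans hgo) (by omega) hclu' ?_ hLu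
      fun x hx => hx.1).mono le_rfl ?_
    · rintro ⟨-, h⟩
      rw [hHL] at h
      exact hmin h
    rintro s' ⟨hs', hU⟩
    have harr : ∀ c ∈ [2, 3, 4], ∀ j, i < j → (j < C ∨ C + univ g (ℓ + 1) ≤ j) →
        arr s'.mem q c j = arr s.mem q c j := by
      intro c hc j h₁ h₂
      rw [hU.arr_field hc (by omega), hmem]
      simp (disch := first | omega | assumption) only [arr_update_of_ne]
    refine ⟨⟨(Ends.of_update (mem := s.mem) (ha.insert y) (hc.insert y)).congr_arr fun c hc => ?_, ?_⟩, ?_⟩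
    · have hc' : c ∈ [2, 3, 4] := by simp at hc ⊢; omega
      rw [hU.arr_field hc' (by omega), hmem]
    · rw [hin]
      refine hR.replace hg hHu (fun c hc j h₁ h₂ => ?_) ?_ ?_ ?_ (h := H)
      · exact harr c hc j (by omega) (by omega)
      · rw [← hHL, highs_insert hLu, Set.insert_eq_of_mem (mem_highs_iff.2 hlow)]
        exact (rest_succ.1 hR).1.congr hg fun c hc j h₁ h₂ => harr c hc j (by omega) (by omega)
      · rwa [← hHL, lows_insert hLu, hC]
      · intro k hk
        rw [← hHL, lows_insert_of_ne hLu hk]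
    · refine Unchanged.trans ?_ (hU.mono (by simp) (by omega) (by omega))
      rw [hmem]
      exact Unchanged.store_ends _ le_rfl (by omega)

/-! ### One step of a deletion -/

namespace Code
open WordRAM.Expr WordRAM.Cmd

/-- Begin the deletion of `y` from the current tree. If `y` is one of its ends, it is replaced by
an inner element, and then this is the element to be deleted from the subtrees. -/
def deletePick : Cmd :=
  lo ::= ld 2 i ;;
  hi ::= ld 3 i ;;
  z ::= y + 1 ;;
  ite (bin .eq lo hi) (st 2 i 0 ;; go ::= 0)
    (ite (bin .eq bits leaf) (e ::= ld 4 i) (e ::= ld 2 (i + 1)) ;;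
      ite e
        (ite (bin .eq z lo)
          (ite (bin .eq bits leaf) (y ::= msb (e - bin .band e (e - 1)))
            (half ::= bits / 2 ;;
              clu ::= i + 1 + bin .shl e bits ;;
              y ::= bin .shl (e - 1) half + (ld 2 clu - 1)) ;;
            st 2 i (y + 1))
          (ite (bin .eq z hi)
            (ite (bin .eq bits leaf) (y ::= msb e)
              (half ::= bits / 2 ;;
                e ::= ld 3 (i + 1) ;;
                clu ::= i + 1 + bin .shl e bits ;;
                y ::= bin .shl (e - 1) half + (ld 3 clu - 1)) ;;
              st 3 i (y + 1))
            skip))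
        (z ::= lo + hi - z ;; st 2 i z ;; st 3 i z ;; go ::= 0))

/-- Delete the inner element `y` from the bitmap of a leaf, or find the subtree from which
a part of `y` is to be deleted. -/
def deleteRemove : Cmd :=
  ite (bin .eq bits leaf) (st 4 i (bin .bxor (ld 4 i) (bin .shl 1 y)) ;; go ::= 0)
    (split ;;
      ite (bin .eq (ld 2 clu) (ld 3 clu)) (st 2 clu 0 ;; i ::= i + 1 ;; y ::= h)
        (i ::= clu ;; y ::= l))

/-- One step down of a deletion. -/
def deleteStep : Cmd := deletePick ;; ite go deleteRemove skip

/-- Delete `y` from the tree at `i`. -/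
def deleteLoop : Cmd := .while go deleteStep

end Code

section deletePick

variable {b q i y a c m e B G B' C : ℕ} {s : State} (hb : 64 < 2 ^ b) (hq : s.regs Code.q = q)
  (hi : s.regs Code.i = i) (hy : s.regs Code.y = y) (hblock : q + 16 * (i + 1 + 1) ≤ 2 ^ b)
include hb hq hi hy hblock

theorem run_deletePick_singleton (hover : y + 1 < 2 ^ b)
    (h : s.mem (q + (16 * i + 2)) = s.mem (q + (16 * i + 3))) :
    (Code.deletePick.run b s).regs Code.go = 0 ∧
    (Code.deletePick.run b s).mem = update s.mem (q + (16 * i + 2)) 0 := by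
  simp (disch := omega) only [Code.deletePick, Code.st, Code.ld, Code.addr, Code.split, Cmd.run,
    eval_rules, eval_binOp_rules, eval_lit, eval_add, eval_sub, eval_mul, eval_shl,
    eval_lt_pos, eval_lt_neg, eval_eq_pos, eval_eq_neg, update_reg, update_self,
    update_mem_of_ne, ↓reduceIte, Nat.reduceEqDiff, OfNat.ofNat_ne_zero, OfNat.zero_ne_ofNat,
    OfNat.ofNat_ne_one, OfNat.one_ne_ofNat, one_ne_zero, zero_ne_one, and_self, hq, hi, hy, h]

variable (hac : a ≠ c) (hover : a + c + 3 < 2 ^ b)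
    (h₂ : s.mem (q + (16 * i + 2)) = a + 1) (h₃ : s.mem (q + (16 * i + 3)) = c + 1)
    (hbits : s.regs Code.bits = B) (hleaf : s.regs Code.leaf = G)
    (he : if B = G then s.mem (q + (16 * i + 4)) = e else s.mem (q + (16 * (i + 1) + 2)) = e)
include hac hover h₂ h₃ hbits hleaf he

theorem run_deletePick_pair (hm : m + y = a + c) (hya : y = a ∨ y = c) (h0 : e = 0) :
    (Code.deletePick.run b s).regs Code.go = 0 ∧
    (Code.deletePick.run b s).mem =
      update (update s.mem (q + (16 * i + 2)) (m + 1)) (q + (16 * i + 3)) (m + 1) := by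
  have e₁ : a + 1 + (c + 1) - (y + 1) = m + 1 := by omega
  subst h0
  by_cases hBG : B = G
  · rw [if_pos hBG] at he
    simp (disch := omega) only [Code.deletePick, Code.st, Code.ld, Code.addr, Code.split, Cmd.run,
      eval_rules, eval_binOp_rules, eval_lit, eval_add, eval_sub, eval_mul, eval_shl,
      eval_lt_pos, eval_lt_neg, eval_eq_pos, eval_eq_neg, update_reg, update_self,
      update_mem_of_ne, ↓reduceIte, Nat.reduceEqDiff, OfNat.ofNat_ne_zero, OfNat.zero_ne_ofNat,
      OfNat.ofNat_ne_one, OfNat.one_ne_ofNat, one_ne_zero, zero_ne_one, and_self, hq, hi, hy, h₂, h₃, he, hbits, hleaf, e₁]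
  · rw [if_neg hBG] at he
    simp (disch := omega) only [Code.deletePick, Code.st, Code.ld, Code.addr, Code.split, Cmd.run,
      eval_rules, eval_binOp_rules, eval_lit, eval_add, eval_sub, eval_mul, eval_shl,
      eval_lt_pos, eval_lt_neg, eval_eq_pos, eval_eq_neg, update_reg, update_self,
      update_mem_of_ne, ↓reduceIte, Nat.reduceEqDiff, OfNat.ofNat_ne_zero, OfNat.zero_ne_ofNat,
      OfNat.ofNat_ne_one, OfNat.one_ne_ofNat, one_ne_zero, zero_ne_one, and_self, hq, hi, hy, h₂, h₃, he, hbits, hleaf, e₁]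

theorem run_deletePick_inner (hya : y ≠ a) (hyc : y ≠ c) (hyb : y + 1 < 2 ^ b) (h0 : e ≠ 0) :
    (Code.deletePick.run b s).regs Code.q = q ∧
    (Code.deletePick.run b s).regs Code.i = i ∧
    (Code.deletePick.run b s).regs Code.y = y ∧
    (Code.deletePick.run b s).regs Code.bits = B ∧
    (Code.deletePick.run b s).regs Code.leaf = G ∧
    (Code.deletePick.run b s).regs Code.go = s.regs Code.go ∧
    (Code.deletePick.run b s).mem = s.mem := by
  by_cases hBG : B = G
  · rw [if_pos hBG] at he
    simp (disch := omega) only [Code.deletePick, Code.st, Code.ld, Code.addr, Code.split, Cmd.run,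
      eval_rules, eval_binOp_rules, eval_lit, eval_add, eval_sub, eval_mul, eval_shl,
      eval_lt_pos, eval_lt_neg, eval_eq_pos, eval_eq_neg, update_reg, update_self,
      update_mem_of_ne, ↓reduceIte, Nat.reduceEqDiff, OfNat.ofNat_ne_zero, OfNat.zero_ne_ofNat,
      OfNat.ofNat_ne_one, OfNat.one_ne_ofNat, one_ne_zero, zero_ne_one, and_self, hq, hi, hy, h₂, h₃, he, hbits, hleaf, h0]
  · rw [if_neg hBG] at he
    simp (disch := omega) only [Code.deletePick, Code.st, Code.ld, Code.addr, Code.split, Cmd.run,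
      eval_rules, eval_binOp_rules, eval_lit, eval_add, eval_sub, eval_mul, eval_shl,
      eval_lt_pos, eval_lt_neg, eval_eq_pos, eval_eq_neg, update_reg, update_self,
      update_mem_of_ne, ↓reduceIte, Nat.reduceEqDiff, OfNat.ofNat_ne_zero, OfNat.zero_ne_ofNat,
      OfNat.ofNat_ne_one, OfNat.one_ne_ofNat, one_ne_zero, zero_ne_one, and_self, hq, hi, hy, h₂, h₃, he, hbits, hleaf, h0]

theorem run_deletePick_least (hya : y = a) (h0 : e ≠ 0) (hmb : m + 1 < 2 ^ b) (heb : e < 2 ^ b)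
    (hm : if B = G then e &&& (e - 1) ≤ e ∧ Nat.log 2 (e - (e &&& (e - 1))) = m
      else B / 2 = B' ∧ (e - 1) * 2 ^ B' ≤ m ∧ i + 1 + e * 2 ^ B = C ∧ q + 16 * (C + 1) ≤ 2 ^ b ∧
        s.mem (q + (16 * C + 2)) = m - (e - 1) * 2 ^ B' + 1) :
    (Code.deletePick.run b s).regs Code.q = q ∧
    (Code.deletePick.run b s).regs Code.i = i ∧
    (Code.deletePick.run b s).regs Code.y = m ∧
    (Code.deletePick.run b s).regs Code.bits = B ∧
    (Code.deletePick.run b s).regs Code.leaf = G ∧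
    (Code.deletePick.run b s).regs Code.go = s.regs Code.go ∧
    (Code.deletePick.run b s).mem = update s.mem (q + (16 * i + 2)) (m + 1) := by
  by_cases hBG : B = G
  · rw [if_pos hBG] at he hm
    obtain ⟨e₁, e₂⟩ := hm
    simp (disch := omega) only [Code.deletePick, Code.st, Code.ld, Code.addr, Code.split, Cmd.run,
      eval_rules, eval_binOp_rules, eval_lit, eval_add, eval_sub, eval_mul, eval_shl,
      eval_lt_pos, eval_lt_neg, eval_eq_pos, eval_eq_neg, update_reg, update_self,
      update_mem_of_ne, ↓reduceIte, Nat.reduceEqDiff, OfNat.ofNat_ne_zero, OfNat.zero_ne_ofNat,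
      OfNat.ofNat_ne_one, OfNat.one_ne_ofNat, one_ne_zero, zero_ne_one, and_self, hq, hi, hy, h₂, h₃, he, hbits, hleaf, h0, e₂]
  · rw [if_neg hBG] at he hm
    obtain ⟨e₁, e₂, e₃, e₄, e₅⟩ := hm
    have e₆ : (e - 1) * 2 ^ B' + (m - (e - 1) * 2 ^ B') = m := by omega
    have e₇ : m - (e - 1) * 2 ^ B' + 1 - 1 = m - (e - 1) * 2 ^ B' := by omega
    simp (disch := omega) only [Code.deletePick, Code.st, Code.ld, Code.addr, Code.split, Cmd.run,
      eval_rules, eval_binOp_rules, eval_lit, eval_add, eval_sub, eval_mul, eval_shl,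
      eval_lt_pos, eval_lt_neg, eval_eq_pos, eval_eq_neg, update_reg, update_self,
      update_mem_of_ne, ↓reduceIte, Nat.reduceEqDiff, OfNat.ofNat_ne_zero, OfNat.zero_ne_ofNat,
      OfNat.ofNat_ne_one, OfNat.one_ne_ofNat, one_ne_zero, zero_ne_one, and_self, hq, hi, hy, h₂, h₃, he, hbits, hleaf, h0, e₁, e₃, e₅, e₆, e₇]

theorem run_deletePick_greatest {e' : ℕ} (hya : y = c) (h0 : e ≠ 0) (hmb : m + 1 < 2 ^ b)
    (hm : if B = G then Nat.log 2 e = m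
      else s.mem (q + (16 * (i + 1) + 3)) = e' ∧ e' ≠ 0 ∧ e' < 2 ^ b ∧
        B / 2 = B' ∧ (e' - 1) * 2 ^ B' ≤ m ∧ i + 1 + e' * 2 ^ B = C ∧ q + 16 * (C + 1) ≤ 2 ^ b ∧
        s.mem (q + (16 * C + 3)) = m - (e' - 1) * 2 ^ B' + 1) :
    (Code.deletePick.run b s).regs Code.q = q ∧
    (Code.deletePick.run b s).regs Code.i = i ∧
    (Code.deletePick.run b s).regs Code.y = m ∧
    (Code.deletePick.run b s).regs Code.bits = B ∧
    (Code.deletePick.run b s).regs Code.leaf = G ∧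
    (Code.deletePick.run b s).regs Code.go = s.regs Code.go ∧
    (Code.deletePick.run b s).mem = update s.mem (q + (16 * i + 3)) (m + 1) := by
  by_cases hBG : B = G
  · rw [if_pos hBG] at he hm
    simp (disch := omega) only [Code.deletePick, Code.st, Code.ld, Code.addr, Code.split, Cmd.run,
      eval_rules, eval_binOp_rules, eval_lit, eval_add, eval_sub, eval_mul, eval_shl,
      eval_lt_pos, eval_lt_neg, eval_eq_pos, eval_eq_neg, update_reg, update_self,
      update_mem_of_ne, ↓reduceIte, Nat.reduceEqDiff, OfNat.ofNat_ne_zero, OfNat.zero_ne_ofNat,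
      OfNat.ofNat_ne_one, OfNat.one_ne_ofNat, one_ne_zero, zero_ne_one, and_self, hq, hi, hy, h₂, h₃, he, hbits, hleaf, h0, hm]
  · rw [if_neg hBG] at he hm
    obtain ⟨e₀, e₀', e₀'', e₁, e₂, e₃, e₄, e₅⟩ := hm
    have e₆ : (e' - 1) * 2 ^ B' + (m - (e' - 1) * 2 ^ B') = m := by omega
    have e₇ : m - (e' - 1) * 2 ^ B' + 1 - 1 = m - (e' - 1) * 2 ^ B' := by omega
    simp (disch := omega) only [Code.deletePick, Code.st, Code.ld, Code.addr, Code.split, Cmd.run,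
      eval_rules, eval_binOp_rules, eval_lit, eval_add, eval_sub, eval_mul, eval_shl,
      eval_lt_pos, eval_lt_neg, eval_eq_pos, eval_eq_neg, update_reg, update_self,
      update_mem_of_ne, ↓reduceIte, Nat.reduceEqDiff, OfNat.ofNat_ne_zero, OfNat.zero_ne_ofNat,
      OfNat.ofNat_ne_one, OfNat.one_ne_ofNat, one_ne_zero, zero_ne_one, and_self, hq, hi, hy, h₂, h₃, he, hbits, hleaf, h0, e₀, e₁, e₃, e₅, e₆, e₇]

end deletePick

section deleteRemove

variable {b q i m B : ℕ} {s : State} (hb : 64 < 2 ^ b) (hq : s.regs Code.q = q)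
  (hi : s.regs Code.i = i) (hy : s.regs Code.y = m) (hblock : q + 16 * (i + 1) ≤ 2 ^ b)
include hb hq hi hy hblock

theorem run_deleteRemove_leaf (hbits : s.regs Code.bits = B) (hleaf : s.regs Code.leaf = B)
    (hmb : 2 ^ m < 2 ^ b) :
    (Code.deleteRemove.run b s).regs Code.go = 0 ∧
    (Code.deleteRemove.run b s).mem =
      update s.mem (q + (16 * i + 4)) (s.mem (q + (16 * i + 4)) ^^^ 2 ^ m) := by
  simp (disch := omega) only [Code.deleteRemove, Code.st, Code.ld, Code.addr, Code.split, Cmd.run,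
    eval_rules, eval_binOp_rules, eval_lit, eval_add, eval_sub, eval_mul, eval_shl,
    eval_lt_pos, eval_lt_neg, eval_eq_pos, eval_eq_neg, update_reg, update_self,
    update_mem_of_ne, ↓reduceIte, Nat.reduceEqDiff, OfNat.ofNat_ne_zero, OfNat.zero_ne_ofNat,
    OfNat.ofNat_ne_one, OfNat.one_ne_ofNat, one_ne_zero, zero_ne_one, and_self, hq, hi, hy, hbits, hleaf, one_mul]

variable {B' G H L C : ℕ} (hbits : s.regs Code.bits = B) (hleaf : s.regs Code.leaf = G)
    (hBG : B ≠ G) (hB : B / 2 = B') (hH : m / 2 ^ B' = H) (hL : m - H * 2 ^ B' = L)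
    (hC : i + 1 + (H + 1) * 2 ^ B = C) (hHm : H * 2 ^ B' ≤ m) (hm : m < 2 ^ b)
    (hHb : H + 1 < 2 ^ b) (hCb : q + 16 * (C + 1) ≤ 2 ^ b)
include hbits hleaf hBG hB hH hL hC hHm hHb hCb hm

theorem run_deleteRemove_summary (h : s.mem (q + (16 * C + 2)) = s.mem (q + (16 * C + 3))) :
    (Code.deleteRemove.run b s).regs Code.q = q ∧
    (Code.deleteRemove.run b s).regs Code.i = i + 1 ∧
    (Code.deleteRemove.run b s).regs Code.y = H ∧
    (Code.deleteRemove.run b s).regs Code.bits = B' ∧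
    (Code.deleteRemove.run b s).regs Code.leaf = G ∧
    (Code.deleteRemove.run b s).regs Code.go = s.regs Code.go ∧
    (Code.deleteRemove.run b s).mem = update s.mem (q + (16 * C + 2)) 0 := by
  simp (disch := omega) only [Code.deleteRemove, Code.st, Code.ld, Code.addr, Code.split, Cmd.run,
    eval_rules, eval_binOp_rules, eval_lit, eval_add, eval_sub, eval_mul, eval_shl,
    eval_lt_pos, eval_lt_neg, eval_eq_pos, eval_eq_neg, update_reg, update_self,
    update_mem_of_ne, ↓reduceIte, Nat.reduceEqDiff, OfNat.ofNat_ne_zero, OfNat.zero_ne_ofNat,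
    OfNat.ofNat_ne_one, OfNat.one_ne_ofNat, one_ne_zero, zero_ne_one, and_self, hq, hi, hy, hbits, hleaf, hB, hH, hL, hC, h]

theorem run_deleteRemove_cluster (h : s.mem (q + (16 * C + 2)) ≠ s.mem (q + (16 * C + 3))) :
    (Code.deleteRemove.run b s).regs Code.q = q ∧
    (Code.deleteRemove.run b s).regs Code.i = C ∧
    (Code.deleteRemove.run b s).regs Code.y = L ∧
    (Code.deleteRemove.run b s).regs Code.bits = B' ∧
    (Code.deleteRemove.run b s).regs Code.leaf = G ∧
    (Code.deleteRemove.run b s).regs Code.go = s.regs Code.go ∧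
    (Code.deleteRemove.run b s).mem = s.mem := by
  simp (disch := omega) only [Code.deleteRemove, Code.st, Code.ld, Code.addr, Code.split, Cmd.run,
    eval_rules, eval_binOp_rules, eval_lit, eval_add, eval_sub, eval_mul, eval_shl,
    eval_lt_pos, eval_lt_neg, eval_eq_pos, eval_eq_neg, update_reg, update_self,
    update_mem_of_ne, ↓reduceIte, Nat.reduceEqDiff, OfNat.ofNat_ne_zero, OfNat.zero_ne_ofNat,
    OfNat.ofNat_ne_one, OfNat.one_ne_ofNat, one_ne_zero, zero_ne_one, and_self, hq, hi, hy, hbits, hleaf, hB, hH, hL, hC, h]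

end deleteRemove

/-! ### Deletion from a van Emde Boas tree -/

/-- The number `e - (e &&& (e - 1))` is the lowest one-bit of `e`. -/
theorem isLeast_testBit {e : ℕ} (he : e ≠ 0) :
    IsLeast {j | e.testBit j = true} (Nat.log 2 (e - (e &&& (e - 1)))) := by
  suffices h : ∃ m, e - (e &&& (e - 1)) = 2 ^ m ∧ IsLeast {j | e.testBit j = true} m by
    obtain ⟨m, h₁, h₂⟩ := h
    rwa [h₁, Nat.log_pow (by norm_num)]
  induction e using Nat.strong_induction_on with
  | _ e ih =>
  rcases Nat.even_or_odd' e with ⟨t, rfl | rfl⟩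
  · obtain ⟨m, h₁, h₂⟩ := ih t (by omega) (by omega)
    have h : 2 * t &&& (2 * t - 1) = 2 * (t &&& (t - 1)) := by
      apply Nat.eq_of_testBit_eq
      rintro (- | j)
      · simp
      · rw [Nat.testBit_and, Nat.testBit_succ, Nat.testBit_succ, Nat.testBit_succ,
          Nat.mul_div_cancel_left _ two_pos, Nat.mul_div_cancel_left _ two_pos,
          show (2 * t - 1) / 2 = t - 1 by omega, Nat.testBit_and]
    refine ⟨m + 1, by rw [h, ← Nat.mul_sub, h₁, pow_succ, mul_comm], ?_, ?_⟩
    · change (2 * t).testBit (m + 1) = true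
      rw [Nat.testBit_succ, Nat.mul_div_cancel_left _ two_pos]
      exact h₂.1
    · rintro (- | j) hj
      · simp at hj
      · change (2 * t).testBit (j + 1) = true at hj
        rw [Nat.testBit_succ, Nat.mul_div_cancel_left _ two_pos] at hj
        exact Nat.succ_le_succ (h₂.2 hj)
  · have h : (2 * t + 1) &&& (2 * t + 1 - 1) = 2 * t := by
      apply Nat.eq_of_testBit_eq
      rintro (- | j)
      · simp
      · rw [Nat.testBit_and, Nat.testBit_succ, Nat.testBit_succ,
          show (2 * t + 1) / 2 = t by omega, show (2 * t + 1 - 1) / 2 = t by omega,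
          Bool.and_self, Nat.testBit_succ, Nat.mul_div_cancel_left _ two_pos]
    exact ⟨0, by rw [h]; omega, by simp, fun _ _ => Nat.zero_le _⟩

theorem isGreatest_testBit {e : ℕ} (he : e ≠ 0) :
    IsGreatest {j | e.testBit j = true} (Nat.log 2 e) := by
  constructor
  · change e.testBit (Nat.log 2 e) = true
    rw [Nat.testBit_eq_decide_div_mod_eq, decide_eq_true_eq]
    have h₁ := Nat.pow_log_le_self 2 he
    have h₂ := Nat.lt_pow_succ_log_self (b := 2) (by norm_num) e
    have : e / 2 ^ Nat.log 2 e = 1 := by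
      rw [pow_succ] at h₂
      exact Nat.div_eq_of_lt_le (by omega) (by omega)
    rw [this]
  · intro j hj
    exact Nat.le_log_of_pow_le (by norm_num) (Nat.ge_two_pow_of_testBit hj)

/-- A bound for the steps of one iteration of a deletion. -/
def deleteStepTime : ℕ := 2 + Code.deleteStep.len

theorem loopFree_deleteStep : Code.deleteStep.LoopFree := by
  simp [Code.deleteStep, Code.deletePick, Code.deleteRemove, Code.split, Code.st, Cmd.LoopFree]

theorem ends_iff_pos {σ : ℕ → ℕ → ℕ} {i : ℕ} {A : Set ℕ} (h : Ends σ i A) :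
    σ 2 i ≠ 0 ↔ A.Nonempty := by
  rcases h with ⟨h, rfl⟩ | ⟨a, c, h, -, ha, -⟩
  · simp [h]
  · exact ⟨fun _ => ⟨a, ha.1⟩, fun _ => by omega⟩

/-- The outcome of the first half of a step of a deletion. -/
theorem deletePick_spec {b q g : ℕ} (hg : 1 ≤ g) (hgb : 2 ^ g ≤ b) (hb : 64 < 2 ^ b) {ℓ : ℕ}
    {s : State} {i y : ℕ} {A : Set ℕ} (hq : s.regs Code.q = q) (hi : s.regs Code.i = i)
    (hy : s.regs Code.y = y) (hbits : s.regs Code.bits = g * 2 ^ ℓ) (hleaf : s.regs Code.leaf = g)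
    (hblock : q + 16 * (i + univ g (ℓ + 1)) ≤ 2 ^ b)
    (hA : Holds g (arr s.mem q) ℓ i A) (hyA : y ∈ A) (hAu : ∀ x ∈ A, x < univ g ℓ) :
    Unchanged q [2, 3] i (i + 1) s.mem (Code.deletePick.run b s).mem ∧
    (((Code.deletePick.run b s).regs Code.go = 0 ∧
      Holds g (arr (Code.deletePick.run b s).mem q) ℓ i (A \ {y})) ∨
    ∃ m ∈ inner A,
      (Code.deletePick.run b s).regs Code.q = q ∧
      (Code.deletePick.run b s).regs Code.i = i ∧
      (Code.deletePick.run b s).regs Code.y = m ∧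
      (Code.deletePick.run b s).regs Code.bits = g * 2 ^ ℓ ∧
      (Code.deletePick.run b s).regs Code.leaf = g ∧
      (Code.deletePick.run b s).regs Code.go = s.regs Code.go ∧
      Ends (arr (Code.deletePick.run b s).mem q) i (A \ {y}) ∧
      inner (A \ {y}) = inner A \ {m} ∧
      Rest g (arr (Code.deletePick.run b s).mem q) ℓ i (inner A)) := by
  have hu := univ_le_succ g ℓ
  have hup := univ_pos g ℓ
  have hu2 : 2 ≤ univ g ℓ := by
    have : (2 : ℕ) ^ 1 ≤ univ g ℓ :=
      Nat.pow_le_pow_right (by norm_num) (Nat.mul_pos hg (Nat.two_pow_pos ℓ))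
    simpa using this
  rcases hA.1 with ⟨h₂, rfl⟩ | ⟨a, c, h₂, h₃, ha, hc⟩
  · exact hyA.elim
  have hau := hAu a ha.1
  have hcu := hAu c hc.1
  have hyu := hAu y hyA
  by_cases hac : a = c
  · subst hac
    obtain ⟨hgo', hmem⟩ := run_deletePick_singleton hb hq hi hy (by omega) (by omega)
      (h₂.trans h₃.symm)
    rw [hmem]
    have hAy := eq_singleton_of_ends ha hc
    rw [hAy] at hyA
    obtain rfl := hyA
    refine ⟨(Unchanged.refl _).store (by simp) le_rfl (by omega), .inl ⟨hgo', .inl ?_, ?_⟩⟩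
    · simp [arr_update, hAy]
    · rw [hAy, Set.sdiff_self]
      rw [inner_empty, ← inner_singleton y, ← hAy]
      refine hA.2.congr hg (by simp [arr_update]) fun c hc j h₁ _ => ?_
      rw [arr_update_of_ne (by simp) hc (by omega)]
  have hin : ∀ x, x ∈ inner A → x < univ g ℓ := fun x hx => hAu x hx.1
  obtain ⟨e, he, he0, heb, hleast, hgreatest⟩ : ∃ e,
      (if g * 2 ^ ℓ = g then s.mem (q + (16 * i + 4)) = e
        else s.mem (q + (16 * (i + 1) + 2)) = e) ∧ (e = 0 → inner A = ∅) ∧ e < 2 ^ b ∧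
      (e ≠ 0 → ∃ m C, IsLeast (inner A) m ∧
        if g * 2 ^ ℓ = g then e &&& (e - 1) ≤ e ∧ Nat.log 2 (e - (e &&& (e - 1))) = m
        else g * 2 ^ ℓ / 2 = g * 2 ^ (ℓ - 1) ∧ (e - 1) * 2 ^ (g * 2 ^ (ℓ - 1)) ≤ m ∧
          i + 1 + e * 2 ^ (g * 2 ^ ℓ) = C ∧ q + 16 * (C + 1) ≤ 2 ^ b ∧
          s.mem (q + (16 * C + 2)) = m - (e - 1) * 2 ^ (g * 2 ^ (ℓ - 1)) + 1) ∧
      (e ≠ 0 → ∃ m C e', IsGreatest (inner A) m ∧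
        if g * 2 ^ ℓ = g then Nat.log 2 e = m
        else s.mem (q + (16 * (i + 1) + 3)) = e' ∧ e' ≠ 0 ∧ e' < 2 ^ b ∧
          g * 2 ^ ℓ / 2 = g * 2 ^ (ℓ - 1) ∧ (e' - 1) * 2 ^ (g * 2 ^ (ℓ - 1)) ≤ m ∧
          i + 1 + e' * 2 ^ (g * 2 ^ ℓ) = C ∧ q + 16 * (C + 1) ≤ 2 ^ b ∧
          s.mem (q + (16 * C + 3)) = m - (e' - 1) * 2 ^ (g * 2 ^ (ℓ - 1)) + 1) := by
    rcases ℓ with - | ℓ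
    · have hR : {j | (arr s.mem q 4 i).testBit j = true} = inner A := Set.ext hA.2
      simp only [pow_zero, mul_one, if_true]
      refine ⟨_, rfl, fun h => ?_, ?_, fun h => ⟨_, 0, ?_, Nat.and_le_left, rfl⟩,
        fun h => ⟨_, 0, 0, ?_, rfl⟩⟩
      · rw [← hR, arr, h]; ext; simp
      · refine Nat.lt_pow_two_of_testBit _ fun j hj => ?_
        by_contra h
        have : j ∈ inner A := (hA.2 j).1 (by simpa [arr] using h)
        have := hin j this
        simp only [univ, pow_zero, mul_one] at this
        omega
      · rw [← hR]; exact isLeast_testBit h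
      · rw [← hR]; exact isGreatest_testBit h
    · have hR := rest_succ.1 hA.2
      have hQ := univ_pos g ℓ
      have hQ2 := univ_le_succ g ℓ
      have key : ∀ h < univ g ℓ, ∃ C, i + 1 + (h + 1) * 2 ^ (g * 2 ^ (ℓ + 1)) = C ∧
          q + 16 * (C + 1) ≤ 2 ^ b := by
        intro h hh
        refine ⟨_, rfl, ?_⟩
        have h₁ := block_le hg hh
        have h₂ := univ_pos g (ℓ + 1)
        change q + 16 * (i + 1 + (h + 1) * univ g (ℓ + 1) + 1) ≤ _
        rw [show ℓ + 1 + 1 = ℓ + 2 from rfl] at hblock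
        omega
      simp only [if_neg (bits_ne hg ℓ), Nat.add_sub_cancel]
      refine ⟨_, rfl, fun h => ?_, ?_, fun h => ?_, fun h => ?_⟩
      · by_contra hne
        obtain ⟨x, hx⟩ := Set.nonempty_iff_ne_empty.2 hne
        refine (ends_iff_pos hR.1.1).2 ⟨x / univ g ℓ, x % univ g ℓ, Nat.mod_lt _ hQ, ?_⟩ h
        rwa [Nat.div_add_mod']
      · rcases hR.1.1 with ⟨h, -⟩ | ⟨a', c', h, -, ha', -⟩
        · rw [arr] at h; omega
        · have := lt_univ_of_mem_highs hin ha'.1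
          rw [arr] at h; omega
      · rcases hR.1.1 with ⟨h', -⟩ | ⟨a', c', h', -, ha', -⟩
        · exact (h h').elim
        have ha'' := lt_univ_of_mem_highs hin ha'.1
        obtain ⟨C, hC, hCb⟩ := key a' ha''
        rcases (hR.2 a' ha'').1 with ⟨-, h₀⟩ | ⟨a₂, c₂, h₂', -, ha₂, -⟩
        · exact (Set.nonempty_iff_ne_empty.1 (mem_highs_iff.1 ha'.1) h₀).elim
        refine ⟨a' * univ g ℓ + a₂, C, isLeast_halves ha' ha₂ hQ, bits_half g ℓ, ?_, ?_, hCb, ?_⟩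
        · rw [arr] at h'; rw [h', Nat.add_sub_cancel]; exact Nat.le_add_right _ _
        · rw [arr] at h'; rw [h', hC]
        · rw [arr] at h' h₂'
          change _ + (a' + 1) * univ g (ℓ + 1) = C at hC
          rw [hC] at h₂'
          rw [h', h₂', Nat.add_sub_cancel]
          change _ = a' * univ g ℓ + a₂ - a' * univ g ℓ + 1
          omega
      · rcases hR.1.1 with ⟨h', -⟩ | ⟨a', c', -, h', -, ha'⟩
        · exact (h h').elim
        have ha'' := lt_univ_of_mem_highs hin ha'.1
        obtain ⟨C, hC, hCb⟩ := key c' ha''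
        rcases (hR.2 c' ha'').1 with ⟨-, h₀⟩ | ⟨a₂, c₂, -, h₂', -, ha₂⟩
        · exact (Set.nonempty_iff_ne_empty.1 (mem_highs_iff.1 ha'.1) h₀).elim
        refine ⟨c' * univ g ℓ + c₂, C, c' + 1, isGreatest_halves ha' ha₂ hQ, h', by omega, by omega,
          bits_half g ℓ, ?_, hC, hCb, ?_⟩
        · rw [Nat.add_sub_cancel]; exact Nat.le_add_right _ _
        · rw [arr] at h₂'
          change _ + (c' + 1) * univ g (ℓ + 1) = C at hC
          rw [hC] at h₂'
          rw [h₂', Nat.add_sub_cancel]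
          change _ = c' * univ g ℓ + c₂ - c' * univ g ℓ + 1
          omega
  by_cases h0 : e = 0
  · have hemp := he0 h0
    have hpair := eq_pair_of_inner_eq_empty ha hc hemp
    have hya : y = a ∨ y = c := by rw [hpair] at hyA; exact hyA
    obtain ⟨m, hm⟩ : ∃ m, m + y = a + c := ⟨a + c - y, by omega⟩
    obtain ⟨hgo', hmem⟩ := run_deletePick_pair hb hq hi hy (by omega) hac (by omega) h₂ h₃ hbits hleaf
      he hm hya h0
    rw [hmem]
    have hAy : A \ {y} = {m} := by
      rw [hpair]
      ext z
      simp only [Set.mem_sdiff, Set.mem_insert_iff, Set.mem_singleton_iff]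
      omega
    refine ⟨((Unchanged.refl _).store (by simp) le_rfl (by omega)).store (by simp) le_rfl (by omega),
      .inl ⟨hgo', ?_⟩⟩
    rw [hAy]
    exact hA.store_ends hg (by simp) (by simp) (by rw [inner_singleton, hemp])
  · obtain ⟨m₁, C₁, hm₁, hc₁⟩ := hleast h0
    obtain ⟨m₂, C₂, e₂, hm₂, hc₂⟩ := hgreatest h0
    have hm₁u := hin _ hm₁.1
    have hm₂u := hin _ hm₂.1
    by_cases hya : y = a
    · obtain ⟨r₁, r₂, r₃, r₄, r₅, r₆, hmem⟩ := run_deletePick_least hb hq hi hy (by omega) hac (by omega) h₂ h₃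
        hbits hleaf he hya h0 (by omega) heb hc₁
      obtain ⟨k₁, k₂, k₃⟩ := erase_least ha hc hm₁
      subst hya
      rw [hmem]
      refine ⟨(Unchanged.refl _).store (by simp) le_rfl (by omega), .inr ⟨m₁, hm₁.1, r₁, r₂, r₃, r₄,
        r₅, r₆, .inr ⟨m₁, c, by simp [arr_update], ?_, k₁, k₂⟩, k₃, ?_⟩⟩
      · simpa [arr_update] using h₃
      · refine hA.2.congr hg (by simp [arr_update]) fun c hc j h₁ _ => ?_
        rw [arr_update_of_ne (by simp) hc (by omega)]
    by_cases hyc : y = c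
    · obtain ⟨r₁, r₂, r₃, r₄, r₅, r₆, hmem⟩ := run_deletePick_greatest hb hq hi hy (by omega) hac (by omega) h₂
        h₃ hbits hleaf he hyc h0 (by omega) hc₂
      obtain ⟨k₁, k₂, k₃⟩ := erase_greatest ha hc hm₂
      subst hyc
      rw [hmem]
      refine ⟨(Unchanged.refl _).store (by simp) le_rfl (by omega), .inr ⟨m₂, hm₂.1, r₁, r₂, r₃, r₄,
        r₅, r₆, .inr ⟨a, m₂, ?_, by simp [arr_update], k₁, k₂⟩, k₃, ?_⟩⟩
      · simpa [arr_update] using h₂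
      · refine hA.2.congr hg (by simp [arr_update]) fun c hc j h₁ _ => ?_
        rw [arr_update_of_ne (by simp) hc (by omega)]
    · obtain ⟨r₁, r₂, r₃, r₄, r₅, r₆, hmem⟩ := run_deletePick_inner hb hq hi hy (by omega) hac (by omega) h₂ h₃
        hbits hleaf he hya hyc (by omega) h0
      obtain ⟨k₁, k₂, k₃⟩ := erase_inner ha hc hya hyc
      rw [hmem]
      exact ⟨.refl _, .inr ⟨y, ⟨hyA, ⟨a, ha.1, lt_of_le_of_ne (ha.2 hyA) (Ne.symm hya)⟩,
        c, hc.1, lt_of_le_of_ne (hc.2 hyA) hyc⟩, r₁, r₂, r₃, r₄, r₅, r₆,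
        .inr ⟨a, c, h₂, h₃, k₁, k₂⟩, k₃, hA.2⟩⟩

/-- A deletion goes on in the summary if the cluster has no other elements, and in the cluster
otherwise. -/
theorem halts_deleteLoop {b q g : ℕ} (hg : 1 ≤ g) (hgb : 2 ^ g ≤ b) (hb : 64 < 2 ^ b) {ℓ : ℕ}
    {s : State} {i y : ℕ} {A : Set ℕ} (hq : s.regs Code.q = q) (hi : s.regs Code.i = i)
    (hy : s.regs Code.y = y) (hbits : s.regs Code.bits = g * 2 ^ ℓ) (hleaf : s.regs Code.leaf = g)
    (hgo : s.regs Code.go = 1) (hblock : q + 16 * (i + univ g (ℓ + 1)) ≤ 2 ^ b)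
    (hA : Holds g (arr s.mem q) ℓ i A) (hyA : y ∈ A) (hAu : ∀ x ∈ A, x < univ g ℓ) :
    Halts b Code.deleteLoop s ((ℓ + 1) * deleteStepTime + 2) (fun s' =>
      Holds g (arr s'.mem q) ℓ i (A \ {y}) ∧
      Unchanged q [2, 3, 4] i (i + univ g (ℓ + 1)) s.mem s'.mem) := by
  induction ℓ using Nat.strong_induction_on generalizing s i y A with
  | _ ℓ ih =>
  have hu := univ_le_succ g ℓ
  have hup := univ_pos g ℓ
  rw [show (ℓ + 1) * deleteStepTime + 2 =
    1 + 1 + Code.deleteStep.len + (ℓ * deleteStepTime + 2) by rw [deleteStepTime]; ring]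
  refine Halts.while_run (by simp [Expr.eval, hgo]) loopFree_deleteStep ?_
  obtain ⟨hU₁, ⟨hgo', hA'⟩ | ⟨m, hm, hq', hi', hy', hbits', hleaf', hgo', hE, hin, hR⟩⟩ :=
    deletePick_spec hg hgb hb hq hi hy hbits hleaf hblock hA hyA hAu
  · have hrun : Code.deleteStep.run b s = Code.deletePick.run b s := by
      simp only [Code.deleteStep, Cmd.run, Expr.eval, hgo', if_true]
    rw [hrun]
    exact (Halts.while_false (e := .reg Code.go) hgo' ⟨hA', hU₁.mono (by simp) le_rfl (by omega)⟩).mono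
      (Nat.le_add_left _ _) fun _ => id
  have hrun : Code.deleteStep.run b s = Code.deleteRemove.run b (Code.deletePick.run b s) := by
    simp only [Code.deleteStep, Cmd.run, Expr.eval, hgo', hgo, one_ne_zero, if_false]
  rw [hrun]
  rw [hgo] at hgo'
  replace hU₁ : Unchanged q [2, 3, 4] i (i + univ g (ℓ + 1)) s.mem (Code.deletePick.run b s).mem :=
    hU₁.mono (by simp) le_rfl (by omega)
  generalize Code.deletePick.run b s = s₁ at *
  have hmu : m < univ g ℓ := hAu m hm.1
  have hRu : ∀ x ∈ inner A, x < univ g ℓ := fun x hx => hAu x hx.1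
  rcases ℓ with - | ℓ
  · have hmb : m < b := lt_of_lt_of_le (by simpa [univ] using hmu) hgb
    obtain ⟨hgo', hmem⟩ := run_deleteRemove_leaf hb hq' hi' hy' (by omega) hbits'
      (by simpa using hleaf') (Nat.pow_lt_pow_right (by norm_num) hmb)
    refine (Halts.while_false (e := .reg Code.go) hgo' ?_).mono (Nat.le_add_left _ _) fun _ => id
    rw [hmem]
    refine ⟨⟨hE.congr_arr fun c hc => ?_, fun j => ?_⟩, hU₁.store (by simp) le_rfl (by omega)⟩
    · simp only [List.mem_cons, List.not_mem_nil, or_false] at hc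
      rcases hc with rfl | rfl <;> simp [arr_update]
    · have h := hR j
      have h' := hR m
      rw [hin, Set.mem_sdiff, ← h, Set.mem_singleton_iff]
      simp only [arr_update, Nat.reduceLT, and_self, if_true, Nat.testBit_xor, Nat.testBit_two_pow]
      change ((arr s₁.mem q 4 i).testBit j ^^ decide (m = j)) = true ↔ _
      by_cases hj : j = m
      · subst hj; simp [h'.2 hm]
      · simp [hj, Ne.symm hj]
  obtain ⟨H, hH⟩ : ∃ H, m / univ g ℓ = H := ⟨_, rfl⟩
  obtain ⟨L, hL⟩ : ∃ L, m - H * univ g ℓ = L := ⟨_, rfl⟩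
  obtain ⟨C, hC⟩ : ∃ C, i + 1 + (H + 1) * univ g (ℓ + 1) = C := ⟨_, rfl⟩
  obtain ⟨hHL, hHu, hLu, hC₁, hC₂⟩ := split_spec hg hmu hH hL hC
  rw [show ℓ + 1 + 1 = ℓ + 2 from rfl] at *
  have hu' := univ_le_succ g ℓ
  have hup' := univ_pos g ℓ
  have hclu := (rest_succ.1 hR).2 H hHu
  rw [hC] at hclu
  have hLmem : L ∈ lows (univ g ℓ) (inner A) H := ⟨hLu, by rwa [hHL]⟩
  have hHm : H * 2 ^ (g * 2 ^ ℓ) ≤ m := by change H * univ g ℓ ≤ m; omega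
  rcases hclu.1 with ⟨-, h⟩ | ⟨x, z, hx, hz, hxl, hzg⟩
  · rw [h] at hLmem; exact hLmem.elim
  by_cases hxz : x = z
  · subst hxz
    obtain ⟨hq', hi', hy', hbits', hleaf', hgo'', hmem⟩ :=
      run_deleteRemove_summary hb hq' hi' hy' (by omega) hbits' hleaf'
        (bits_ne hg ℓ) (bits_half g ℓ) hH hL hC hHm (by omega) (by omega) (by omega) (hx.trans hz.symm)
    have hlow := eq_singleton_of_ends hxl hzg
    have hLx : L = x := by rw [hlow] at hLmem; exact hLmem
    rw [← hLx] at hlow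
    have hsum : Holds g (arr (Code.deleteRemove.run b s₁).mem q) ℓ (i + 1)
        (highs (univ g ℓ) (inner A)) := by
      refine (rest_succ.1 hR).1.congr hg fun c hc j h₁ h₂ => ?_
      rw [hmem, arr_update_of_ne (by simp) hc (by omega)]
    refine (ih ℓ (by omega) hq' hi' hy' hbits' hleaf' (hgo''.trans hgo') (by omega) hsum
      ⟨L, hLmem⟩ fun x hx => lt_univ_of_mem_highs hRu hx).mono le_rfl ?_
    rintro s' ⟨hs', hU⟩
    have harr : ∀ c ∈ [2, 3, 4], ∀ j, (j < i + 1 ∨ i + 1 + univ g (ℓ + 1) ≤ j) → j ≠ C →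
        arr s'.mem q c j = arr s₁.mem q c j := by
      intro c hc j h₁ h₂
      rw [hU.arr_field hc h₁, hmem, arr_update_of_ne (by simp) hc h₂]
    refine ⟨⟨hE.congr_arr fun c hc => harr c (by simp at hc ⊢; omega) i (by omega) (by omega), ?_⟩, ?_⟩
    · rw [hin]
      refine hR.replace hg hHu (fun c hc j h₁ h₂ => harr c hc j (by omega) (by omega)) ?_ ?_ ?_ (h := H)
      · rwa [← hHL, highs_erase_of_lows_eq hLu hlow]
      · rw [← hHL, lows_erase hLu, hlow, Set.sdiff_self, hC]
        rw [hlow] at hclu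
        refine ⟨.inl ⟨?_, rfl⟩, ?_⟩
        · rw [hU.arr_field (by simp) (by omega), hmem]
          simp [arr_update]
        · rw [inner_empty, ← inner_singleton L]
          refine hclu.2.congr hg ?_ fun c hc j h₁ h₂ => harr c hc j (by omega) (by omega)
          rw [hU.arr_field (by simp) (by omega), hmem]
          simp [arr_update]
      · intro k hk
        rw [← hHL, lows_erase_of_ne hLu hk]
    · refine hU₁.trans (Unchanged.trans ?_ (hU.mono (by simp) (by omega) (by omega)))
      rw [hmem]
      exact (Unchanged.refl _).store (by simp) (by omega) (by omega)
  · have hne : s₁.mem (q + (16 * C + 2)) ≠ s₁.mem (q + (16 * C + 3)) := by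
      rw [arr] at hx hz; omega
    obtain ⟨hq', hi', hy', hbits', hleaf', hgo'', hmem⟩ :=
      run_deleteRemove_cluster hb hq' hi' hy' (by omega) hbits' hleaf'
        (bits_ne hg ℓ) (bits_half g ℓ) hH hL hC hHm (by omega) (by omega) (by omega) hne
    rw [← hmem] at hclu
    refine (ih ℓ (by omega) hq' hi' hy' hbits' hleaf' (hgo''.trans hgo') (by omega) hclu
      hLmem fun x hx => hx.1).mono le_rfl ?_
    rintro s' ⟨hs', hU⟩
    rw [hmem] at hU
    obtain ⟨L', hL', hLL'⟩ : ∃ L' ∈ lows (univ g ℓ) (inner A) H, L' ≠ L := by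
      by_cases h : x = L
      · exact ⟨z, hzg.1, by omega⟩
      · exact ⟨x, hxl.1, h⟩
    refine ⟨⟨hE.congr_arr fun c hc => hU.arr_field (by simp at hc ⊢; omega) (by omega), ?_⟩, ?_⟩
    · rw [hin]
      refine hR.replace hg hHu (fun c hc j h₁ h₂ => hU.arr_field hc (by omega)) ?_ ?_ ?_ (h := H)
      · rw [← hHL, highs_erase_of_lows_ne hLu hL' hLL']
        exact (rest_succ.1 hR).1.congr hg fun c hc j h₁ h₂ => hU.arr_field hc (by omega)
      · rwa [← hHL, lows_erase hLu, hC]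
      · intro k hk
        rw [← hHL, lows_erase_of_ne hLu hk]
    · exact hU₁.trans (hU.mono (by simp) (by omega) (by omega))

/-! ### One step of a predecessor search -/

namespace Code
open WordRAM.Expr WordRAM.Cmd

/-- One step down in the search for the greatest element below `y`. It goes on in the cluster of
the high half of `y` if this has an element below the low half, otherwise in the summary; a frame
on the stack records how to turn the result of the subtree into that of the tree. -/
def predStep : Cmd :=
  lo ::= ld 2 i ;;
  hi ::= ld 3 i ;;
  ite (bin .lt y hi)
    (res ::= lo - 1 ;;
      ite (bin .eq bits leaf)
        (go ::= 0 ;;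
          e ::= bin .band (ld 4 i) (bin .shl 1 y - 1) ;;
          ite e (res ::= msb e) skip)
        (split ;;
          e ::= ld 2 clu ;;
          ite (bin .lt 0 e * bin .lt e (l + 1))
            (st 11 depth (h + 1) ;; depth ::= depth + 1 ;; i ::= clu ;; y ::= l)
            (e ::= ld 2 (i + 1) ;;
              ite (bin .lt 0 e * bin .lt e (h + 1))
                (st 10 depth i ;; st 11 depth 0 ;; depth ::= depth + 1 ;; i ::= i + 1 ;; y ::= h)
                (bits ::= 2 * bits ;; go ::= 0))))
    (res ::= hi - 1 ;; go ::= 0)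

/-- The way down of a search, until the answer is found in a node. -/
def predDown : Cmd := .while go predStep

/-- One step back up: the greatest element below `y` has been found in a subtree. -/
def predUpStep : Cmd :=
  depth ::= depth - 1 ;;
  e ::= ld 11 depth ;;
  ite e (res ::= bin .shl (e - 1) bits + res)
    (clu ::= ld 10 depth + 1 + bin .shl (res + 1) (2 * bits) ;;
      res ::= bin .shl res bits + (ld 3 clu - 1)) ;;
  bits ::= 2 * bits

/-- The way back up, until the stack is empty. -/
def predUp : Cmd := .while depth predUpStep

end Code

section run

variable {b q i y a c B G : ℕ} {s : State} (hb : 64 < 2 ^ b) (hq : s.regs Code.q = q)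
  (hi : s.regs Code.i = i) (hy : s.regs Code.y = y) (hblock : q + 16 * (i + 1 + 1) ≤ 2 ^ b)
  (h₂ : s.mem (q + (16 * i + 2)) = a + 1) (h₃ : s.mem (q + (16 * i + 3)) = c + 1)
  (hbits : s.regs Code.bits = B) (hover : a + c + y + 2 < 2 ^ b)
include hb hq hi hy hblock h₂ h₃ hbits hover

theorem run_predStep_above (hcy : c < y) :
    (Code.predStep.run b s).regs Code.q = q ∧
    (Code.predStep.run b s).regs Code.depth = s.regs Code.depth ∧
    (Code.predStep.run b s).regs Code.bits = B ∧
    (Code.predStep.run b s).regs Code.res = c ∧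
    (Code.predStep.run b s).regs Code.go = 0 ∧
    (Code.predStep.run b s).mem = s.mem := by
  have e₁ : c + 1 - 1 = c := by omega
  simp (disch := omega) only [Code.predStep, Code.st, Code.ld, Code.addr, Code.split, Cmd.run,
    eval_rules, eval_binOp_rules, eval_lit, eval_add, eval_sub, eval_mul, eval_shl,
    eval_lt_pos, eval_lt_neg, eval_eq_pos, eval_eq_neg, update_reg, update_self,
    update_mem_of_ne, ↓reduceIte, Nat.reduceEqDiff, OfNat.ofNat_ne_zero, OfNat.zero_ne_ofNat,
    OfNat.ofNat_ne_one, OfNat.one_ne_ofNat, one_ne_zero, zero_ne_one, and_self, hq, hi, hy, h₂, h₃,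
    hbits, e₁]

variable (hleaf : s.regs Code.leaf = G) (hyc : y ≤ c)
include hleaf hyc

theorem run_predStep_leaf {M : ℕ} (hBG : B = G) (hyb : 2 ^ y < 2 ^ b)
    (hM : s.mem (q + (16 * i + 4)) &&& (2 ^ y - 1) = M) :
    (Code.predStep.run b s).regs Code.q = q ∧
    (Code.predStep.run b s).regs Code.depth = s.regs Code.depth ∧
    (Code.predStep.run b s).regs Code.bits = B ∧
    (Code.predStep.run b s).regs Code.res = (if M = 0 then a else Nat.log 2 M) ∧
    (Code.predStep.run b s).regs Code.go = 0 ∧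
    (Code.predStep.run b s).mem = s.mem := by
  have e₁ : a + 1 - 1 = a := by omega
  have e₂ := Nat.two_pow_pos y
  by_cases hM0 : M = 0
  all_goals
    simp (disch := omega) only [Code.predStep, Code.st, Code.ld, Code.addr, Code.split, Cmd.run,
      eval_rules, eval_binOp_rules, eval_lit, eval_add, eval_sub, eval_mul, eval_shl,
      eval_lt_pos, eval_lt_neg, eval_eq_pos, eval_eq_neg, update_reg, update_self,
      update_mem_of_ne, ↓reduceIte, Nat.reduceEqDiff, OfNat.ofNat_ne_zero, OfNat.zero_ne_ofNat,
      OfNat.ofNat_ne_one, OfNat.one_ne_ofNat, one_ne_zero, zero_ne_one, and_self, hq, hi, hy, h₂,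
      h₃, hbits, hleaf, e₁, one_mul, hM, hM0]

variable {B' H L C t S : ℕ} (hBG : B ≠ G) (hB : B / 2 = B') (hB2 : 2 * B' = B) (hBb : B < 2 ^ b)
    (hH : y / 2 ^ B' = H) (hL : y - H * 2 ^ B' = L)
    (hC : i + 1 + (H + 1) * 2 ^ B = C) (hHm : H * 2 ^ B' ≤ y)
    (hHb : H + 1 < 2 ^ b) (hCb : q + 16 * (C + 1) ≤ 2 ^ b)
    (ht : s.regs Code.depth = t) (htb : q + 16 * (t + 1) ≤ 2 ^ b)
    (hS : s.mem (q + (16 * C + 2)) = S)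
include hBG hB hB2 hBb hH hL hC hHm hHb hCb ht htb hS

theorem run_predStep_cluster (hS0 : S ≠ 0) (hSL : S ≤ L) :
    (Code.predStep.run b s).regs Code.q = q ∧
    (Code.predStep.run b s).regs Code.i = C ∧
    (Code.predStep.run b s).regs Code.y = L ∧
    (Code.predStep.run b s).regs Code.depth = t + 1 ∧
    (Code.predStep.run b s).regs Code.bits = B' ∧
    (Code.predStep.run b s).regs Code.leaf = G ∧
    (Code.predStep.run b s).regs Code.go = s.regs Code.go ∧
    (Code.predStep.run b s).mem = update s.mem (q + (16 * t + 11)) (H + 1) := by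
  simp (disch := omega) only [Code.predStep, Code.st, Code.ld, Code.addr, Code.split, Cmd.run,
    eval_rules, eval_binOp_rules, eval_lit, eval_add, eval_sub, eval_mul, eval_shl,
    eval_lt_pos, eval_lt_neg, eval_eq_pos, eval_eq_neg, update_reg, update_self,
    update_mem_of_ne, ↓reduceIte, Nat.reduceEqDiff, OfNat.ofNat_ne_zero, OfNat.zero_ne_ofNat,
    OfNat.ofNat_ne_one, OfNat.one_ne_ofNat, one_ne_zero, zero_ne_one, and_self, hq, hi, hy, h₂, h₃,
    hbits, hleaf, hB, hH, hL, hC, ht, hS, mul_one]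

variable {S' : ℕ} (hS' : s.mem (q + (16 * (i + 1) + 2)) = S') (hSL : S = 0 ∨ L < S)
include hS' hSL

theorem run_predStep_summary (hS'0 : S' ≠ 0) (hSH : S' ≤ H) :
    (Code.predStep.run b s).regs Code.q = q ∧
    (Code.predStep.run b s).regs Code.i = i + 1 ∧
    (Code.predStep.run b s).regs Code.y = H ∧
    (Code.predStep.run b s).regs Code.depth = t + 1 ∧
    (Code.predStep.run b s).regs Code.bits = B' ∧
    (Code.predStep.run b s).regs Code.leaf = G ∧
    (Code.predStep.run b s).regs Code.go = s.regs Code.go ∧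
    (Code.predStep.run b s).mem =
      update (update s.mem (q + (16 * t + 10)) i) (q + (16 * t + 11)) 0 := by
  rcases Nat.eq_zero_or_pos S with h0 | h0
  · subst h0
    simp (disch := omega) only [Code.predStep, Code.st, Code.ld, Code.addr, Code.split, Cmd.run,
      eval_rules, eval_binOp_rules, eval_lit, eval_add, eval_sub, eval_mul, eval_shl,
      eval_lt_pos, eval_lt_neg, eval_eq_pos, eval_eq_neg, update_reg, update_self,
      update_mem_of_ne, ↓reduceIte, Nat.reduceEqDiff, OfNat.ofNat_ne_zero, OfNat.zero_ne_ofNat,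
      OfNat.ofNat_ne_one, OfNat.one_ne_ofNat, one_ne_zero, zero_ne_one, and_self, hq, hi, hy, h₂,
      h₃, hbits, hleaf, hB, hH, hL, hC, ht, hS, hS', mul_one, zero_mul]
  · have hLS : L + 1 ≤ S := by omega
    simp (disch := omega) only [Code.predStep, Code.st, Code.ld, Code.addr, Code.split, Cmd.run,
      eval_rules, eval_binOp_rules, eval_lit, eval_add, eval_sub, eval_mul, eval_shl,
      eval_lt_pos, eval_lt_neg, eval_eq_pos, eval_eq_neg, update_reg, update_self,
      update_mem_of_ne, ↓reduceIte, Nat.reduceEqDiff, OfNat.ofNat_ne_zero, OfNat.zero_ne_ofNat,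
      OfNat.ofNat_ne_one, OfNat.one_ne_ofNat, one_ne_zero, zero_ne_one, and_self, hq, hi, hy, h₂,
      h₃, hbits, hleaf, hB, hH, hL, hC, ht, hS, hS', mul_one, mul_zero]

theorem run_predStep_none (hSH : S' = 0 ∨ H < S') :
    (Code.predStep.run b s).regs Code.q = q ∧
    (Code.predStep.run b s).regs Code.depth = s.regs Code.depth ∧
    (Code.predStep.run b s).regs Code.bits = B ∧
    (Code.predStep.run b s).regs Code.res = a ∧
    (Code.predStep.run b s).regs Code.go = 0 ∧
    (Code.predStep.run b s).mem = s.mem := by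
  have e₁ : a + 1 - 1 = a := by omega
  have e₂ : BinOp.eval b .mul (BinOp.eval b .lt 0 S) (BinOp.eval b .lt S (L + 1)) = 0 := by
    rcases Nat.eq_zero_or_pos S with h0 | h0
    · rw [eval_lt_neg h0.le, eval_mul (by simp), zero_mul]
    · rw [eval_lt_neg (x := S) (by omega), eval_mul (by simp), mul_zero]
  have e₃ : BinOp.eval b .mul (BinOp.eval b .lt 0 S') (BinOp.eval b .lt S' (H + 1)) = 0 := by
    rcases Nat.eq_zero_or_pos S' with h0 | h0
    · rw [eval_lt_neg h0.le, eval_mul (by simp), zero_mul]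
    · rw [eval_lt_neg (x := S') (by omega), eval_mul (by simp), mul_zero]
  simp (disch := omega) only [Code.predStep, Code.st, Code.ld, Code.addr, Code.split, Cmd.run,
    eval_rules, eval_binOp_rules, eval_lit, eval_add, eval_sub, e₂, e₃, eval_mul, eval_shl,
    eval_lt_pos, eval_lt_neg, eval_eq_pos, eval_eq_neg, update_reg, update_self,
    update_mem_of_ne, ↓reduceIte, Nat.reduceEqDiff, OfNat.ofNat_ne_zero, OfNat.zero_ne_ofNat,
    OfNat.ofNat_ne_one, OfNat.one_ne_ofNat, one_ne_zero, zero_ne_one, and_self, hq, hi, hy, h₂, h₃,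
    hbits, hleaf, hB, hB2, hH, hL, hC, ht, hS, hS', e₁]

end run

section runUp

variable {b q t r B : ℕ} {s : State} (hb : 64 < 2 ^ b) (hq : s.regs Code.q = q)
  (ht : s.regs Code.depth = t + 1) (hr : s.regs Code.res = r) (hbits : s.regs Code.bits = B)
  (hBb : 2 * B < 2 ^ b) (htb : q + 16 * (t + 1) ≤ 2 ^ b)
include hb hq ht hr hbits hBb htb

theorem run_predUpStep_cluster {H : ℕ} (hH : s.mem (q + (16 * t + 11)) = H + 1)
    (hover : H * 2 ^ B + r + 1 < 2 ^ b) (hHb : H + 1 < 2 ^ b) :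
    (Code.predUpStep.run b s).regs Code.q = q ∧
    (Code.predUpStep.run b s).regs Code.depth = t ∧
    (Code.predUpStep.run b s).regs Code.bits = 2 * B ∧
    (Code.predUpStep.run b s).regs Code.res = H * 2 ^ B + r ∧
    (Code.predUpStep.run b s).mem = s.mem := by
  have e₁ : t + 1 - 1 = t := by omega
  have e₂ : H + 1 - 1 = H := by omega
  have e₃ : H + 1 ≠ 0 := by omega
  simp (disch := omega) only [Code.predUpStep, Code.st, Code.ld, Code.addr, Code.split, Cmd.run,
    eval_rules, eval_binOp_rules, eval_lit, eval_add, eval_sub, eval_mul, eval_shl,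
    eval_lt_pos, eval_lt_neg, eval_eq_pos, eval_eq_neg, update_reg, update_self,
    update_mem_of_ne, ↓reduceIte, Nat.reduceEqDiff, OfNat.ofNat_ne_zero, OfNat.zero_ne_ofNat,
    OfNat.ofNat_ne_one, OfNat.one_ne_ofNat, one_ne_zero, zero_ne_one, and_self, hq, ht, hr, hbits,
    hH, e₁, e₂, e₃]

theorem run_predUpStep_summary {i C z : ℕ} (hH : s.mem (q + (16 * t + 11)) = 0)
    (hi : s.mem (q + (16 * t + 10)) = i) (hC : i + 1 + (r + 1) * 2 ^ (2 * B) = C)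
    (hCb : q + 16 * (C + 1) ≤ 2 ^ b) (hz : s.mem (q + (16 * C + 3)) = z + 1)
    (hover : r * 2 ^ B + z + 1 < 2 ^ b) (hrb : r + 1 < 2 ^ b) :
    (Code.predUpStep.run b s).regs Code.q = q ∧
    (Code.predUpStep.run b s).regs Code.depth = t ∧
    (Code.predUpStep.run b s).regs Code.bits = 2 * B ∧
    (Code.predUpStep.run b s).regs Code.res = r * 2 ^ B + z ∧
    (Code.predUpStep.run b s).mem = s.mem := by
  have e₁ : t + 1 - 1 = t := by omega
  have e₂ : z + 1 - 1 = z := by omega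
  simp (disch := omega) only [Code.predUpStep, Code.st, Code.ld, Code.addr, Code.split, Cmd.run,
    eval_rules, eval_binOp_rules, eval_lit, eval_add, eval_sub, eval_mul, eval_shl,
    eval_lt_pos, eval_lt_neg, eval_eq_pos, eval_eq_neg, update_reg, update_self,
    update_mem_of_ne, ↓reduceIte, Nat.reduceEqDiff, OfNat.ofNat_ne_zero, OfNat.zero_ne_ofNat,
    OfNat.ofNat_ne_one, OfNat.one_ne_ofNat, one_ne_zero, zero_ne_one, and_self, hq, ht, hr, hbits,
    hH, hi, hC, hz, e₁, e₂]

end runUp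

/-! ### Predecessors in a van Emde Boas tree -/

theorem Halts.while_seq_run {b : ℕ} {c c' : Cmd} {s : State} {T : ℕ} {P : State → Prop} {e : Expr}
    (h : e.eval b s ≠ 0) (hc : c.LoopFree)
    (hP : Halts b (.seq (.while e c) c') (c.run b s) T P) :
    Halts b (.seq (.while e c) c') s (e.cost + 1 + c.len + T) P := by
  obtain ⟨t₁, e₁, l₁⟩ := exec_run b c hc s
  obtain ⟨t, s', ex, l, p⟩ := hP
  cases ex with
  | seq h₁ h₂ => exact ⟨_, _, .seq (.while_true h e₁ h₁) h₂, by omega, p⟩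

theorem Halts.while_seq_false {b : ℕ} {c c' : Cmd} {s : State} {T : ℕ} {P : State → Prop} {e : Expr}
    (h : e.eval b s = 0) (hP : Halts b c' s T P) :
    Halts b (.seq (.while e c) c') s (e.cost + 1 + T) P :=
  .seq ⟨_, _, .while_false h, le_rfl, hP⟩

theorem exists_isGreatest_lt {A : Set ℕ} {y : ℕ} (h : ∃ a ∈ A, a < y) :
    ∃ r, IsGreatest {a ∈ A | a < y} r := by
  obtain ⟨a, ha, hay⟩ := h
  have hb : BddAbove {a ∈ A | a < y} := ⟨y, fun z hz => hz.2.le⟩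
  exact ⟨_, Nat.sSup_mem ⟨a, ha, hay⟩ hb, fun z hz => le_csSup hb hz⟩

theorem pred_inner {A : Set ℕ} {a c y r : ℕ} (ha : IsLeast A a) (hc : c ∈ A) (hyc : y ≤ c)
    (hr : IsGreatest {x ∈ inner A | x < y} r) : IsGreatest {x ∈ A | x < y} r := by
  refine ⟨⟨hr.1.1.1, hr.1.2⟩, fun z hz => ?_⟩
  obtain ⟨a', ha', h'⟩ := hr.1.1.2.1
  rcases (ha.2 hz.1).eq_or_lt with h | h
  · have := ha.2 ha'; omega
  · exact hr.2 ⟨⟨hz.1, ⟨a, ha.1, h⟩, c, hc, lt_of_lt_of_le hz.2 hyc⟩, hz.2⟩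

theorem pred_least {A : Set ℕ} {a c y : ℕ} (ha : IsLeast A a) (hc : c ∈ A) (hyc : y ≤ c)
    (hay : a < y) (hno : ∀ x ∈ inner A, y ≤ x) : IsGreatest {x ∈ A | x < y} a := by
  refine ⟨⟨ha.1, hay⟩, fun z hz => ?_⟩
  rcases (ha.2 hz.1).eq_or_lt with h | h
  · exact h.ge
  · have := hno z ⟨hz.1, ⟨a, ha.1, h⟩, c, hc, lt_of_lt_of_le hz.2 hyc⟩
    have := hz.2
    omega

theorem isGreatest_testBit_lt {e y : ℕ} {R : Set ℕ} (hR : ∀ j, e.testBit j = true ↔ j ∈ R)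
    (he : e &&& (2 ^ y - 1) ≠ 0) :
    IsGreatest {x ∈ R | x < y} (Nat.log 2 (e &&& (2 ^ y - 1))) := by
  have h := isGreatest_testBit he
  convert h using 1
  ext j
  simp [← hR, and_comm]

theorem le_of_testBit_lt {e y : ℕ} {R : Set ℕ} (hR : ∀ j, e.testBit j = true ↔ j ∈ R)
    (he : e &&& (2 ^ y - 1) = 0) : ∀ x ∈ R, y ≤ x := by
  intro x hx
  by_contra h
  have := congrArg (fun e => e.testBit x) he
  simp [(hR x).2 hx] at this
  omega

/-- A bound for the steps that a query spends on one level of the tree, down and up. -/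
def predStepTime : ℕ := 4 + Code.predStep.len + Code.predUpStep.len

theorem loopFree_predStep : Code.predStep.LoopFree := by
  simp [Code.predStep, Code.split, Code.st, Cmd.LoopFree]

theorem loopFree_predUpStep : Code.predUpStep.LoopFree := by
  simp [Code.predUpStep, Cmd.LoopFree]

theorem Ends.zero_or_lt {σ : ℕ → ℕ → ℕ} {i l : ℕ} {A : Set ℕ} (h : Ends σ i A)
    (h' : ¬ (σ 2 i ≠ 0 ∧ σ 2 i ≤ l)) : ∀ a ∈ A, l ≤ a := by
  rcases h with ⟨-, rfl⟩ | ⟨a, c, h₂, -, ha, -⟩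
  · simp
  · intro z hz; have := ha.2 hz; omega

theorem Ends.exists_lt {σ : ℕ → ℕ → ℕ} {i l : ℕ} {A : Set ℕ} (h : Ends σ i A)
    (h₀ : σ 2 i ≠ 0) (h₁ : σ 2 i ≤ l) : ∃ a ∈ A, a < l := by
  rcases h with ⟨h, -⟩ | ⟨a, c, h₂, -, ha, -⟩
  · exact (h₀ h).elim
  · exact ⟨a, ha.1, by omega⟩

/-- The search for the greatest element `r` of `A` below `y`, in continuation passing style: if the
way up halts from every configuration in which `r` has been found, then so does the way down
followed by the way up. -/
theorem halts_pred {b q g M : ℕ} (hg : 1 ≤ g) (hgb : 2 ^ g ≤ b) (hb : 64 < 2 ^ b)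
    (hM : q + 16 * M ≤ 2 ^ b) {ℓ : ℕ}
    {s : State} {i y t r T : ℕ} {A : Set ℕ} {P : State → Prop}
    (hq : s.regs Code.q = q) (hi : s.regs Code.i = i)
    (hy : s.regs Code.y = y) (hbits : s.regs Code.bits = g * 2 ^ ℓ) (hleaf : s.regs Code.leaf = g)
    (hgo : s.regs Code.go = 1) (ht : s.regs Code.depth = t) (htM : t + ℓ ≤ M)
    (hblock : q + 16 * (i + univ g (ℓ + 1)) ≤ 2 ^ b)
    (hA : Holds g (arr s.mem q) ℓ i A) (hyu : y < univ g ℓ)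
    (hAu : ∀ x ∈ A, x < univ g ℓ) (hr : IsGreatest {x ∈ A | x < y} r)
    (hup : ∀ s' : State, s'.regs Code.q = q → s'.regs Code.depth = t → s'.regs Code.res = r →
      s'.regs Code.bits = g * 2 ^ ℓ → Unchanged q [10, 11] t M s.mem s'.mem →
      Halts b Code.predUp s' T P) :
    Halts b (.seq Code.predDown Code.predUp) s (T + ((ℓ + 1) * predStepTime + 2)) P := by
  induction ℓ using Nat.strong_induction_on generalizing s i y A t r T with
  | _ ℓ ih =>
  have hu := univ_le_succ g ℓ
  have hup' := univ_pos g ℓ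
  rw [show T + ((ℓ + 1) * predStepTime + 2) = 1 + 1 + Code.predStep.len +
    (T + (1 + 1 + Code.predUpStep.len) + (ℓ * predStepTime + 2)) by rw [predStepTime]; ring]
  refine Halts.while_seq_run (by simp [Expr.eval, hgo]) loopFree_predStep ?_
  rcases hA.1 with ⟨-, rfl⟩ | ⟨a, c, h₂, h₃, ha, hc⟩
  · exact hr.1.1.elim
  rw [arr] at h₂ h₃
  have hau := hAu a ha.1
  have hcu := hAu c hc.1
  have hgl : g * 2 ^ ℓ < univ g ℓ := Nat.lt_two_pow_self
  -- the search ends at this tree, with result `z`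
  have finishes : ∀ z, IsGreatest {x ∈ A | x < y} z →
      (Code.predStep.run b s).regs Code.q = q ∧
      (Code.predStep.run b s).regs Code.depth = s.regs Code.depth ∧
      (Code.predStep.run b s).regs Code.bits = g * 2 ^ ℓ ∧
      (Code.predStep.run b s).regs Code.res = z ∧
      (Code.predStep.run b s).regs Code.go = 0 ∧
      (Code.predStep.run b s).mem = s.mem →
      Halts b (.seq Code.predDown Code.predUp) (Code.predStep.run b s)
        (T + (1 + 1 + Code.predUpStep.len) + (ℓ * predStepTime + 2)) P := by
    rintro z hz ⟨k₁, k₂, k₃, k₄, k₅, k₆⟩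
    obtain rfl := hz.unique hr
    refine (Halts.while_seq_false (e := .reg Code.go) k₅
      (hup _ k₁ (k₂.trans ht) k₄ k₃ (by rw [k₆]; exact .refl _))).mono ?_ fun _ => id
    simp only [Expr.cost]; omega
  by_cases hcy : c < y
  · refine finishes c ⟨⟨hc.1, hcy⟩, fun z hz => hc.2 hz.1⟩
      (run_predStep_above hb hq hi hy (by omega) h₂ h₃ hbits (by omega) hcy)
  have hyc : y ≤ c := by omega
  have hay : a < y := lt_of_le_of_lt (ha.2 hr.1.1) hr.1.2
  rcases ℓ with - | ℓ
  · have hyb : y < b := lt_of_lt_of_le (by simpa [univ] using hyu) hgb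
    refine finishes _ ?_ (run_predStep_leaf hb hq hi hy (by omega) h₂ h₃ hbits (by omega) hleaf hyc
      (by simp) (Nat.pow_lt_pow_right (by norm_num) hyb) rfl)
    split_ifs with h0
    · exact pred_least ha hc.1 hyc hay (le_of_testBit_lt hA.2 h0)
    · exact pred_inner ha hc.1 hyc (isGreatest_testBit_lt hA.2 h0)
  have hRu : ∀ x ∈ inner A, x < univ g (ℓ + 1) := fun x hx => hAu x hx.1
  obtain ⟨H, hH⟩ : ∃ H, y / univ g ℓ = H := ⟨_, rfl⟩
  obtain ⟨L, hL⟩ : ∃ L, y - H * univ g ℓ = L := ⟨_, rfl⟩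
  obtain ⟨C, hC⟩ : ∃ C, i + 1 + (H + 1) * univ g (ℓ + 1) = C := ⟨_, rfl⟩
  obtain ⟨hHL, hHu, hLu, hC₁, hC₂⟩ := split_spec hg hyu hH hL hC
  rw [show ℓ + 1 + 1 = ℓ + 2 from rfl] at *
  have hu' := univ_le_succ g ℓ
  have hup'' := univ_pos g ℓ
  have hclu := (rest_succ.1 hA.2).2 H hHu
  have hsum := (rest_succ.1 hA.2).1
  rw [hC] at hclu
  have hHm : H * 2 ^ (g * 2 ^ ℓ) ≤ y := by change H * univ g ℓ ≤ y; omega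
  have hB2 : 2 * (g * 2 ^ ℓ) = g * 2 ^ (ℓ + 1) := by rw [pow_succ]; ring
  by_cases hS : arr s.mem q 2 C ≠ 0 ∧ arr s.mem q 2 C ≤ L
  · obtain ⟨k₁, k₂, k₃, k₄, k₅, k₆, k₇, k₈⟩ := run_predStep_cluster hb hq hi hy (by omega) h₂ h₃
      hbits (by omega) hleaf hyc (bits_ne hg ℓ) (bits_half g ℓ) hB2 (by omega) hH hL hC hHm
      (by omega) (by omega) ht (by omega) rfl hS.1 hS.2
    obtain ⟨r', hr'⟩ := exists_isGreatest_lt (hclu.1.exists_lt hS.1 hS.2)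
    have hrr : r = H * univ g ℓ + r' := by
      refine hr.unique (pred_inner ha hc.1 hyc ?_)
      have := pred_halves_low hLu hr'
      rwa [hHL] at this
    have hU : Unchanged q [10, 11] t M s.mem (Code.predStep.run b s).mem := by
      rw [k₈]; exact (Unchanged.refl _).store (by simp) le_rfl (by omega)
    refine (ih ℓ (by omega) k₁ k₂ k₃ k₅ k₆ (k₇.trans hgo) k₄ (by omega) (by omega)
      (hclu.congr hg fun c hc j h₁ h₂ => hU.arr_eq (by simp) (by simp at hc; omega)
        (by simp at hc ⊢; omega)) hLu (fun x hx => hx.1) hr' (T := T + (1 + 1 + Code.predUpStep.len))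
        ?_).mono (by omega) fun _ => id
    intro s' l₁ l₂ l₃ l₄ hU'
    have hmemt : s'.mem (q + (16 * t + 11)) = H + 1 := by
      have := hU'.arr_eq (c := 11) (j := t) (by simp) (by simp) (by simp)
      rw [arr, arr, k₈] at this
      rw [this, update_self]
    have hr'L := hr'.1.2
    have hover : H * 2 ^ (g * 2 ^ ℓ) + r' + 1 < 2 ^ b := by
      change H * univ g ℓ + r' + 1 < _
      omega
    obtain ⟨m₁, m₂, m₃, m₄, m₅⟩ := run_predUpStep_cluster hb l₁ l₂ l₃ l₄ (by omega) (by omega) hmemt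
      hover (by omega)
    refine (Halts.while_run (e := .reg Code.depth) (by simp [Expr.eval, l₂]) loopFree_predUpStep
      (hup _ m₁ m₂ ?_ ?_ ?_)).mono (by simp only [Expr.cost]; omega) fun _ => id
    · rw [m₄, hrr]; rfl
    · rw [m₃, hB2]
    · rw [m₅]; exact hU.trans (hU'.mono (by simp) (by omega) le_rfl)
  have hno := hclu.1.zero_or_lt hS
  have hSL : arr s.mem q 2 C = 0 ∨ L < arr s.mem q 2 C := by omega
  by_cases hS' : arr s.mem q 2 (i + 1) ≠ 0 ∧ arr s.mem q 2 (i + 1) ≤ H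
  · obtain ⟨k₁, k₂, k₃, k₄, k₅, k₆, k₇, k₈⟩ := run_predStep_summary hb hq hi hy (by omega) h₂ h₃
      hbits (by omega) hleaf hyc (bits_ne hg ℓ) (bits_half g ℓ) hB2 (by omega) hH hL hC hHm
      (by omega) (by omega) ht (by omega) rfl rfl hSL hS'.1 hS'.2
    obtain ⟨h', hh'⟩ := exists_isGreatest_lt (hsum.1.exists_lt hS'.1 hS'.2)
    have hh'u := lt_univ_of_mem_highs hRu hh'.1.1
    have hclu' := (rest_succ.1 hA.2).2 h' hh'u
    obtain ⟨C', hC'⟩ : ∃ C', i + 1 + (h' + 1) * univ g (ℓ + 1) = C' := ⟨_, rfl⟩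
    have hC'₁ := block_le hg hh'u
    rw [hC'] at hclu'
    rcases hclu'.1 with ⟨-, h⟩ | ⟨x, z, hx, hz, hxl, hzg⟩
    · exact (Set.nonempty_iff_ne_empty.1 (mem_highs_iff.1 hh'.1.1) h).elim
    have hrr : r = h' * univ g ℓ + z := by
      refine hr.unique (pred_inner ha hc.1 hyc ?_)
      have := pred_halves_high hLu hno hh' hzg
      rwa [hHL] at this
    have hU : Unchanged q [10, 11] t M s.mem (Code.predStep.run b s).mem := by
      rw [k₈]
      exact ((Unchanged.refl _).store (by simp) le_rfl (by omega)).store (by simp) le_rfl (by omega)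
    refine (ih ℓ (by omega) k₁ k₂ k₃ k₅ k₆ (k₇.trans hgo) k₄ (by omega) (by omega)
      (hsum.congr hg fun c hc j h₁ h₂ => hU.arr_eq (by simp) (by simp at hc; omega)
        (by simp at hc ⊢; omega)) hHu (fun x hx => lt_univ_of_mem_highs hRu hx) hh'
        (T := T + (1 + 1 + Code.predUpStep.len)) ?_).mono (by omega) fun _ => id
    intro s' l₁ l₂ l₃ l₄ hU'
    have hU'' := hU.trans (hU'.mono (by simp) (Nat.le_succ t) le_rfl)
    have hmemt : s'.mem (q + (16 * t + 11)) = 0 := by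
      have := hU'.arr_eq (c := 11) (j := t) (by simp) (by simp) (by simp)
      rw [arr, arr, k₈] at this
      rw [this, update_self]
    have hmemt' : s'.mem (q + (16 * t + 10)) = i := by
      have := hU'.arr_eq (c := 10) (j := t) (by simp) (by simp) (by simp)
      rw [arr, arr, k₈] at this
      rw [this, update_of_ne (by omega), update_self]
    have hmemz : s'.mem (q + (16 * C' + 3)) = z + 1 := by
      have := hU''.arr_eq (c := 3) (j := C') (by simp) (by simp) (by simp)
      rw [← hz, ← this, arr]
    have hrr' := hr.1.2
    have hover : h' * 2 ^ (g * 2 ^ ℓ) + z + 1 < 2 ^ b := by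
      change h' * univ g ℓ + z + 1 < _
      omega
    obtain ⟨m₁, m₂, m₃, m₄, m₅⟩ := run_predUpStep_summary hb l₁ l₂ l₃ l₄ (by omega) (by omega) hmemt
      hmemt' (by rw [hB2]; exact hC') (by omega) hmemz hover (by omega)
    refine (Halts.while_run (e := .reg Code.depth) (by simp [Expr.eval, l₂]) loopFree_predUpStep
      (hup _ m₁ m₂ ?_ ?_ ?_)).mono (by simp only [Expr.cost]; omega) fun _ => id
    · rw [m₄, hrr]; rfl
    · rw [m₃, hB2]
    · rw [m₅]; exact hU''
  · have hno' := hsum.1.zero_or_lt hS'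
    refine finishes a (pred_least ha hc.1 hyc hay ?_) (run_predStep_none hb hq hi hy (by omega) h₂ h₃
      hbits (by omega) hleaf hyc (bits_ne hg ℓ) (bits_half g ℓ) hB2 (by omega) hH hL hC hHm
      (by omega) (by omega) ht (by omega) rfl rfl hSL (by rw [arr] at hS'; omega))
    have := no_pred_halves hLu hno hno'
    rwa [hHL] at this

/-! ### Lists of entries in the order of their keys -/

section lists

variable {f : ℕ → ℕ} {L A B : List Item} {κ r N : ℕ} {it : Item}

theorem filter_le_append_filter_lt (h : L.Pairwise (fun p q => f p.elem ≤ f q.elem)) (κ : ℕ) :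
    L.filter (fun it => f it.elem ≤ κ) ++ L.filter (fun it => κ < f it.elem) = L := by
  induction L with
  | nil => rfl
  | cons it L ih =>
    rw [List.pairwise_cons] at h
    by_cases hit : f it.elem ≤ κ
    · simp [hit, ih h.2]
    · have h₁ : L.filter (fun it => f it.elem ≤ κ) = [] := by
        simp only [List.filter_eq_nil_iff, decide_eq_true_eq]
        intro z hz; have := h.1 z hz; omega
      have := ih h.2
      rw [h₁] at this
      simp [hit, h₁, not_le.1 hit] at this ⊢
      exact this

theorem filter_lt_append_filter_eq (h : L.Pairwise (fun p q => f p.elem ≤ f q.elem)) (r : ℕ) :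
    L.filter (fun it => f it.elem < r) ++ L.filter (fun it => f it.elem = r) =
      L.filter (fun it => f it.elem ≤ r) := by
  have := filter_le_append_filter_lt (L := L.filter (fun it => f it.elem ≤ r))
    (f := fun x => if f x < r then 0 else 1) (h.filter _ |>.imp fun {a b} hab => by
      split_ifs <;> omega) 0
  rw [List.filter_filter, List.filter_filter] at this
  refine Eq.trans ?_ this
  congr 1 <;> refine List.filter_congr fun x _ => ?_
  · rw [← Bool.decide_and, decide_eq_decide]; split_ifs <;> omega
  · rw [← Bool.decide_and, decide_eq_decide]; split_ifs <;> omega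

/-- The name of the last entry with the key `κ`, or nil. -/
def lastName (f : ℕ → ℕ) (L : List Item) (κ : ℕ) : ℕ :=
  nameOrNil (L.filter (fun it => f it.elem = κ)).getLast?

/-- The name of the last entry whose key is at most `κ`, or nil. -/
def lastNameLe (f : ℕ → ℕ) (L : List Item) (κ : ℕ) : ℕ :=
  nameOrNil (L.filter (fun it => f it.elem ≤ κ)).getLast?

/-- The keys of the entries. -/
def keys (f : ℕ → ℕ) (L : List Item) : Set ℕ := {κ | ∃ it ∈ L, f it.elem = κ}

theorem filter_key_eq_nil : L.filter (fun it => f it.elem = κ) = [] ↔ κ ∉ keys f L := by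
  simp [keys, List.filter_eq_nil_iff]

theorem nameOrNil_getLast?_eq_zero {l : List Item} (h : ∀ it ∈ l, it.name ≠ 0) :
    nameOrNil l.getLast? = 0 ↔ l = [] := by
  rcases List.eq_nil_or_concat l with rfl | ⟨l', a, rfl⟩
  · simp [nameOrNil]
  · simpa [nameOrNil] using h a (by simp)

theorem lastName_eq_zero (h : ∀ it ∈ L, it.name ≠ 0) : lastName f L κ = 0 ↔ κ ∉ keys f L := by
  rw [lastName, nameOrNil_getLast?_eq_zero fun it hit => h it (List.mem_of_mem_filter hit),
    filter_key_eq_nil]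

theorem lastNameLe_eq (h : L.Pairwise (fun p q => f p.elem ≤ f q.elem))
    (hr : IsGreatest {x ∈ keys f L | x ≤ κ} r) : lastNameLe f L κ = lastName f L r := by
  have h₁ : L.filter (fun it => f it.elem ≤ κ) = L.filter (fun it => f it.elem ≤ r) := by
    refine List.filter_congr fun x hx => ?_
    rw [decide_eq_decide]
    have h₁ := hr.1.2
    exact ⟨fun h => hr.2 ⟨⟨x, hx, rfl⟩, h⟩, fun h => h.trans h₁⟩
  have h₂ : L.filter (fun it => f it.elem = r) ≠ [] := by
    rw [Ne, filter_key_eq_nil, not_not]; exact hr.1.1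
  rw [lastNameLe, lastName, h₁, ← filter_lt_append_filter_eq h, List.getLast?_append_of_ne_nil _ h₂]

theorem lastNameLe_eq_zero (h : ∀ x ∈ keys f L, κ < x) : lastNameLe f L κ = 0 := by
  have : L.filter (fun it => f it.elem ≤ κ) = [] := by
    simp only [List.filter_eq_nil_iff, decide_eq_true_eq, not_le]
    exact fun it hit => h _ ⟨it, hit, rfl⟩
  rw [lastNameLe, this]; rfl

/-- The search for the last entry of key at most `κ` has the effect that is required of it. -/
theorem search_effect {x : ℕ} (h : Consistent f L) :
    Op.Effect f L (lastNameLe f L (f x)) L (.search x) := by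
  refine ⟨rfl, ?_⟩
  rcases List.eq_nil_or_concat (L.filter (fun it => f it.elem ≤ f x)) with h' | ⟨l, a, h'⟩
  · refine .inl ⟨by rw [lastNameLe, h']; rfl, fun it hit => ?_⟩
    have := List.filter_eq_nil_iff.1 h' it hit
    simpa using this
  · have ha : a ∈ L.filter (fun it => f it.elem ≤ f x) := by simp [h']
    have hp := h.2.2.filter (fun it => decide (f it.elem ≤ f x))
    rw [List.mem_filter, decide_eq_true_eq] at ha
    refine .inr ⟨a, ha.1, by simp [lastNameLe, h', nameOrNil], ha.2, fun z hz hzx => ?_⟩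
    have hz' : z ∈ L.filter (fun it => f it.elem ≤ f x) := by simp [hz, hzx]
    rw [h', List.concat_eq_append] at hz' hp
    rw [List.pairwise_append] at hp
    rw [List.mem_append, List.mem_singleton] at hz'
    rcases hz' with hz' | rfl
    · exact hp.2.2 z hz' a (by simp)
    · exact le_rfl

theorem keys_insert : keys f (A ++ it :: B) = insert (f it.elem) (keys f (A ++ B)) := by
  ext z
  simp only [keys, List.mem_append, List.mem_cons, Set.mem_ofPred_eq, Set.mem_insert_iff]
  constructor
  · rintro ⟨x, h | rfl | h, rfl⟩
    · exact .inr ⟨x, .inl h, rfl⟩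
    · exact .inl rfl
    · exact .inr ⟨x, .inr h, rfl⟩
  · rintro (rfl | ⟨x, h | h, rfl⟩)
    · exact ⟨it, .inr (.inl rfl), rfl⟩
    · exact ⟨x, .inl h, rfl⟩
    · exact ⟨x, .inr (.inr h), rfl⟩

theorem lastName_insert_of_ne (h : f it.elem ≠ κ) :
    lastName f (A ++ it :: B) κ = lastName f (A ++ B) κ := by
  simp [lastName, List.filter_append, List.filter_cons, h]

theorem lastName_insert_self (h : ∀ z ∈ B, f it.elem < f z.elem) :
    lastName f (A ++ it :: B) (f it.elem) = it.name := by
  have : B.filter (fun z => f z.elem = f it.elem) = [] := by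
    simp only [List.filter_eq_nil_iff, decide_eq_true_eq]
    intro z hz; have := h z hz; omega
  simp [lastName, List.filter_append, List.filter_cons, this, nameOrNil]

/-- If an entry is not the last one of its key, then its deletion leaves the last one unchanged. -/
theorem lastName_erase_of_ne (h : lastName f (A ++ it :: B) (f it.elem) ≠ it.name) :
    lastName f (A ++ B) (f it.elem) = lastName f (A ++ it :: B) (f it.elem) ∧
      f it.elem ∈ keys f (A ++ B) := by
  have hB : B.filter (fun z => f z.elem = f it.elem) ≠ [] := by
    intro hB
    apply h
    simp [lastName, List.filter_append, List.filter_cons, hB, nameOrNil]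
  constructor
  · unfold lastName
    rw [List.filter_append, List.filter_append, List.filter_cons_of_pos (by simp),
      List.getLast?_append_of_ne_nil _ hB, List.getLast?_append_of_ne_nil _ (by simp),
      List.getLast?_cons_of_ne_nil hB]
  · rw [Ne, filter_key_eq_nil, not_not] at hB
    obtain ⟨z, hz, h'⟩ := hB
    exact ⟨z, by simp [hz], h'⟩

/-- If an entry is the last one of its key, then its deletion makes its predecessor the last one,
or leaves no entry of this key. -/
theorem lastName_erase_self (h : Consistent f (A ++ it :: B))
    (hl : lastName f (A ++ it :: B) (f it.elem) = it.name) :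
    (∀ p ∈ A.getLast?, f p.elem = f it.elem → lastName f (A ++ B) (f it.elem) = p.name ∧
        f it.elem ∈ keys f (A ++ B)) ∧
      ((∀ p ∈ A.getLast?, f p.elem ≠ f it.elem) → lastName f (A ++ B) (f it.elem) = 0 ∧
        f it.elem ∉ keys f (A ++ B)) := by
  obtain ⟨hn, hnz, hs⟩ := h
  have hB : B.filter (fun z => f z.elem = f it.elem) = [] := by
    by_contra hB
    unfold lastName at hl
    rw [List.filter_append, List.filter_cons_of_pos (by simp),
      List.getLast?_append_of_ne_nil _ (by simp), List.getLast?_cons_of_ne_nil hB,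
      List.getLast?_eq_some_getLast hB] at hl
    have hm := List.mem_of_mem_filter (List.getLast_mem hB)
    simp only [List.map_append, List.map_cons, List.nodup_append, List.nodup_cons] at hn
    exact hn.2.1.1 (List.mem_map.2 ⟨_, hm, hl⟩)
  have hBk : f it.elem ∉ keys f B := filter_key_eq_nil.1 hB
  constructor
  · intro p hp hpk
    have hpA : p ∈ A := List.mem_of_getLast? hp
    refine ⟨?_, p, by simp [hpA], hpk⟩
    obtain ⟨A', rfl⟩ := List.getLast?_eq_some_iff.1 hp
    simp [lastName, List.filter_append, hB, hpk, nameOrNil]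
  · intro hno
    have hA : f it.elem ∉ keys f A := by
      rintro ⟨z, hz, hzk⟩
      rcases List.eq_nil_or_concat A with rfl | ⟨A', p, rfl⟩
      · simp at hz
      · refine hno p (by simp) ?_
        rw [List.concat_eq_append] at hz hs
        rw [List.pairwise_append] at hs
        have h₁ := hs.2.2 p (by simp) it (by simp)
        have h₂ := (List.pairwise_append.1 hs.1).2.2
        rw [List.mem_append, List.mem_singleton] at hz
        rcases hz with hz | rfl
        · have := h₂ z hz p (by simp); omega
        · exact hzk
    have hAB : f it.elem ∉ keys f (A ++ B) := by
      rintro ⟨z, hz, hzk⟩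
      rcases List.mem_append.1 hz with hz | hz
      exacts [hA ⟨z, hz, hzk⟩, hBk ⟨z, hz, hzk⟩]
    refine ⟨?_, hAB⟩
    rw [lastName, filter_key_eq_nil.2 hAB]; rfl

theorem Consistent.insert (h : Consistent f L) (hN : ∀ z ∈ L, z.name ≠ it.name)
    (h0 : it.name ≠ 0) :
    Consistent f (L.filter (fun z => f z.elem ≤ f it.elem) ++
      it :: L.filter (fun z => f it.elem < f z.elem)) := by
  obtain ⟨hn, hnz, hs⟩ := h
  have hL := filter_le_append_filter_lt hs (f it.elem)
  have hp : ((L.filter (fun z => f z.elem ≤ f it.elem)) ++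
      it :: L.filter (fun z => f it.elem < f z.elem)).Perm (it :: L) := by
    conv_rhs => rw [← hL]
    exact List.perm_middle
  refine ⟨?_, ?_, ?_⟩
  · rw [(hp.map Item.name).nodup_iff, List.map_cons, List.nodup_cons]
    refine ⟨fun h => ?_, hn⟩
    obtain ⟨z, hz, h'⟩ := List.mem_map.1 h
    exact hN z hz h'
  · intro z hz
    rcases List.mem_cons.1 (hp.mem_iff.1 hz) with rfl | hz
    exacts [h0, hnz z hz]
  · rw [List.pairwise_append, List.pairwise_cons]
    refine ⟨hs.filter _, ⟨fun z hz => ?_, hs.filter _⟩, fun x hx z hz => ?_⟩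
    · simp only [List.mem_filter, decide_eq_true_eq] at hz; exact hz.2.le
    · simp only [List.mem_filter, decide_eq_true_eq, List.mem_cons] at hx hz
      rcases hz with rfl | hz
      · exact hx.2
      · exact hx.2.trans hz.2.le

theorem Consistent.sublist {L' : List Item} (h : Consistent f L) (h' : L'.Sublist L) :
    Consistent f L' :=
  ⟨h.1.sublist (h'.map _), fun z hz => h.2.1 z (h'.subset hz), h.2.2.sublist h'⟩

theorem exists_split_of_mem (hit : it ∈ L) : ∃ A B, L = A ++ it :: B := by
  obtain ⟨A, B, h⟩ := List.append_of_mem hit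
  exact ⟨A, B, h⟩

theorem filter_name_ne (h : ((A ++ it :: B).map Item.name).Nodup) :
    (A ++ it :: B).filter (fun z => z.name ≠ it.name) = A ++ B := by
  simp only [List.map_append, List.map_cons, List.nodup_append, List.nodup_cons, List.mem_map] at h
  rw [List.filter_append, List.filter_cons_of_neg (by simp)]
  congr 1
  · refine List.filter_eq_self.2 fun z hz => ?_
    simpa using h.2.2 z.name ⟨z, hz, rfl⟩ it.name (by simp)
  · refine List.filter_eq_self.2 fun z hz => ?_
    have := h.2.1.1
    simp only [not_exists, not_and] at this
    simpa using this z hz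

end lists

/-! ### Doubly linked lists -/

section chains

variable {R S : ℕ → ℕ → Prop}

theorem isChain_of_agree {l : List ℕ} (h : l.IsChain R)
    (hRS : ∀ u ∈ l.dropLast, ∀ v ∈ l.tail, R u v → S u v) : l.IsChain S := by
  induction l with
  | nil => exact .nil
  | cons a l ih =>
    cases l with
    | nil => exact .singleton _
    | cons c l =>
      rw [List.isChain_cons_cons] at h ⊢
      refine ⟨hRS a (by simp) c (by simp) h.1, ih h.2 fun u hu v hv => ?_⟩
      exact hRS u (by simp [List.dropLast_cons_of_ne_nil, hu]) v
        (by simp at hv ⊢; exact .inr hv)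

/-- The doubly linked circular list with successors `nx` and predecessors `pv`, through the
sentinel `0`. -/
def Links (nx pv : ℕ → ℕ) (l : List ℕ) : Prop :=
  (0 :: (l ++ [0])).IsChain (fun a c => nx a = c ∧ pv c = a)

/-- The last entry of a list, or the sentinel. -/
def last0 (l : List ℕ) : ℕ := l.getLast?.getD 0

/-- The first entry of a list, or the sentinel. -/
def head0 (l : List ℕ) : ℕ := l.head?.getD 0

theorem getLast?_cons_zero (A : List ℕ) : (0 :: A).getLast? = some (last0 A) := by
  rw [List.getLast?_cons, last0]

theorem head?_append_zero (B : List ℕ) : (B ++ [0]).head? = some (head0 B) := by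
  cases B <;> simp [head0]

theorem links_append {nx pv : ℕ → ℕ} {A B : List ℕ} :
    Links nx pv (A ++ B) ↔ (0 :: A).IsChain (fun a c => nx a = c ∧ pv c = a) ∧
      (B ++ [0]).IsChain (fun a c => nx a = c ∧ pv c = a) ∧
      nx (last0 A) = head0 B ∧ pv (head0 B) = last0 A := by
  rw [Links, List.append_assoc, ← List.cons_append, List.isChain_append, getLast?_cons_zero,
    head?_append_zero]
  simp

theorem links_middle {nx pv : ℕ → ℕ} {A B : List ℕ} {N : ℕ} :
    Links nx pv (A ++ N :: B) ↔ (0 :: A).IsChain (fun a c => nx a = c ∧ pv c = a) ∧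
      (B ++ [0]).IsChain (fun a c => nx a = c ∧ pv c = a) ∧
      (nx (last0 A) = N ∧ pv N = last0 A) ∧ nx N = head0 B ∧ pv (head0 B) = N := by
  have h : (N :: (B ++ [0])).IsChain (fun a c => nx a = c ∧ pv c = a) ↔ _ := List.isChain_cons
  rw [links_append, List.cons_append, h, head?_append_zero]
  simp only [head0, List.head?_cons, Option.getD_some, Option.mem_def, Option.some.injEq,
    forall_eq']
  tauto

theorem last0_mem (A : List ℕ) : last0 A = 0 ∨ last0 A ∈ A := by
  rcases List.eq_nil_or_concat A with rfl | ⟨A', p, rfl⟩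
  · exact .inl rfl
  · exact .inr (by simp [last0])

theorem head0_mem (B : List ℕ) : head0 B = 0 ∨ head0 B ∈ B := by
  cases B <;> simp [head0]

theorem chain_left {nx pv nx' pv' : ℕ → ℕ} {A : List ℕ}
    (h : (0 :: A).IsChain (fun a c => nx a = c ∧ pv c = a)) (hA : (0 :: A).Nodup)
    (hnx : ∀ u ∈ 0 :: A, u ≠ last0 A → nx' u = nx u) (hpv : ∀ v ∈ A, pv' v = pv v) :
    (0 :: A).IsChain (fun a c => nx' a = c ∧ pv' c = a) := by
  refine isChain_of_agree h fun u hu v hv huv => ?_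
  rw [hpv v (by simpa using hv), hnx u (List.mem_of_mem_dropLast hu) ?_]
  · exact huv
  · rintro rfl
    have h₁ := List.dropLast_concat_getLast (l := 0 :: A) (by simp)
    rw [← h₁, List.nodup_append] at hA
    have h₂ : (0 :: A).getLast (by simp) = last0 A := by
      have := getLast?_cons_zero A
      rwa [List.getLast?_eq_some_getLast (by simp), Option.some.injEq] at this
    exact hA.2.2 _ hu _ (by simp) h₂.symm

theorem chain_right {nx pv nx' pv' : ℕ → ℕ} {B : List ℕ}
    (h : (B ++ [0]).IsChain (fun a c => nx a = c ∧ pv c = a)) (hB : (B ++ [0]).Nodup)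
    (hnx : ∀ u ∈ B, nx' u = nx u) (hpv : ∀ v ∈ B ++ [0], v ≠ head0 B → pv' v = pv v) :
    (B ++ [0]).IsChain (fun a c => nx' a = c ∧ pv' c = a) := by
  refine isChain_of_agree h fun u hu v hv huv => ?_
  rw [hnx u (by simpa using hu), hpv v (List.mem_of_mem_tail hv) ?_]
  · exact huv
  · rintro rfl
    cases B with
    | nil => simp at hv
    | cons a B =>
      simp only [List.cons_append, List.nodup_cons, List.tail_cons, head0, List.head?_cons,
        Option.getD_some] at hB hv
      exact hB.1 hv

variable {nx pv nx' pv' : ℕ → ℕ} {A B : List ℕ} {N : ℕ}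

/-- Insertion of `N` between `A` and `B`. -/
theorem Links.insert (h : Links nx pv (A ++ B)) (hn : (A ++ B).Nodup) (h0 : 0 ∉ A ++ B)
    (hN : N ∉ A ++ B) (hN0 : N ≠ 0)
    (hnx : ∀ u, nx' u = if u = N then head0 B else if u = last0 A then N else nx u)
    (hpv : ∀ u, pv' u = if u = N then last0 A else if u = head0 B then N else pv u) :
    Links nx' pv' (A ++ N :: B) := by
  obtain ⟨h₁, h₂, h₃, h₄⟩ := links_append.1 h
  simp only [List.mem_append, not_or] at h0 hN
  rw [List.nodup_append] at hn
  have hl := last0_mem A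
  have hh := head0_mem B
  have hlN : last0 A ≠ N := by rintro rfl; rcases hl with h | h; exacts [hN0 h, hN.1 h]
  have hhN : head0 B ≠ N := by rintro rfl; rcases hh with h | h; exacts [hN0 h, hN.2 h]
  refine links_middle.2 ⟨chain_left h₁ (by simp [h0, hn]) ?_ ?_, chain_right h₂ ?_ ?_ ?_, ⟨?_, ?_⟩, ?_, ?_⟩
  · intro u hu hul
    rw [hnx, if_neg, if_neg hul]
    rintro rfl
    rcases List.mem_cons.1 hu with h | h
    exacts [hN0 h, hN.1 h]
  · intro v hv
    rw [hpv, if_neg (by rintro rfl; exact hN.1 hv), if_neg]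
    rintro rfl
    rcases hh with h | h
    · rw [h] at hv; exact h0.1 hv
    · exact hn.2.2 _ hv _ h rfl
  · rw [List.nodup_append]
    refine ⟨hn.2.1, by simp, ?_⟩
    rintro a ha c hc rfl
    rw [List.mem_singleton] at hc
    exact h0.2 (hc ▸ ha)
  · intro u hu
    rw [hnx, if_neg (by rintro rfl; exact hN.2 hu), if_neg]
    rintro rfl
    rcases hl with h | h
    · rw [h] at hu; exact h0.2 hu
    · exact hn.2.2 _ h _ hu rfl
  · intro v hv hvh
    rw [hpv, if_neg, if_neg hvh]
    rintro rfl
    rcases List.mem_append.1 hv with h | h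
    exacts [hN.2 h, hN0 (by simpa using h)]
  · rw [hnx, if_neg hlN, if_pos rfl]
  · rw [hpv, if_pos rfl]
  · rw [hnx, if_pos rfl]
  · rw [hpv, if_neg hhN, if_pos rfl]

/-- Deletion of `N` between `A` and `B`. -/
theorem Links.erase (h : Links nx pv (A ++ N :: B)) (hn : (A ++ N :: B).Nodup)
    (h0 : 0 ∉ A ++ N :: B)
    (hnx : ∀ u, nx' u = if u = last0 A then head0 B else nx u)
    (hpv : ∀ u, pv' u = if u = head0 B then last0 A else pv u) :
    Links nx' pv' (A ++ B) := by
  obtain ⟨h₁, h₂, h₃, h₄⟩ := links_middle.1 h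
  simp only [List.mem_append, List.mem_cons, not_or] at h0
  rw [List.nodup_append, List.nodup_cons] at hn
  have hl := last0_mem A
  have hh := head0_mem B
  refine links_append.2 ⟨chain_left h₁ (by simp [h0, hn]) ?_ ?_, chain_right h₂ ?_ ?_ ?_, ?_, ?_⟩
  · intro u hu hul
    rw [hnx, if_neg hul]
  · intro v hv
    rw [hpv, if_neg]
    rintro rfl
    rcases hh with h | h
    · rw [h] at hv; exact h0.1 hv
    · exact hn.2.2 _ hv _ (by simp [h]) rfl
  · rw [List.nodup_append]
    refine ⟨hn.2.1.2, by simp, ?_⟩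
    rintro a ha c hc rfl
    rw [List.mem_singleton] at hc
    exact h0.2.2 (hc ▸ ha)
  · intro u hu
    rw [hnx, if_neg]
    rintro rfl
    rcases hl with h | h
    · rw [h] at hu; exact h0.2.2 hu
    · exact hn.2.2 _ h _ (by simp [hu]) rfl
  · intro v hv hvh
    rw [hpv, if_neg hvh]
  · rw [hnx, if_pos rfl]
  · rw [hpv, if_pos rfl]

end chains

/-! ### Keys and the set of keys -/

namespace Code
open WordRAM.Expr WordRAM.Cmd

/-- `key (q, x)`: the key of the element `x`. -/
def key : Cmd :=
  z ::= ld 0 0 ;;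
  e ::= msb y ;;
  h ::= bin .lt z e * (e - z) ;;
  q ::= bin .shr y h + bin .shl h z

/-- Start at the root of the tree. -/
def start : Cmd := i ::= 0 ;; bits ::= ld 0 1 ;; leaf ::= ld 0 2 ;; go ::= 1

/-- The name of the last entry of key less than `y`, if there is one. -/
def findPred : Cmd := start ;; depth ::= 0 ;; (predDown ;; predUp) ;; q ::= ld 1 res

/-- `locate (q, y)`: the name of the last entry of key at most `y`, or nil. -/
def locate : Cmd :=
  z ::= ld 1 y ;;
  ite z (q ::= z)
    (lo ::= ld 2 0 ;;
      ite (bin .lt 0 lo * bin .lt lo (y + 1))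
        findPred
        (q ::= 0))

/-- `setInsert (q, y)`: insert `y` into the set of keys. -/
def setInsert : Cmd := start ;; insertLoop

/-- `setDelete (q, y)`: delete `y` from the set of keys. -/
def setDelete : Cmd := start ;; deleteLoop

end Code

/-- The floating point number with `k` bits after the leading one that is the truncation of `x`,
as an integer whose order is that of the floating point numbers. -/
def trunc (k x : ℕ) : ℕ := x / 2 ^ (Nat.log 2 x - k) + (Nat.log 2 x - k) * 2 ^ k

/-- Keys are no greater than their elements, so that a tree of keys fits wherever the elements
do, whatever the precision. -/
theorem trunc_le (k x : ℕ) : trunc k x ≤ x := by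
  rcases Nat.eq_zero_or_pos x with rfl | hx
  · simp [trunc]
  unfold trunc
  obtain ⟨s, hs⟩ : ∃ s, Nat.log 2 x - k = s := ⟨_, rfl⟩
  rw [hs]
  rcases Nat.eq_zero_or_pos s with rfl | hs0
  · simp
  have h₁ : 2 ^ Nat.log 2 x ≤ x := Nat.pow_log_le_self 2 hx.ne'
  have h₂ : Nat.log 2 x = k + s := by omega
  rw [h₂, pow_add] at h₁
  have h₃ := Nat.div_add_mod' x (2 ^ s)
  have h₄ : 2 ^ k ≤ x / 2 ^ s := (Nat.le_div_iff_mul_le (Nat.two_pow_pos s)).2 h₁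
  obtain ⟨w, hw⟩ : ∃ w, 2 ^ s = s + 1 + w := ⟨2 ^ s - (s + 1), by
    have : s < 2 ^ s := Nat.lt_two_pow_self
    omega⟩
  have h₅ := Nat.mul_le_mul_left s h₄
  generalize x / 2 ^ s = D at *
  have h₆ : D * 2 ^ s = D * s + D + D * w := by rw [hw]; ring
  have h₇ : s * D = D * s := mul_comm _ _
  omega

theorem loopFree_key : Code.key.LoopFree := by simp [Code.key, Cmd.LoopFree]

theorem loopFree_start : Code.start.LoopFree := by simp [Code.start, Cmd.LoopFree]

theorem argRegs_zero (a : ℕ) (l : List ℕ) : argRegs (a :: l) ⟨0⟩ = a := rfl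

theorem argRegs_succ (a : ℕ) (l : List ℕ) (k : ℕ) : argRegs (a :: l) ⟨k + 1⟩ = argRegs l ⟨k⟩ := rfl

theorem run_key {b q x k : ℕ} {s : State} (hb : 64 < 2 ^ b) (hq : s.regs Code.q = q)
    (hx : s.regs Code.y = x) (hxb : x < 2 ^ b) (hqb : q + 16 ≤ 2 ^ b) (hk : s.mem q = k) :
    (Code.key.run b s).regs ⟨0⟩ = trunc k x ∧ (Code.key.run b s).mem = s.mem := by
  have h₁ := trunc_le k x
  unfold trunc at h₁ ⊢
  have h₂ : Nat.log 2 x ≤ x := Nat.log_le_self 2 x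
  obtain ⟨l, hl⟩ : ∃ l, Nat.log 2 x = l := ⟨_, rfl⟩
  rw [hl] at h₁ h₂ ⊢
  obtain ⟨t, ht⟩ : ∃ t, l - k = t := ⟨_, rfl⟩
  obtain ⟨D, hD⟩ : ∃ D, x / 2 ^ t = D := ⟨_, rfl⟩
  have e₁ : BinOp.eval b .mul (BinOp.eval b .lt k l) (BinOp.eval b .sub l k) = t := by
    rcases Nat.lt_or_ge k l with h | h
    · rw [eval_lt_pos h, eval_sub h.le (by omega), eval_mul (by omega), one_mul, ht]
    · rw [eval_lt_neg h, eval_mul (by simp), zero_mul]; omega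
  rw [ht, hD] at h₁ ⊢
  simp (disch := omega) only [Code.key, Code.st, Code.ld, Code.addr, Cmd.run,
    eval_rules, eval_binOp_rules, eval_lit, eval_add, eval_sub, e₁, eval_mul, eval_shl,
    eval_lt_pos, eval_lt_neg, eval_eq_pos, eval_eq_neg, update_reg, update_self,
    update_mem_of_ne, ↓reduceIte, Nat.reduceEqDiff, OfNat.ofNat_ne_zero, OfNat.zero_ne_ofNat,
    OfNat.ofNat_ne_one, OfNat.one_ne_ofNat, one_ne_zero, zero_ne_one, and_self, hq, hx, hk, hl,
    hD, mul_zero, add_zero]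

/-- The parameters of a structure: the address `q`, the bound `U` for the elements, the number `n`
of entries, the precision `k`, and the parameters `g` and `d` of the tree of keys. -/
structure Params (b q U n k g d : ℕ) : Prop where
  one_le_g : 1 ≤ g
  two_pow_g : 2 ^ g ≤ b
  lt_two_pow : 64 < 2 ^ b
  head : q + 16 * 64 ≤ 2 ^ b
  tree : q + 16 * univ g (d + 1) ≤ 2 ^ b
  names : q + 16 * (n + 1) ≤ 2 ^ b
  elems : U < 2 ^ b
  trunc_lt : trunc k U < univ g d

/-- The header of the storage: the precision and the parameters of the tree of keys. -/
def Header (k g d : ℕ) (σ : ℕ → ℕ → ℕ) : Prop := σ 0 0 = k ∧ σ 0 1 = g * 2 ^ d ∧ σ 0 2 = g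

theorem Unchanged.arr_of_notMem {q : ℕ} {cs : List ℕ} {lo hi : ℕ} {m₁ m₂ : ℕ → ℕ}
    (h : Unchanged q cs lo hi m₁ m₂) (hcs : ∀ c ∈ cs, c < 16) {c : ℕ} (hc : c < 16)
    (hc' : c ∉ cs) (j : ℕ) : arr m₂ q c j = arr m₁ q c j :=
  h.arr_eq hcs hc fun h => (hc' h).elim

section

variable {b q U n k g d : ℕ} (hp : Params b q U n k g d)
include hp

theorem run_start {s : State} (hq : s.regs Code.q = q) (h : Header k g d (arr s.mem q)) :
    (Code.start.run b s).regs Code.q = q ∧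
    (Code.start.run b s).regs Code.y = s.regs Code.y ∧
    (Code.start.run b s).regs Code.i = 0 ∧
    (Code.start.run b s).regs Code.bits = g * 2 ^ d ∧
    (Code.start.run b s).regs Code.leaf = g ∧
    (Code.start.run b s).regs Code.go = 1 ∧
    (Code.start.run b s).mem = s.mem := by
  obtain ⟨-, h₁, h₂⟩ := h
  have hb := hp.lt_two_pow
  have hh := hp.head
  rw [arr] at h₁ h₂
  simp (disch := omega) only [Code.start, Code.st, Code.ld, Code.addr, Cmd.run,
    eval_rules, eval_binOp_rules, eval_lit, eval_add, eval_sub, eval_mul, eval_shl,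
    eval_lt_pos, eval_lt_neg, eval_eq_pos, eval_eq_neg, update_reg, update_self,
    update_mem_of_ne, ↓reduceIte, Nat.reduceEqDiff, OfNat.ofNat_ne_zero, OfNat.zero_ne_ofNat,
    OfNat.ofNat_ne_one, OfNat.one_ne_ofNat, one_ne_zero, zero_ne_one, and_self, hq, h₁, h₂]

theorem returns_setInsert {mem : ℕ → ℕ} {y : ℕ} {A : Set ℕ} (h : Header k g d (arr mem q))
    (hA : Holds g (arr mem q) d 0 A) (hyA : y ∉ A) (hyu : y < univ g d)
    (hAu : ∀ x ∈ A, x < univ g d) :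
    Returns b Code.setInsert [q, y] mem (Code.start.len + ((d + 1) * insertStepTime + 2))
      (fun _ mem' => Holds g (arr mem' q) d 0 (insert y A) ∧
        Unchanged q [2, 3, 4] 0 (univ g (d + 1)) mem mem') := by
  refine Halts.run_seq loopFree_start ?_
  obtain ⟨h₁, h₂, h₃, h₄, h₅, h₆, h₇⟩ := run_start hp (s := ⟨argRegs [q, y], mem⟩) (by rfl) h
  have := halts_insertLoop hp.one_le_g hp.two_pow_g hp.lt_two_pow h₁ h₃ (h₂.trans rfl) h₄ h₅ h₆
    (by simpa using hp.tree) (A := A) (by rw [h₇]; exact hA) hyA hyu hAu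
  rw [h₇, zero_add] at this
  exact this

theorem returns_setDelete {mem : ℕ → ℕ} {y : ℕ} {A : Set ℕ} (h : Header k g d (arr mem q))
    (hA : Holds g (arr mem q) d 0 A) (hyA : y ∈ A) (hAu : ∀ x ∈ A, x < univ g d) :
    Returns b Code.setDelete [q, y] mem (Code.start.len + ((d + 1) * deleteStepTime + 2))
      (fun _ mem' => Holds g (arr mem' q) d 0 (A \ {y}) ∧
        Unchanged q [2, 3, 4] 0 (univ g (d + 1)) mem mem') := by
  refine Halts.run_seq loopFree_start ?_
  obtain ⟨h₁, h₂, h₃, h₄, h₅, h₆, h₇⟩ := run_start hp (s := ⟨argRegs [q, y], mem⟩) (by rfl) h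
  have := halts_deleteLoop hp.one_le_g hp.two_pow_g hp.lt_two_pow h₁ h₃ (h₂.trans rfl) h₄ h₅ h₆
    (by simpa using hp.tree) (A := A) (by rw [h₇]; exact hA) hyA hAu
  rw [h₇, zero_add] at this
  exact this

theorem depth_succ_lt : d + 1 < univ g (d + 1) := by
  have h₁ : d + 1 < 2 ^ (d + 1) := Nat.lt_two_pow_self
  have h₂ : 1 * 2 ^ (d + 1) ≤ g * 2 ^ (d + 1) := Nat.mul_le_mul_right _ hp.one_le_g
  have h₃ : g * 2 ^ (d + 1) < univ g (d + 1) := Nat.lt_two_pow_self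
  omega

/-- A bound for the steps of a search for a key. -/
def locateTime (d : ℕ) : ℕ := (d + 1) * predStepTime + 200

theorem halts_findPred {s : State} {y r : ℕ} {A : Set ℕ} (hq : s.regs Code.q = q)
    (hy : s.regs Code.y = y) (h : Header k g d (arr s.mem q)) (hA : Holds g (arr s.mem q) d 0 A)
    (hyu : y < univ g d) (hAu : ∀ x ∈ A, x < univ g d) (hr : IsGreatest {x ∈ A | x < y} r) :
    Halts b Code.findPred s
      (Code.start.len + (2 + ((2 + ((d + 1) * predStepTime + 2)) + 9)))
      (fun s' => s'.regs ⟨0⟩ = arr s.mem q 1 r ∧ Unchanged q [10, 11] 0 (d + 1) s.mem s'.mem) := by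
  have hb := hp.lt_two_pow
  have hh := hp.head
  have htree := hp.tree
  have hu := univ_le_succ g d
  have hd := depth_succ_lt hp
  obtain ⟨h₁, h₂, h₃, h₄, h₅, h₆, h₇⟩ := run_start hp hq h
  refine Halts.run_seq loopFree_start (Halts.run_seq (by simp [Cmd.LoopFree]) (Halts.seq ?_))
  generalize Code.start.run b s = s₁ at *
  refine (halts_pred (q := q) hp.one_le_g hp.two_pow_g hb (M := d + 1) (by omega) (ℓ := d) (i := 0) (t := 0)
    (y := y) (r := r) (T := 2) (A := A) ?_ ?_ ?_ ?_ ?_ ?_ ?_ (by omega) (by omega) ?_ hyu hAu hr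
    (P := fun s' => s'.regs Code.q = q ∧ s'.regs Code.res = r ∧
      Unchanged q [10, 11] 0 (d + 1) s.mem s'.mem) ?_).mono le_rfl ?_
  · simpa [Cmd.run, update_reg] using h₁
  · simpa [Cmd.run, update_reg] using h₃
  · simp [Cmd.run, update_reg, h₂, hy]
  · simpa [Cmd.run, update_reg] using h₄
  · simpa [Cmd.run, update_reg] using h₅
  · simpa [Cmd.run, update_reg] using h₆
  · simp (disch := omega) only [Cmd.run, update_self, eval_rules, eval_lit]
  · simp only [Cmd.run]; rw [h₇]; exact hA
  · intro s' l₁ l₂ l₃ l₄ hU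
    refine Halts.while_false (e := .reg Code.depth) l₂ ⟨l₁, l₃, ?_⟩
    simp only [Cmd.run] at hU
    rwa [h₇] at hU
  · rintro s' ⟨l₁, l₂, hU⟩
    have hrb : r < univ g d := hAu r hr.1.1
    have hm := hU.arr_of_notMem (c := 1) (by simp) (by simp) (by simp) r
    refine (Halts.of_run (by simp [Cmd.LoopFree]) ⟨?_, ?_⟩).mono (T := Cmd.len (.assign _ _))
      (by decide) fun _ h => h
    · rw [arr] at hm
      simp (disch := omega) only [Code.ld, Code.addr, Cmd.run,
        eval_rules, eval_binOp_rules, eval_lit, eval_add, eval_mul, update_self, l₁, l₂, hm]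
    · exact hU

theorem returns_locate {mem : ℕ → ℕ} {f : ℕ → ℕ} {L : List Item} {y : ℕ}
    (h : Header k g d (arr mem q)) (hL : Consistent f L)
    (hA : Holds g (arr mem q) d 0 (keys f L)) (hyu : y < univ g d)
    (hAu : ∀ x ∈ keys f L, x < univ g d) (hlast : ∀ x, arr mem q 1 x = lastName f L x) :
    Returns b Code.locate [q, y] mem (locateTime d)
      (fun r mem' => r = lastNameLe f L y ∧ Unchanged q [10, 11] 0 (d + 1) mem mem') := by
  have hb := hp.lt_two_pow
  have hh := hp.head
  have htree := hp.tree
  have hu := univ_le_succ g d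
  have hu' := univ_pos g d
  have hly := hlast y
  have hEnds := hA.1
  obtain ⟨a, ha⟩ : ∃ a, arr mem q 2 0 = a := ⟨_, rfl⟩
  have hab : a < 2 ^ b := by
    rcases hA.1 with ⟨h, -⟩ | ⟨x, -, h, -, hx, -⟩
    · omega
    · have := hAu x hx.1; omega
  have ha' := ha
  rw [arr] at hly ha'
  have l₁ : Cmd.len (.assign Code.z (Code.ld 1 Code.y)) = 9 := by decide
  have l₂ : Cmd.len (.assign Code.lo (Code.ld 2 0)) = 9 := by decide
  have l₃ : Code.start.len ≤ 40 := by decide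
  unfold Returns locateTime
  refine (Halts.run_seq (T := 2 + (9 + (10 + (Code.start.len +
    (2 + ((2 + ((d + 1) * predStepTime + 2)) + 9)))))) (by simp [Cmd.LoopFree])
    (Halts.ite (fun h₀ => ?_) fun h₀ => ?_)).mono (by omega) fun _ => id
  · -- there is an entry of key `y`
    refine (Halts.of_run (by simp [Cmd.LoopFree]) ?_).mono (T := 2) (by omega) fun _ => id
    simp (disch := omega) only [Code.ld, Code.addr, Cmd.run, eval_rules, eval_lit, eval_add,
      eval_mul, update_self, argRegs_zero, argRegs_succ] at h₀ ⊢
    change mem (q + (16 * y + 1)) ≠ 0 at h₀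
    refine ⟨?_, .refl _⟩
    rw [hly]
    rw [hly] at h₀
    have hy : y ∈ keys f L := by
      by_contra hy; exact h₀ ((lastName_eq_zero hL.2.1).2 hy)
    exact (lastNameLe_eq hL.2.2 ⟨⟨hy, le_rfl⟩, fun x hx => hx.2⟩).symm
  · simp (disch := omega) only [Code.ld, Code.addr, Cmd.run, eval_rules, eval_lit, eval_add,
      eval_mul, update_self, argRegs_zero, argRegs_succ] at h₀
    change mem (q + (16 * y + 1)) = 0 at h₀
    rw [hly, lastName_eq_zero hL.2.1] at h₀
    have hle : ∀ x ∈ keys f L, x ≤ y → x < y := fun x hx hxy =>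
      lt_of_le_of_ne hxy (by rintro rfl; exact h₀ hx)
    rw [← l₂]
    refine Halts.run_seq (by simp [Cmd.LoopFree]) ?_
    generalize hs₁ : (Cmd.assign Code.lo (Code.ld 2 0)).run b _ = s₁
    have hs : s₁.regs Code.lo = a ∧ s₁.regs Code.y = y ∧ s₁.regs Code.q = q ∧ s₁.mem = mem := by
      rw [← hs₁]
      simp (disch := omega) only [Code.ld, Code.addr, Cmd.run, eval_rules, eval_lit, eval_add,
        eval_mul, update_self, update_reg, argRegs_zero, argRegs_succ, ↓reduceIte, Nat.reduceEqDiff,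
        OfNat.ofNat_ne_zero, OfNat.zero_ne_ofNat, OfNat.ofNat_ne_one, OfNat.one_ne_ofNat,
        one_ne_zero, zero_ne_one, and_true]
      exact ha'
    obtain ⟨k₁, k₂, k₃, k₄⟩ := hs
    have hc : Expr.eval b s₁ (.bin .lt 0 (.reg Code.lo) *
        .bin .lt (.reg Code.lo) (.reg Code.y + 1)) = if 0 < a ∧ a ≤ y then 1 else 0 := by
      simp (disch := omega) only [eval_rules, eval_lit, eval_add, k₁, k₂]
      rcases Nat.eq_zero_or_pos a with h | h
      · rw [eval_lt_neg h.le, eval_mul (by simp), zero_mul, if_neg (by omega)]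
      · rw [eval_lt_pos h]
        by_cases h' : a ≤ y
        · rw [eval_lt_pos (by omega), eval_mul (by omega), if_pos ⟨h, h'⟩]
        · rw [eval_lt_neg (by omega), eval_mul (by simp), if_neg (by omega)]
    refine (Halts.ite (T := (Code.start.len +
      (2 + ((2 + ((d + 1) * predStepTime + 2)) + 9)))) (fun h₁ => ?_) fun h₁ => ?_).mono
      (Nat.add_le_add_right (by decide) _) fun _ => id
    · rw [hc] at h₁
      have h₁' : 0 < a ∧ a ≤ y := by by_contra h; exact h₁ (if_neg h)
      rcases hEnds with ⟨h, -⟩ | ⟨x, x', hx, -, hxl, -⟩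
      · omega
      obtain ⟨r, hr⟩ := exists_isGreatest_lt (A := keys f L) (y := y) ⟨x, hxl.1, by omega⟩
      refine (halts_findPred hp k₃ k₂ (by rwa [k₄]) (by rwa [k₄]) hyu hAu hr).mono le_rfl ?_
      rw [k₄]
      rintro s' ⟨m₁, m₂⟩
      refine ⟨?_, m₂⟩
      rw [m₁, hlast]
      exact (lastNameLe_eq hL.2.2 ⟨⟨hr.1.1, hr.1.2.le⟩, fun x hx => hr.2 ⟨hx.1, hle x hx.1 hx.2⟩⟩).symm
    · rw [hc] at h₁
      have h₁' : ¬ (0 < a ∧ a ≤ y) := by intro h; rw [if_pos h] at h₁; omega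
      refine (Halts.of_run (by simp [Cmd.LoopFree]) ?_).mono (T := 2) (by omega) fun _ => id
      simp (disch := omega) only [Cmd.run, eval_rules, eval_lit, update_self, k₄]
      refine ⟨(lastNameLe_eq_zero fun x hx => ?_).symm, .refl _⟩
      by_contra hxy
      have := hEnds.zero_or_lt (l := y) (by rw [ha]; omega) x hx
      have := hle x hx (by omega)
      omega

end

/-! ### Names -/

/-- The list of free names that starts at `lk 0`. -/
def FreeList (lk : ℕ → ℕ) (fr : List ℕ) : Prop := (0 :: (fr ++ [0])).IsChain (fun a c => lk a = c)

/-- The names `1, …, count` are those in use and those in the list of free names. -/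
def NameSupply (lk : ℕ → ℕ) (count n : ℕ) (names : List ℕ) : Prop :=
  ∃ fr, FreeList lk fr ∧ (names ++ fr).Nodup ∧ (∀ N ∈ names ++ fr, 1 ≤ N ∧ N ≤ count) ∧
    (names ++ fr).length = count ∧ count ≤ n

theorem freeList_iff {lk : ℕ → ℕ} {fr : List ℕ} :
    FreeList lk fr ↔ lk 0 = head0 fr ∧ (fr ++ [0]).IsChain (fun a c => lk a = c) := by
  have h : (0 :: (fr ++ [0])).IsChain (fun a c => lk a = c) ↔ _ := List.isChain_cons
  rw [FreeList, h, head?_append_zero]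
  simp

theorem NameSupply.perm {lk : ℕ → ℕ} {count n : ℕ} {names names' : List ℕ}
    (h : NameSupply lk count n names) (hp : names.Perm names') : NameSupply lk count n names' := by
  obtain ⟨fr, h₁, h₂, h₃, h₄, h₅⟩ := h
  have hp' := hp.append_right fr
  exact ⟨fr, h₁, hp'.nodup_iff.1 h₂, fun N hN => h₃ N (hp'.mem_iff.2 hN),
    hp'.length_eq.symm.trans h₄, h₅⟩

/-- Taking a name from the list of free names. -/
theorem NameSupply.pop {lk lk' : ℕ → ℕ} {count n N : ℕ} {names : List ℕ}
    (h : NameSupply lk count n names) (hN : lk 0 = N) (hN0 : N ≠ 0)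
    (hlk : ∀ u, lk' u = if u = 0 then lk N else lk u) : NameSupply lk' count n (N :: names) := by
  obtain ⟨fr, h₁, h₂, h₃, h₄, h₅⟩ := h
  rw [freeList_iff, hN] at h₁
  cases fr with
  | nil => exact (hN0 (by simpa [head0] using h₁.1)).elim
  | cons M fr =>
    obtain rfl : N = M := by simpa [head0] using h₁.1
    have hp : (names ++ N :: fr).Perm (N :: names ++ fr) := List.perm_middle
    have hc : (N :: (fr ++ [0])).IsChain (fun a c => lk a = c) ↔ _ := List.isChain_cons
    have h₁' := h₁.2
    rw [List.cons_append, hc, head?_append_zero] at h₁'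
    refine ⟨fr, freeList_iff.2 ⟨?_, isChain_of_agree h₁'.2 fun u hu v _ huv => ?_⟩,
      hp.nodup_iff.1 h₂, fun M hM => h₃ M (hp.mem_iff.2 hM), hp.length_eq.symm.trans h₄, h₅⟩
    · rw [hlk, if_pos rfl]; simpa using h₁'.1
    · have hu' : u ∈ fr := by simpa using hu
      have := h₃ u (by simp [hu'])
      rw [hlk, if_neg (by omega)]
      exact huv

/-- If no name is free, all the names so far are in use, so that there are fewer than `n`. -/
theorem NameSupply.fresh {lk : ℕ → ℕ} {count n : ℕ} {names : List ℕ}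
    (h : NameSupply lk count n names) (h0 : lk 0 = 0) (hn : names.length < n) :
    NameSupply lk (count + 1) n ((count + 1) :: names) := by
  obtain ⟨fr, h₁, h₂, h₃, h₄, h₅⟩ := h
  rw [freeList_iff, h0] at h₁
  cases fr with
  | nil =>
    simp only [List.append_nil] at *
    refine ⟨[], freeList_iff.2 ⟨by simpa [head0] using h0, by simp⟩, ?_, ?_, ?_, by omega⟩
    · simp only [List.append_nil, List.nodup_cons, h₂, and_true]
      intro h; have := h₃ _ h; omega
    · intro N hN
      simp only [List.append_nil, List.mem_cons] at hN
      rcases hN with rfl | hN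
      · omega
      · have := h₃ N hN; omega
    · simpa using h₄
  | cons M fr =>
    obtain rfl : 0 = M := by simpa [head0] using h₁.1
    have := h₃ 0 (by simp)
    omega

/-- Returning a name to the list of free names. -/
theorem NameSupply.push {lk lk' : ℕ → ℕ} {count n N : ℕ} {names : List ℕ}
    (h : NameSupply lk count n (N :: names))
    (hlk : ∀ u, lk' u = if u = 0 then N else if u = N then lk 0 else lk u) :
    NameSupply lk' count n names := by
  obtain ⟨fr, h₁, h₂, h₃, h₄, h₅⟩ := h
  have hp : (names ++ N :: fr).Perm (N :: names ++ fr) := List.perm_middle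
  have hN := h₃ N (by simp)
  rw [freeList_iff] at h₁
  refine ⟨N :: fr, freeList_iff.2 ⟨by simp [hlk, head0], ?_⟩, hp.nodup_iff.2 h₂,
    fun M hM => h₃ M (hp.mem_iff.1 hM), hp.length_eq.trans h₄, h₅⟩
  have h : (N :: (fr ++ [0])).IsChain (fun a c => lk' a = c) ↔ _ := List.isChain_cons
  rw [List.cons_append, h, head?_append_zero]
  refine ⟨?_, isChain_of_agree h₁.2 fun u hu v _ huv => ?_⟩
  · simp only [Option.mem_def, Option.some.injEq, forall_eq']
    rw [hlk, if_neg (by omega), if_pos rfl]; exact h₁.1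
  · have hu' : u ∈ fr := by simpa using hu
    have := h₃ u (by simp [hu'])
    simp only [List.cons_append, List.nodup_cons, List.mem_append, not_or] at h₂
    rw [hlk, if_neg (by omega), if_neg (by rintro rfl; exact h₂.1.2 hu')]
    exact huv

/-! ### The representation of a structure -/

/-- The storage from the address `q` on represents a structure with contents `L`. The entry with
the name `N` uses the cell `N` of the arrays `5` (predecessor), `6` (successor), `7` (element) and
`8` (data item); the array `1` holds the last entry of every key, and the arrays `2`, `3` and `4`
hold the set of keys. -/
structure Rep (q U n k g d : ℕ) (mem : ℕ → ℕ) (L : List Item) : Prop where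
  header : Header k g d (arr mem q)
  consistent : Consistent (trunc k) L
  le : ∀ it ∈ L, it.elem ≤ U
  set : Holds g (arr mem q) d 0 (keys (trunc k) L)
  last : ∀ x, arr mem q 1 x = lastName (trunc k) L x
  links : Links (arr mem q 6) (arr mem q 5) (L.map Item.name)
  elem : ∀ it ∈ L, arr mem q 7 it.name = it.elem
  elem_zero : arr mem q 7 0 = 0
  data : ∀ it ∈ L, arr mem q 8 it.name = it.data
  names : NameSupply (arr mem q 9) (arr mem q 0 3) n (L.map Item.name)

theorem Rep.congr {q U n k g d : ℕ} {mem mem' : ℕ → ℕ} {L : List Item}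
    (h : Rep q U n k g d mem L) (hmem : ∀ a, q ≤ a → mem' a = mem a) :
    Rep q U n k g d mem' L := by
  have : arr mem' q = arr mem q := by
    funext c i; exact hmem _ (Nat.le_add_right _ _)
  obtain ⟨h₁, h₂, h₃, h₄, h₅, h₆, h₇, h₈, h₉, h₀⟩ := h
  rw [← this] at h₁ h₄ h₅ h₆ h₇ h₈ h₉ h₀
  exact ⟨h₁, h₂, h₃, h₄, h₅, h₆, h₇, h₈, h₉, h₀⟩

/-- A change of the stack of a search does not matter. -/
theorem Rep.congr_stack {q U n k g d M : ℕ} {mem mem' : ℕ → ℕ} {L : List Item} (hg : 1 ≤ g)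
    (h : Rep q U n k g d mem L) (hU : Unchanged q [10, 11] 0 M mem mem') :
    Rep q U n k g d mem' L := by
  have key : ∀ c < 10, ∀ j, arr mem' q c j = arr mem q c j := fun c hc j =>
    hU.arr_of_notMem (by simp) (by omega) (by simp; omega) j
  have key' : ∀ c < 10, arr mem' q c = arr mem q c := fun c hc => funext (key c hc)
  obtain ⟨h₁, h₂, h₃, h₄, h₅, h₆, h₇, h₈, h₉, h₀⟩ := h
  refine ⟨?_, h₂, h₃, h₄.congr hg fun c hc j _ _ => key c (by simp at hc; omega) j, ?_, ?_, ?_, ?_,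
    ?_, ?_⟩
  · rw [Header, key 0 (by omega), key 0 (by omega), key 0 (by omega)]; exact h₁
  · rwa [key' 1 (by omega)]
  · rwa [key' 6 (by omega), key' 5 (by omega)]
  · rwa [key' 7 (by omega)]
  · rwa [key 7 (by omega)]
  · rwa [key' 8 (by omega)]
  · rwa [key' 9 (by omega), key 0 (by omega)]

theorem Rep.name_le {q U n k g d : ℕ} {mem : ℕ → ℕ} {L : List Item}
    (h : Rep q U n k g d mem L) {N : ℕ} (hN : N ∈ L.map Item.name) : 1 ≤ N ∧ N ≤ n := by
  obtain ⟨fr, h₁, h₂, h₃, h₄, h₅⟩ := h.names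
  have := h₃ N (by simp only [List.mem_append]; exact .inl hN)
  omega

theorem head0_map (L : List Item) : head0 (L.map Item.name) = nameOrNil L.head? := by
  simp [head0, nameOrNil]

theorem last0_map (L : List Item) : last0 (L.map Item.name) = nameOrNil L.getLast? := by
  simp [last0, nameOrNil]

theorem Rep.links_of_eq {q U n k g d : ℕ} {mem : ℕ → ℕ} {A B : List Item} {it : Item}
    (h : Rep q U n k g d mem (A ++ it :: B)) :
    arr mem q 5 it.name = nameOrNil A.getLast? ∧ arr mem q 6 it.name = nameOrNil B.head? := by
  have := h.links
  rw [List.map_append, List.map_cons, links_middle, last0_map, head0_map] at this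
  exact ⟨this.2.2.1.2, this.2.2.2.1⟩

theorem Rep.links_zero {q U n k g d : ℕ} {mem : ℕ → ℕ} {L : List Item}
    (h : Rep q U n k g d mem L) :
    arr mem q 6 0 = nameOrNil L.head? ∧ arr mem q 5 0 = nameOrNil L.getLast? := by
  have h₁ := h.links
  have h₂ := h.links
  rw [← List.nil_append (L.map Item.name), links_append, head0_map] at h₁
  rw [← List.append_nil (L.map Item.name), links_append, last0_map] at h₂
  exact ⟨by simpa [last0] using h₁.2.2.1, by simpa [head0] using h₂.2.2.2⟩

/-- Beyond the precision `k`, a larger exponent outweighs the digits. -/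
theorem trunc_lt_of_log_lt {k x y : ℕ} (h : Nat.log 2 x - k < Nat.log 2 y - k) :
    trunc k x < trunc k y := by
  unfold trunc
  have hy : y ≠ 0 := by rintro rfl; simp at h
  have h₁ : x < 2 ^ (Nat.log 2 x + 1) := Nat.lt_pow_succ_log_self (by norm_num) x
  have h₂ : 2 ^ Nat.log 2 y ≤ y := Nat.pow_log_le_self 2 hy
  generalize Nat.log 2 x = l at *
  obtain ⟨t, ht⟩ : ∃ t, Nat.log 2 y - k = t := ⟨_, rfl⟩
  rw [ht] at h ⊢
  have h₃ : x / 2 ^ (l - k) < 2 ^ (k + 1) := by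
    refine Nat.div_lt_of_lt_mul (h₁.trans_le ?_)
    rw [← pow_add]
    exact Nat.pow_le_pow_right (by norm_num) (by omega)
  have h₄ : 2 ^ k ≤ y / 2 ^ t := by
    refine (Nat.le_div_iff_mul_le (Nat.two_pow_pos t)).2 (le_trans ?_ h₂)
    rw [← pow_add]
    exact Nat.pow_le_pow_right (by norm_num) (by omega)
  have h₅ : (l - k + 1) * 2 ^ k ≤ t * 2 ^ k := Nat.mul_le_mul_right _ h
  rw [Nat.add_mul] at h₅
  rw [pow_succ] at h₃
  omega

theorem trunc_mono {k x y : ℕ} (h : x ≤ y) : trunc k x ≤ trunc k y := by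
  have h₁ : Nat.log 2 x - k ≤ Nat.log 2 y - k := Nat.sub_le_sub_right (Nat.log_mono_right h) k
  rcases h₁.eq_or_lt with h₁ | h₁
  · unfold trunc
    rw [h₁]
    exact Nat.add_le_add_right (Nat.div_le_div_right h) _
  · exact (trunc_lt_of_log_lt h₁).le

theorem Rep.key_lt {b q U n k g d : ℕ} (hp : Params b q U n k g d) {mem : ℕ → ℕ} {L : List Item}
    (h : Rep q U n k g d mem L) : ∀ x ∈ keys (trunc k) L, x < univ g d := by
  rintro x ⟨it, hit, rfl⟩
  exact (trunc_mono (h.le it hit)).trans_lt hp.trunc_lt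

/-! ### The operations of the structure -/

namespace Code
open WordRAM.Expr WordRAM.Cmd

/-- The element or the name to which an operation refers. -/
abbrev x : Reg := ⟨1⟩
/-- The data item of a new entry. -/
abbrev dat : Reg := ⟨2⟩
/-- The key of the element. -/
abbrev ky : Reg := ⟨3⟩
/-- The entry before the one in question. -/
abbrev p : Reg := ⟨4⟩
/-- The name of a new entry. -/
abbrev N : Reg := ⟨5⟩
/-- The entry after the one in question. -/
abbrev nx : Reg := ⟨6⟩
/-- A key, or a result that is not needed. -/
abbrev u : Reg := ⟨7⟩

/-- Take a name from the list of free names, or a new one. -/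
def newName : Cmd :=
  N ::= ld 9 0 ;;
  ite N (st 9 0 (ld 9 N)) (N ::= ld 0 3 + 1 ;; st 0 3 N)

/-- Insert the entry `N` after the entry `p`. -/
def link : Cmd :=
  nx ::= ld 6 p ;;
  st 6 p N ;; st 5 nx N ;; st 5 N p ;; st 6 N nx ;; st 7 N x ;; st 8 N dat ;; st 1 ky N ;;
  q ::= N

/-- `insert (q, x, d)`: the new entry comes after the last one of key at most its own. -/
def insert : Cmd :=
  call ky key [q, x] ;;
  call p locate [q, ky] ;;
  ite (ld 1 ky) skip (call u setInsert [q, ky]) ;;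
  newName ;;
  link

/-- Remove the entry `x` from the list, and its name from those in use. -/
def unlink : Cmd :=
  st 6 p nx ;; st 5 nx p ;; st 9 x (ld 9 0) ;; st 9 0 x

/-- `delete (q, x)`. If the entry `x` is the last one of its key, then its predecessor becomes the
last one, provided that it exists and has the same key; otherwise the key is deleted. -/
def delete : Cmd :=
  call ky key [q, ld 7 x] ;;
  p ::= ld 5 x ;;
  nx ::= ld 6 x ;;
  ite (bin .eq (ld 1 ky) x)
    (call u key [q, ld 7 p] ;;
      ite (bin .lt 0 p * bin .eq u ky) (st 1 ky p) (st 1 ky 0 ;; call u setDelete [q, ky]))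
    skip ;;
  unlink

/-- `search (q, x)` -/
def search : Cmd := call ky key [q, x] ;; call q locate [q, ky]

/-- Instantiation: find the number of bits per word, choose the precision `e` of the keys, and
double the number of bits of the universe until it holds the key of `U`. At the start, the
registers `y`, `i` and `bits` hold the arguments `U` and the two words of the error. -/
def new : Cmd :=
  z ::= msb (0 - 1) + 1 ;;
  leaf ::= msb z ;;
  ite i (e ::= 0) (e ::= z - msb bits) ;;
  st 0 0 e ;;
  call y key [q, y] ;;
  h ::= msb y + 1 ;;
  bits ::= leaf ;;
  .while (bin .lt bits h) (bits ::= 2 * bits) ;;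
  st 0 1 bits ;;
  st 0 2 leaf

end Code

/-- The van Emde Boas structure. -/
def vebCode : VEBCode where
  new := Code.new
  insert := Code.insert
  delete := Code.delete
  search := Code.search
  minimum := Code.q ::= Code.ld 6 0
  maximum := Code.q ::= Code.ld 5 0
  predecessor := Code.q ::= Code.ld 5 Code.x
  successor := Code.q ::= Code.ld 6 Code.x
  data := Code.q ::= Code.ld 8 Code.x
  element := Code.q ::= Code.ld 7 Code.x

/-- A bound for the steps of an operation. -/
def opTime (d : ℕ) : ℕ := (d + 1) * (insertStepTime + deleteStepTime + predStepTime) + 2000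

theorem Halts.call_seq {b : ℕ} {s : State} {T₁ T₂ : ℕ} {P : State → Prop} {r : Reg} {c c' : Cmd}
    {args : List Expr} {R : ℕ → (ℕ → ℕ) → Prop}
    (h : Returns b c (args.map (Expr.eval b s)) s.mem T₁ R)
    (hP : ∀ v mem', R v mem' → Halts b c' ⟨update s.regs r v, mem'⟩ T₂ P) :
    Halts b (.seq (.call r c args) c') s ((args.map Expr.cost).sum + 1 + T₁ + T₂) P :=
  .seq (.call h hP)

section

variable {b q U n k g d : ℕ} (hp : Params b q U n k g d)
include hp

theorem returns_key {mem : ℕ → ℕ} {x : ℕ} (h : Header k g d (arr mem q)) (hx : x < 2 ^ b) :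
    Returns b Code.key [q, x] mem Code.key.len (fun r mem' => r = trunc k x ∧ mem' = mem) :=
  Halts.of_run loopFree_key (run_key (q := q) (s := ⟨argRegs [q, x], mem⟩) hp.lt_two_pow rfl rfl hx
    (by have := hp.head; omega) h.1)

theorem eval_ld {s : State} {c j : ℕ} {e : Expr} (hq : s.regs Code.q = q)
    (he : e.eval b s = j) (hc : c < 16) (hj : j ≤ n) :
    (Code.ld c e).eval b s = arr s.mem q c j := by
  have hb := hp.lt_two_pow
  have := hp.names
  simp (disch := omega) only [Code.ld, Code.addr, eval_rules, eval_lit, eval_add, eval_mul, hq, he]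
  rfl

theorem returns_ld {mem : ℕ → ℕ} {c j : ℕ} {e : Expr} {args : List ℕ}
    (he : e.eval b ⟨argRegs (q :: args), mem⟩ = j) (hec : e.cost = 1) (hc : c < 16) (hj : j ≤ n) :
    Returns b (Code.q ::= Code.ld c e) (q :: args) mem (opTime d)
      (fun r mem' => r = arr mem q c j ∧ mem' = mem) := by
  have h := eval_ld hp (s := ⟨argRegs (q :: args), mem⟩) rfl he hc hj
  have h8 : (Code.q ::= Code.ld c e).len = 8 + e.cost := by
    change 1 + (1 + e.cost + 1 + 1 + 1) + 1 + 1 + 1 = _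
    ring
  have h9 : (Code.q ::= Code.ld c e).len ≤ opTime d := by rw [h8, hec, opTime]; omega
  refine Halts.mono (P := fun s => s.regs ⟨0⟩ = arr mem q c j ∧ s.mem = mem)
    (Halts.of_run (by simp [Cmd.LoopFree]) ⟨?_, rfl⟩) h9 fun _ h => h
  simpa only [Cmd.run, update_self] using h

/-- What an operation has to achieve. -/
def Correct (b q U n k g d : ℕ) (op : Op) (mem : ℕ → ℕ) (L : List Item) : Prop :=
  Returns b (op.code vebCode) (q :: op.args) mem (opTime d) (fun r mem' =>
    (∀ a, a < q → mem' a = mem a) ∧ ∃ L', op.Effect (trunc k) L r L' ∧ Rep q U n k g d mem' L')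

variable {mem : ℕ → ℕ} {L : List Item} (hL : Rep q U n k g d mem L)
include hL

theorem correct_minimum : Correct b q U n k g d .minimum mem L := by
  have hb := hp.lt_two_pow
  refine (returns_ld hp (c := 6) (j := 0) (eval_lit (by omega)) rfl (by omega) (by omega)).mono
    le_rfl ?_
  rintro r _ ⟨rfl, rfl⟩
  exact ⟨fun _ _ => rfl, L, ⟨rfl, hL.links_zero.1⟩, hL⟩

theorem correct_maximum : Correct b q U n k g d .maximum mem L := by
  have hb := hp.lt_two_pow
  refine (returns_ld hp (c := 5) (j := 0) (eval_lit (by omega)) rfl (by omega) (by omega)).mono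
    le_rfl ?_
  rintro r _ ⟨rfl, rfl⟩
  exact ⟨fun _ _ => rfl, L, ⟨rfl, hL.links_zero.2⟩, hL⟩

theorem correct_ld {N c : ℕ} (hN : ∃ it ∈ L, it.name = N) (hc : c < 16) :
    Returns b (Code.q ::= Code.ld c Code.x) [q, N] mem (opTime d)
      (fun r mem' => r = arr mem q c N ∧ mem' = mem) := by
  obtain ⟨it, hit, rfl⟩ := hN
  exact returns_ld hp rfl rfl hc (hL.name_le (List.mem_map_of_mem hit)).2

theorem correct_predecessor {N : ℕ} (hN : ∃ it ∈ L, it.name = N) :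
    Correct b q U n k g d (.predecessor N) mem L := by
  refine (correct_ld hp hL hN (c := 5) (by omega)).mono le_rfl ?_
  rintro r _ ⟨rfl, rfl⟩
  obtain ⟨it, hit, rfl⟩ := hN
  obtain ⟨A, B, rfl⟩ := exists_split_of_mem hit
  exact ⟨fun _ _ => rfl, _, ⟨rfl, A, it, B, rfl, rfl, hL.links_of_eq.1⟩, hL⟩

theorem correct_successor {N : ℕ} (hN : ∃ it ∈ L, it.name = N) :
    Correct b q U n k g d (.successor N) mem L := by
  refine (correct_ld hp hL hN (c := 6) (by omega)).mono le_rfl ?_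
  rintro r _ ⟨rfl, rfl⟩
  obtain ⟨it, hit, rfl⟩ := hN
  obtain ⟨A, B, rfl⟩ := exists_split_of_mem hit
  exact ⟨fun _ _ => rfl, _, ⟨rfl, A, it, B, rfl, rfl, hL.links_of_eq.2⟩, hL⟩

theorem correct_data {N : ℕ} (hN : ∃ it ∈ L, it.name = N) :
    Correct b q U n k g d (.data N) mem L := by
  refine (correct_ld hp hL hN (c := 8) (by omega)).mono le_rfl ?_
  rintro r _ ⟨rfl, rfl⟩
  obtain ⟨it, hit, rfl⟩ := hN
  exact ⟨fun _ _ => rfl, _, ⟨rfl, it, hit, rfl, hL.data it hit⟩, hL⟩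

theorem correct_element {N : ℕ} (hN : ∃ it ∈ L, it.name = N) :
    Correct b q U n k g d (.element N) mem L := by
  refine (correct_ld hp hL hN (c := 7) (by omega)).mono le_rfl ?_
  rintro r _ ⟨rfl, rfl⟩
  obtain ⟨it, hit, rfl⟩ := hN
  exact ⟨fun _ _ => rfl, _, ⟨rfl, it, hit, rfl, hL.elem it hit⟩, hL⟩

theorem correct_search {x : ℕ} (hx : x ≤ U) : Correct b q U n k g d (.search x) mem L := by
  have hxb := hx.trans_lt hp.elems
  have hkx : trunc k x < univ g d := (trunc_mono hx).trans_lt hp.trunc_lt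
  refine Halts.mono (T := 2 + 1 + Code.key.len + (2 + 1 + locateTime d))
    (Halts.call_seq (returns_key hp hL.header hxb) ?_) ?_ fun _ h => h
  · rintro r _ ⟨rfl, rfl⟩
    refine Halts.call (returns_locate hp hL.header hL.consistent hL.set hkx (hL.key_lt hp)
      hL.last) ?_
    rintro _ mem' ⟨rfl, hU⟩
    exact ⟨fun a ha => hU.of_lt ha, L, search_effect hL.consistent,
      hL.congr_stack hp.one_le_g hU⟩
  · have : Code.key.len ≤ 100 := by decide
    have h := Nat.mul_le_mul_left (d + 1)
      (Nat.le_add_left predStepTime (insertStepTime + deleteStepTime))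
    simp only [opTime, locateTime]
    omega

end

/-! ### Insertion of an entry -/

theorem loopFree_newName : Code.newName.LoopFree := by simp [Code.newName, Code.st, Cmd.LoopFree]

theorem loopFree_link : Code.link.LoopFree := by simp [Code.link, Code.st, Cmd.LoopFree]

section

variable {b q U n k g d : ℕ} (hp : Params b q U n k g d)
include hp

theorem run_newName {s : State} {names : List ℕ} (hq : s.regs Code.q = q)
    (h : NameSupply (arr s.mem q 9) (arr s.mem q 0 3) n names) (hn : names.length < n) :
    (∀ r : Reg, r ≠ Code.N → (Code.newName.run b s).regs r = s.regs r) ∧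
    ∃ N, (Code.newName.run b s).regs Code.N = N ∧ N ∉ names ∧ N ≠ 0 ∧ N ≤ n ∧
      NameSupply (arr (Code.newName.run b s).mem q 9) (arr (Code.newName.run b s).mem q 0 3) n
        (N :: names) ∧
      (∀ c j, c < 16 → c ≠ 9 → (c = 0 → j ≠ 3) →
        arr (Code.newName.run b s).mem q c j = arr s.mem q c j) ∧
      ∀ a, a < q → (Code.newName.run b s).mem a = s.mem a := by
  have hb := hp.lt_two_pow
  have hnb := hp.names
  have hh := hp.head
  obtain ⟨F, hF⟩ : ∃ F, arr s.mem q 9 0 = F := ⟨_, rfl⟩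
  obtain ⟨M, hM⟩ : ∃ M, arr s.mem q 0 3 = M := ⟨_, rfl⟩
  have key : ∀ {lk : ℕ → ℕ} {count N : ℕ}, NameSupply lk count n (N :: names) →
      N ∉ names ∧ N ≠ 0 ∧ N ≤ n := by
    rintro lk count N ⟨fr, h₁, h₂, h₃, h₄, h₅⟩
    have := h₃ N (by simp)
    simp only [List.cons_append, List.nodup_cons, List.mem_append, not_or] at h₂
    exact ⟨h₂.1.1, by omega, by omega⟩
  have hF' := hF
  have hM' := hM
  rw [arr] at hF' hM'
  by_cases hF0 : F = 0
  · have h' := h.fresh (hF.trans hF0) hn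
    rw [hM] at h'
    obtain ⟨k₁, k₂, k₃⟩ := key h'
    have hrun : Code.newName.run b s = ⟨update (update s.regs Code.N 0) Code.N (M + 1),
        update s.mem (q + (16 * 3 + 0)) (M + 1)⟩ := by
      subst hF0
      simp (disch := omega) only [Code.newName, Code.st, Code.ld, Code.addr, Cmd.run,
        eval_rules, eval_lit, eval_add, eval_mul, update_reg, update_self, update_mem_of_ne,
        ↓reduceIte, Nat.reduceEqDiff, hq, hF', hM']
    rw [hrun]
    refine ⟨fun r hr => by simp [hr], M + 1, by simp, k₁, k₂, k₃, ?_, ?_, ?_⟩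
    · have e₁ : arr (update s.mem (q + (16 * 3 + 0)) (M + 1)) q 9 = arr s.mem q 9 := by
        funext j; rw [arr_update (by omega) (by omega)]; simp
      have e₂ : arr (update s.mem (q + (16 * 3 + 0)) (M + 1)) q 0 3 = M + 1 := by
        rw [arr_update (by omega) (by omega)]; simp
      simp only [e₁, e₂]
      exact h'
    · intro c j hc _ hj
      simp only []
      rw [arr_update (by omega) hc, if_neg (by tauto)]
    · intro a ha
      exact update_of_ne (by omega) _ _
  · have h' := h.pop hF hF0 (lk' := arr (update s.mem (q + (16 * 0 + 9)) (arr s.mem q 9 F)) q 9)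
      (fun u => by rw [arr_update (by omega) (by omega)]; simp)
    obtain ⟨k₁, k₂, k₃⟩ := key h'
    have hrun : Code.newName.run b s = ⟨update s.regs Code.N F,
        update s.mem (q + (16 * 0 + 9)) (arr s.mem q 9 F)⟩ := by
      rw [arr]
      simp (disch := omega) only [Code.newName, Code.st, Code.ld, Code.addr, Cmd.run,
        eval_rules, eval_lit, eval_add, eval_mul, update_reg, update_self, update_mem_of_ne,
        ↓reduceIte, Nat.reduceEqDiff, hq, hF', hF0]
    rw [hrun]
    refine ⟨fun r hr => by simp [hr], F, by simp, k₁, k₂, k₃, ?_, ?_, ?_⟩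
    · have e₂ : arr (update s.mem (q + (16 * 0 + 9)) (arr s.mem q 9 F)) q 0 3 = arr s.mem q 0 3 := by
        rw [arr_update (by omega) (by omega)]; simp
      simp only [e₂]
      exact h'
    · intro c j hc hc' _
      simp only []
      rw [arr_update (by omega) hc, if_neg (by tauto)]
    · intro a ha
      exact update_of_ne (by omega) _ _

theorem run_link {s : State} {p N v x D κ : ℕ} (hq : s.regs Code.q = q) (hx : s.regs Code.x = x)
    (hd : s.regs Code.dat = D) (hk : s.regs Code.ky = κ) (hpp : s.regs Code.p = p)
    (hN : s.regs Code.N = N) (hv : arr s.mem q 6 p = v) (hpn : p ≤ n) (hNn : N ≤ n) (hvn : v ≤ n)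
    (hκ : q + 16 * (κ + 1) ≤ 2 ^ b) :
    (Code.link.run b s).regs ⟨0⟩ = N ∧
    (Code.link.run b s).mem = update (update (update (update (update (update (update s.mem
      (q + (16 * p + 6)) N) (q + (16 * v + 5)) N) (q + (16 * N + 5)) p) (q + (16 * N + 6)) v)
      (q + (16 * N + 7)) x) (q + (16 * N + 8)) D) (q + (16 * κ + 1)) N := by
  have hb := hp.lt_two_pow
  have hnb := hp.names
  rw [arr] at hv
  simp (disch := omega) only [Code.link, Code.st, Code.ld, Code.addr, Cmd.run,
    eval_rules, eval_lit, eval_add, eval_mul, update_reg, update_self, update_mem_of_ne,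
    ↓reduceIte, Nat.reduceEqDiff, OfNat.ofNat_ne_zero, OfNat.zero_ne_ofNat, OfNat.ofNat_ne_one,
    OfNat.one_ne_ofNat, one_ne_zero, zero_ne_one, hq, hx, hd, hk, hpp, hN, hv, and_self]

omit hp in
/-- Inserting an entry into the list, after the tree of keys and the supply of names have been
updated. -/
theorem Rep.insert {mem m m' : ℕ → ℕ} {L : List Item} {N p v x D κ : ℕ} (hg : 1 ≤ g)
    (hL : Rep q U n k g d mem L) (hx : x ≤ U) (hκ : trunc k x = κ)
    (hset : Holds g (arr m q) d 0 (insert κ (keys (trunc k) L)))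
    (hm : ∀ c < 10, c ∉ [2, 3, 4, 9] → ∀ j, (c = 0 → j ≠ 3) → arr m q c j = arr mem q c j)
    (hnames : NameSupply (arr m q 9) (arr m q 0 3) n (N :: L.map Item.name))
    (hN0 : N ≠ 0) (hN : N ∉ L.map Item.name)
    (hpL : p = lastNameLe (trunc k) L κ) (hv : arr mem q 6 p = v)
    (hm' : m' = update (update (update (update (update (update (update m
      (q + (16 * p + 6)) N) (q + (16 * v + 5)) N) (q + (16 * N + 5)) p) (q + (16 * N + 6)) v)
      (q + (16 * N + 7)) x) (q + (16 * N + 8)) D) (q + (16 * κ + 1)) N) :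
    ∃ L', Op.Effect (trunc k) L N L' (.insert x D) ∧ Rep q U n k g d m' L' := by
  obtain ⟨A, hA⟩ : ∃ A, L.filter (fun z => trunc k z.elem ≤ κ) = A := ⟨_, rfl⟩
  obtain ⟨B, hB⟩ : ∃ B, L.filter (fun z => κ < trunc k z.elem) = B := ⟨_, rfl⟩
  have hcons := hL.consistent
  have hAB : A ++ B = L := by
    rw [← hA, ← hB]; exact filter_le_append_filter_lt hcons.2.2 κ
  have hcons' : Consistent (trunc k) (A ++ ⟨N, x, D⟩ :: B) := by
    have := hcons.insert (it := ⟨N, x, D⟩)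
      (fun z hz h => hN (List.mem_map.2 ⟨z, hz, h⟩)) hN0
    simpa only [hκ, hA, hB] using this
  have hp' : p = last0 (A.map Item.name) := by rw [hpL, lastNameLe, hA, last0_map]
  have hlinks := hL.links
  have hnd := hcons.1
  have h0 : 0 ∉ L.map Item.name := by
    intro h
    obtain ⟨z, hz, h'⟩ := List.mem_map.1 h
    exact hcons.2.1 z hz h'
  have hN' := hN
  rw [← hAB, List.map_append] at hlinks hnd h0 hN'
  have hv' : v = head0 (B.map Item.name) := by
    rw [← hv, hp']
    exact (links_append.1 hlinks).2.2.1
  have e₂ : ∀ c < 5, c ≠ 1 → ∀ j, arr m' q c j = arr m q c j := by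
    intro c hc hc1 j
    rw [hm']
    simp (disch := omega) only [arr_update]
    simp (disch := omega) only [if_neg]
  have e₉ : ∀ j, arr m' q 9 j = arr m q 9 j := by
    intro j; rw [hm']; simp [arr_update]
  have e₁ : ∀ j, arr m' q 1 j = if j = κ then N else arr mem q 1 j := by
    intro j; rw [hm', ← hm 1 (by omega) (by simp) j (by simp)]; simp [arr_update]
  have e₅ : ∀ j, arr m' q 5 j = if j = N then p else if j = v then N else arr mem q 5 j := by
    intro j; rw [hm', ← hm 5 (by omega) (by simp) j (by simp)]; simp [arr_update]
  have e₆ : ∀ j, arr m' q 6 j = if j = N then v else if j = p then N else arr mem q 6 j := by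
    intro j; rw [hm', ← hm 6 (by omega) (by simp) j (by simp)]; simp [arr_update]
  have e₇ : ∀ j, arr m' q 7 j = if j = N then x else arr mem q 7 j := by
    intro j; rw [hm', ← hm 7 (by omega) (by simp) j (by simp)]; simp [arr_update]
  have e₈ : ∀ j, arr m' q 8 j = if j = N then D else arr mem q 8 j := by
    intro j; rw [hm', ← hm 8 (by omega) (by simp) j (by simp)]; simp [arr_update]
  have hmem : ∀ z ∈ A ++ ⟨N, x, D⟩ :: B, z = ⟨N, x, D⟩ ∨ z ∈ L := by
    intro z hz
    rw [← hAB]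
    simp only [List.mem_append, List.mem_cons] at hz ⊢
    tauto
  have hne : ∀ z ∈ L, z.name ≠ N := fun z hz h => hN (List.mem_map.2 ⟨z, hz, h⟩)
  refine ⟨A ++ ⟨N, x, D⟩ :: B, ⟨A, B, hAB.symm, rfl⟩, ?_, hcons', ?_, ?_, ?_, ?_, ?_, ?_, ?_, ?_⟩
  · have := hL.header
    rw [Header] at this ⊢
    rwa [e₂ 0 (by omega) (by omega), e₂ 0 (by omega) (by omega), e₂ 0 (by omega) (by omega),
      hm 0 (by omega) (by simp) 0 (by simp), hm 0 (by omega) (by simp) 1 (by simp),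
      hm 0 (by omega) (by simp) 2 (by simp)]
  · intro z hz
    rcases hmem z hz with rfl | hz
    exacts [hx, hL.le z hz]
  · rw [keys_insert, hAB]
    simp only [hκ]
    exact hset.congr hg fun c hc j _ _ => by
      simp only [List.mem_cons, List.not_mem_nil, or_false] at hc
      exact e₂ c (by omega) (by omega) j
  · intro y
    rw [e₁]
    split_ifs with hy
    · rw [hy, ← hκ]
      refine (lastName_insert_self (it := ⟨N, x, D⟩) fun z hz => ?_).symm
      rw [← hB, List.mem_filter, decide_eq_true_eq] at hz
      rw [hκ]; exact hz.2
    · rw [lastName_insert_of_ne (it := ⟨N, x, D⟩) (by simp only [hκ]; exact fun h => hy h.symm),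
        hAB, hL.last]
  · rw [List.map_append, List.map_cons]
    refine hlinks.insert hnd h0 hN' hN0 (fun j => ?_) fun j => ?_
    · rw [e₆, hp', hv']
    · rw [e₅, hp', hv']
  · intro z hz
    rw [e₇]
    rcases hmem z hz with rfl | hz
    · simp
    · rw [if_neg (hne z hz), hL.elem z hz]
  · rw [e₇, if_neg (Ne.symm hN0), hL.elem_zero]
  · intro z hz
    rw [e₈]
    rcases hmem z hz with rfl | hz
    · simp
    · rw [if_neg (hne z hz), hL.data z hz]
  · rw [funext e₉, e₂ 0 (by omega) (by omega)]
    refine hnames.perm ?_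
    rw [List.map_append, List.map_cons, ← hAB, List.map_append]
    exact List.perm_middle.symm

theorem correct_insert {mem : ℕ → ℕ} {L : List Item} (hL : Rep q U n k g d mem L) {x D : ℕ}
    (hx : x ≤ U) (hn : L.length < n) : Correct b q U n k g d (.insert x D) mem L := by
  have hb := hp.lt_two_pow
  have hh := hp.head
  have htree := hp.tree
  have hu := univ_le_succ g d
  have hxb := hx.trans_lt hp.elems
  obtain ⟨κ, hκ⟩ : ∃ κ, trunc k x = κ := ⟨_, rfl⟩
  have hkx : κ < univ g d := hκ ▸ (trunc_mono hx).trans_lt hp.trunc_lt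
  have hck : Code.key.len ≤ 100 := by decide
  have hcs : Code.start.len ≤ 100 := by decide
  have hcn : Code.newName.len + Code.link.len ≤ 300 := by decide
  refine Halts.mono (T := 2 + 1 + Code.key.len + (2 + 1 + locateTime d + ((8 + 1 + (2 + 1 +
      (Code.start.len + ((d + 1) * insertStepTime + 2)))) + (Code.newName.len + Code.link.len))))
    (Halts.call_seq (returns_key hp hL.header hxb) ?_) ?_ fun _ h => h
  swap
  · have h := Nat.mul_le_mul_left (d + 1)
      (show insertStepTime + predStepTime ≤ insertStepTime + deleteStepTime + predStepTime by omega)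
    rw [mul_add] at h
    simp only [opTime, locateTime]
    omega
  rintro r m₀ ⟨hr, hm₀⟩
  rw [show r = κ from hr.trans hκ, show m₀ = mem from hm₀]
  change Halts b _ ⟨update (argRegs [q, x, D]) Code.ky κ, mem⟩ _ _
  refine Halts.call_seq (returns_locate hp hL.header hL.consistent hL.set hkx (hL.key_lt hp)
      hL.last) ?_
  rintro p m₁ ⟨hpe, hU₁⟩
  replace hpe : p = lastNameLe (trunc k) L κ := hpe
  have hL₁ := hL.congr_stack hp.one_le_g hU₁
  have hbelow₁ : ∀ a, a < q → m₁ a = mem a := fun a ha => hU₁.of_lt ha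
  clear hU₁
  have hs₁q : ∀ v w, update (update (update (argRegs [q, x, D]) Code.ky κ) Code.p p) Code.u v = w →
      w Code.q = q ∧ w Code.x = x ∧ w Code.dat = D ∧ w Code.ky = κ ∧ w Code.p = p := by
    rintro v w rfl
    simp only [update_reg, ↓reduceIte, Nat.reduceEqDiff, OfNat.ofNat_ne_zero, OfNat.zero_ne_ofNat,
      OfNat.ofNat_ne_one, OfNat.one_ne_ofNat, one_ne_zero, zero_ne_one]
    exact ⟨rfl, rfl, rfl, trivial, trivial⟩
  have hld : (Code.ld 1 Code.ky).eval b
      ⟨update (update (argRegs [q, x, D]) Code.ky κ) Code.p p, m₁⟩ = arr m₁ q 1 κ := by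
    simp (disch := omega) only [Code.ld, Code.addr, eval_rules, eval_lit, eval_add, eval_mul,
      update_reg, argRegs_zero, ↓reduceIte, Nat.reduceEqDiff, OfNat.zero_ne_ofNat,
      OfNat.ofNat_ne_zero]
    rfl
  have hfin : ∀ v m₂, Holds g (arr m₂ q) d 0 (insert κ (keys (trunc k) L)) →
      Unchanged q [2, 3, 4] 0 (univ g (d + 1)) m₁ m₂ →
      Halts b (.seq Code.newName Code.link)
        ⟨update (update (update (argRegs [q, x, D]) Code.ky κ) Code.p p) Code.u v, m₂⟩
        (Code.newName.len + Code.link.len) (fun s => (∀ a, a < q → s.mem a = mem a) ∧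
          ∃ L', Op.Effect (trunc k) L (s.regs ⟨0⟩) L' (.insert x D) ∧ Rep q U n k g d s.mem L') := by
    intro v m₂ hset hU₂
    have harr : ∀ c < 16, c ∉ [2, 3, 4] → ∀ j, arr m₂ q c j = arr m₁ q c j := fun c hc hc' j =>
      hU₂.arr_of_notMem (by simp) hc hc' j
    obtain ⟨k₁, k₂, k₃, k₄, k₅⟩ := hs₁q v _ rfl
    have hnames := hL₁.names
    rw [← funext (harr 9 (by omega) (by simp)), ← harr 0 (by omega) (by simp)] at hnames
    obtain ⟨hr, N, hN, hN', hN0, hNn, hns, hm₃, hbelow₃⟩ := run_newName hp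
      (s := ⟨update (update (update (argRegs [q, x, D]) Code.ky κ) Code.p p) Code.u v, m₂⟩)
      k₁ hnames (by simpa using hn)
    refine Halts.run_seq loopFree_newName (Halts.of_run loopFree_link ?_)
    generalize Code.newName.run b _ = s₃ at *
    have hpv : p = last0 ((L.filter (fun z => trunc k z.elem ≤ κ)).map Item.name) := by
      rw [hpe, lastNameLe, last0_map]
    have hsub : ∀ {P : Item → Bool} {N}, N ∈ (L.filter P).map Item.name → N ∈ L.map Item.name := by
      intro P N h
      obtain ⟨z, hz, rfl⟩ := List.mem_map.1 h
      exact List.mem_map_of_mem (List.mem_of_mem_filter hz)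
    have hpn : p ≤ n := by
      rcases last0_mem ((L.filter (fun z => trunc k z.elem ≤ κ)).map Item.name) with h | h
      · omega
      · rw [← hpv] at h
        exact (hL.name_le (hsub h)).2
    have hvn : arr m₁ q 6 p ≤ n := by
      have hl := hL₁.links
      rw [← filter_le_append_filter_lt hL.consistent.2.2 κ, List.map_append, links_append,
        ← hpv] at hl
      rw [hl.2.2.1]
      rcases head0_mem ((L.filter (fun z => κ < trunc k z.elem)).map Item.name) with h | h
      · omega
      · exact (hL.name_le (hsub h)).2
    have h6 : arr s₃.mem q 6 p = arr m₁ q 6 p := by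
      rw [hm₃ 6 p (by omega) (by omega) (by omega)]
      exact harr 6 (by omega) (by simp) p
    obtain ⟨l₁, l₂⟩ := run_link hp ((hr _ (by decide)).trans k₁) ((hr _ (by decide)).trans k₂)
      ((hr _ (by decide)).trans k₃) ((hr _ (by decide)).trans k₄) ((hr _ (by decide)).trans k₅) hN
      h6 hpn hNn hvn (by omega)
    rw [l₁]
    refine ⟨fun a ha => ?_, hL₁.insert hp.one_le_g hx hκ ?_ ?_ hns hN0 hN' hpe rfl l₂⟩
    · have h₁ := hbelow₃ a ha
      have h₂ := hU₂.of_lt ha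
      have h₃ := hbelow₁ a ha
      dsimp only at h₁
      rw [l₂, ← h₃, ← h₂, ← h₁]
      simp (disch := omega) only [update_mem_of_ne]
    · refine hset.congr hp.one_le_g fun c hc j _ _ => hm₃ c j ?_ ?_ ?_ <;> simp at hc <;> omega
    · intro c hc hc' j hj
      simp only [List.mem_cons, List.not_mem_nil, or_false, not_or] at hc'
      exact (hm₃ c j (by omega) (by omega) hj).trans (harr c (by omega) (by simp; omega) j)
  refine Halts.seq (Halts.mono (T := 8 + 1 + (2 + 1 +
      (Code.start.len + ((d + 1) * insertStepTime + 2)))) (Halts.ite (fun h₀ => ?_) fun h₀ => ?_)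
      le_rfl fun _ h => h)
  · rw [hld, hL₁.last, Ne, lastName_eq_zero hL.consistent.2.1, not_not] at h₀
    refine ⟨_, _, .skip _, by omega, ?_⟩
    have := hfin (update (update (argRegs [q, x, D]) Code.ky κ) Code.p p Code.u) m₁
      (by rw [Set.insert_eq_of_mem h₀]; exact hL₁.set) (.refl _)
    rwa [update_eq_self] at this
  · rw [hld, hL₁.last, lastName_eq_zero hL.consistent.2.1] at h₀
    refine Halts.call (returns_setInsert hp hL₁.header hL₁.set h₀ hkx (hL.key_lt hp)) ?_
    rintro v m₂ ⟨h₁, h₂⟩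
    exact hfin v m₂ h₁ h₂

end

/-! ### Deletion of an entry -/

theorem loopFree_unlink : Code.unlink.LoopFree := by simp [Code.unlink, Code.st, Cmd.LoopFree]

section

variable {b q U n k g d : ℕ} (hp : Params b q U n k g d)
include hp

theorem run_unlink {s : State} {p N v F : ℕ} (hq : s.regs Code.q = q) (hx : s.regs Code.x = N)
    (hpp : s.regs Code.p = p) (hv : s.regs Code.nx = v) (hF : arr s.mem q 9 0 = F)
    (hpn : p ≤ n) (hNn : N ≤ n) (hvn : v ≤ n) :
    (Code.unlink.run b s).mem = update (update (update (update s.mem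
      (q + (16 * p + 6)) v) (q + (16 * v + 5)) p) (q + (16 * N + 9)) F) (q + (16 * 0 + 9)) N := by
  have hb := hp.lt_two_pow
  have hnb := hp.names
  rw [arr] at hF
  simp (disch := omega) only [Code.unlink, Code.st, Code.ld, Code.addr, Cmd.run,
    eval_rules, eval_lit, eval_add, eval_mul, update_reg, update_self, update_mem_of_ne,
    ↓reduceIte, Nat.reduceEqDiff, OfNat.ofNat_ne_zero, OfNat.zero_ne_ofNat, OfNat.ofNat_ne_one,
    OfNat.one_ne_ofNat, one_ne_zero, zero_ne_one, hq, hx, hpp, hv, hF, and_self]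

omit hp in
/-- Removing an entry from the list, after the tree of keys and the last entries of the keys have
been updated. -/
theorem Rep.erase {mem m m' : ℕ → ℕ} {A B : List Item} {it : Item} {p v F : ℕ} (hg : 1 ≤ g)
    (hL : Rep q U n k g d mem (A ++ it :: B))
    (hset : Holds g (arr m q) d 0 (keys (trunc k) (A ++ B)))
    (hlast : ∀ y, arr m q 1 y = lastName (trunc k) (A ++ B) y)
    (hm : ∀ c < 10, c ∉ [1, 2, 3, 4] → ∀ j, arr m q c j = arr mem q c j)
    (hp : arr mem q 5 it.name = p) (hv : arr mem q 6 it.name = v) (hF : arr mem q 9 0 = F)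
    (hm' : m' = update (update (update (update m (q + (16 * p + 6)) v) (q + (16 * v + 5)) p)
      (q + (16 * it.name + 9)) F) (q + (16 * 0 + 9)) it.name) :
    Rep q U n k g d m' (A ++ B) := by
  have hcons := hL.consistent
  have hsub : (A ++ B).Sublist (A ++ it :: B) :=
    List.Sublist.append_left (List.sublist_cons_self _ _) _
  have hlinks := hL.links
  have hnd := hcons.1
  have h0 : 0 ∉ (A ++ it :: B).map Item.name := by
    intro h
    obtain ⟨z, hz, h'⟩ := List.mem_map.1 h
    exact hcons.2.1 z hz h'
  have hname := hL.name_le (N := it.name) (by simp)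
  rw [List.map_append, List.map_cons] at hlinks hnd h0
  have hp' : p = last0 (A.map Item.name) := hp.symm.trans (links_middle.1 hlinks).2.2.1.2
  have hv' : v = head0 (B.map Item.name) := hv.symm.trans (links_middle.1 hlinks).2.2.2.1
  have e₂ : ∀ c < 9, c ≠ 5 → c ≠ 6 → ∀ j, arr m' q c j = arr m q c j := by
    intro c hc hc5 hc6 j
    rw [hm']
    simp (disch := omega) only [arr_update]
    simp (disch := omega) only [if_neg]
  have e₅ : ∀ j, arr m' q 5 j = if j = v then p else arr mem q 5 j := by
    intro j; rw [hm', ← hm 5 (by omega) (by simp) j]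
    simp (disch := omega) only [arr_update]
    simp
  have e₆ : ∀ j, arr m' q 6 j = if j = p then v else arr mem q 6 j := by
    intro j; rw [hm', ← hm 6 (by omega) (by simp) j]
    simp (disch := omega) only [arr_update]
    simp
  have e₉ : ∀ j, arr m' q 9 j =
      if j = 0 then it.name else if j = it.name then arr mem q 9 0 else arr mem q 9 j := by
    intro j; rw [hm', ← hm 9 (by omega) (by simp) j, hF]
    simp (disch := omega) only [arr_update]
    simp
  refine ⟨?_, hcons.sublist hsub, fun z hz => hL.le z (hsub.subset hz), ?_, ?_, ?_, ?_, ?_, ?_, ?_⟩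
  · have := hL.header
    rw [Header] at this ⊢
    rwa [e₂ 0 (by omega) (by omega) (by omega), e₂ 0 (by omega) (by omega) (by omega),
      e₂ 0 (by omega) (by omega) (by omega),
      hm 0 (by omega) (by simp) 0, hm 0 (by omega) (by simp) 1, hm 0 (by omega) (by simp) 2]
  · exact hset.congr hg fun c hc j _ _ => by
      simp only [List.mem_cons, List.not_mem_nil, or_false] at hc
      exact e₂ c (by omega) (by omega) (by omega) j
  · intro y
    rw [e₂ 1 (by omega) (by omega) (by omega), hlast]
  · rw [List.map_append]
    refine hlinks.erase hnd h0 (fun j => ?_) fun j => ?_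
    · rw [e₆, hp', hv']
    · rw [e₅, hp', hv']
  · intro z hz
    rw [e₂ 7 (by omega) (by omega) (by omega), hm 7 (by omega) (by simp), hL.elem z (hsub.subset hz)]
  · rw [e₂ 7 (by omega) (by omega) (by omega), hm 7 (by omega) (by simp), hL.elem_zero]
  · intro z hz
    rw [e₂ 8 (by omega) (by omega) (by omega), hm 8 (by omega) (by simp), hL.data z (hsub.subset hz)]
  · have h := hL.names
    rw [e₂ 0 (by omega) (by omega) (by omega), hm 0 (by omega) (by simp)]
    refine NameSupply.push (N := it.name) (h.perm ?_) e₉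
    rw [List.map_append, List.map_cons, List.map_append]
    exact List.perm_middle

theorem correct_delete {mem : ℕ → ℕ} {L : List Item} (hL : Rep q U n k g d mem L) {N : ℕ}
    (hN : ∃ it ∈ L, it.name = N) : Correct b q U n k g d (.delete N) mem L := by
  have hb := hp.lt_two_pow
  have hh := hp.head
  have htree := hp.tree
  have hu := univ_le_succ g d
  have hUb := hp.elems
  obtain ⟨it, hit, rfl⟩ := hN
  have hNn := (hL.name_le (List.mem_map_of_mem hit)).2
  have hx := hL.le it hit
  have hel := hL.elem it hit
  obtain ⟨A, B, rfl⟩ := exists_split_of_mem hit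
  obtain ⟨κ, hκ⟩ : ∃ κ, trunc k it.elem = κ := ⟨_, rfl⟩
  have hkx : κ < univ g d := hκ ▸ (trunc_mono hx).trans_lt hp.trunc_lt
  obtain ⟨hlp, hlv⟩ := hL.links_of_eq
  obtain ⟨p, hpp⟩ : ∃ p, arr mem q 5 it.name = p := ⟨_, rfl⟩
  obtain ⟨v, hvv⟩ : ∃ v, arr mem q 6 it.name = v := ⟨_, rfl⟩
  have hcons := hL.consistent
  have hpA : (p = 0 ∧ A = []) ∨ ∃ z, A.getLast? = some z ∧ z.name = p := by
    rw [← hpp, hlp]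
    rcases List.eq_nil_or_concat A with rfl | ⟨A', z, rfl⟩
    · exact .inl ⟨rfl, rfl⟩
    · exact .inr ⟨z, by simp, by simp [nameOrNil]⟩
  have hpn : p ≤ n := by
    rcases hpA with ⟨h, -⟩ | ⟨z, hz, rfl⟩
    · omega
    · exact (hL.name_le (List.mem_map_of_mem (List.mem_append_left _ (List.mem_of_getLast? hz)))).2
  have hvn : v ≤ n := by
    rw [← hvv, hlv, ← head0_map]
    rcases head0_mem (B.map Item.name) with h | h
    · omega
    · refine (hL.name_le ?_).2
      rw [List.map_append, List.map_cons]
      exact List.mem_append_right _ (List.mem_cons_of_mem _ h)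
  have hck : Code.key.len ≤ 100 := by decide
  have hcs : Code.start.len ≤ 100 := by decide
  have hcn : Code.unlink.len ≤ 300 := by decide
  refine Halts.mono (T := 9 + 1 + Code.key.len + (9 + (9 + ((10 + 1 + (9 + 1 + Code.key.len +
      (7 + 1 + (9 + (2 + 1 + (Code.start.len + ((d + 1) * deleteStepTime + 2))))))) +
      Code.unlink.len))))
    (Halts.call_seq (R := fun r mem' => r = κ ∧ mem' = mem) ?_ ?_) ?_ fun _ h => h
  · have h := returns_key hp hL.header (x := it.elem) (by omega)
    rw [hκ] at h
    have e : (Code.ld 7 Code.x).eval b ⟨argRegs [q, it.name], mem⟩ = arr mem q 7 it.name :=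
      eval_ld hp rfl rfl (by omega) hNn
    simp only [Op.args, List.map]
    rw [e, hel]
    exact h
  swap
  · have h := Nat.mul_le_mul_left (d + 1)
      (show deleteStepTime ≤ insertStepTime + deleteStepTime + predStepTime by omega)
    simp only [opTime]
    omega
  rintro r m₀ ⟨hr, hm₀⟩
  rw [hr, hm₀]
  change Halts b _ ⟨update (argRegs [q, it.name]) Code.ky κ, mem⟩ _ _
  refine Halts.run_seq (c₁ := Code.p ::= Code.ld 5 Code.x) (by simp [Cmd.LoopFree])
    (Halts.run_seq (c₁ := Code.nx ::= Code.ld 6 Code.x) (by simp [Cmd.LoopFree]) ?_)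
  have hs : (Code.nx ::= Code.ld 6 Code.x).run b ((Code.p ::= Code.ld 5 Code.x).run b
      ⟨update (argRegs [q, it.name]) Code.ky κ, mem⟩) =
      ⟨update (update (update (argRegs [q, it.name]) Code.ky κ) Code.p p) Code.nx v, mem⟩ := by
    simp only [Cmd.run]
    rw [eval_ld hp (j := it.name) rfl rfl (by omega) hNn, hpp,
      eval_ld hp (j := it.name) rfl rfl (by omega) hNn, hvv]
  rw [hs]
  generalize hw : update (update (update (argRegs [q, it.name]) Code.ky κ) Code.p p) Code.nx v = w
  have hws : w Code.q = q ∧ w Code.x = it.name ∧ w Code.ky = κ ∧ w Code.p = p ∧ w Code.nx = v := by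
    rw [← hw]
    simp only [update_reg, ↓reduceIte, Nat.reduceEqDiff, OfNat.ofNat_ne_zero, OfNat.zero_ne_ofNat,
      OfNat.ofNat_ne_one, OfNat.one_ne_ofNat, one_ne_zero, zero_ne_one]
    exact ⟨rfl, rfl, trivial, trivial, trivial⟩
  obtain ⟨w₁, w₂, w₃, w₄, w₅⟩ := hws
  clear hs hw
  have hkeys : keys (trunc k) (A ++ it :: B) = insert κ (keys (trunc k) (A ++ B)) := by
    rw [keys_insert, hκ]
  have hlast_ne : ∀ y ≠ κ, lastName (trunc k) (A ++ it :: B) y = lastName (trunc k) (A ++ B) y :=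
    fun y hy => lastName_insert_of_ne (by rw [hκ]; exact hy.symm)
  have hfin : ∀ (s : State), (∀ r : Reg, r ≠ Code.u → s.regs r = w r) →
      Holds g (arr s.mem q) d 0 (keys (trunc k) (A ++ B)) →
      (∀ y, arr s.mem q 1 y = lastName (trunc k) (A ++ B) y) →
      (∀ c < 10, c ∉ [1, 2, 3, 4] → ∀ j, arr s.mem q c j = arr mem q c j) →
      (∀ a, a < q → s.mem a = mem a) →
      Halts b Code.unlink s Code.unlink.len (fun s => (∀ a, a < q → s.mem a = mem a) ∧
          ∃ L', Op.Effect (trunc k) (A ++ it :: B) (s.regs ⟨0⟩) L' (.delete it.name) ∧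
            Rep q U n k g d s.mem L') := by
    intro s hr hset hlast hm hbelow
    have hmem := run_unlink hp ((hr _ (by decide)).trans w₁) ((hr _ (by decide)).trans w₂)
      ((hr _ (by decide)).trans w₄) ((hr _ (by decide)).trans w₅) (hm 9 (by omega) (by simp) 0)
      hpn hNn hvn
    refine Halts.of_run loopFree_unlink ⟨fun a ha => ?_, A ++ B, (filter_name_ne hcons.1).symm,
      hL.erase hp.one_le_g hset hlast hm hpp hvv rfl hmem⟩
    rw [hmem, ← hbelow a ha]
    simp (disch := omega) only [update_mem_of_ne]
  have hld : (Code.ld 1 Code.ky).eval b ⟨w, mem⟩ = arr mem q 1 κ := by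
    simp (disch := omega) only [Code.ld, Code.addr, eval_rules, eval_lit, eval_add, eval_mul,
      w₁, w₃]
    rfl
  refine Halts.seq (Halts.mono (Halts.ite (T := (9 + 1 + Code.key.len +
      (7 + 1 + (9 + (2 + 1 + (Code.start.len + ((d + 1) * deleteStepTime + 2)))))))
      (fun h₀ => ?_) fun h₀ => ?_)
      le_rfl fun _ h => h)
  swap
  · -- the entry is not the last one of its key
    have h₁ : lastName (trunc k) (A ++ it :: B) (trunc k it.elem) ≠ it.name := by
      rw [hκ, ← hL.last]
      intro h
      refine absurd h₀ ?_
      simp only [eval_rules]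
      rw [hld, w₂, eval_eq_pos h]
      exact one_ne_zero
    obtain ⟨h₂, h₃⟩ := lastName_erase_of_ne h₁
    rw [hκ] at h₂ h₃
    refine ⟨_, _, .skip _, by omega, hfin _ (fun _ _ => rfl) ?_ (fun y => ?_) (fun _ _ _ _ => rfl)
      fun _ _ => rfl⟩
    · have := hL.set
      rwa [hkeys, Set.insert_eq_of_mem h₃] at this
    · rw [hL.last]
      by_cases hy : y = κ
      · rw [hy, h₂]
      · exact hlast_ne y hy
  have h₁ : lastName (trunc k) (A ++ it :: B) (trunc k it.elem) = it.name := by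
    by_contra h
    rw [hκ, ← hL.last] at h
    simp only [eval_rules] at h₀
    rw [hld, w₂, eval_eq_neg h] at h₀
    exact h₀ rfl
  obtain ⟨h₂, h₃⟩ := lastName_erase_self hcons h₁
  rw [hκ] at h₂ h₃
  have hep : arr mem q 7 p < 2 ^ b := by
    rcases hpA with ⟨rfl, -⟩ | ⟨z, hz, rfl⟩
    · rw [hL.elem_zero]; omega
    · have hzL : z ∈ A ++ it :: B := List.mem_append_left _ (List.mem_of_getLast? hz)
      rw [hL.elem z hzL]
      exact (hL.le z hzL).trans_lt hUb
  refine Halts.call_seq (R := fun r mem' => r = trunc k (arr mem q 7 p) ∧ mem' = mem) ?_ ?_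
  · have h := returns_key hp hL.header hep
    have e : (Code.ld 7 Code.p).eval b ⟨w, mem⟩ = arr mem q 7 p :=
      eval_ld hp w₁ w₄ (by omega) hpn
    have e' : Expr.eval b ⟨w, mem⟩ (.reg Code.q) = q := w₁
    simp only [List.map]
    rw [e, e']
    exact h
  rintro u m₀ ⟨hu', hm₀⟩
  rw [show m₀ = mem from hm₀]
  change Halts b _ ⟨update w Code.u u, mem⟩ _ _
  generalize hw' : update w Code.u u = w'
  have hww : ∀ r : Reg, r ≠ Code.u → w' r = w r := fun r hr => by
    rw [← hw']; exact update_of_ne hr _ _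
  have hwu : w' Code.u = u := by rw [← hw']; exact update_self _ _ _
  have v₁ := (hww Code.q (by decide)).trans w₁
  have v₃ := (hww Code.ky (by decide)).trans w₃
  have v₄ := (hww Code.p (by decide)).trans w₄
  have hcond : Expr.eval b ⟨w', mem⟩ (.bin .lt 0 (.reg Code.p) *
      .bin .eq (.reg Code.u) (.reg Code.ky)) = if 0 < p ∧ u = κ then 1 else 0 := by
    simp (disch := omega) only [eval_rules, eval_lit, v₃, v₄, hwu]
    rcases Nat.eq_zero_or_pos p with h | h
    · rw [eval_lt_neg h.le, eval_mul (by simp), zero_mul, if_neg (by omega)]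
    · rw [eval_lt_pos h]
      by_cases h' : u = κ
      · rw [eval_eq_pos h', eval_mul (by omega), if_pos ⟨h, h'⟩]
      · rw [eval_eq_neg h', eval_mul (by simp), if_neg (by omega)]
  have hst : ∀ e j, Expr.eval b ⟨w', mem⟩ e = j → (Code.st 1 Code.ky e).run b ⟨w', mem⟩ =
      ⟨w', update mem (q + (16 * κ + 1)) j⟩ := by
    rintro e j rfl
    simp (disch := omega) only [Code.st, Code.addr, Cmd.run, eval_rules, eval_lit, eval_add,
      eval_mul, v₁, v₃]
  refine Halts.ite (fun h₄ => ?_) fun h₄ => ?_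
  · rw [hcond] at h₄
    obtain ⟨hp0, huκ⟩ : 0 < p ∧ u = κ := by by_contra h; exact h₄ (if_neg h)
    rcases hpA with ⟨h, -⟩ | ⟨z, hz, hzp⟩
    · omega
    have hzL : z ∈ A ++ it :: B := List.mem_append_left _ (List.mem_of_getLast? hz)
    obtain ⟨h₅, h₆⟩ := h₂ z hz (by rw [← huκ, hu', ← hzp, hL.elem z hzL])
    refine (Halts.of_run (by simp [Code.st, Cmd.LoopFree]) ?_).mono
      (T := Cmd.len (Code.st 1 Code.ky Code.p)) ?_ fun _ h => h
    · rw [hst (.reg Code.p) p v₄]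
      refine hfin _ hww ?_ (fun y => ?_) (fun c hc hc' j => ?_) fun a ha => update_of_ne (by omega) _ _
      · have := hL.set
        rw [hkeys, Set.insert_eq_of_mem h₆] at this
        refine this.congr hp.one_le_g fun c hc j _ _ => ?_
        simp only [List.mem_cons, List.not_mem_nil, or_false] at hc
        simp (disch := omega) only [arr_update]
        exact if_neg (by omega)
      · simp (disch := omega) only [arr_update]
        by_cases hy : y = κ
        · rw [if_pos (by simpa using hy), hy, h₅, hzp]
        · rw [if_neg (by tauto), hL.last, hlast_ne y hy]
      · simp only [List.mem_cons, List.not_mem_nil, or_false] at hc'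
        simp (disch := omega) only [arr_update]
        exact if_neg (by omega)
    · have : Cmd.len (Code.st 1 Code.ky Code.p) = 9 := by decide
      omega
  · rw [hcond] at h₄
    have h₄' : ¬ (0 < p ∧ u = κ) := by intro h; rw [if_pos h] at h₄; omega
    obtain ⟨h₅, h₆⟩ := h₃ fun z hz hzκ => h₄' <| by
      have hzL : z ∈ A ++ it :: B := List.mem_append_left _ (List.mem_of_getLast? hz)
      rcases hpA with ⟨-, rfl⟩ | ⟨z', hz', hzp⟩
      · simp at hz
      · obtain rfl : z' = z := Option.some.inj (hz'.symm.trans hz)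
        rw [hu', ← hzp, hL.elem z' hzL]
        exact ⟨Nat.pos_of_ne_zero (hcons.2.1 z' hzL), hzκ⟩
    refine (Halts.run_seq (T := 2 + 1 + (Code.start.len + ((d + 1) * deleteStepTime + 2)))
      (by simp [Code.st, Cmd.LoopFree]) ?_).mono (T := Cmd.len (Code.st 1 Code.ky 0) + _) ?_
      fun _ h => h
    · rw [hst 0 0 (eval_lit (c := 0) (by omega))]
      have hset : Holds g (arr (update mem (q + (16 * κ + 1)) 0) q) d 0
          (keys (trunc k) (A ++ it :: B)) := by
        refine hL.set.congr hp.one_le_g fun c hc j _ _ => ?_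
        simp only [List.mem_cons, List.not_mem_nil, or_false] at hc
        simp (disch := omega) only [arr_update]
        exact if_neg (by omega)
      have hhead : Header k g d (arr (update mem (q + (16 * κ + 1)) 0) q) := by
        have := hL.header
        rw [Header] at this ⊢
        simp (disch := omega) only [arr_update]
        exact this
      have h₇ := returns_setDelete hp hhead hset (y := κ) (by rw [hkeys]; exact Set.mem_insert _ _)
        (hL.key_lt hp)
      refine Halts.call (R := fun _ mem' =>
        Holds g (arr mem' q) d 0 (keys (trunc k) (A ++ it :: B) \ {κ}) ∧
          Unchanged q [2, 3, 4] 0 (univ g (d + 1)) (update mem (q + (16 * κ + 1)) 0) mem') ?_ ?_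
      · have e₁ : Expr.eval b ⟨w', update mem (q + (16 * κ + 1)) 0⟩ (.reg Code.q) = q := v₁
        have e₂ : Expr.eval b ⟨w', update mem (q + (16 * κ + 1)) 0⟩ (.reg Code.ky) = κ := v₃
        simp only [List.map]
        rw [e₁, e₂]
        exact h₇
      rintro r m₂ ⟨hset₂, hU⟩
      rw [hkeys, Set.insert_sdiff_of_mem _ (Set.mem_singleton κ), Set.sdiff_singleton_eq_self h₆]
        at hset₂
      have harr : ∀ c < 16, c ∉ [2, 3, 4] → ∀ j, arr m₂ q c j =
          arr (update mem (q + (16 * κ + 1)) 0) q c j := fun c hc hc' j =>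
        hU.arr_of_notMem (by simp) hc hc' j
      refine hfin _ (fun r hr => (update_of_ne hr _ _).trans (hww r hr)) hset₂ (fun y => ?_)
        (fun c hc hc' j => ?_) fun a ha => (hU.of_lt ha).trans (update_of_ne (by omega) _ _)
      · rw [harr 1 (by omega) (by simp)]
        simp (disch := omega) only [arr_update]
        by_cases hy : y = κ
        · rw [if_pos (by simpa using hy), hy, h₅]
        · rw [if_neg (by tauto), hL.last, hlast_ne y hy]
      · simp only [List.mem_cons, List.not_mem_nil, or_false] at hc'
        rw [harr c (by omega) (by simp; omega)]
        simp (disch := omega) only [arr_update]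
        exact if_neg (by omega)
    · have : Cmd.len (Code.st 1 Code.ky 0) = 9 := by decide
      omega

end

/-! ### Instantiation -/

/-- The precision of the keys for the error `i + j / 2 ^ b`. With an error of at least `1`, the
exponents suffice. If `j = 0`, then the error is below `2 ^ (-b)` and nothing is truncated. -/
def precision (b i j : ℕ) : ℕ := if i = 0 then b - Nat.log 2 j else 0

theorem rep_nil {q U n k g d : ℕ} {mem : ℕ → ℕ} (h : Header k g d (arr mem q))
    (h0 : ∀ c < 10, c ≠ 0 → ∀ j, arr mem q c j = 0) (h3 : arr mem q 0 3 = 0) :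
    Rep q U n k g d mem [] := by
  have hk : keys (trunc k) [] = ∅ := by simp [keys]
  refine ⟨h, ⟨by simp, by simp, by simp⟩, by simp, ?_, fun x => ?_, ?_, by simp, ?_, by simp, ?_⟩
  · rw [hk]
    refine holds_empty (fun c hc j => ?_) d 0
    simp only [List.mem_cons, List.not_mem_nil, or_false] at hc
    exact h0 c (by omega) (by omega) j
  · rw [h0 1 (by omega) (by omega)]; rfl
  · simp [Links, h0]
  · exact h0 7 (by omega) (by omega) 0
  · refine ⟨[], ?_, by simp, by simp, by simpa using h3.symm, by omega⟩
    simp [FreeList, h0]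

theorem halts_double {b g B d : ℕ} (hb : 64 < 2 ^ b) (hBb : 2 * B < 2 ^ b) {s : State}
    (hbits : s.regs Code.bits = g) (hh : s.regs Code.h = B) (hB : B ≤ g * 2 ^ d)
    (hd : ∀ d' < d, g * 2 ^ d' < B) :
    Halts b (.while (.bin .lt (.reg Code.bits) (.reg Code.h))
      (Code.bits ::= 2 * (.reg Code.bits))) s (8 * d + 4)
      (fun s' => s'.regs Code.bits = g * 2 ^ d ∧ (∀ r : Reg, r ≠ Code.bits → s'.regs r = s.regs r) ∧
        s'.mem = s.mem) := by
  induction d generalizing g s with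
  | zero =>
    rw [pow_zero, mul_one] at *
    exact .while_false (by simp only [eval_rules, hbits, hh]; exact eval_lt_neg hB)
      ⟨hbits, fun _ _ => rfl, rfl⟩
  | succ d ih =>
    have h₀ := hd 0 (by omega)
    rw [pow_zero, mul_one] at h₀
    have hrun : (Code.bits ::= 2 * (.reg Code.bits)).run b s =
        ⟨update s.regs Code.bits (g * 2), s.mem⟩ := by
      simp (disch := omega) only [Cmd.run, eval_rules, eval_lit, eval_mul, hbits]
      rw [mul_comm]
    refine (Halts.while_run (T := 8 * d + 4) (by
      simp only [eval_rules, hbits, hh]; rw [eval_lt_pos h₀]; exact one_ne_zero)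
      (by simp [Cmd.LoopFree]) ?_).mono ?_ fun _ h => h
    · rw [hrun]
      refine (ih (g := g * 2) (s := ⟨update s.regs Code.bits (g * 2), s.mem⟩)
        (by exact update_self Code.bits (g * 2) s.regs)
        (by rw [← hh]; exact update_of_ne (a := Code.h) (a' := Code.bits) (by decide) (g * 2) s.regs) ?_ fun d' hd' => ?_).mono le_rfl ?_
      · rwa [mul_assoc, ← pow_succ']
      · have := hd (d' + 1) (by omega)
        rwa [mul_assoc, ← pow_succ']
      · rintro s' ⟨h₁, h₂, h₃⟩
        refine ⟨by rw [h₁, mul_assoc, ← pow_succ'], fun r hr => ?_, h₃⟩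
        rw [h₂ r hr]; exact update_of_ne hr _ _
    · have : (Code.bits ::= 2 * (Expr.reg Code.bits)).len = 4 := by decide
      rw [this]; simp only [Expr.cost]; omega

theorem returns_new {b q U n k g d i j B : ℕ} (hp : Params b q U n k g d) {mem : ℕ → ℕ}
    (hg : Nat.log 2 b = g) (hk : precision b i j = k) (hj : j < 2 ^ b)
    (hBU : Nat.log 2 (trunc k U) + 1 = B) (hB : B ≤ g * 2 ^ d) (hd : ∀ d' < d, g * 2 ^ d' < B)
    (h0 : ∀ a, q ≤ a → mem a = 0) :
    Returns b Code.new [q, U, i, j] mem (opTime d) (fun _ mem' =>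
      (∀ a, a < q → mem' a = mem a) ∧ Rep q U n k g d mem' []) := by
  have hb := hp.lt_two_pow
  have hh := hp.head
  have hU := hp.elems
  have hbb : 6 < b := (Nat.pow_lt_pow_iff_right (by norm_num : 1 < 2)).1 (by simpa using hb)
  have hb4 : 4 * b < 2 ^ b := by
    clear * - hbb
    induction b, hbb using Nat.le_induction with
    | base => norm_num
    | succ b h ih => rw [pow_succ]; omega
  have hlj : Nat.log 2 j < b := by
    rcases Nat.eq_zero_or_pos j with rfl | h
    · simp; omega
    · exact (Nat.log_lt_iff_lt_pow (by norm_num) h.ne').2 hj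
  have hlU : Nat.log 2 (trunc k U) < b := by
    rcases Nat.eq_zero_or_pos (trunc k U) with h | h
    · simp [h]; omega
    · exact (Nat.log_lt_iff_lt_pow (by norm_num) h.ne').2 ((trunc_le k U).trans_lt hU)
  have hlog : Nat.log 2 (2 ^ b - 1) = b - 1 := by
    refine (Nat.log_eq_iff (.inr ⟨by norm_num, by omega⟩)).2 ⟨?_, ?_⟩
    · have : 2 ^ b = 2 * 2 ^ (b - 1) := by rw [← pow_succ']; congr 1; omega
      have := Nat.two_pow_pos (b - 1)
      omega
    · rw [show b - 1 + 1 = b by omega]; omega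
  have hsub : BinOp.eval b .sub 0 1 = 2 ^ b - 1 := by
    rw [BinOp.eval, zero_add, Nat.mod_eq_of_lt (by omega)]
  have hb1 : b - 1 + 1 = b := by omega
  have hck : Code.key.len ≤ 100 := by decide
  have hci : 8 ≤ insertStepTime := by decide
  have l₁ : (Code.z ::= Expr.msb (0 - 1) + 1).len = 7 := by decide
  have l₂ : (Code.leaf ::= Expr.msb (Expr.reg Code.z)).len = 3 := by decide
  have l₃ : (Cmd.ite (Expr.reg Code.i) (Code.e ::= 0)
    (Code.e ::= Expr.reg Code.z - Expr.msb (Expr.reg Code.bits))).len = 9 := by decide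
  have l₄ : (Code.st 0 0 (Expr.reg Code.e)).len = 9 := by decide
  have l₅ : (Code.h ::= Expr.msb (Expr.reg Code.y) + 1).len = 5 := by decide
  have l₆ : (Code.bits ::= Expr.reg Code.leaf).len = 2 := by decide
  have l₇ : (Cmd.seq (Code.st 0 1 (Expr.reg Code.bits)) (Code.st 0 2 (Expr.reg Code.leaf))).len = 18 :=
    by decide
  refine Halts.mono (T := (Code.z ::= Expr.msb (0 - 1) + 1).len +
    ((Code.leaf ::= Expr.msb (Expr.reg Code.z)).len + ((Cmd.ite (Expr.reg Code.i) (Code.e ::= 0)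
      (Code.e ::= Expr.reg Code.z - Expr.msb (Expr.reg Code.bits))).len +
    ((Code.st 0 0 (Expr.reg Code.e)).len + (2 + 1 + Code.key.len +
    ((Code.h ::= Expr.msb (Expr.reg Code.y) + 1).len + ((Code.bits ::= Expr.reg Code.leaf).len +
    (8 * d + 4 + (Cmd.seq (Code.st 0 1 (Expr.reg Code.bits))
      (Code.st 0 2 (Expr.reg Code.leaf))).len))))))))
    ?_ ?_ fun _ h => h
  swap
  · have h := Nat.mul_le_mul_left (d + 1)
      (show 8 ≤ insertStepTime + deleteStepTime + predStepTime by omega)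
    simp only [opTime]
    omega
  unfold Code.new
  refine Halts.run_seq (by simp [Cmd.LoopFree]) (Halts.run_seq (by simp [Cmd.LoopFree])
    (Halts.run_seq (by simp [Cmd.LoopFree]) (Halts.run_seq (by simp [Cmd.LoopFree, Code.st]) ?_)))
  generalize hs₁ : (Code.st 0 0 (Expr.reg Code.e)).run b _ = s₁
  have hs : s₁.regs Code.q = q ∧ s₁.regs Code.y = U ∧ s₁.regs Code.leaf = g ∧
      s₁.mem = update mem (q + (16 * 0 + 0)) k := by
    rw [← hs₁, ← hk, precision]
    have a₁ : argRegs [q, U, i, j] Code.q = q := rfl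
    have a₂ : argRegs [q, U, i, j] Code.y = U := rfl
    have a₃ : argRegs [q, U, i, j] Code.i = i := rfl
    have a₄ : argRegs [q, U, i, j] Code.bits = j := rfl
    generalize argRegs [q, U, i, j] = w at *
    by_cases hi : i = 0
    all_goals
      simp (disch := omega) only [Code.st, Code.ld, Code.addr, Cmd.run,
        eval_rules, eval_binOp_rules, eval_lit, hsub, hlog, hb1, eval_add, eval_sub, eval_mul,
        update_reg, update_self, ↓reduceIte, Nat.reduceEqDiff, OfNat.ofNat_ne_zero,
        OfNat.zero_ne_ofNat, OfNat.ofNat_ne_one, OfNat.one_ne_ofNat, one_ne_zero, zero_ne_one, and_self,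
        a₁, a₂, a₃, a₄, hi, hg]
  obtain ⟨k₁, k₂, k₃, k₄⟩ := hs
  have h00 : ∀ m : ℕ → ℕ, (∀ a, q ≤ a → m a = 0) → ∀ c j, arr m q c j = 0 :=
    fun m h c j => h _ (Nat.le_add_right _ _)
  have hkey : Returns b Code.key [q, U] s₁.mem Code.key.len
      (fun r mem' => r = trunc k U ∧ mem' = s₁.mem) := by
    refine Halts.of_run loopFree_key (run_key (q := q) (s := ⟨argRegs [q, U], s₁.mem⟩) hb rfl rfl hU
      (by omega) ?_)
    simp only [k₄]
    exact update_self _ _ _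
  refine Halts.call_seq (R := fun r mem' => r = trunc k U ∧ mem' = s₁.mem) ?_ ?_
  · simp only [List.map, eval_rules, k₁, k₂]; exact hkey
  rintro r m₀ ⟨hr, hm₀⟩
  rw [hr, hm₀]
  refine Halts.run_seq (by simp [Cmd.LoopFree]) (Halts.run_seq (by simp [Cmd.LoopFree]) ?_)
  generalize hs₂ : (Code.bits ::= Expr.reg Code.leaf).run b _ = s₂
  have hs : s₂.regs Code.q = q ∧ s₂.regs Code.leaf = g ∧ s₂.regs Code.bits = g ∧
      s₂.regs Code.h = B ∧ s₂.mem = s₁.mem := by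
    rw [← hs₂]
    simp (disch := omega) only [Cmd.run, eval_rules, eval_lit, eval_add, update_reg, update_self,
      ↓reduceIte, Nat.reduceEqDiff, OfNat.ofNat_ne_zero, OfNat.zero_ne_ofNat, OfNat.ofNat_ne_one,
      OfNat.one_ne_ofNat, one_ne_zero, zero_ne_one, and_self, k₁, k₃, hBU]
  obtain ⟨m₁, m₂, m₃, m₄, m₅⟩ := hs
  refine Halts.seq ((halts_double hb (by omega) m₃ m₄ hB hd).mono le_rfl ?_)
  rintro s₃ ⟨n₁, n₂, n₃⟩
  refine Halts.of_run (by simp [Cmd.LoopFree, Code.st]) ?_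
  have hmem : (Cmd.seq (Code.st 0 1 (Expr.reg Code.bits)) (Code.st 0 2 (Expr.reg Code.leaf))).run b s₃ =
      ⟨s₃.regs, update (update (update mem (q + (16 * 0 + 0)) k) (q + (16 * 1 + 0)) (g * 2 ^ d))
        (q + (16 * 2 + 0)) g⟩ := by
    have o₁ := (n₂ Code.q (by decide)).trans m₁
    have o₂ := (n₂ Code.leaf (by decide)).trans m₂
    simp (disch := omega) only [Code.st, Code.addr, Cmd.run, eval_rules, eval_lit, eval_add,
      eval_mul, o₁, o₂, n₁, n₃, m₅, k₄]
  rw [hmem]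
  refine ⟨fun a ha => ?_, rep_nil ⟨?_, ?_, ?_⟩ (fun c hc hc0 j => ?_) ?_⟩
  · simp (disch := omega) only [update_mem_of_ne]
  all_goals
    simp (disch := omega) only [arr_update]
    simp [h00 mem h0, *]

/-! ### The precision of the keys -/

/-- Keys separate elements that are represented without truncation, and elements that differ by
a factor `1 + ε` if `1 ≤ ε * 2 ^ k`. -/
theorem trunc_lt_trunc {k x y : ℕ} {ε : ℝ} (hxy : x < y)
    (h : Nat.log 2 y ≤ k ∨ (1 ≤ ε * 2 ^ k ∧ (1 + ε) * (x : ℝ) ≤ y)) : trunc k x < trunc k y := by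
  have h₁ : Nat.log 2 x - k ≤ Nat.log 2 y - k := Nat.sub_le_sub_right (Nat.log_mono_right hxy.le) k
  rcases h₁.eq_or_lt with h₁ | h₁
  swap
  · exact trunc_lt_of_log_lt h₁
  obtain ⟨s, hs⟩ : ∃ s, Nat.log 2 x - k = s := ⟨_, rfl⟩
  unfold trunc
  rw [← h₁, hs]
  refine Nat.add_lt_add_right ?_ _
  rcases Nat.eq_zero_or_pos s with rfl | hs0
  · simpa using hxy
  rcases h with h | ⟨h, h'⟩
  · omega
  have hx : x ≠ 0 := by rintro rfl; simp at hs; omega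
  have h₂ : 2 ^ Nat.log 2 x ≤ x := Nat.pow_log_le_self 2 hx
  rw [show Nat.log 2 x = k + s by omega, pow_add] at h₂
  have h₃ : x + 2 ^ s ≤ y := by
    have h₄ : (2 : ℝ) ^ k * 2 ^ s ≤ x := by exact_mod_cast h₂
    have h₅ : (1 : ℝ) * 2 ^ s ≤ ε * 2 ^ k * 2 ^ s := by gcongr
    have h₆ : (x : ℝ) + 2 ^ s ≤ y := by
      have hε : 0 ≤ ε := by
        by_contra hε
        have : (0 : ℝ) < 2 ^ k := by positivity
        nlinarith
      nlinarith
    exact_mod_cast h₆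
  calc x / 2 ^ s < (x + 2 ^ s) / 2 ^ s := by
        rw [Nat.add_div_right _ (Nat.two_pow_pos s)]; omega
    _ ≤ y / 2 ^ s := Nat.div_le_div_right h₃

/-- The two words that represent `ε` determine a precision that is fine enough, and no finer than
necessary up to a constant factor. -/
theorem precision_spec {b : ℕ} {ε : ℝ} (hε : 0 < ε) (hb : b ≠ 0) :
    (b ≤ precision b (intWord b ε) (fracWord b ε) ∨
      1 ≤ ε * 2 ^ precision b (intWord b ε) (fracWord b ε)) ∧
    (2 : ℝ) ^ precision b (intWord b ε) (fracWord b ε) ≤ 1 + 2 / ε := by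
  have hε2 : 0 < 2 / ε := by positivity
  unfold precision
  split_ifs with h
  · have h1 : ε < 1 := by
      rw [intWord, min_eq_iff] at h
      have : 2 ^ 1 ≤ 2 ^ b := Nat.pow_le_pow_right (by norm_num) (by omega)
      rcases h with ⟨h, -⟩ | ⟨h, -⟩
      · exact Nat.floor_eq_zero.1 h
      · omega
    have hf : fracWord b ε = ⌊ε * 2 ^ b⌋₊ := by
      rw [fracWord, Int.fract_eq_self.2 ⟨hε.le, h1⟩]
    have hpos : 0 ≤ ε * 2 ^ b := by positivity
    have hlt := Nat.lt_floor_add_one (ε * 2 ^ b)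
    have hle := Nat.floor_le hpos
    rw [← hf] at hlt hle
    have h2b : (0 : ℝ) < 2 ^ b := by positivity
    generalize fracWord b ε = j at *
    rcases Nat.eq_zero_or_pos j with rfl | hj
    · refine ⟨.inl (by simp), ?_⟩
      simp only [Nat.cast_zero, zero_add, Nat.log_zero_right, Nat.sub_zero] at *
      have : (2 : ℝ) ^ b ≤ 1 / ε := by rw [le_div_iff₀ hε]; linarith
      have : 2 / ε = 1 / ε + 1 / ε := by ring
      have : 0 < 1 / ε := by positivity
      linarith
    · have hjb : j < 2 ^ b := by
        have : (j : ℝ) < 2 ^ b := by nlinarith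
        exact_mod_cast this
      have hl : Nat.log 2 j < b := (Nat.log_lt_iff_lt_pow (by norm_num) hj.ne').2 hjb
      have h₁ : (2 : ℝ) ^ Nat.log 2 j ≤ j := by exact_mod_cast Nat.pow_log_le_self 2 hj.ne'
      have h₂ : (j : ℝ) + 1 ≤ 2 ^ (Nat.log 2 j + 1) := by
        exact_mod_cast Nat.lt_pow_succ_log_self (by norm_num) j
      have h₃ : (2 : ℝ) ^ (b - Nat.log 2 j) * 2 ^ Nat.log 2 j = 2 ^ b := by
        rw [← pow_add]; congr 1; omega
      have h₄ : (0 : ℝ) < 2 ^ Nat.log 2 j := by positivity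
      rw [pow_succ] at h₂
      generalize (2 : ℝ) ^ (b - Nat.log 2 j) = K at *
      generalize (2 : ℝ) ^ Nat.log 2 j = J at *
      rw [← h₃] at hle hlt
      constructor
      · right
        by_contra hK
        push Not at hK
        nlinarith
      · have : K ≤ 2 / ε := by
          rw [le_div_iff₀ hε]
          by_contra hK
          push Not at hK
          nlinarith
        linarith
  · refine ⟨.inr ?_, by rw [pow_zero]; linarith⟩
    rw [pow_zero, mul_one]
    by_contra h1
    exact h (by rw [intWord, Nat.floor_eq_zero.2 (by linarith)]; simp)

theorem preservesOrder_trunc {b U : ℕ} {ε : ℝ} (hε : 0 < ε) (hU : U < 2 ^ b) :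
    PreservesOrder (trunc (precision b (intWord b ε) (fracWord b ε))) U ε := by
  refine ⟨fun x y hxy _ => trunc_mono hxy, fun x y hxy hy h => ?_⟩
  have hb : b ≠ 0 := by rintro rfl; simp at hU; omega
  refine trunc_lt_trunc hxy ((precision_spec hε hb).1.imp (fun h' => ?_) fun h' => ⟨h', h⟩)
  exact ((Nat.log_lt_iff_lt_pow (by norm_num) (by omega)).2 (hy.trans_lt hU)).le.trans h'

theorem trunc_le_mul {k U : ℕ} : trunc k U ≤ (2 + Nat.log 2 U) * 2 ^ k := by
  unfold trunc
  have h₁ : U < 2 ^ (Nat.log 2 U + 1) := Nat.lt_pow_succ_log_self (by norm_num) U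
  generalize Nat.log 2 U = l at *
  have h₃ : U / 2 ^ (l - k) < 2 ^ (k + 1) := by
    refine Nat.div_lt_of_lt_mul (h₁.trans_le ?_)
    rw [← pow_add]
    exact Nat.pow_le_pow_right (by norm_num) (by omega)
  have h₄ : (l - k) * 2 ^ k ≤ l * 2 ^ k := Nat.mul_le_mul_right _ (Nat.sub_le _ _)
  rw [pow_succ] at h₃
  rw [Nat.add_mul]
  omega

/-! ### The height of the tree of keys -/

theorem log_two_le_vebTime {b U : ℕ} {ε : ℝ} (hε : 0 < ε) : Real.log 2 ≤ vebTime b U ε := by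
  unfold vebTime
  refine Real.log_le_log (by norm_num) ?_
  have h₁ : 0 ≤ Real.log (2 + Real.log (2 + U) / ε) := by
    refine Real.log_nonneg ?_
    have : 0 ≤ Real.log (2 + U) := Real.log_nonneg (by linarith [Nat.cast_nonneg (α := ℝ) U])
    have : 0 ≤ Real.log (2 + U) / ε := by positivity
    linarith
  have h₂ : 0 ≤ Real.log (2 + b) := Real.log_nonneg (by linarith [Nat.cast_nonneg (α := ℝ) b])
  have : 0 ≤ Real.log (2 + Real.log (2 + U) / ε) / Real.log (2 + b) := by positivity
  linarith

/-- The tree of keys has `O(log log_b (log U / ε))` levels. -/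
theorem height_le {b U g d k : ℕ} {ε : ℝ} (hε : 0 < ε) (hb : 2 ≤ b) (hU : U < 2 ^ b)
    (hg : Nat.log 2 b = g) (hk : (2 : ℝ) ^ k ≤ 1 + 2 / ε)
    (hd : ∀ d' < d, g * 2 ^ d' < Nat.log 2 (trunc k U) + 1) :
    (d + 1 : ℝ) ≤ 14 * vebTime b U ε := by
  have hV := log_two_le_vebTime (b := b) (U := U) hε
  have hlog2 := Real.log_two_gt_d9
  have hlog2' := Real.log_two_lt_d9
  have hg1 : 1 ≤ g := by rw [← hg]; exact Nat.log_pos (by norm_num) hb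
  rcases d with - | d
  · push_cast; linarith
  have h₁ : (2 : ℝ) ^ (g * 2 ^ d) ≤ (2 + b) * (1 + 2 / ε) := by
    have h₁ := hd d (by omega)
    have h₂ : trunc k U ≠ 0 := by
      intro h
      rw [h] at h₁
      have := Nat.mul_pos hg1 (Nat.two_pow_pos d)
      simp at h₁
      omega
    have h₃ : 2 ^ (g * 2 ^ d) ≤ trunc k U :=
      (Nat.pow_le_pow_right (by norm_num) (by omega)).trans (Nat.pow_log_le_self 2 h₂)
    have h₄ : 2 ^ (g * 2 ^ d) ≤ (2 + b) * 2 ^ k := by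
      refine h₃.trans (trunc_le_mul.trans (Nat.mul_le_mul_right _ ?_))
      have : Nat.log 2 U ≤ b := by
        rw [← Nat.log_pow (b := 2) (by norm_num) b]
        exact Nat.log_mono_right hU.le
      omega
    have h₅ : (2 : ℝ) ^ (g * 2 ^ d) ≤ (2 + b) * 2 ^ k := by exact_mod_cast h₄
    exact h₅.trans (by gcongr)
  have hLU : (1 / 2 : ℝ) ≤ Real.log (2 + U) := by
    have : Real.log 2 ≤ Real.log (2 + U) :=
      Real.log_le_log (by norm_num) (by linarith [Nat.cast_nonneg (α := ℝ) U])
    linarith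
  unfold vebTime at hV ⊢
  obtain ⟨Y, hY⟩ : ∃ Y, 2 + Real.log (2 + U) / ε = Y := ⟨_, rfl⟩
  have hY' : 2 + 1 / 2 / ε ≤ Y := by rw [← hY]; gcongr
  have hY1 : 1 + 2 / ε ≤ Y ^ 4 := by
    have h0 : 0 < 1 / 2 / ε := by positivity
    have e : 2 / ε = 4 * (1 / 2 / ε) := by field_simp; norm_num
    rw [e]
    have hY2 : 2 ≤ Y := by linarith
    have : Y ^ 4 = Y ^ 3 * Y := by ring
    have : 8 ≤ Y ^ 3 := by nlinarith [mul_nonneg (sub_nonneg.2 hY2) (sub_nonneg.2 hY2)]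
    nlinarith
  have hY0 : 0 < Y := by
    have : 0 < 1 / 2 / ε := by positivity
    linarith
  obtain ⟨W, hW⟩ : ∃ W, Real.log (2 + b) = W := ⟨_, rfl⟩
  have hb0 : (0 : ℝ) ≤ b := Nat.cast_nonneg _
  have h₂ : (g * 2 ^ d : ℝ) * Real.log 2 ≤ W + 4 * Real.log Y := by
    have h := Real.log_le_log (by positivity) (h₁.trans (mul_le_mul_of_nonneg_left hY1 (by positivity)))
    rw [Real.log_pow, Real.log_mul (by positivity) (by positivity), Real.log_pow, hW] at h
    push_cast at h
    linarith
  have hWg : W ≤ 3 * g * Real.log 2 := by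
    have h := Nat.lt_pow_succ_log_self (b := 2) (by norm_num) b
    rw [hg] at h
    have h' : 2 + b ≤ 2 ^ (3 * g) := by
      have h₁ : 2 ^ (g + 1) ≤ 2 ^ (2 * g) := Nat.pow_le_pow_right (by norm_num) (by omega)
      have h₂ : 2 ^ (3 * g) = 2 ^ (2 * g) * 2 ^ g := by rw [← pow_add]; congr 1; omega
      have h₃ : 2 ^ 1 ≤ 2 ^ g := Nat.pow_le_pow_right (by norm_num) hg1
      have h₄ := Nat.mul_le_mul_left (2 ^ (2 * g)) h₃
      rw [Nat.succ_eq_add_one] at h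
      omega
    have h'' : (2 + b : ℝ) ≤ 2 ^ (3 * g) := by exact_mod_cast h'
    have := Real.log_le_log (by positivity) h''
    rw [Real.log_pow, hW] at this
    push_cast at this
    linarith
  have hW0 : 0 < W := by rw [← hW]; exact Real.log_pos (by linarith)
  have hlY : 0 ≤ Real.log Y := by
    refine Real.log_nonneg ?_
    have : 0 < 1 / 2 / ε := by positivity
    linarith
  rw [hY, hW] at hV ⊢
  obtain ⟨X, hX⟩ : ∃ X, Real.log Y / W = X := ⟨_, rfl⟩
  have hX0 : 0 ≤ X := by rw [← hX]; positivity
  have hXW : Real.log Y = X * W := by rw [← hX]; field_simp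
  rw [hX] at hV ⊢
  have h₃ : (2 : ℝ) ^ d ≤ 12 * (2 + X) := by
    rw [hXW] at h₂
    have h : 2 ^ d * W ≤ (2 : ℝ) ^ d * (3 * g * Real.log 2) := by gcongr
    have h' : (2 : ℝ) ^ d * W ≤ 12 * (2 + X) * W := by nlinarith
    exact le_of_mul_le_mul_right h' hW0
  have h₄ : (2 : ℝ) ^ d ≤ 2 ^ 4 * (2 + X) := h₃.trans (by nlinarith)
  have h₅ := Real.log_le_log (by positivity) h₄
  rw [Real.log_pow, Real.log_mul (by norm_num) (by positivity), Real.log_pow] at h₅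
  push_cast at h₅ ⊢
  have hd0 : (0 : ℝ) ≤ d := Nat.cast_nonneg _
  nlinarith

/-! ### The approximate van Emde Boas structure -/

theorem two_mul_log_add_le {b : ℕ} (hb : 20 ≤ b) : 2 * Nat.log 2 b + 5 ≤ b := by
  have h : 2 ^ Nat.log 2 b ≤ b := Nat.pow_log_le_self 2 (by omega)
  generalize Nat.log 2 b = g at *
  rcases Nat.lt_or_ge g 8 with hg | hg
  · interval_cases g <;> omega
  · have : 2 * g + 5 ≤ 2 ^ g := by
      induction g, hg using Nat.le_induction with
      | base => norm_num
      | succ g hg ih =>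
        rw [pow_succ] at h ⊢
        have := ih (by omega)
        omega
    omega

/-- The parameters of the structure, on words with sufficiently many bits. If the root is a
leaf, then the tree of keys takes `O(b ^ 2)` cells; otherwise, `univ g d` is at most `U ^ 2`, and the
tree takes `O(U ^ 4)` cells. -/
theorem exists_params {b U n q k : ℕ} (h : (n + U + 2) ^ 20 ≤ 2 ^ b) (hq : 2 * q ≤ 2 ^ b) :
    ∃ d, Params b q U n k (Nat.log 2 b) d ∧
      Nat.log 2 (trunc k U) + 1 ≤ Nat.log 2 b * 2 ^ d ∧
      ∀ d' < d, Nat.log 2 b * 2 ^ d' < Nat.log 2 (trunc k U) + 1 := by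
  have h2 : 2 ^ 20 ≤ 2 ^ b := le_trans (Nat.pow_le_pow_left (by omega) 20) h
  have hb : 20 ≤ b := (Nat.pow_le_pow_iff_right (by norm_num : 1 < 2)).1 h2
  have hg : 1 ≤ Nat.log 2 b := Nat.log_pos (by norm_num) (by omega)
  have hself : ∀ x : ℕ, 1 ≤ x → x ≤ x ^ 20 := fun x hx => Nat.le_self_pow (by norm_num) x
  have hU : U < 2 ^ b := lt_of_lt_of_le (by omega) ((hself (n + U + 2) (by omega)).trans h)
  have hn : 32 * (n + 1) ≤ 2 ^ b := by
    refine le_trans ?_ h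
    have h₁ : 2 ^ 19 ≤ (n + U + 2) ^ 19 := Nat.pow_le_pow_left (by omega) 19
    rw [pow_succ]
    calc 32 * (n + 1) ≤ 2 ^ 19 * (n + U + 2) := by omega
      _ ≤ _ := Nat.mul_le_mul_right _ h₁
  have hL : 20 * Nat.log 2 (U + 2) ≤ b := by
    have h₁ : 2 ^ (20 * Nat.log 2 (U + 2)) ≤ 2 ^ b := by
      rw [mul_comm, pow_mul]
      exact (Nat.pow_le_pow_left ((Nat.pow_log_le_self 2 (by omega)).trans
        (by omega : U + 2 ≤ n + U + 2)) 20).trans h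
    exact (Nat.pow_le_pow_iff_right (by norm_num : 1 < 2)).1 h₁
  have hB : Nat.log 2 (trunc k U) ≤ Nat.log 2 (U + 2) :=
    Nat.log_mono_right ((trunc_le k U).trans (by omega))
  have hlt : trunc k U < 2 ^ (Nat.log 2 (trunc k U) + 1) :=
    Nat.lt_pow_succ_log_self (by norm_num) _
  have h1 : 1 ≤ Nat.log 2 (U + 2) := Nat.log_pos (by norm_num) (by omega)
  have h5 := two_mul_log_add_le hb
  generalize Nat.log 2 (trunc k U) = B at *
  have hex : ∃ d, B + 1 ≤ Nat.log 2 b * 2 ^ d := by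
    refine ⟨B + 1, ?_⟩
    have : B + 1 < 2 ^ (B + 1) := Nat.lt_two_pow_self
    nlinarith
  classical
  refine ⟨Nat.find hex, ?_, Nat.find_spec hex, fun d' hd' => not_le.1 (Nat.find_min hex hd')⟩
  have hK : 2 * (Nat.log 2 b * 2 ^ Nat.find hex) + 5 ≤ b := by
    rcases hd : Nat.find hex with - | d
    · simpa using h5
    · have : Nat.log 2 b * 2 ^ d < B + 1 := not_le.1 (Nat.find_min hex (by omega))
      rw [pow_succ, ← mul_assoc (Nat.log 2 b)]
      omega
  have hspec := Nat.find_spec hex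
  generalize Nat.find hex = d at *
  refine ⟨hg, Nat.pow_log_le_self 2 (by omega), by omega, by omega, ?_, by omega, hU,
    hlt.trans_le (Nat.pow_le_pow_right (by norm_num) hspec)⟩
  have e : univ (Nat.log 2 b) (d + 1) = 2 ^ (2 * (Nat.log 2 b * 2 ^ d)) := by
    rw [univ, pow_succ]; congr 1; ring
  have h₁ : 2 ^ (2 * (Nat.log 2 b * 2 ^ d) + 5) ≤ 2 ^ b := Nat.pow_le_pow_right (by norm_num) hK
  rw [pow_add] at h₁
  rw [e]
  omega

/-- A bound for the steps of an operation, relative to `vebTime`. -/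
noncomputable def vebConst : ℝ :=
  14 * (insertStepTime + deleteStepTime + predStepTime + 2000)

theorem opTime_le {b U g d k : ℕ} {ε : ℝ} (hε : 0 < ε) (hb : 2 ≤ b) (hU : U < 2 ^ b)
    (hg : Nat.log 2 b = g) (hk : (2 : ℝ) ^ k ≤ 1 + 2 / ε)
    (hd : ∀ d' < d, g * 2 ^ d' < Nat.log 2 (trunc k U) + 1) :
    (opTime d : ℝ) ≤ vebConst * vebTime b U ε := by
  have h := height_le hε hb hU hg hk hd
  have hA : (0 : ℝ) ≤ insertStepTime + deleteStepTime + predStepTime := by positivity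
  have hd0 : (0 : ℝ) ≤ d := Nat.cast_nonneg _
  unfold opTime vebConst
  push_cast
  nlinarith [mul_le_mul_of_nonneg_left h hA]

theorem isApproxVEB_vebCode : IsApproxVEB vebCode 20 vebConst := by
  intro b U ε hε
  by_cases hU : U < 2 ^ b
  swap
  -- Then no `n` satisfies the lower bound for the number of bits per word.
  · refine ⟨id, ⟨fun _ _ h _ => h, fun _ _ h _ _ => h⟩, fun n q h _ => absurd ?_ hU⟩
    exact lt_of_lt_of_le (by omega) ((Nat.le_self_pow (by norm_num) (n + U + 2)).trans h)
  obtain ⟨k, hk⟩ : ∃ k, precision b (intWord b ε) (fracWord b ε) = k := ⟨_, rfl⟩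
  refine ⟨trunc k, hk ▸ preservesOrder_trunc hε hU, fun n q h hq => ?_⟩
  have h2 : 2 ^ 20 ≤ 2 ^ b := le_trans (Nat.pow_le_pow_left (by omega) 20) h
  have hb : 20 ≤ b := (Nat.pow_le_pow_iff_right (by norm_num : 1 < 2)).1 h2
  obtain ⟨d, hp, hd₁, hd₂⟩ := exists_params (k := k) h hq
  have hk' := (precision_spec (b := b) hε (by omega)).2
  rw [hk] at hk'
  have htime := opTime_le hε (by omega) hU rfl hk' hd₂
  refine ⟨Rep q U n k (Nat.log 2 b) d, fun mem L h => h.consistent,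
    fun mem mem' L hm h => h.congr hm, fun mem h0 => ?_, fun op mem L hL hv => ?_⟩
  · have hj : fracWord b ε < 2 ^ b := by
      have h₁ : Int.fract ε * 2 ^ b < 2 ^ b := by
        have := Int.fract_lt_one ε
        have h2b : (0 : ℝ) < 2 ^ b := by positivity
        nlinarith
      have h₂ : 0 ≤ Int.fract ε * 2 ^ b := mul_nonneg (Int.fract_nonneg ε) (by positivity)
      have h₃ : ((fracWord b ε : ℕ) : ℝ) < 2 ^ b := (Nat.floor_le h₂).trans_lt h₁
      exact_mod_cast h₃
    obtain ⟨t, r, mem', h₁, h₂, h₃, h₄⟩ :=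
      (returns_new hp rfl hk hj rfl hd₁ hd₂ h0).exists_runs
    exact ⟨t, r, mem', h₁, le_trans (by exact_mod_cast h₂) htime, h₃, h₄⟩
  · have hcor : Correct b q U n k (Nat.log 2 b) d op mem L := by
      cases op with
      | insert x D => exact correct_insert hp hL hv.1 hv.2.2
      | delete N => exact correct_delete hp hL hv
      | search x => exact correct_search hp hL hv
      | minimum => exact correct_minimum hp hL
      | maximum => exact correct_maximum hp hL
      | predecessor N => exact correct_predecessor hp hL hv
      | successor N => exact correct_successor hp hL hv
      | data N => exact correct_data hp hL hv
      | element N => exact correct_element hp hL hv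
    obtain ⟨t, r, mem', h₁, h₂, h₃, L', h₄, h₅⟩ := hcor.exists_runs
    exact ⟨t, r, mem', L', h₁, le_trans (by exact_mod_cast h₂) htime, h₃, h₄, h₅⟩

/-! ### Greedy growth of a tree with approximately minimum edges -/

section graph

variable {V : Type*} [Fintype V] [DecidableEq V]

/-- In a connected graph, an edge that leaves `S` may be traded for any given pair that
leaves `S`. -/
theorem exists_exchange {H : SimpleGraph V} (hH : H.Connected) {S : Set V} {u v : V}
    (hu : u ∈ S) (hv : v ∉ S) :
    ∃ a b, H.Adj a b ∧ a ∈ S ∧ b ∉ S ∧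
      (SimpleGraph.fromEdgeSet (insert s(u, v) (H.edgeSet \ {s(a, b)}))).Connected := by
  have huv : u ≠ v := fun h => hv (h ▸ hu)
  by_cases hadj : H.Adj u v
  · refine ⟨u, v, hadj, hu, hv, ?_⟩
    rwa [Set.insert_sdiff_singleton, Set.insert_eq_of_mem (H.mem_edgeSet.2 hadj),
      SimpleGraph.fromEdgeSet_edgeSet]
  obtain ⟨p, hp⟩ := hH.exists_isPath v u
  obtain ⟨d, hd, hda, hdb⟩ := p.reverse.exists_boundary_dart S hu hv
  refine ⟨d.fst, d.snd, d.adj, hda, hdb, ?_⟩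
  -- The pair closes the path to a cycle, which the edge `d` of the path is on.
  let H' := H ⊔ SimpleGraph.edge u v
  have hle : H ≤ H' := le_sup_left
  have hadj' : H'.Adj u v := Or.inr (by simp [SimpleGraph.edge_adj, huv])
  have hdp : d.edge ∈ p.edges := by
    have : d.edge ∈ p.reverse.edges := List.mem_map_of_mem hd
    simpa using this
  have hcycle : ((p.mapLe hle).cons hadj').IsCycle := by
    rw [SimpleGraph.Walk.cons_isCycle_iff]
    refine ⟨hp.mapLe hle, ?_⟩
    rw [SimpleGraph.Walk.edges_mapLe_eq_edges]
    exact fun h => hadj (p.edges_subset_edgeSet h)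
  have hbr : ¬ H'.IsBridge s(d.fst, d.snd) := by
    rw [SimpleGraph.isBridge_iff_forall_cycle_notMem (hle d.adj)]
    intro h
    refine h _ hcycle ?_
    rw [SimpleGraph.Walk.edges_cons, SimpleGraph.Walk.edges_mapLe_eq_edges]
    exact List.mem_cons_of_mem _ hdp
  have hconn := (hH.mono hle).connected_delete_edge_of_not_isBridge hbr
  refine hconn.mono ?_
  rw [← SimpleGraph.edgeSet_subset_edgeSet, SimpleGraph.edgeSet_deleteEdges]
  rintro e ⟨he, hne⟩
  have hdiag := H'.not_isDiag_of_mem_edgeSet he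
  rw [SimpleGraph.edgeSet_fromEdgeSet]
  refine ⟨?_, hdiag⟩
  rw [SimpleGraph.edgeSet_sup] at he
  rcases he with he | he
  · exact Or.inr ⟨he, hne⟩
  · rw [SimpleGraph.edge, SimpleGraph.edgeSet_fromEdgeSet] at he
    exact Or.inl he.1

theorem edgeSet_fromEdgeSet_of_subset {G : SimpleGraph V} {F : Set (Sym2 V)}
    (h : F ⊆ G.edgeSet) : (SimpleGraph.fromEdgeSet F).edgeSet = F := by
  rw [SimpleGraph.edgeSet_fromEdgeSet]
  exact Set.Subset.antisymm Set.sdiff_subset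
    fun e he => ⟨he, G.not_isDiag_of_mem_edgeSet (h he)⟩

/-- The edges `F` form a tree on `S`. Moreover, any connected spanning subgraph, with edges `E₀`,
may be changed into one that contains `F`, such that its weight is at most `1 + ε` times that of
`E₀` even if its edges outside of `F` are counted `1 + ε` times. -/
structure IsGoodTree (G : SimpleGraph V) (w : Sym2 V → ℕ) (ε : ℝ) (r : V) (S : Finset V)
    (F : Finset (Sym2 V)) : Prop where
  root_mem : r ∈ S
  subset : (F : Set (Sym2 V)) ⊆ G.edgeSet
  mem_of_mem : ∀ e ∈ F, ∀ x ∈ e, x ∈ S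
  card : F.card + 1 = S.card
  reachable : ∀ x ∈ S, (SimpleGraph.fromEdgeSet (F : Set (Sym2 V))).Reachable r x
  extends_to : ∀ T : SimpleGraph V, T.Connected → T ≤ G → ∀ E₀ : Finset (Sym2 V),
    (E₀ : Set (Sym2 V)) = T.edgeSet → ∃ E : Finset (Sym2 V), F ⊆ E ∧ (E : Set (Sym2 V)) ⊆ G.edgeSet ∧
      (SimpleGraph.fromEdgeSet (E : Set (Sym2 V))).Connected ∧
      (∑ e ∈ F, (w e : ℝ)) + (1 + ε) * ∑ e ∈ E \ F, (w e : ℝ) ≤ (1 + ε) * ∑ e ∈ E₀, (w e : ℝ)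

variable {G : SimpleGraph V} {w : Sym2 V → ℕ} {ε : ℝ} {r : V} {S : Finset V} {F : Finset (Sym2 V)}

theorem isGoodTree_singleton (r : V) : IsGoodTree G w ε r {r} ∅ where
  root_mem := by simp
  subset := by simp
  mem_of_mem := by simp
  card := by simp
  reachable := by simp
  extends_to T hT hTG E₀ hE₀ := by
    refine ⟨E₀, by simp, ?_, ?_, by simp⟩
    · rw [hE₀]; exact SimpleGraph.edgeSet_mono hTG
    · rwa [hE₀, SimpleGraph.fromEdgeSet_edgeSet]

/-- The new edge replaces an edge that crosses the same cut. In the bound, the latter was counted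
`1 + ε` times, which pays for the new edge, counted once. -/
theorem IsGoodTree.insert (h : IsGoodTree G w ε r S F) (hε : 0 < ε) {u v : V} (huv : G.Adj u v)
    (hu : u ∈ S) (hv : v ∉ S)
    (hmin : ∀ a b, G.Adj a b → a ∈ S → b ∉ S → (w s(u, v) : ℝ) ≤ (1 + ε) * w s(a, b)) :
    IsGoodTree G w ε r (insert v S) (insert s(u, v) F) := by
  have hF : ∀ a b, b ∉ S → s(a, b) ∉ F := fun a b hb hm => hb (h.mem_of_mem _ hm b (by simp))
  refine ⟨by simp [h.root_mem], ?_, ?_, ?_, ?_, ?_⟩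
  · rw [Finset.coe_insert]
    exact Set.insert_subset huv h.subset
  · intro e he x hx
    rcases Finset.mem_insert.1 he with rfl | he
    · rcases Sym2.mem_iff.1 hx with rfl | rfl <;> simp [hu]
    · exact Finset.mem_insert_of_mem (h.mem_of_mem e he x hx)
  · rw [Finset.card_insert_of_notMem (hF u v hv), Finset.card_insert_of_notMem hv, h.card]
  · have hle : SimpleGraph.fromEdgeSet (F : Set (Sym2 V)) ≤
        SimpleGraph.fromEdgeSet ((Insert.insert s(u, v) F : Finset (Sym2 V)) : Set (Sym2 V)) :=
      SimpleGraph.fromEdgeSet_mono (by simp)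
    intro x hx
    rcases Finset.mem_insert.1 hx with rfl | hx
    · refine ((h.reachable u hu).mono hle).trans (SimpleGraph.Adj.reachable ?_)
      rw [SimpleGraph.fromEdgeSet_adj]
      exact ⟨by simp, huv.ne⟩
    · exact (h.reachable x hx).mono hle
  · intro T hT hTG E₀ hE₀
    obtain ⟨E, hFE, hEG, hE, hw⟩ := h.extends_to T hT hTG E₀ hE₀
    obtain ⟨a, b, hab, ha, hb, hc⟩ := exists_exchange (S := (S : Set V)) hE hu hv
    rw [SimpleGraph.fromEdgeSet_adj] at hab
    have habE : s(a, b) ∈ E \ F := Finset.mem_sdiff.2 ⟨hab.1, hF a b hb⟩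
    refine ⟨Insert.insert s(u, v) (E.erase s(a, b)), ?_, ?_, ?_, ?_⟩
    · refine Finset.insert_subset_insert _ fun e he => Finset.mem_erase.2 ⟨?_, hFE he⟩
      rintro rfl
      exact hF a b hb he
    · intro e he
      rcases Finset.mem_insert.1 he with rfl | he
      · exact huv
      · exact hEG (Finset.mem_of_mem_erase he)
    · refine hc.mono (SimpleGraph.fromEdgeSet_mono ?_)
      rw [SimpleGraph.edgeSet_fromEdgeSet]
      intro e
      simp only [Finset.coe_insert, Finset.coe_erase, Set.mem_insert_iff, Set.mem_sdiff]
      tauto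
    · have hm := hmin a b (hEG hab.1) ha hb
      have hsub : (Insert.insert s(u, v) (E.erase s(a, b))) \ (Insert.insert s(u, v) F) ⊆
          (E \ F).erase s(a, b) := by
        intro e
        simp only [Finset.mem_sdiff, Finset.mem_insert, Finset.mem_erase]
        tauto
      have hsum := Finset.sum_le_sum_of_subset_of_nonneg (f := fun e => (w e : ℝ)) hsub
        (fun _ _ _ => Nat.cast_nonneg _)
      have herase := Finset.add_sum_erase (E \ F) (fun e => (w e : ℝ)) habE
      rw [Finset.sum_insert (hF u v hv)]
      nlinarith

theorem IsGoodTree.isTree (h : IsGoodTree G w ε r Finset.univ F) :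
    (SimpleGraph.fromEdgeSet (F : Set (Sym2 V))).IsTree := by
  rw [SimpleGraph.isTree_iff_connected_and_card]
  constructor
  · exact (SimpleGraph.connected_iff_exists_forall_reachable _).2
      ⟨r, fun x => h.reachable x (Finset.mem_univ x)⟩
  · rw [edgeSet_fromEdgeSet_of_subset h.subset, Nat.card_eq_fintype_card,
      Nat.card_eq_fintype_card]
    simpa using h.card

end graph

theorem IsGoodTree.isApproxMST {n : ℕ} {G : SimpleGraph (Fin n)} {w : Sym2 (Fin n) → ℕ} {ε : ℝ}
    {r : Fin n} {F : Finset (Sym2 (Fin n))} (hε : 0 < ε)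
    (h : IsGoodTree G w ε r Finset.univ F) :
    IsApproxMST G w ε (SimpleGraph.fromEdgeSet (F : Set (Sym2 (Fin n)))) := by
  classical
  have hF := edgeSet_fromEdgeSet_of_subset h.subset
  refine ⟨⟨?_, h.isTree⟩, fun T' hT' => ?_⟩
  · rw [← SimpleGraph.edgeSet_subset_edgeSet, hF]
    exact h.subset
  · obtain ⟨E, -, -, -, hE⟩ := h.extends_to T' hT'.2.connected hT'.1 T'.edgeFinset (by simp)
    have h₁ : (weight w (SimpleGraph.fromEdgeSet (F : Set (Sym2 (Fin n)))) : ℝ) =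
        ∑ e ∈ F, (w e : ℝ) := by
      rw [weight, Nat.cast_sum]
      refine Finset.sum_congr ?_ fun _ _ => rfl
      rw [← Finset.coe_inj, SimpleGraph.coe_edgeFinset, hF]
    have h₂ : (weight w T' : ℝ) = ∑ e ∈ T'.edgeFinset, (w e : ℝ) := by
      rw [weight, Nat.cast_sum]
    rw [h₁, h₂]
    have h₃ : 0 ≤ ∑ e ∈ E \ F, (w e : ℝ) := Finset.sum_nonneg fun _ _ => Nat.cast_nonneg _
    nlinarith

/-! ### The frontier of Prim's algorithm and its queue -/

/-- The source of the half-edge `k` of the edge `k / 2`, where the input is stored in `M`. -/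
def src (M : ℕ → ℕ) (k : ℕ) : ℕ := M (3 * (k / 2) + k % 2)

/-- The target of the half-edge `k`. -/
def tgt (M : ℕ → ℕ) (k : ℕ) : ℕ := M (3 * (k / 2) + (k + 1) % 2)

/-- The weight of the half-edge `k`. -/
def wt (M : ℕ → ℕ) (k : ℕ) : ℕ := M (3 * (k / 2) + 2)

/-- The tree with the vertices `S` and the edges `X` arises from the vertex `0` by adding, again
and again, an edge that leaves the tree and whose weight is least after it is mapped by `f`. -/
inductive Grown (M : ℕ → ℕ) (m : ℕ) (f : ℕ → ℕ) : Set ℕ → Set ℕ → Prop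
  | start : Grown M m f {0} ∅
  | step {S X : Set ℕ} {k : ℕ} : Grown M m f S X → k < 2 * m → src M k ∈ S → tgt M k ∉ S →
      (∀ k' < 2 * m, src M k' ∈ S → tgt M k' ∉ S → f (wt M k) ≤ f (wt M k')) →
      Grown M m f (insert (tgt M k) S) (insert (k / 2) X)

/-- The frontier, when all the half-edges in `D` have been examined. Here `st`, `ky` and `ed` are
the contents of the arrays `status`, `key` and `edge`. -/
structure Front (M : ℕ → ℕ) (n m : ℕ) (f st ky ed : ℕ → ℕ) (D : Set ℕ) : Prop where
  st_le : ∀ v < n, st v ≤ 2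
  root : (st 0 = 1 ∧ ∀ v < n, st v ≠ 2) ∨ st 0 = 2
  queued : ∀ v < n, v ≠ 0 → st v = 1 →
    ∃ k < 2 * m, tgt M k = v ∧ st (src M k) = 2 ∧ ed v = k / 2 ∧ ky v = wt M k
  done : ∀ k ∈ D, k < 2 * m →
    st (tgt M k) = 2 ∨ st (tgt M k) = 1 ∧ ky (tgt M k) ≤ wt M k
  grown : st 0 = 2 →
    Grown M m f {v | v < n ∧ st v = 2} {e | ∃ v < n, v ≠ 0 ∧ st v = 2 ∧ e = ed v}

/-- The queue holds the vertices of status `1` with their keys. -/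
structure Queue (n : ℕ) (st nm ky : ℕ → ℕ) (L : List Item) : Prop where
  item : ∀ it ∈ L, it.data < n ∧ st it.data = 1 ∧ nm it.data = it.name ∧ ky it.data = it.elem
  exists_item : ∀ v < n, st v = 1 → ∃ it ∈ L, it.data = v

section

variable {M st nm ky ed f : ℕ → ℕ} {n m U : ℕ} {D : Set ℕ} {L A B : List Item}

theorem front_start (hsrc : ∀ k < 2 * m, src M k < n) (h0 : st 0 = 1) (h : ∀ v < n, v ≠ 0 → st v = 0) :
    Front M n m f st ky ed {k | st (src M k) = 2} where
  st_le v hv := by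
    by_cases hv0 : v = 0
    · subst hv0; omega
    · rw [h v hv hv0]; omega
  root := by
    refine Or.inl ⟨h0, fun v hv => ?_⟩
    by_cases hv0 : v = 0
    · subst hv0; omega
    · rw [h v hv hv0]; omega
  queued v hv hv0 h1 := by rw [h v hv hv0] at h1; omega
  done k hk hm := by
    exfalso
    have : st (src M k) = 2 := hk
    by_cases hv0 : src M k = 0
    · rw [hv0] at this
      omega
    · rw [h _ (hsrc k hm) hv0] at this
      omega
  grown h2 := by omega

/-- Nothing is to be done if the target is in the tree or has a key that is not larger. -/
theorem Front.insert_of_le (h : Front M n m f st ky ed D) {k : ℕ}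
    (hk : st (tgt M k) = 2 ∨ st (tgt M k) = 1 ∧ ky (tgt M k) ≤ wt M k) :
    Front M n m f st ky ed (insert k D) :=
  ⟨h.st_le, h.root, h.queued, fun k' hk' hm => by
    rcases hk' with rfl | hk'
    · exact hk
    · exact h.done k' hk' hm, h.grown⟩

theorem Front.relax (h : Front M n m f st ky ed D) {k : ℕ} (hk : k < 2 * m) (hu : tgt M k < n)
    (hsn : src M k < n) (hs : st (src M k) = 2)
    (hlt : st (tgt M k) = 0 ∨ st (tgt M k) = 1 ∧ wt M k < ky (tgt M k)) :
    Front M n m f (update st (tgt M k) 1) (update ky (tgt M k) (wt M k))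
      (update ed (tgt M k) (k / 2)) (insert k D) := by
  have h0 : st 0 = 2 := h.root.resolve_left fun h' => h'.2 _ hsn hs
  have hu2 : st (tgt M k) ≠ 2 := by omega
  have hst : ∀ v, update st (tgt M k) 1 v = 2 ↔ st v = 2 := by
    intro v
    rw [update_apply]
    split_ifs with hv
    · subst hv; omega
    · rfl
  refine ⟨fun v hv => ?_, Or.inr ((hst 0).2 h0), fun v hv hv0 h1 => ?_, fun k' hk' hm => ?_,
    fun _ => ?_⟩
  · rw [update_apply]
    split_ifs with hvu
    · omega
    · exact h.st_le v hv
  · by_cases hvu : v = tgt M k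
    · subst hvu
      exact ⟨k, hk, rfl, (hst _).2 hs, update_self .., update_self ..⟩
    · rw [update_of_ne hvu] at h1
      obtain ⟨k', hk', e₁, e₂, e₃, e₄⟩ := h.queued v hv hv0 h1
      exact ⟨k', hk', e₁, (hst _).2 e₂, by rw [update_of_ne hvu, e₃],
        by rw [update_of_ne hvu, e₄]⟩
  · by_cases hvu : tgt M k' = tgt M k
    · rw [hvu, update_self, update_self]
      refine Or.inr ⟨rfl, ?_⟩
      rcases hk' with rfl | hk'
      · exact le_rfl
      · have := h.done k' hk' hm
        rw [hvu] at this
        omega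
    · rw [update_of_ne hvu, update_of_ne hvu]
      refine h.done k' (hk'.resolve_left ?_) hm
      rintro rfl
      exact hvu rfl
  · have := h.grown h0
    simp only [hst]
    convert this using 2
    ext e
    refine exists_congr fun v => and_congr_right fun _ => and_congr_right fun _ =>
      and_congr_right fun h2 => ?_
    rw [update_of_ne]
    rintro rfl
    exact hu2 h2

/-- A queued vertex whose key is least, after it is mapped by `f`, may be moved to the tree. -/
theorem Front.extract (h : Front M n m f st ky ed {k | st (src M k) = 2})
    (hf : ∀ x y, x ≤ y → y ≤ U → f x ≤ f y) (hw : ∀ k < 2 * m, wt M k ≤ U)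
    (hsrc : ∀ k < 2 * m, src M k < n) (htgt : ∀ k < 2 * m, tgt M k < n) {v : ℕ} (hv : v < n) (h1 : st v = 1)
    (hmin : ∀ u < n, st u = 1 → f (ky v) ≤ f (ky u)) :
    Front M n m f (update st v 2) ky ed {k | st (src M k) = 2} := by
  have h0 : update st v 2 0 = 2 := by
    by_cases hv0 : v = 0
    · subst hv0; exact update_self ..
    · rw [update_of_ne (Ne.symm hv0)]
      refine h.root.resolve_left fun h' => ?_
      obtain ⟨k, hk, -, h2, -⟩ := h.queued v hv hv0 h1
      exact h'.2 _ (hsrc k hk) h2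
  have hst : ∀ u, st u = 2 → update st v 2 u = 2 := by
    intro u hu
    rw [update_apply, hu, ite_self]
  refine ⟨fun u hu => ?_, Or.inr h0, fun u hu hu0 hu1 => ?_, fun k hk hm => ?_, fun _ => ?_⟩
  · rw [update_apply]
    split_ifs
    · rfl
    · exact h.st_le u hu
  · have huv : u ≠ v := by
      rintro rfl
      rw [update_self] at hu1
      omega
    rw [update_of_ne huv] at hu1
    obtain ⟨k, hk, e₁, e₂, e₃⟩ := h.queued u hu hu0 hu1
    exact ⟨k, hk, e₁, hst _ e₂, e₃⟩
  · by_cases hkv : tgt M k = v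
    · rw [hkv, update_self]; exact Or.inl rfl
    · rw [update_of_ne hkv]; exact h.done k hk hm
  · by_cases hv0 : v = 0
    · subst hv0
      have hn2 : ∀ u < n, st u ≠ 2 := (h.root.resolve_right (by omega)).2
      have e₁ : {u | u < n ∧ update st 0 2 u = 2} = {0} := by
        ext u
        simp only [Set.mem_ofPred_eq, Set.mem_singleton_iff]
        refine ⟨fun ⟨hu, h2⟩ => ?_, ?_⟩
        · by_contra hu0
          rw [update_of_ne hu0] at h2
          exact hn2 u hu h2
        · rintro rfl
          exact ⟨hv, update_self ..⟩
      have e₂ : {e | ∃ u < n, u ≠ 0 ∧ update st 0 2 u = 2 ∧ e = ed u} = ∅ := by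
        ext e
        simp only [Set.mem_ofPred_eq, Set.mem_empty_iff_false, iff_false]
        rintro ⟨u, hu, hu0, h2, -⟩
        rw [update_of_ne hu0] at h2
        exact hn2 u hu h2
      rw [e₁, e₂]
      exact .start
    · rw [update_of_ne (Ne.symm hv0)] at h0
      obtain ⟨k, hk, rfl, h2, hed, hky⟩ := h.queued v hv hv0 h1
      have hg := (h.grown h0).step hk ⟨hsrc k hk, h2⟩ (fun h' => by have := h'.2; omega)
        fun k' hk' hs' ht' => by
          have hd := (h.done k' hs'.2 hk').resolve_left fun h' => ht' ⟨htgt k' hk', h'⟩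
          rw [← hky]
          exact (hmin _ (htgt k' hk') hd.1).trans (hf _ _ hd.2 (hw k' hk'))
      convert hg using 1
      · ext u
        simp only [Set.mem_ofPred_eq, Set.mem_insert_iff]
        by_cases hu : u = tgt M k
        · subst hu; simp [hv]
        · simp [hu, update_of_ne hu]
      · ext e
        simp only [Set.mem_ofPred_eq, Set.mem_insert_iff]
        constructor
        · rintro ⟨u, hu, hu0, hu2, rfl⟩
          by_cases hut : u = tgt M k
          · subst hut; exact Or.inl hed
          · rw [update_of_ne hut] at hu2
            exact Or.inr ⟨u, hu, hu0, hu2, rfl⟩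
        · rintro (rfl | ⟨u, hu, hu0, hu2, rfl⟩)
          · exact ⟨_, hv, hv0, update_self .., hed.symm⟩
          · exact ⟨u, hu, hu0, hst u hu2, rfl⟩

/-- When the queue is empty and all the half-edges of the tree have been examined, the tree
spans the graph. -/
theorem Front.finish (h : Front M n m f st ky ed {k | st (src M k) = 2})
    (hq : ∀ v < n, st v ≠ 1) (hn : 0 < n) (htgt : ∀ k < 2 * m, tgt M k < n)
    (hconn : ∀ S : Set ℕ, 0 ∈ S → (∀ k < 2 * m, src M k ∈ S → tgt M k ∈ S) → ∀ v < n, v ∈ S) :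
    Grown M m f {v | v < n} {e | ∃ v < n, v ≠ 0 ∧ e = ed v} := by
  have h0 : st 0 = 2 := h.root.resolve_left fun h' => hq 0 hn h'.1
  have hall : ∀ v < n, st v = 2 := by
    refine hconn {v | st v = 2} h0 fun k hk hs => ?_
    exact (h.done k hs hk).resolve_right fun h' => hq _ (htgt k hk) h'.1
  convert h.grown h0 using 1
  · ext v
    simp only [Set.mem_ofPred_eq]
    exact ⟨fun hv => ⟨hv, hall v hv⟩, And.left⟩
  · ext e
    simp only [Set.mem_ofPred_eq]
    exact exists_congr fun v => and_congr_right fun hv => by simp [hall v hv]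

theorem Queue.delete (h : Queue n st nm ky L) (hL : Consistent f L) {it : Item} (hit : it ∈ L)
    {c : ℕ} (hc : c ≠ 1) :
    Queue n (update st it.data c) nm ky (L.filter (fun it' => it'.name ≠ it.name)) := by
  refine ⟨fun it' h' => ?_, fun v hv h1 => ?_⟩
  · rw [List.mem_filter] at h'
    obtain ⟨h₁, h₂, h₃, h₄⟩ := h.item it' h'.1
    have hne : it'.data ≠ it.data := by
      intro e
      have := h'.2
      simp only [decide_eq_true_eq] at this
      exact this (by rw [← h₃, e, (h.item it hit).2.2.1])
    rw [update_of_ne hne]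
    exact ⟨h₁, h₂, h₃, h₄⟩
  · have hne : v ≠ it.data := by
      rintro rfl
      rw [update_self] at h1
      exact hc h1
    rw [update_of_ne hne] at h1
    obtain ⟨it', h', rfl⟩ := h.exists_item v hv h1
    refine ⟨it', List.mem_filter.2 ⟨h', ?_⟩, rfl⟩
    simp only [decide_eq_true_eq]
    -- Distinct entries have distinct names.
    intro e
    exact hne (congrArg Item.data (List.inj_on_of_nodup_map hL.1 h' hit e))

theorem Queue.insert (h : Queue n st nm ky (A ++ B)) {u r x : ℕ} (hu : u < n) (hu1 : st u ≠ 1) :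
    Queue n (update st u 1) (update nm u r) (update ky u x) (A ++ ⟨r, x, u⟩ :: B) := by
  refine ⟨fun it hit => ?_, fun v hv h1 => ?_⟩
  · have hit' : it = ⟨r, x, u⟩ ∨ it ∈ A ++ B := by
      simp only [List.mem_append, List.mem_cons] at hit ⊢
      tauto
    rcases hit' with rfl | hit'
    · simp [hu]
    · obtain ⟨h₁, h₂, h₃, h₄⟩ := h.item it hit'
      have : it.data ≠ u := by rintro rfl; exact hu1 h₂
      rw [update_of_ne this, update_of_ne this, update_of_ne this]
      exact ⟨h₁, h₂, h₃, h₄⟩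
  · by_cases hvu : v = u
    · exact ⟨⟨r, x, u⟩, by simp, hvu.symm⟩
    · rw [update_of_ne hvu] at h1
      obtain ⟨it, hit, e⟩ := h.exists_item v hv h1
      refine ⟨it, ?_, e⟩
      simp only [List.mem_append, List.mem_cons] at hit ⊢
      tauto

/-- The queue leaves room for a vertex that is not queued. -/
theorem Queue.length_lt (h : Queue n st nm ky L) (hL : Consistent f L) {u : ℕ} (hu : u < n)
    (hu1 : st u ≠ 1) : L.length < n := by
  have hnd : (L.map Item.data).Nodup := by
    rw [List.nodup_map_iff_inj_on (List.Nodup.of_map _ hL.1)]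
    intro it hit it' hit' e
    refine List.inj_on_of_nodup_map hL.1 hit hit' ?_
    rw [← (h.item it hit).2.2.1, e, (h.item it' hit').2.2.1]
  have hsub : (L.map Item.data).toFinset ⊆ (Finset.range n).erase u := by
    intro v hv
    rw [List.mem_toFinset, List.mem_map] at hv
    obtain ⟨it, hit, rfl⟩ := hv
    refine Finset.mem_erase.2 ⟨?_, Finset.mem_range.2 (h.item it hit).1⟩
    rintro rfl
    exact hu1 (h.item it hit).2.1
  have := Finset.card_le_card hsub
  rw [List.toFinset_card_of_nodup hnd, List.length_map,
    Finset.card_erase_of_mem (Finset.mem_range.2 hu), Finset.card_range] at this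
  omega

end

/-! ### Adjacency lists -/

/-- The linked list of the numbers in `l`, all increased by one, begins at `s`. The successor of
`k + 1` is `nx k`. -/
def Follows (nx : ℕ → ℕ) : ℕ → List ℕ → Prop
  | s, [] => s = 0
  | s, k :: l => s = k + 1 ∧ Follows nx (nx k) l

theorem Follows.congr {nx nx' : ℕ → ℕ} {s : ℕ} {l : List ℕ} (h : Follows nx s l)
    (hx : ∀ k ∈ l, nx' k = nx k) : Follows nx' s l := by
  induction l generalizing s with
  | nil => exact h
  | cons k l ih =>
    refine ⟨h.1, ?_⟩
    rw [hx k (by simp)]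
    exact ih h.2 fun k' hk' => hx k' (by simp [hk'])

/-- The half-edges at the vertex `v` with numbers below `j`, in descending order. -/
def halfEdges (M : ℕ → ℕ) (v : ℕ) : ℕ → List ℕ
  | 0 => []
  | k + 1 => if src M k = v then k :: halfEdges M v k else halfEdges M v k

theorem mem_halfEdges {M : ℕ → ℕ} {v j k : ℕ} : k ∈ halfEdges M v j ↔ k < j ∧ src M k = v := by
  induction j with
  | zero => simp [halfEdges]
  | succ j ih =>
    rw [halfEdges]
    split_ifs with h
    · rw [List.mem_cons, ih]
      constructor
      · rintro (rfl | h')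
        · exact ⟨by omega, h⟩
        · exact ⟨by omega, h'.2⟩
      · rintro ⟨h₁, h₂⟩
        by_cases hkj : k = j
        · exact Or.inl hkj
        · exact Or.inr ⟨by omega, h₂⟩
    · rw [ih]
      refine and_congr_left fun h' => ?_
      have : k ≠ j := by rintro rfl; exact h h'
      omega

theorem sum_length_halfEdges {M : ℕ → ℕ} {n j : ℕ} (h : ∀ k < j, src M k < n) :
    ∑ v ∈ Finset.range n, (halfEdges M v j).length = j := by
  induction j with
  | zero => simp [halfEdges]
  | succ j ih =>
    have e : ∀ v, (halfEdges M v (j + 1)).length = (halfEdges M v j).length +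
        if src M j = v then 1 else 0 := by
      intro v
      rw [halfEdges]
      split_ifs <;> simp
    rw [Finset.sum_congr rfl fun v _ => e v, Finset.sum_add_distrib,
      ih fun k hk => h k (by omega), Finset.sum_ite_eq,
      if_pos (Finset.mem_range.2 (h j (by omega)))]

/-- The memory holds the adjacency lists of the first `j` half-edges. -/
def Adjacent (M : ℕ → ℕ) (n m j : ℕ) (mem : ℕ → ℕ) : Prop :=
  ∀ v < n, Follows (fun k => mem (3 * m + n + k)) (mem (3 * m + v)) (halfEdges M v j)

/-- The half-edge `k` is put in front of the list of `v`. -/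
def pushHalf (n m : ℕ) (mem : ℕ → ℕ) (k v : ℕ) : ℕ → ℕ :=
  update (update mem (3 * m + n + k) (mem (3 * m + v))) (3 * m + v) (k + 1)

theorem Adjacent.push {M mem : ℕ → ℕ} {n m k : ℕ} (h : Adjacent M n m k mem)
    (hv : src M k < n) : Adjacent M n m (k + 1) (pushHalf n m mem k (src M k)) := by
  have hnx : ∀ k' < k, pushHalf n m mem k (src M k) (3 * m + n + k') = mem (3 * m + n + k') := by
    intro k' hk'
    rw [pushHalf, update_of_ne (by omega), update_of_ne (by omega)]
  have hk : pushHalf n m mem k (src M k) (3 * m + n + k) = mem (3 * m + src M k) := by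
    rw [pushHalf, update_of_ne (by omega), update_self]
  intro v hvn
  have hl := (h v hvn).congr (nx' := fun k' => pushHalf n m mem k (src M k) (3 * m + n + k'))
    fun k' hk' => hnx k' (mem_halfEdges.1 hk').1
  rw [halfEdges]
  split_ifs with hkv
  · subst hkv
    refine ⟨by rw [pushHalf, update_self], ?_⟩
    rwa [← hk] at hl
  · rwa [pushHalf, update_of_ne (by omega), update_of_ne (by omega)]

theorem Adjacent.congr {M mem mem' : ℕ → ℕ} {n m : ℕ} (h : Adjacent M n m (2 * m) mem)
    (hm : ∀ a < 5 * m + n, mem' a = mem a) : Adjacent M n m (2 * m) mem' := by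
  intro v hv
  rw [hm _ (by omega)]
  exact (h v hv).congr fun k hk => hm _ (by have := (mem_halfEdges.1 hk).1; omega)

/-- The contents of the registers that are fixed after the layout of the arrays. -/
structure Laid (n m : ℕ) (r : Reg → ℕ) : Prop where
  head : r Prim.head = 3 * m
  next : r Prim.next = 3 * m + n
  status : r Prim.status = 5 * m + n
  name : r Prim.name = 5 * m + 2 * n
  key : r Prim.key = 5 * m + 3 * n
  edge : r Prim.edge = 5 * m + 4 * n
  q : r Prim.q = 5 * m + 5 * n

theorem Laid.update {n m : ℕ} {r : Reg → ℕ} (h : Laid n m r) {x : Reg} (hx : 12 ≤ x.idx) (v : ℕ) :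
    Laid n m (update r x v) := by
  have e : ∀ y : Reg, y.idx < 12 → Function.update r x v y = r y := fun y hy =>
    update_of_ne (by rintro rfl; omega) _ _
  constructor
  · rw [e _ (by decide), h.head]
  · rw [e _ (by decide), h.next]
  · rw [e _ (by decide), h.status]
  · rw [e _ (by decide), h.name]
  · rw [e _ (by decide), h.key]
  · rw [e _ (by decide), h.edge]
  · rw [e _ (by decide), h.q]

open Prim in
theorem halts_layout {b : ℕ} {mem : ℕ → ℕ} {l : List ℕ} {n m : ℕ} (hb : 5 * m + 5 * n + 3 < 2 ^ b) :
    Halts b layout ⟨argRegs (n :: m :: l), mem⟩ layout.len (fun s =>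
      Laid n m s.regs ∧ (∀ r : Reg, r.idx < 5 → s.regs r = argRegs (n :: m :: l) r) ∧
      s.mem = mem) := by
  refine .of_run (by simp [layout, Cmd.LoopFree]) ?_
  have h₀ : argRegs (n :: m :: l) Prim.n = n := rfl
  have h₁ : argRegs (n :: m :: l) Prim.m = m := rfl
  refine ⟨?_, fun r hr => ?_, rfl⟩
  · constructor <;>
    simp (disch := first | decide | omega) only [layout, Cmd.run, eval_rules, eval_binOp_rules,
      eval_lit, eval_add, eval_mul, update_self, update_of_ne, h₀, h₁] <;> omega
  · have e : ∀ x : Reg, 5 ≤ x.idx → r ≠ x := by rintro x hx rfl; omega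
    simp only [layout, Cmd.run]
    rw [update_of_ne (e _ (by decide)), update_of_ne (e _ (by decide)),
      update_of_ne (e _ (by decide)), update_of_ne (e _ (by decide)),
      update_of_ne (e _ (by decide)), update_of_ne (e _ (by decide)),
      update_of_ne (e _ (by decide))]

/-- The body of the loop that builds the adjacency lists. -/
def Prim.adjacencyStep : Cmd :=
  v ::= .load (3 * i) ;;
  .store (next + 2 * i) (.load (head + v)) ;;
  .store (head + v) (2 * i + 1) ;;
  v ::= .load (3 * i + 1) ;;
  .store (next + 2 * i + 1) (.load (head + v)) ;;
  .store (head + v) (2 * i + 2) ;;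
  i ::= i + 1

theorem run_adjacencyStep {b n m j v v' : ℕ} {s : State} (hb : 5 * m + 5 * n + 3 < 2 ^ b)
    (hs : Laid n m s.regs) (hj : s.regs Prim.i = j) (hjm : j < m) (hv : s.mem (3 * j) = v)
    (hv' : s.mem (3 * j + 1) = v') (hvn : v < n) (hvn' : v' < n) :
    Laid n m (Prim.adjacencyStep.run b s).regs ∧
    (Prim.adjacencyStep.run b s).regs Prim.i = j + 1 ∧
    (∀ r : Reg, r.idx < 12 → (Prim.adjacencyStep.run b s).regs r = s.regs r) ∧
    (Prim.adjacencyStep.run b s).mem =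
      pushHalf n m (pushHalf n m s.mem (2 * j) v) (2 * j + 1) v' := by
  have h₁ := hs.head
  have h₂ := hs.next
  refine ⟨((hs.update (by decide) _).update (by decide) _).update (by decide) _, ?_,
    fun r hr => ?_, ?_⟩
  · simp (disch := first | decide | omega) only [Prim.adjacencyStep, Cmd.run, eval_rules,
      eval_binOp_rules, eval_lit, eval_add, eval_mul, update_self, update_of_ne, h₁, h₂, hj, hv, hv']
  · have e : ∀ x : Reg, 12 ≤ x.idx → r ≠ x := by rintro x hx rfl; omega
    simp only [Prim.adjacencyStep, Cmd.run]
    rw [update_of_ne (e _ (by decide)), update_of_ne (e _ (by decide)),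
      update_of_ne (e _ (by decide))]
  · simp (disch := first | decide | omega) only [Prim.adjacencyStep, Cmd.run, eval_rules,
      eval_binOp_rules, eval_lit, eval_add, eval_mul, update_self, update_of_ne, h₁, h₂, hj, hv, hv',
      pushHalf, add_assoc, Nat.reduceAdd]

theorem halts_adjacency_loop {b n m d : ℕ} {M : ℕ → ℕ} (hb : 5 * m + 5 * n + 3 < 2 ^ b)
    (hsrc : ∀ k < 2 * m, src M k < n) {s : State} {j : ℕ} (hjd : j + d = m)
    (hs : Laid n m s.regs) (hm : s.regs Prim.m = m) (hj : s.regs Prim.i = j)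
    (hM : ∀ a < 3 * m, s.mem a = M a) (hadj : Adjacent M n m (2 * j) s.mem)
    (h0 : ∀ a, 5 * m + n ≤ a → s.mem a = 0) :
    Halts b (.while (.bin .lt Prim.i Prim.m) Prim.adjacencyStep) s
      (d * (4 + Prim.adjacencyStep.len) + 4) (fun s' => Laid n m s'.regs ∧
        (∀ r : Reg, r.idx < 12 → s'.regs r = s.regs r) ∧ (∀ a < 3 * m, s'.mem a = M a) ∧
        Adjacent M n m (2 * m) s'.mem ∧ ∀ a, 5 * m + n ≤ a → s'.mem a = 0) := by
  induction d generalizing s j with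
  | zero =>
    obtain rfl : j = m := by omega
    rw [Nat.zero_mul, Nat.zero_add]
    refine Halts.while_false (e := .bin .lt Prim.i Prim.m) ?_ ⟨hs, fun _ _ => rfl, hM, hadj, h0⟩
    simp [Expr.eval, BinOp.eval, hj, hm]
  | succ d ih =>
    have hv : s.mem (3 * j) = src M (2 * j) := by
      rw [hM _ (by omega), src]
      congr 1; omega
    have hv' : s.mem (3 * j + 1) = src M (2 * j + 1) := by
      rw [hM _ (by omega), src]
      congr 1; omega
    have hvn := hsrc (2 * j) (by omega)
    have hvn' := hsrc (2 * j + 1) (by omega)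
    obtain ⟨r₁, r₂, r₃, r₄⟩ := run_adjacencyStep hb hs hj (by omega) hv hv' hvn hvn'
    have hout : ∀ mem k v a, k < 2 * m → v < n → (a < 3 * m ∨ 5 * m + n ≤ a) →
        pushHalf n m mem k v a = mem a := by
      intro mem k v a hk hv ha
      rw [pushHalf, update_of_ne (by omega), update_of_ne (by omega)]
    refine (Halts.while_run (e := .bin .lt Prim.i Prim.m) ?_
      (by simp [Prim.adjacencyStep, Cmd.LoopFree])
      ((ih (by omega : j + 1 + d = m) r₁ (by rw [r₃ _ (by decide), hm]) r₂ ?_ ?_ ?_).mono le_rfl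
        ?_)).mono ?_ fun _ h => h
    · simp [Expr.eval, BinOp.eval, hj, hm]; omega
    · intro a ha
      rw [r₄, hout _ _ _ _ (by omega) hvn' (Or.inl ha), hout _ _ _ _ (by omega) hvn (Or.inl ha),
        hM a ha]
    · rw [r₄]
      exact (hadj.push hvn).push hvn'
    · intro a ha
      rw [r₄, hout _ _ _ _ (by omega) hvn' (Or.inr ha), hout _ _ _ _ (by omega) hvn (Or.inr ha),
        h0 a ha]
    · rintro s' ⟨g₁, g₂, g₃⟩
      exact ⟨g₁, fun r hr => (g₂ r hr).trans (r₃ r hr), g₃⟩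
    · rw [Nat.succ_mul]
      have : (Expr.bin BinOp.lt (Prim.i : Expr) (Prim.m : Expr)).cost = 3 := rfl
      omega

theorem halts_adjacency {b n m : ℕ} {M : ℕ → ℕ} (hb : 5 * m + 5 * n + 3 < 2 ^ b)
    (hsrc : ∀ k < 2 * m, src M k < n) {s : State}
    (hs : Laid n m s.regs) (hm : s.regs Prim.m = m) (hM : s.mem = M)
    (h0 : ∀ a, 3 * m ≤ a → M a = 0) :
    Halts b Prim.adjacency s (2 + (m * (4 + Prim.adjacencyStep.len) + 4)) (fun s' =>
      Laid n m s'.regs ∧ (∀ r : Reg, r.idx < 12 → s'.regs r = s.regs r) ∧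
        (∀ a < 3 * m, s'.mem a = M a) ∧
        Adjacent M n m (2 * m) s'.mem ∧ ∀ a, 5 * m + n ≤ a → s'.mem a = 0) := by
  subst hM
  refine Halts.run_seq (c₁ := Prim.i ::= 0) trivial ?_
  refine (halts_adjacency_loop (s := (Prim.i ::= 0).run b s) (j := 0) (M := s.mem) hb hsrc
    (Nat.zero_add m)
    (hs.update (by decide) _) ?_ ?_ (fun _ _ => rfl) ?_ ?_).mono le_rfl ?_
  · rw [← hm]
    simp only [Cmd.run]
    rw [update_of_ne (by decide)]
  · simp only [Cmd.run, eval_rules]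
    rw [update_self]
    exact Nat.zero_mod _
  · intro v hv
    exact h0 _ (by omega)
  · intro a ha
    exact h0 a (by omega)
  · rintro s' ⟨g₁, g₂, g₃⟩
    refine ⟨g₁, fun r hr => (g₂ r hr).trans (update_of_ne ?_ _ _), g₃⟩
    rintro rfl
    exact absurd hr (by decide)

/-! ### The examination of an edge -/

/-- With the storage at the address `q`, the procedures in `V` maintain lists ordered by `f`,
within `T` steps per operation. -/
structure IsQueue (V : VEBCode) (b U n q : ℕ) (f : ℕ → ℕ) (T : ℕ)
    (Rep : (ℕ → ℕ) → List Item → Prop) : Prop where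
  consistent : ∀ mem L, Rep mem L → Consistent f L
  congr : ∀ mem mem' L, (∀ a, q ≤ a → mem' a = mem a) → Rep mem L → Rep mem' L
  returns : ∀ (op : Op) mem L, Rep mem L → op.Valid b U n L →
    Returns b (op.code V) (q :: op.args) mem T (fun r mem' => (∀ a < q, mem' a = mem a) ∧
      ∃ L', op.Effect f L r L' ∧ Rep mem' L')

/-- The arrays `status`, `name`, `key` and `edge` have the given contents. -/
structure View (n m : ℕ) (mem st nm ky ed : ℕ → ℕ) : Prop where
  status : ∀ v < n, mem (5 * m + n + v) = st v
  name : ∀ v < n, mem (5 * m + 2 * n + v) = nm v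
  key : ∀ v < n, mem (5 * m + 3 * n + v) = ky v
  edge : ∀ v < n, mem (5 * m + 4 * n + v) = ed v

section

variable {n m u : ℕ} {mem mem' st nm ky ed : ℕ → ℕ} (h : View n m mem st nm ky ed)
include h

theorem View.congr (hm : ∀ a < 5 * m + 5 * n, mem' a = mem a) : View n m mem' st nm ky ed :=
  ⟨fun v hv => (hm _ (by omega)).trans (h.status v hv),
    fun v hv => (hm _ (by omega)).trans (h.name v hv),
    fun v hv => (hm _ (by omega)).trans (h.key v hv),
    fun v hv => (hm _ (by omega)).trans (h.edge v hv)⟩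

theorem View.update_status (hu : u < n) (x : ℕ) :
    View n m (update mem (5 * m + n + u) x) (update st u x) nm ky ed := by
  refine ⟨fun v hv => ?_, fun v hv => ?_, fun v hv => ?_, fun v hv => ?_⟩
  · by_cases hvu : v = u
    · subst hvu; rw [update_self, update_self]
    · rw [update_of_ne hvu, update_of_ne (by omega), h.status v hv]
  · rw [update_of_ne (by omega), h.name v hv]
  · rw [update_of_ne (by omega), h.key v hv]
  · rw [update_of_ne (by omega), h.edge v hv]

theorem View.update_name (hu : u < n) (x : ℕ) :
    View n m (update mem (5 * m + 2 * n + u) x) st (update nm u x) ky ed := by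
  refine ⟨fun v hv => ?_, fun v hv => ?_, fun v hv => ?_, fun v hv => ?_⟩
  · rw [update_of_ne (by omega), h.status v hv]
  · by_cases hvu : v = u
    · subst hvu; rw [update_self, update_self]
    · rw [update_of_ne hvu, update_of_ne (by omega), h.name v hv]
  · rw [update_of_ne (by omega), h.key v hv]
  · rw [update_of_ne (by omega), h.edge v hv]

theorem View.update_key (hu : u < n) (x : ℕ) :
    View n m (update mem (5 * m + 3 * n + u) x) st nm (update ky u x) ed := by
  refine ⟨fun v hv => ?_, fun v hv => ?_, fun v hv => ?_, fun v hv => ?_⟩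
  · rw [update_of_ne (by omega), h.status v hv]
  · rw [update_of_ne (by omega), h.name v hv]
  · by_cases hvu : v = u
    · subst hvu; rw [update_self, update_self]
    · rw [update_of_ne hvu, update_of_ne (by omega), h.key v hv]
  · rw [update_of_ne (by omega), h.edge v hv]

theorem View.update_edge (hu : u < n) (x : ℕ) :
    View n m (update mem (5 * m + 4 * n + u) x) st nm ky (update ed u x) := by
  refine ⟨fun v hv => ?_, fun v hv => ?_, fun v hv => ?_, fun v hv => ?_⟩
  · rw [update_of_ne (by omega), h.status v hv]
  · rw [update_of_ne (by omega), h.name v hv]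
  · rw [update_of_ne (by omega), h.key v hv]
  · by_cases hvu : v = u
    · subst hvu; rw [update_self, update_self]
    · rw [update_of_ne hvu, update_of_ne (by omega), h.edge v hv]

end

/-- The invariant of Prim's algorithm, when the half-edges in `D` have been examined. -/
structure Inv (M : ℕ → ℕ) (n m : ℕ) (f : ℕ → ℕ) (Rep : (ℕ → ℕ) → List Item → Prop)
    (mem st nm ky ed : ℕ → ℕ) (D : Set ℕ) (L : List Item) : Prop where
  input : ∀ a < 3 * m, mem a = M a
  adjacent : Adjacent M n m (2 * m) mem
  view : View n m mem st nm ky ed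
  rep : Rep mem L
  queue : Queue n st nm ky L
  front : Front M n m f st ky ed D

/-- The first part of `Prim.relax`. -/
def Prim.relaxDelete (V : VEBCode) : Cmd :=
  .ite (.bin .band (.bin .eq (.load (status + u)) 1) (.bin .lt x (.load (key + u))))
    (.call N V.delete [q, .load (name + u)] ;;
      .store (status + u) 0)
    .skip

/-- The second part of `Prim.relax`. -/
def Prim.relaxInsert (V : VEBCode) : Cmd :=
  .ite (.bin .eq (.load (status + u)) 0)
    (.store (status + u) 1 ;;
      .store (key + u) x ;;
      .store (edge + u) e ;;
      .call N V.insert [q, x, u] ;;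
      .store (name + u) N)
    .skip

section

variable {V : VEBCode} {b U n m T : ℕ} {f st nm ky ed : ℕ → ℕ}
  {Rep : (ℕ → ℕ) → List Item → Prop} (hQ : IsQueue V b U n (5 * m + 5 * n) f T Rep)
  (hb : 5 * m + 5 * n + 3 < 2 ^ b) {s : State} {L : List Item} (hs : Laid n m s.regs)
  (hv : View n m s.mem st nm ky ed) (hr : Rep s.mem L) (hq : Queue n st nm ky L)
  {u x : ℕ} (hu : s.regs Prim.u = u) (hun : u < n) (hx : s.regs Prim.x = x)
include hQ hb hs hv hr hq hu hun hx

theorem halts_relaxDelete : Halts b (Prim.relaxDelete V) s (30 + T) (fun s' =>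
    (∀ r, r ≠ Prim.N → s'.regs r = s.regs r) ∧ (∀ a < 5 * m + n, s'.mem a = s.mem a) ∧
    ∃ st' L', View n m s'.mem st' nm ky ed ∧ Rep s'.mem L' ∧ Queue n st' nm ky L' ∧
      ((st' = st ∧ ¬ (st u = 1 ∧ x < ky u)) ∨
        (st u = 1 ∧ x < ky u ∧ st' = update st u 0))) := by
  have h₁ := hs.status
  have h₂ := hs.key
  have h₃ := hs.name
  have h₄ := hs.q
  have h₅ := hv.status u hun
  have h₆ := hv.key u hun
  have h₇ := hv.name u hun
  have hcond : (Expr.bin .band (.bin .eq (.load (Prim.status + Prim.u)) 1)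
      (.bin .lt Prim.x (.load (Prim.key + Prim.u)))).eval b s =
      if st u = 1 ∧ x < ky u then 1 else 0 := by
    simp (disch := first | decide | omega) only [eval_rules, eval_binOp_rules, eval_lit, eval_add,
      h₁, h₂, hu, hx, h₅, h₆]
    by_cases c₁ : st u = 1
    · by_cases c₂ : x < ky u
      · rw [eval_eq_pos c₁, eval_lt_pos c₂, if_pos ⟨c₁, c₂⟩]; rfl
      · rw [eval_lt_neg (not_lt.1 c₂), if_neg fun h => c₂ h.2, Nat.and_zero]
    · rw [eval_eq_neg c₁, if_neg fun h => c₁ h.1, Nat.zero_and]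
  refine (Halts.ite (T := T + 14) (fun hc => ?_) fun hc => ?_).mono ?_ fun _ h => h
  · rw [hcond] at hc
    have hc' : st u = 1 ∧ x < ky u := by
      by_contra h
      exact hc (if_neg h)
    obtain ⟨it, hit, hd⟩ := hq.exists_item u hun hc'.1
    have hN : nm u = it.name := by rw [← hd]; exact (hq.item it hit).2.2.1
    refine (Halts.call_seq (R := fun r mem' => (∀ a < 5 * m + 5 * n, mem' a = s.mem a) ∧
        Rep mem' (L.filter (fun it' => it'.name ≠ it.name))) (T₁ := T) (T₂ := 5) ?_ ?_).mono ?_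
      fun _ h => h
    · have e : List.map (Expr.eval b s) [(Prim.q : Expr), .load (Prim.name + Prim.u)] =
          (5 * m + 5 * n) :: (Op.delete it.name).args := by
        simp (disch := first | decide | omega) only [List.map, eval_rules, eval_add, h₃, h₄, hu,
          h₇, hN, Op.args]
      rw [e]
      refine (hQ.returns (.delete it.name) s.mem L hr ⟨it, hit, rfl⟩).mono le_rfl ?_
      rintro r mem' ⟨hm, L', rfl, hL'⟩
      exact ⟨hm, hL'⟩
    · rintro r mem' ⟨hm, hL'⟩
      refine (Halts.of_run (c := .store (Prim.status + Prim.u) 0) trivial ?_).mono (by decide)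
        fun _ h => h
      have e : (Cmd.store (Prim.status + Prim.u) 0).run b ⟨update s.regs Prim.N r, mem'⟩ =
          ⟨update s.regs Prim.N r, update mem' (5 * m + n + u) 0⟩ := by
        simp (disch := first | decide | omega) only [Cmd.run, eval_rules, eval_lit, eval_add,
          update_of_ne, h₁, hu]
      rw [e]
      refine ⟨fun y hy => update_of_ne hy _ _, fun a ha => ?_, update st u 0, _,
        (hv.congr hm).update_status hun 0, hQ.congr _ _ _ (fun a ha => update_of_ne (by omega) _ _)
          hL', ?_, Or.inr ⟨hc'.1, hc'.2, rfl⟩⟩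
      · change update mem' _ _ a = _
        rw [update_of_ne (by omega), hm a (by omega)]
      · rw [← hd]
        exact hq.delete (hQ.consistent _ _ hr) hit (by decide)
    · have : (List.map Expr.cost [(Prim.q : Expr), .load (Prim.name + Prim.u)]).sum = 5 := rfl
      omega
  · rw [hcond] at hc
    have hc' : ¬ (st u = 1 ∧ x < ky u) := fun h => by rw [if_pos h] at hc; exact one_ne_zero hc
    exact (Halts.of_run (c := .skip) trivial ⟨fun _ _ => rfl, fun _ _ => rfl, st, L, hv, hr, hq,
      Or.inl ⟨rfl, hc'⟩⟩).mono (by simp [Cmd.len]) fun _ h => h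
  · have : (Expr.bin .band (.bin .eq (.load (Prim.status + Prim.u)) 1)
      (.bin .lt Prim.x (.load (Prim.key + Prim.u)))).cost = 13 := rfl
    omega

theorem halts_relaxInsert {e : ℕ} (he : s.regs Prim.e = e) (hxU : x ≤ U) (hU : U < 2 ^ b) :
    Halts b (Prim.relaxInsert V) s (50 + T) (fun s' =>
      (∀ r, r ≠ Prim.N → s'.regs r = s.regs r) ∧ (∀ a < 5 * m + n, s'.mem a = s.mem a) ∧
      ((st u ≠ 0 ∧ s'.mem = s.mem) ∨ (st u = 0 ∧ ∃ r L',
        View n m s'.mem (update st u 1) (update nm u r) (update ky u x) (update ed u e) ∧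
        Rep s'.mem L' ∧ Queue n (update st u 1) (update nm u r) (update ky u x) L'))) := by
  have h₁ := hs.status
  have h₂ := hs.key
  have h₃ := hs.name
  have h₄ := hs.q
  have h₈ := hs.edge
  have h₅ := hv.status u hun
  have hcond : (Expr.bin .eq (.load (Prim.status + Prim.u)) 0).eval b s =
      if st u = 0 then 1 else 0 := by
    simp (disch := first | decide | omega) only [eval_rules, eval_lit, eval_add, h₁, hu, h₅]
    rfl
  obtain ⟨mem₁, hmem₁⟩ : ∃ mem₁, mem₁ = update (update (update s.mem (5 * m + n + u) 1)
    (5 * m + 3 * n + u) x) (5 * m + 4 * n + u) e := ⟨_, rfl⟩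
  have hrun : (Cmd.store (Prim.edge + Prim.u) Prim.e).run b
      ((Cmd.store (Prim.key + Prim.u) Prim.x).run b
        ((Cmd.store (Prim.status + Prim.u) 1).run b s)) = ⟨s.regs, mem₁⟩ := by
    rw [hmem₁]
    simp (disch := first | decide | omega) only [Cmd.run, eval_rules, eval_lit, eval_add,
      h₁, h₂, h₈, hu, hx, he]
  refine (Halts.ite (T := T + 40) (fun hc => ?_) fun hc => ?_).mono ?_ fun _ h => h
  · rw [hcond] at hc
    have hc' : st u = 0 := by
      by_contra h
      exact hc (if_neg h)
    refine (Halts.run_seq (c₁ := .store (Prim.status + Prim.u) 1) trivial <|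
      Halts.run_seq (c₁ := .store (Prim.key + Prim.u) Prim.x) trivial <|
      Halts.run_seq (c₁ := .store (Prim.edge + Prim.u) Prim.e) trivial <|
      Halts.call_seq (R := fun r mem' => (∀ a < 5 * m + 5 * n, mem' a = mem₁ a) ∧ ∃ A B, L = A ++ B ∧
        Rep mem' (A ++ ⟨r, x, u⟩ :: B)) (T₁ := T) (T₂ := 5) ?_ ?_).mono ?_ fun _ h => h
    · rw [hrun]
      have ea : List.map (Expr.eval b ⟨s.regs, mem₁⟩) [(Prim.q : Expr), Prim.x, Prim.u] =
          (5 * m + 5 * n) :: (Op.insert x u).args := by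
        simp only [List.map, eval_rules, h₄, hu, hx, Op.args]
      rw [ea]
      have hr₁ : Rep mem₁ L := hQ.congr _ _ _ (fun a ha => by
        rw [hmem₁, update_of_ne (by omega), update_of_ne (by omega), update_of_ne (by omega)]) hr
      refine (hQ.returns (.insert x u) mem₁ L hr₁ ⟨hxU, by omega,
        hq.length_lt (hQ.consistent _ _ hr) hun (by omega)⟩).mono le_rfl ?_
      rintro r mem' ⟨hm, L', ⟨A, B, rfl, rfl⟩, hL'⟩
      exact ⟨hm, A, B, rfl, hL'⟩
    · rintro r mem' ⟨hm, A, B, rfl, hL'⟩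
      rw [hrun]
      refine (Halts.of_run (c := .store (Prim.name + Prim.u) Prim.N) trivial ?_).mono (by decide)
        fun _ h => h
      have er : (Cmd.store (Prim.name + Prim.u) Prim.N).run b ⟨update s.regs Prim.N r, mem'⟩ =
          ⟨update s.regs Prim.N r, update mem' (5 * m + 2 * n + u) r⟩ := by
        simp (disch := first | decide | omega) only [Cmd.run, eval_rules, eval_lit, eval_add,
          update_of_ne, update_self, h₃, hu]
      rw [er]
      have hv₁ := ((hv.update_status hun 1).update_key hun x).update_edge hun e
      rw [← hmem₁] at hv₁
      refine ⟨fun y hy => update_of_ne hy _ _, fun a ha => ?_, Or.inr ⟨hc', r, _,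
        (hv₁.congr hm).update_name hun r,
        hQ.congr _ _ _ (fun a ha => update_of_ne (by omega) _ _) hL',
        hq.insert hun (by omega)⟩⟩
      change update mem' _ _ a = _
      rw [update_of_ne (by omega), hm a (by omega), hmem₁, update_of_ne (by omega),
        update_of_ne (by omega), update_of_ne (by omega)]
    · have : (List.map Expr.cost [(Prim.q : Expr), Prim.x, Prim.u]).sum = 3 := rfl
      have : (Cmd.store (Prim.status + Prim.u) 1).len = 5 := rfl
      have : (Cmd.store (Prim.key + Prim.u) Prim.x).len = 5 := rfl
      have : (Cmd.store (Prim.edge + Prim.u) Prim.e).len = 5 := rfl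
      omega
  · rw [hcond] at hc
    have hc' : st u ≠ 0 := fun h => by rw [if_pos h] at hc; exact one_ne_zero hc
    exact (Halts.of_run (c := .skip) trivial ⟨fun _ _ => rfl, fun _ _ => rfl,
      Or.inl ⟨hc', rfl⟩⟩).mono (by simp [Cmd.len]) fun _ h => h
  · have : (Expr.bin .eq (.load (Prim.status + Prim.u)) 0).cost = 6 := rfl
    omega

end

theorem halts_relax {V : VEBCode} {b U n m T : ℕ} {M f st nm ky ed : ℕ → ℕ}
    {Rep : (ℕ → ℕ) → List Item → Prop} (hQ : IsQueue V b U n (5 * m + 5 * n) f T Rep)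
    (hb : 5 * m + 5 * n + 3 < 2 ^ b) (hU : U < 2 ^ b) {s : State} {L : List Item} {D : Set ℕ}
    (hs : Laid n m s.regs) (hI : Inv M n m f Rep s.mem st nm ky ed D L) {k : ℕ} (hk : k < 2 * m)
    (hsrc : src M k < n) (htgt : tgt M k < n) (hw : wt M k ≤ U) (hst : st (src M k) = 2)
    (hu : s.regs Prim.u = tgt M k) (hx : s.regs Prim.x = wt M k) (he : s.regs Prim.e = k / 2) :
    Halts b (Prim.relax V) s (2 * T + 80) (fun s' =>
      (∀ r, r ≠ Prim.N → s'.regs r = s.regs r) ∧ (∀ a < 5 * m + n, s'.mem a = s.mem a) ∧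
      ∃ st' nm' ky' ed' L', Inv M n m f Rep s'.mem st' nm' ky' ed' (insert k D) L' ∧ ∀ v, st' v = 2 ↔ st v = 2) := by
  refine (Halts.seq (T₂ := 50 + T) ((halts_relaxDelete hQ hb hs hI.view hI.rep hI.queue hu htgt
    hx).mono le_rfl ?_)).mono (by omega : 30 + T + (50 + T) ≤ _) fun _ h => h
  rintro s₁ ⟨hr₁, hm₁, st₁, L₁, hv₁, hR₁, hq₁, hst₁⟩
  have hs₁ : Laid n m s₁.regs := by
    constructor
    · rw [hr₁ _ (by decide), hs.head]
    · rw [hr₁ _ (by decide), hs.next]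
    · rw [hr₁ _ (by decide), hs.status]
    · rw [hr₁ _ (by decide), hs.name]
    · rw [hr₁ _ (by decide), hs.key]
    · rw [hr₁ _ (by decide), hs.edge]
    · rw [hr₁ _ (by decide), hs.q]
  refine (halts_relaxInsert hQ hb hs₁ hv₁ hR₁ hq₁ ((hr₁ _ (by decide)).trans hu) htgt
    ((hr₁ _ (by decide)).trans hx) ((hr₁ _ (by decide)).trans he) hw hU).mono le_rfl ?_
  rintro s₂ ⟨hr₂, hm₂, h⟩
  have hm : ∀ a < 5 * m + n, s₂.mem a = s.mem a := fun a ha => (hm₂ a ha).trans (hm₁ a ha)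
  refine ⟨fun r hr => (hr₂ r hr).trans (hr₁ r hr), hm, ?_⟩
  have hin : ∀ a < 3 * m, s₂.mem a = M a := fun a ha =>
    (hm a (by omega)).trans (hI.input a ha)
  have hst_le := hI.front.st_le _ htgt
  rcases h with ⟨h0, e⟩ | ⟨h0, r, L', hv', hR', hq'⟩
  · have hst' : st₁ = st ∧ ¬ (st (tgt M k) = 1 ∧ wt M k < ky (tgt M k)) := by
      refine hst₁.resolve_right fun h => h0 ?_
      rw [h.2.2, update_self]
    obtain ⟨rfl, hc⟩ := hst'
    refine ⟨st₁, nm, ky, ed, L₁, ⟨hin, hI.adjacent.congr hm, e ▸ hv₁, e ▸ hR₁, hq₁,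
      hI.front.insert_of_le (by omega)⟩, fun _ => Iff.rfl⟩
  · have hst' : update st₁ (tgt M k) 1 = update st (tgt M k) 1 ∧
        (st (tgt M k) = 0 ∨ st (tgt M k) = 1 ∧ wt M k < ky (tgt M k)) := by
      rcases hst₁ with ⟨rfl, -⟩ | ⟨h₁, h₂, rfl⟩
      · exact ⟨rfl, Or.inl h0⟩
      · exact ⟨update_idem .., Or.inr ⟨h₁, h₂⟩⟩
    rw [hst'.1] at hv' hq'
    refine ⟨_, _, _, _, L', ⟨hin, hI.adjacent.congr hm, hv', hR', hq',
      hI.front.relax hk htgt hsrc hst hst'.2⟩, fun v => ?_⟩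
    rw [update_apply]
    split_ifs with hvu
    · subst hvu; omega
    · rfl

/-! ### Prim's algorithm -/

theorem Laid.congr {n m : ℕ} {r r' : Reg → ℕ} (h : Laid n m r)
    (hr : ∀ x : Reg, x.idx < 12 → r' x = r x) : Laid n m r' :=
  ⟨(hr _ (by decide)).trans h.head, (hr _ (by decide)).trans h.next,
    (hr _ (by decide)).trans h.status, (hr _ (by decide)).trans h.name,
    (hr _ (by decide)).trans h.key, (hr _ (by decide)).trans h.edge, (hr _ (by decide)).trans h.q⟩

/-- The body of the loop of `Prim.scan`. -/
def Prim.scanStep (V : VEBCode) : Cmd :=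
  e ::= (h - 1) / 2 ;;
  u ::= .load (3 * e + .bin .band h 1) ;;
  x ::= .load (3 * e + 2) ;;
  relax V ;;
  h ::= .load (next + h - 1)

section

variable {V : VEBCode} {b U n m T : ℕ} {M f : ℕ → ℕ}
  {Rep : (ℕ → ℕ) → List Item → Prop} (hQ : IsQueue V b U n (5 * m + 5 * n) f T Rep)
  (hb : 5 * m + 5 * n + 3 < 2 ^ b) (hU : U < 2 ^ b) (hsrc : ∀ k < 2 * m, src M k < n)
  (htgt : ∀ k < 2 * m, tgt M k < n) (hw : ∀ k < 2 * m, wt M k ≤ U)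
include hQ hb hU hsrc htgt hw

theorem halts_scanStep {st nm ky ed : ℕ → ℕ} {s : State} {L : List Item} {D : Set ℕ}
    (hs : Laid n m s.regs) (hI : Inv M n m f Rep s.mem st nm ky ed D L) {k : ℕ} (hk : k < 2 * m)
    (hst : st (src M k) = 2) (hh : s.regs Prim.h = k + 1) :
    Halts b (Prim.scanStep V) s (2 * T + 110) (fun s' =>
      Laid n m s'.regs ∧ s'.regs Prim.h = s.mem (3 * m + n + k) ∧
      (∀ a < 5 * m + n, s'.mem a = s.mem a) ∧
      ∃ st' nm' ky' ed' L', Inv M n m f Rep s'.mem st' nm' ky' ed' (insert k D) L' ∧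
        ∀ v, st' v = 2 ↔ st v = 2) := by
  obtain ⟨s₁, hs₁⟩ : ∃ s₁, s₁ = (Prim.x ::= .load (3 * Prim.e + 2)).run b
    ((Prim.u ::= .load (3 * Prim.e + .bin .band Prim.h 1)).run b
      ((Prim.e ::= (Prim.h - 1) / 2).run b s)) := ⟨_, rfl⟩
  have e₁ : k + 1 - 1 = k := rfl
  have hmod : (k + 1) % 2 < 2 := Nat.mod_lt _ (by omega)
  have e₂ : s.mem (3 * (k / 2) + (k + 1) % 2) = tgt M k := hI.input _ (by omega)
  have e₃ : s.mem (3 * (k / 2) + 2) = wt M k := hI.input _ (by omega)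
  have hL : Laid n m s₁.regs := by
    rw [hs₁]
    exact ((hs.update (by decide) _).update (by decide) _).update (by decide) _
  have hmem : s₁.mem = s.mem := by rw [hs₁]; rfl
  have hr : s₁.regs Prim.e = k / 2 ∧ s₁.regs Prim.u = tgt M k ∧ s₁.regs Prim.x = wt M k ∧
      s₁.regs Prim.h = k + 1 := by
    rw [hs₁]
    simp (disch := first | decide | omega) only [Cmd.run, eval_rules, eval_binOp_rules, eval_lit,
      eval_add, eval_mul, eval_sub, update_self, update_of_ne, hh, e₁, e₂, e₃, Nat.and_one_is_mod,
      and_self]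
  refine (Halts.run_seq (c₁ := Prim.e ::= (Prim.h - 1) / 2) trivial <|
    Halts.run_seq (c₁ := Prim.u ::= .load (3 * Prim.e + .bin .band Prim.h 1)) trivial <|
    Halts.run_seq (c₁ := Prim.x ::= .load (3 * Prim.e + 2)) trivial <|
    Halts.seq (T₁ := 2 * T + 80) (T₂ := 7) ?_).mono ?_ fun _ h => h
  · rw [← hs₁]
    refine (halts_relax hQ hb hU hL (hmem ▸ hI) hk (hsrc k hk) (htgt k hk) (hw k hk) hst
      hr.2.1 hr.2.2.1 hr.1).mono le_rfl ?_
    rintro s₂ ⟨hr₂, hm₂, st', nm', ky', ed', L', hI', hst'⟩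
    have hL₂ : Laid n m s₂.regs := hL.congr fun y hy => hr₂ y (by rintro rfl; exact absurd hy (by decide))
    refine (Halts.of_run (c := Prim.h ::= .load (Prim.next + Prim.h - 1)) trivial
      ⟨hL₂.update (by decide) _, ?_, fun a ha => (hm₂ a ha).trans (by rw [hmem]), st', nm', ky',
        ed', L', hI', hst'⟩).mono (by decide) fun _ h => h
    have e₄ : 3 * m + n + (k + 1) - 1 = 3 * m + n + k := rfl
    simp (disch := first | decide | omega) only [Cmd.run, eval_rules, eval_lit,
      eval_add, eval_sub, update_self, hL₂.next, hr₂ Prim.h (by decide), hr.2.2.2, e₄]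
    rw [hm₂ _ (by omega), hmem]
  · have : (Prim.e ::= (Prim.h - 1) / 2).len = 6 := rfl
    have : (Prim.u ::= .load (3 * Prim.e + .bin .band Prim.h 1)).len = 9 := rfl
    have : (Prim.x ::= .load (3 * Prim.e + 2)).len = 7 := rfl
    omega

theorem halts_scanLoop {l : List ℕ} {st nm ky ed : ℕ → ℕ} {s : State} {L : List Item} {D : Set ℕ}
    (hs : Laid n m s.regs) (hI : Inv M n m f Rep s.mem st nm ky ed D L)
    (hl : ∀ k ∈ l, k < 2 * m ∧ st (src M k) = 2)
    (hh : Follows (fun k => s.mem (3 * m + n + k)) (s.regs Prim.h) l) :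
    Halts b (.while Prim.h (Prim.scanStep V)) s (l.length * (2 * T + 112) + 2) (fun s' =>
      Laid n m s'.regs ∧
      ∃ st' nm' ky' ed' L', Inv M n m f Rep s'.mem st' nm' ky' ed' (D ∪ {k | k ∈ l}) L' ∧
        ∀ v, st' v = 2 ↔ st v = 2) := by
  induction l generalizing s st nm ky ed L D with
  | nil =>
    refine (Halts.while_false (e := Prim.h) hh ⟨hs, st, nm, ky, ed, L, ?_, fun _ => Iff.rfl⟩).mono
      (by simp [Expr.cost]) fun _ h => h
    convert hI using 1
    simp
  | cons k l ih =>
    obtain ⟨hk, hst⟩ := hl k (by simp)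
    refine (Halts.while_true (e := Prim.h) (T₁ := 2 * T + 110)
      (T₂ := l.length * (2 * T + 112) + 2) ?_
      ((halts_scanStep hQ hb hU hsrc htgt hw hs hI hk hst hh.1).mono le_rfl ?_)).mono ?_
      fun _ h => h
    · rw [Expr.eval, hh.1]; omega
    · rintro s₁ ⟨hs₁, hh₁, hm₁, st₁, nm₁, ky₁, ed₁, L₁, hI₁, hst₁⟩
      refine (ih hs₁ hI₁ (fun k' hk' => ?_) ?_).mono le_rfl ?_
      · exact ⟨(hl k' (by simp [hk'])).1, (hst₁ _).2 (hl k' (by simp [hk'])).2⟩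
      · rw [hh₁]
        exact hh.2.congr fun k' hk' => hm₁ _ (by have := (hl k' (by simp [hk'])).1; omega)
      · rintro s₂ ⟨hs₂, st₂, nm₂, ky₂, ed₂, L₂, hI₂, hst₂⟩
        refine ⟨hs₂, st₂, nm₂, ky₂, ed₂, L₂, ?_, fun v => (hst₂ v).trans (hst₁ v)⟩
        convert hI₂ using 1
        ext k'
        simp only [Set.mem_union, Set.mem_ofPred_eq, List.mem_cons, Set.mem_insert_iff]
        tauto
    · have : (Expr.reg Prim.h).cost = 1 := rfl
      rw [List.length_cons, add_mul, one_mul]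
      omega

theorem halts_scan (hf : ∀ x y, x ≤ y → y ≤ U → f x ≤ f y)
    {st nm ky ed : ℕ → ℕ} {s : State} {it : Item} {L : List Item}
    (hs : Laid n m s.regs)
    (hI : Inv M n m f Rep s.mem st nm ky ed {k | st (src M k) = 2} (it :: L))
    (hN : s.regs Prim.N = it.name) :
    Halts b (Prim.scan V) s (2 * T + 30 + (halfEdges M it.data (2 * m)).length * (2 * T + 112))
      (fun s' => Laid n m s'.regs ∧
      ∃ st' nm' ky' ed' L', Inv M n m f Rep s'.mem st' nm' ky' ed' {k | st' (src M k) = 2} L' ∧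
        ∀ v, st' v = 2 ↔ st v = 2 ∨ v = it.data) := by
  have hq := hs.q
  have hc := hQ.consistent _ _ hI.rep
  obtain ⟨hvn, hv1, hvN, hvk⟩ := hI.queue.item it (by simp)
  have args : ∀ (s : State), s.regs Prim.q = 5 * m + 5 * n → s.regs Prim.N = it.name →
      List.map (Expr.eval b s) [(Prim.q : Expr), Prim.N] = [5 * m + 5 * n, it.name] := by
    intro s h₁ h₂
    simp only [List.map, eval_rules, h₁, h₂]
  refine (Halts.call_seq (R := fun r mem' => r = it.data ∧
    (∀ a < 5 * m + 5 * n, mem' a = s.mem a) ∧ Rep mem' (it :: L)) (T₁ := T)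
    (T₂ := T + 26 + (halfEdges M it.data (2 * m)).length * (2 * T + 112)) ?_ ?_).mono ?_ fun _ h => h
  · rw [args s hq hN]
    refine (hQ.returns (.data it.name) s.mem _ hI.rep ⟨it, by simp, rfl⟩).mono le_rfl ?_
    rintro r mem' ⟨hm, L', ⟨rfl, it', hit', hname, rfl⟩, hR⟩
    rw [List.inj_on_of_nodup_map hc.1 hit' (by simp : it ∈ it :: L) hname]
    exact ⟨rfl, hm, hR⟩
  · rintro _ mem₁ ⟨rfl, hm₁, hR₁⟩
    refine (Halts.call_seq (R := fun _ mem' => (∀ a < 5 * m + 5 * n, mem' a = mem₁ a) ∧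
      Rep mem' ((it :: L).filter fun it' => it'.name ≠ it.name)) (T₁ := T)
      (T₂ := 22 + (halfEdges M it.data (2 * m)).length * (2 * T + 112)) ?_ ?_).mono ?_ fun _ h => h
    · rw [args]
      · refine (hQ.returns (.delete it.name) mem₁ _ hR₁ ⟨it, by simp, rfl⟩).mono le_rfl ?_
        rintro r mem' ⟨hm, L', rfl, hR⟩
        exact ⟨hm, hR⟩
      · exact (update_of_ne (a := Prim.q) (a' := Prim.v) (by decide) it.data s.regs).trans hq
      · exact (update_of_ne (a := Prim.N) (a' := Prim.v) (by decide) it.data s.regs).trans hN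
    · rintro r mem₂ ⟨hm₂, hR₂⟩
      obtain ⟨s₃, hs₃⟩ : ∃ s₃, s₃ = (Prim.h ::= .load (Prim.head + Prim.v)).run b
        ((Cmd.store (Prim.status + Prim.v) 2).run b
          ⟨update (update s.regs Prim.v it.data) Prim.N r, mem₂⟩) := ⟨_, rfl⟩
      have hL₃ : Laid n m s₃.regs := by
        rw [hs₃]
        exact ((hs.update (by decide) _).update (by decide) _).update (by decide) _
      have hm₂₁ : ∀ a < 5 * m + 5 * n, mem₂ a = s.mem a := fun a ha =>
        (hm₂ a ha).trans (hm₁ a ha)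
      have hmem₃ : s₃.mem = update mem₂ (5 * m + n + it.data) 2 := by
        rw [hs₃]
        simp (disch := first | decide | omega) only [Cmd.run, eval_rules, eval_lit,
          eval_add, update_self, update_of_ne, hs.status]
      have hm₃ : ∀ a < 5 * m + n, s₃.mem a = s.mem a := fun a ha => by
        rw [hmem₃, update_of_ne (by omega), hm₂₁ a (by omega)]
      have hh₃ : s₃.regs Prim.h = s₃.mem (3 * m + it.data) := by
        rw [hmem₃, hs₃]
        simp (disch := first | decide | omega) only [Cmd.run, eval_rules, eval_lit,
          eval_add, update_self, update_of_ne, hs.status, hs.head]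
      have hI₃ : Inv M n m f Rep s₃.mem (update st it.data 2) nm ky ed {k | st (src M k) = 2}
          ((it :: L).filter fun it' => it'.name ≠ it.name) := by
        refine ⟨fun a ha => (hm₃ a (by omega)).trans (hI.input a ha), hI.adjacent.congr hm₃, ?_,
          ?_, hI.queue.delete hc (by simp) (by decide),
          hI.front.extract hf hw hsrc htgt hvn hv1 fun u hu hu1 => ?_⟩
        · rw [hmem₃]
          exact (hI.view.congr hm₂₁).update_status hvn 2
        · rw [hmem₃]
          exact hQ.congr _ _ _ (fun a ha => update_of_ne (by omega) _ _) hR₂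
        · obtain ⟨it', hit', rfl⟩ := hI.queue.exists_item u hu hu1
          rw [hvk, (hI.queue.item it' hit').2.2.2]
          rcases List.mem_cons.1 hit' with rfl | hit'
          · exact le_rfl
          · exact (List.pairwise_cons.1 hc.2.2).1 it' hit'
      refine (Halts.run_seq (c₁ := .store (Prim.status + Prim.v) 2) trivial <|
        Halts.run_seq (c₁ := Prim.h ::= .load (Prim.head + Prim.v)) trivial <|
        (?_ : Halts b (.while Prim.h (Prim.scanStep V)) _
          ((halfEdges M it.data (2 * m)).length * (2 * T + 112) + 2) _)).mono ?_ fun _ h => h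
      · rw [← hs₃]
        refine (halts_scanLoop hQ hb hU hsrc htgt hw hL₃ hI₃ (fun k hk => ?_)
          (hh₃ ▸ hI₃.adjacent _ hvn)).mono le_rfl ?_
        · rw [(mem_halfEdges.1 hk).2, update_self]
          exact ⟨(mem_halfEdges.1 hk).1, rfl⟩
        · rintro s₄ ⟨hs₄, st₄, nm₄, ky₄, ed₄, L₄, hI₄, hst₄⟩
          have hst : ∀ v, st₄ v = 2 ↔ st v = 2 ∨ v = it.data := by
            intro v
            rw [hst₄, update_apply]
            split_ifs with h <;> simp [h]
          refine ⟨hs₄, st₄, nm₄, ky₄, ed₄, L₄, ⟨hI₄.input, hI₄.adjacent, hI₄.view, hI₄.rep,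
            hI₄.queue, { hI₄.front with done := fun k hk hkm => hI₄.front.done k ?_ hkm }⟩, hst⟩
          rcases (hst _).1 hk with h | h
          · exact Or.inl h
          · exact Or.inr (mem_halfEdges.2 ⟨hkm, h⟩)
      · have : (Cmd.store (Prim.status + Prim.v) 2).len = 5 := rfl
        have : (Prim.h ::= .load (Prim.head + Prim.v)).len = 5 := rfl
        omega
    · have : (List.map Expr.cost [(Prim.q : Expr), Prim.N]).sum = 2 := rfl
      omega
  · have : (List.map Expr.cost [(Prim.q : Expr), Prim.N]).sum = 2 := rfl
    omega

/-- The loop of Prim's algorithm. The potential `W` pays for the vertices outside the tree and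
their half-edges. -/
theorem halts_primLoop (hf : ∀ x y, x ≤ y → y ≤ U → f x ≤ f y) {W : ℕ}
    {st nm ky ed : ℕ → ℕ} {s : State} {L : List Item} (hs : Laid n m s.regs)
    (hI : Inv M n m f Rep s.mem st nm ky ed {k | st (src M k) = 2} L)
    (hN : s.regs Prim.N = nameOrNil L.head?)
    (hW : ∑ v ∈ Finset.range n, (if st v = 2 then 0 else
      3 * T + 40 + (halfEdges M v (2 * m)).length * (2 * T + 112)) ≤ W) :
    Halts b (.while Prim.N (.seq (Prim.scan V) (.call Prim.N V.minimum [Prim.q]))) s (W + 2)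
      (fun s' => Laid n m s'.regs ∧ ∃ st' nm' ky' ed',
        Inv M n m f Rep s'.mem st' nm' ky' ed' {k | st' (src M k) = 2} []) := by
  induction W using Nat.strong_induction_on generalizing s st nm ky ed L with
  | _ W ih =>
  rcases L with - | ⟨it, L⟩
  · exact (Halts.while_false (e := Prim.N) hN ⟨hs, st, nm, ky, ed, hI⟩).mono
      (by simp [Expr.cost]) fun _ h => h
  · have hc := hQ.consistent _ _ hI.rep
    obtain ⟨hvn, hv1, -⟩ := hI.queue.item it (by simp)
    obtain ⟨c, hcost⟩ : ∃ c, c = (halfEdges M it.data (2 * m)).length * (2 * T + 112) := ⟨_, rfl⟩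
    have hsum : ∀ st' : ℕ → ℕ, (∀ v, st' v = 2 ↔ st v = 2 ∨ v = it.data) →
        ∑ v ∈ Finset.range n, (if st' v = 2 then 0 else
          3 * T + 40 + (halfEdges M v (2 * m)).length * (2 * T + 112)) + (3 * T + 40 + c) ≤ W := by
      intro st' hst'
      refine le_trans (le_of_eq ?_) hW
      have e : ∀ v, (if st v = 2 then 0 else
          3 * T + 40 + (halfEdges M v (2 * m)).length * (2 * T + 112)) = (if st' v = 2 then 0 else
          3 * T + 40 + (halfEdges M v (2 * m)).length * (2 * T + 112)) +
          if v = it.data then 3 * T + 40 + c else 0 := by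
        intro v
        by_cases hv : v = it.data
        · subst hv
          rw [if_neg (by omega), if_pos ((hst' _).2 (Or.inr rfl)), if_pos rfl, hcost, zero_add]
        · simp [hst', hv]
      rw [Finset.sum_congr rfl fun v _ => e v, Finset.sum_add_distrib, Finset.sum_ite_eq',
        if_pos (Finset.mem_range.2 hvn)]
    have hW' := hsum (update st it.data 2) (fun v => by
      rw [update_apply]
      split_ifs with h <;> simp [h])
    refine (Halts.while_true (e := Prim.N) (T₁ := 3 * T + 36 + c)
      (T₂ := W - (3 * T + 40 + c) + 2) ?_
      ((Halts.seq (T₂ := T + 2) ((halts_scan hQ hb hU hsrc htgt hw hf hs hI hN).mono le_rfl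
        ?_)).mono (by omega) fun _ h => h)).mono ?_ fun _ h => h
    · change s.regs Prim.N ≠ 0
      rw [hN]
      exact hc.2.1 it (by simp)
    · rintro s₁ ⟨hs₁, st₁, nm₁, ky₁, ed₁, L₁, hI₁, hst₁⟩
      refine (Halts.call (R := fun r mem' => r = nameOrNil L₁.head? ∧
        (∀ a < 5 * m + 5 * n, mem' a = s₁.mem a) ∧ Rep mem' L₁) (T := T) ?_ ?_).mono ?_
        fun _ h => h
      · have ea : List.map (Expr.eval b s₁) [(Prim.q : Expr)] =
            (5 * m + 5 * n) :: Op.minimum.args := by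
          simp only [List.map, eval_rules, hs₁.q, Op.args]
        rw [ea]
        refine (hQ.returns .minimum s₁.mem _ hI₁.rep trivial).mono le_rfl ?_
        rintro r mem' ⟨hm, L', ⟨rfl, rfl⟩, hR⟩
        exact ⟨rfl, hm, hR⟩
      · rintro r mem₂ ⟨rfl, hm₂, hR₂⟩
        refine ih _ (by omega) (hs₁.update (by decide) _) ⟨fun a ha => (hm₂ a (by omega)).trans
          (hI₁.input a ha), hI₁.adjacent.congr fun a ha => hm₂ a (by omega), hI₁.view.congr hm₂,
          hR₂, hI₁.queue, hI₁.front⟩ (update_self Prim.N (nameOrNil L₁.head?) s₁.regs) ?_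
        have := hsum st₁ hst₁
        omega
      · have : (List.map Expr.cost [(Prim.q : Expr)]).sum = 1 := rfl
        omega
    · have : (Expr.reg Prim.N).cost = 1 := rfl
      omega

end

/-! ### The running time and the result of Prim's algorithm -/

/-- On a connected graph, Prim's algorithm finds a spanning tree that is grown by edges of least
weight after it is mapped by `f`, with `O(n + m)` operations of the queue. -/
theorem halts_prim {V : VEBCode} {b U n m T i j : ℕ} {M f : ℕ → ℕ}
    {Rep : (ℕ → ℕ) → List Item → Prop} (hQ : IsQueue V b U n (5 * m + 5 * n) f T Rep)
    (hnew : ∀ mem, (∀ a, 5 * m + 5 * n ≤ a → mem a = 0) →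
      Returns b V.new [5 * m + 5 * n, U, i, j] mem T (fun _ mem' =>
        (∀ a < 5 * m + 5 * n, mem' a = mem a) ∧ Rep mem' []))
    (hb : 5 * m + 5 * n + 3 < 2 ^ b) (hU : U < 2 ^ b) (hn : 0 < n)
    (hsrc : ∀ k < 2 * m, src M k < n) (htgt : ∀ k < 2 * m, tgt M k < n)
    (hw : ∀ k < 2 * m, wt M k ≤ U) (h0 : ∀ a, 3 * m ≤ a → M a = 0)
    (hf : ∀ x y, x ≤ y → y ≤ U → f x ≤ f y)
    (hconn : ∀ S : Set ℕ, 0 ∈ S → (∀ k < 2 * m, src M k ∈ S → tgt M k ∈ S) → ∀ v < n, v ∈ S) :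
    Halts b (Prim.prim V) ⟨argRegs [n, m, U, i, j], M⟩ (500 * (T + 1) * (n + m)) (fun s' =>
      ∃ ed : ℕ → ℕ, (∀ v < n, s'.mem (s'.regs Prim.edge + v) = ed v) ∧
        Grown M m f {v | v < n} {e | ∃ v < n, v ≠ 0 ∧ e = ed v}) := by
  obtain ⟨W, hW⟩ : ∃ W, W = n * (3 * T + 40) + 2 * m * (2 * T + 112) := ⟨_, rfl⟩
  refine (Halts.seq ((halts_layout hb).mono (T' := 35) (by decide) ?_)
    (T₂ := 6 + m * 100 + 3 * T + W + 40)).mono ?_ fun _ h => h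
  · rintro s₁ ⟨hs₁, hr₁, hm₁⟩
    refine (Halts.seq ((halts_adjacency hb hsrc hs₁ (hr₁ _ (by decide)) hm₁ h0).mono
      (T' := 6 + m * 100) ?_ ?_) (T₂ := 3 * T + W + 40)).mono (by omega) fun _ h => h
    · have : 4 + Prim.adjacencyStep.len ≤ 100 := by decide
      have := Nat.mul_le_mul_left m this
      omega
    rintro s₂ ⟨hs₂, hr₂, hM₂, hA₂, hz₂⟩
    refine (Halts.call_seq (T₁ := T) (T₂ := 2 * T + W + 30) (R := fun _ mem' =>
      (∀ a < 5 * m + 5 * n, mem' a = s₂.mem a) ∧ Rep mem' []) ?_ ?_).mono ?_ fun _ h => h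
    · have ea : List.map (Expr.eval b s₂) [(Prim.q : Expr), Prim.U, Prim.epsInt, Prim.epsFrac] =
          [5 * m + 5 * n, U, i, j] := by
        simp only [List.map, eval_rules, hs₂.q]
        rw [hr₂ _ (by decide), hr₂ _ (by decide), hr₂ _ (by decide), hr₁ _ (by decide),
          hr₁ _ (by decide), hr₁ _ (by decide)]
        rfl
      rw [ea]
      exact hnew s₂.mem fun a ha => hz₂ a (by omega)
    · rintro r₃ mem₃ ⟨hm₃, hR₃⟩
      have hs₃ : Laid n m (update s₂.regs Prim.N r₃) := hs₂.update (by decide) _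
      have hv₃ : View n m (update mem₃ (5 * m + n) 1) (update (fun _ => 0) 0 1) (fun _ => 0)
          (fun _ => 0) (fun _ => 0) := by
        refine View.update_status (u := 0) ⟨?_, ?_, ?_, ?_⟩ hn 1
        all_goals
          intro v hv
          rw [hm₃ _ (by omega), hz₂ _ (by omega)]
      have hrun : (Cmd.store Prim.status 1).run b ⟨update s₂.regs Prim.N r₃, mem₃⟩ =
          ⟨update s₂.regs Prim.N r₃, update mem₃ (5 * m + n) 1⟩ := by
        simp (disch := first | decide | omega) only [Cmd.run, eval_rules, eval_lit, hs₃.status]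
      refine (Halts.run_seq (c₁ := .store Prim.status 1) trivial <|
        Halts.call_seq (T₁ := T) (T₂ := T + W + 15) (R := fun r mem' =>
          (∀ a < 5 * m + 5 * n, mem' a = update mem₃ (5 * m + n) 1 a) ∧ Rep mem' [⟨r, 0, 0⟩])
          ?_ ?_).mono ?_ fun _ h => h
      · rw [hrun]
        have ea : List.map (Expr.eval b ⟨update s₂.regs Prim.N r₃, update mem₃ (5 * m + n) 1⟩)
            [(Prim.q : Expr), 0, 0] = (5 * m + 5 * n) :: (Op.insert 0 0).args := by
          simp (disch := omega) only [List.map, eval_rules, eval_lit, hs₃.q, Op.args]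
        rw [ea]
        refine (hQ.returns (.insert 0 0) _ [] (hQ.congr _ _ _ (fun a ha =>
          update_of_ne (by omega) _ _) hR₃) ⟨Nat.zero_le _, by omega, hn⟩).mono le_rfl ?_
        rintro r mem' ⟨hm, L', ⟨A, B, hAB, rfl⟩, hR⟩
        obtain ⟨rfl, rfl⟩ := List.append_eq_nil_iff.1 hAB.symm
        exact ⟨hm, hR⟩
      · rintro r₄ mem₄ ⟨hm₄, hR₄⟩
        rw [hrun]
        have hs₄ : Laid n m (update (update s₂.regs Prim.N r₃) Prim.N r₄) :=
          hs₃.update (by decide) _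
        have hrun₄ : (Cmd.store Prim.name Prim.N).run b
            ⟨update (update s₂.regs Prim.N r₃) Prim.N r₄, mem₄⟩ =
            ⟨update (update s₂.regs Prim.N r₃) Prim.N r₄, update mem₄ (5 * m + 2 * n) r₄⟩ := by
          simp only [Cmd.run, eval_rules, hs₄.name, update_self]
        have hv₄ : View n m (update mem₄ (5 * m + 2 * n) r₄) (update (fun _ => 0) 0 1)
            (update (fun _ => 0) 0 r₄) (update (fun _ => 0) 0 0) (fun _ => 0) := by
          have e : update (fun _ => 0) 0 0 = fun _ : ℕ => 0 := update_eq_self (0 : ℕ) (fun _ : ℕ => 0)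
          rw [e]
          exact (hv₃.congr hm₄).update_name hn r₄
        have hR₅ : Rep (update mem₄ (5 * m + 2 * n) r₄) [⟨r₄, 0, 0⟩] :=
          hQ.congr _ _ _ (fun a ha => update_of_ne (by omega) _ _) hR₄
        refine (Halts.run_seq (c₁ := .store Prim.name Prim.N) trivial <|
          Halts.call_seq (T₁ := T) (T₂ := W + 2) (R := fun r mem' => r = r₄ ∧
            (∀ a < 5 * m + 5 * n, mem' a = update mem₄ (5 * m + 2 * n) r₄ a) ∧
            Rep mem' [⟨r₄, 0, 0⟩]) ?_ ?_).mono ?_ fun _ h => h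
        · rw [hrun₄]
          have ea : List.map (Expr.eval b ⟨update (update s₂.regs Prim.N r₃) Prim.N r₄,
              update mem₄ (5 * m + 2 * n) r₄⟩) [(Prim.q : Expr)] =
              (5 * m + 5 * n) :: Op.minimum.args := by
            simp only [List.map, eval_rules, hs₄.q, Op.args]
          rw [ea]
          refine (hQ.returns .minimum _ _ hR₅ trivial).mono le_rfl ?_
          rintro r mem' ⟨hm, L', ⟨rfl, rfl⟩, hR⟩
          exact ⟨rfl, hm, hR⟩
        · rintro r mem₅ ⟨rfl, hm₅, hR₅⟩
          rw [hrun₄]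
          have hlow : ∀ a < 5 * m + n, mem₅ a = s₂.mem a := fun a ha => by
            rw [hm₅ a (by omega), update_of_ne (by omega), hm₄ a (by omega),
              update_of_ne (by omega), hm₃ a (by omega)]
          refine (halts_primLoop hQ hb hU hsrc htgt hw hf (W := W) (L := [⟨r, 0, 0⟩])
            (hs₄.update (by decide) _) ⟨fun a ha => (hlow a (by omega)).trans (hM₂ a ha),
              hA₂.congr hlow, hv₄.congr hm₅, hR₅,
              Queue.insert (A := []) (B := []) ⟨by simp, by simp⟩ hn (by simp),
              front_start hsrc (update_self ..) fun v _ hv0 => update_of_ne hv0 _ _⟩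
            (update_self Prim.N r (update (update s₂.regs Prim.N r₃) Prim.N r)) ?_).mono le_rfl ?_
          · have h₁ : ∑ v ∈ Finset.range n, (3 * T + 40 +
                (halfEdges M v (2 * m)).length * (2 * T + 112)) = W := by
              rw [Finset.sum_add_distrib, ← Finset.sum_mul, sum_length_halfEdges hsrc, hW]
              simp
            rw [← h₁]
            refine Finset.sum_le_sum fun v _ => ?_
            split_ifs
            · exact Nat.zero_le _
            · exact le_rfl
          · rintro s₆ ⟨hs₆, st, nm, ky, ed, hI⟩
            refine ⟨ed, fun v hv => ?_, hI.front.finish (fun v hv h1 => ?_) hn htgt hconn⟩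
            · rw [hs₆.edge, hI.view.edge v hv]
            · obtain ⟨it, hit, -⟩ := hI.queue.exists_item v hv h1
              exact absurd hit (by simp)
        · have : (List.map Expr.cost [(Prim.q : Expr)]).sum = 1 := rfl
          have : (Cmd.store Prim.name Prim.N).len = 3 := rfl
          omega
      · have : (List.map Expr.cost [(Prim.q : Expr), 0, 0]).sum = 3 := rfl
        have : (Cmd.store Prim.status 1).len = 3 := rfl
        omega
    · have : (List.map Expr.cost
        [(Prim.q : Expr), Prim.U, Prim.epsInt, Prim.epsFrac]).sum = 4 := rfl
      omega
  · have hT : T ≤ T * n := Nat.le_mul_of_pos_right T hn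
    have e₁ : 500 * (T + 1) * (n + m) = 500 * (T * n) + 500 * (T * m) + 500 * n + 500 * m := by
      ring
    have e₂ : W = 3 * (T * n) + 40 * n + 4 * (T * m) + 224 * m := by rw [hW]; ring
    omega

/-! ### The spanning tree found by Prim's algorithm -/

section

variable {n b U : ℕ} {ε : ℝ} {G : SimpleGraph (Fin n)} {w : Sym2 (Fin n) → ℕ}
  {es : List (Fin n × Fin n)}

theorem halfEdge_of_getElem? {i : ℕ} {p : Fin n × Fin n} (h : es[i]? = some p) :
    (src (input b es w U ε).mem (2 * i) = p.1 ∧ tgt (input b es w U ε).mem (2 * i) = p.2 ∧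
      wt (input b es w U ε).mem (2 * i) = w s(p.1, p.2)) ∧
    (src (input b es w U ε).mem (2 * i + 1) = p.2 ∧ tgt (input b es w U ε).mem (2 * i + 1) = p.1 ∧
      wt (input b es w U ε).mem (2 * i + 1) = w s(p.1, p.2)) := by
  have h₀ : (3 * i) / 3 = i ∧ (3 * i) % 3 = 0 := by omega
  have h₁ : (3 * i + 1) / 3 = i ∧ (3 * i + 1) % 3 = 1 := by omega
  have h₂ : (3 * i + 2) / 3 = i ∧ (3 * i + 2) % 3 = 2 := by omega
  have e₁ : 2 * i / 2 = i ∧ 2 * i % 2 = 0 ∧ (2 * i + 1) / 2 = i ∧ (2 * i + 1) % 2 = 1 ∧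
    (2 * i + 1 + 1) % 2 = 0 := by omega
  simp [src, tgt, wt, input, e₁, h₀, h₁, h₂, h]

theorem adj_of_getElem? (hes : IsEdgeList G es) {i : ℕ} {p : Fin n × Fin n}
    (h : es[i]? = some p) : G.Adj p.1 p.2 :=
  (hes.2 s(p.1, p.2)).1 (List.mem_map.2 ⟨p, List.mem_of_getElem? h, rfl⟩)

theorem exists_adj_of_halfEdge (hes : IsEdgeList G es) {k : ℕ} (hk : k < 2 * es.length) :
    ∃ u v : Fin n, G.Adj u v ∧ src (input b es w U ε).mem k = u ∧
      tgt (input b es w U ε).mem k = v ∧ wt (input b es w U ε).mem k = w s(u, v) ∧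
      ∃ p, es[k / 2]? = some p ∧ s(u, v) = s(p.1, p.2) := by
  obtain ⟨p, hp⟩ : ∃ p, es[k / 2]? = some p := ⟨_, List.getElem?_eq_getElem (by omega)⟩
  obtain ⟨h₁, h₂⟩ := halfEdge_of_getElem? (b := b) (U := U) (ε := ε) (w := w) hp
  have hadj := adj_of_getElem? hes hp
  rcases Nat.mod_two_eq_zero_or_one k with h | h
  · rw [show 2 * (k / 2) = k by omega] at h₁
    exact ⟨p.1, p.2, hadj, h₁.1, h₁.2.1, h₁.2.2, p, hp, rfl⟩
  · rw [show 2 * (k / 2) + 1 = k by omega] at h₂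
    exact ⟨p.2, p.1, hadj.symm, h₂.1, h₂.2.1, by rw [h₂.2.2, Sym2.eq_swap], p, hp, Sym2.eq_swap⟩

theorem exists_halfEdge_of_adj (hes : IsEdgeList G es) {u v : Fin n} (h : G.Adj u v) :
    ∃ k < 2 * es.length, src (input b es w U ε).mem k = u ∧ tgt (input b es w U ε).mem k = v ∧
      wt (input b es w U ε).mem k = w s(u, v) := by
  obtain ⟨p, hp, he⟩ := List.mem_map.1 ((hes.2 s(u, v)).2 h)
  obtain ⟨i, hi, rfl⟩ := List.getElem_of_mem hp
  obtain ⟨h₁, h₂⟩ := halfEdge_of_getElem? (b := b) (U := U) (ε := ε) (w := w)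
    (List.getElem?_eq_getElem hi)
  rw [← he]
  rcases Sym2.eq_iff.1 he with ⟨rfl, rfl⟩ | ⟨rfl, rfl⟩
  · exact ⟨2 * i, by omega, h₁⟩
  · exact ⟨2 * i + 1, by omega, h₂⟩

theorem forall_mem_of_connected (hG : G.Connected) (hes : IsEdgeList G es) (S : Set ℕ)
    (h0 : 0 ∈ S) (hS : ∀ k < 2 * es.length, src (input b es w U ε).mem k ∈ S →
      tgt (input b es w U ε).mem k ∈ S) (v : ℕ) (hv : v < n) : v ∈ S := by
  obtain ⟨p⟩ := hG.preconnected ⟨0, by omega⟩ ⟨v, hv⟩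
  have key : ∀ x y : Fin n, G.Walk x y → (x : ℕ) ∈ S → (y : ℕ) ∈ S := by
    intro x y p
    induction p with
    | nil => exact id
    | cons h p ih =>
      intro hx
      obtain ⟨k, hk, e₁, e₂, -⟩ := exists_halfEdge_of_adj (b := b) (U := U) (ε := ε) (w := w) hes h
      refine ih ?_
      rw [← e₂]
      exact hS k hk (e₁ ▸ hx)
  exact key _ _ p h0

theorem length_le_of_isEdgeList (hes : IsEdgeList G es) : es.length ≤ n * n := by
  have := List.Nodup.length_le_card (List.Nodup.of_map _ hes.1)
  simpa using this

/-- The choice of edges that are least after they are mapped by `f` costs at most a factor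
`1 + ε`. -/
theorem Grown.exists_isGoodTree {f : ℕ → ℕ} (hε : 0 < ε) (hf : PreservesOrder f U ε)
    (hw : ∀ e ∈ G.edgeSet, w e ≤ U) (hes : IsEdgeList G es) {r : Fin n} (hr : (r : ℕ) = 0)
    {S X : Set ℕ} (h : Grown (input b es w U ε).mem es.length f S X) :
    ∃ (S' : Finset (Fin n)) (F : Finset (Sym2 (Fin n))), (∀ v : Fin n, (v : ℕ) ∈ S ↔ v ∈ S') ∧
      (∀ e, e ∈ F ↔ ∃ i ∈ X, ∃ p, es[i]? = some p ∧ e = s(p.1, p.2)) ∧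
      IsGoodTree G w ε r S' F := by
  induction h with
  | start =>
    refine ⟨{r}, ∅, fun v => ?_, by simp, isGoodTree_singleton r⟩
    simp [Fin.ext_iff, hr]
  | @step S X k h hk hs ht hmin ih =>
    obtain ⟨S', F, hS, hF, hgood⟩ := ih
    obtain ⟨u, v, hadj, e₁, e₂, e₃, p, hp, he⟩ :=
      exists_adj_of_halfEdge (b := b) (U := U) (ε := ε) (w := w) hes hk
    rw [e₁, hS] at hs
    rw [e₂, hS] at ht
    refine ⟨insert v S', insert s(u, v) F, fun x => ?_, fun e => ?_,
      hgood.insert hε hadj hs ht fun x y hxy hx hy => ?_⟩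
    · rw [e₂, Set.mem_insert_iff, Finset.mem_insert, hS, Fin.val_inj]
    · rw [Finset.mem_insert, hF]
      constructor
      · rintro (rfl | ⟨i, hi, p', hp', rfl⟩)
        · exact ⟨k / 2, Or.inl rfl, p, hp, he⟩
        · exact ⟨i, Or.inr hi, p', hp', rfl⟩
      · rintro ⟨i, rfl | hi, p', hp', rfl⟩
        · rw [hp] at hp'
          obtain rfl := Option.some.inj hp'
          exact Or.inl he.symm
        · exact Or.inr ⟨i, hi, p', hp', rfl⟩
    · obtain ⟨k', hk', e₄, e₅, e₆⟩ :=
        exists_halfEdge_of_adj (b := b) (U := U) (ε := ε) (w := w) hes hxy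
      have hle := hmin k' hk' (by rw [e₄, hS]; exact hx) (by rw [e₅, hS]; exact hy)
      rw [e₃, e₆] at hle
      by_contra hlt
      rw [not_le] at hlt
      have h0 : (0 : ℝ) ≤ w s(x, y) := Nat.cast_nonneg _
      have hlt' : w s(x, y) < w s(u, v) := by
        have : (w s(x, y) : ℝ) < w s(u, v) := by nlinarith
        exact_mod_cast this
      exact absurd (hf.2 _ _ hlt' (hw _ hadj) hlt.le) (not_lt.2 hle)

/-- The steps of Prim's algorithm in terms of the time per operation of the queue. The first
`5 * (m + n)` cells are taken by the input and the arrays, and the queue begins after them. -/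
theorem primSolves {V : VEBCode} {C : ℝ} (hV : IsApproxVEB V 20 C) (hε : 0 < ε)
    (hb : (n + U + 2) ^ 20 ≤ 2 ^ b) (hG : G.Connected) (hw : ∀ e ∈ G.edgeSet, w e ≤ U)
    (hes : IsEdgeList G es) :
    PrimSolves V b G w es U ε (500 * (C * vebTime b U ε + 1) * ((n : ℝ) + es.length)) := by
  have hn : 0 < n := Fin.pos_iff_nonempty.2 hG.nonempty
  have hlen := length_le_of_isEdgeList hes
  have hsq : (n + U + 2) * (n + U + 2) * 2 ^ 18 ≤ 2 ^ b := by
    refine le_trans ?_ hb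
    rw [show (20 : ℕ) = 2 + 18 from rfl, pow_add, sq]
    exact Nat.mul_le_mul_left _ (Nat.pow_le_pow_left (by omega) 18)
  have hU : U < 2 ^ b := by nlinarith
  have hq : 2 * (5 * es.length + 5 * n) ≤ 2 ^ b := by nlinarith
  have hb' : 5 * es.length + 5 * n + 3 < 2 ^ b := by nlinarith
  obtain ⟨f, hf, hV⟩ := hV b U ε hε
  obtain ⟨Rep, h₁, h₂, h₃, h₄⟩ := hV n (5 * es.length + 5 * n) hb hq
  have hC : 0 ≤ C * vebTime b U ε := by
    obtain ⟨t, _, _, -, ht, -⟩ := h₃ (fun _ => 0) fun _ _ => rfl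
    exact (Nat.cast_nonneg t).trans ht
  have hQ : IsQueue V b U n (5 * es.length + 5 * n) f ⌊C * vebTime b U ε⌋₊ Rep := by
    refine ⟨h₁, h₂, fun op mem L hL hop => ?_⟩
    obtain ⟨t, r, mem', L', hr, ht, hm, he, hR⟩ := h₄ op mem L hL hop
    exact .of_runs hr (Nat.le_floor ht) ⟨hm, L', he, hR⟩
  have hhalf := fun k hk => exists_adj_of_halfEdge (b := b) (U := U) (ε := ε) (w := w) hes (k := k) hk
  obtain ⟨t, s, hexec, ht, ed, hed, hgrown⟩ := halts_prim (M := (input b es w U ε).mem)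
    (i := intWord b ε) (j := fracWord b ε) hQ (fun mem hmem => by
      obtain ⟨t, r, mem', hr, ht, hm, hR⟩ := h₃ mem hmem
      exact .of_runs hr (Nat.le_floor ht) ⟨hm, hR⟩) hb' hU hn
    (fun k hk => by obtain ⟨u, v, -, e, -⟩ := hhalf k hk; rw [e]; exact u.2)
    (fun k hk => by obtain ⟨u, v, -, -, e, -⟩ := hhalf k hk; rw [e]; exact v.2)
    (fun k hk => by obtain ⟨u, v, h, -, -, e, -⟩ := hhalf k hk; rw [e]; exact hw _ h)
    (fun a ha => by
      have : es[a / 3]? = none := List.getElem?_eq_none (by omega)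
      simp only [input, this])
    hf.1 (forall_mem_of_connected hG hes)
  refine ⟨t, s, hexec, ?_, ?_⟩
  · refine (Nat.cast_le.2 ht).trans ?_
    push_cast
    have := Nat.floor_le hC
    gcongr
  · obtain ⟨S', F, hS, hF, hgood⟩ := hgrown.exists_isGoodTree hε hf hw hes (r := ⟨0, hn⟩) rfl
    obtain rfl : S' = Finset.univ := by
      ext v
      simp [← hS, v.2]
    have : outputTree es s = SimpleGraph.fromEdgeSet (F : Set (Sym2 (Fin n))) := by
      rw [outputTree]
      congr 1
      ext e
      rw [Finset.mem_coe, hF]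
      constructor
      · rintro ⟨v, p, hv, hp, rfl⟩
        rw [hed v v.2] at hp
        exact ⟨ed v, ⟨v, v.2, hv, rfl⟩, p, hp, rfl⟩
      · rintro ⟨_, ⟨v, hvn, hv, rfl⟩, p, hp, rfl⟩
        exact ⟨⟨v, hvn⟩, p, hv, by rw [hed v hvn]; exact hp, rfl⟩
    rw [this]
    exact hgood.isApproxMST hε

end

/-! ### Estimates of the running time -/

theorem IsApproxVEB.mono {V : VEBCode} {κ : ℕ} {C C' : ℝ} (h : IsApproxVEB V κ C) (hC : C ≤ C') :
    IsApproxVEB V κ C' := by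
  intro b U ε hε
  have hv : C * vebTime b U ε ≤ C' * vebTime b U ε :=
    mul_le_mul_of_nonneg_right hC
      ((Real.log_nonneg (by norm_num)).trans (log_two_le_vebTime hε))
  obtain ⟨f, hf, h⟩ := h b U ε hε
  refine ⟨f, hf, fun n q hb hq => ?_⟩
  obtain ⟨Rep, h₁, h₂, h₃, h₄⟩ := h n q hb hq
  refine ⟨Rep, h₁, h₂, fun mem hm => ?_, fun op mem L hL hop => ?_⟩
  · obtain ⟨t, r, mem', hr, ht, h⟩ := h₃ mem hm
    exact ⟨t, r, mem', hr, ht.trans hv, h⟩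
  · obtain ⟨t, r, mem', L', hr, ht, h⟩ := h₄ op mem L hL hop
    exact ⟨t, r, mem', L', hr, ht.trans hv, h⟩

theorem two_le_log_add_sixteen (n U : ℕ) : 2 ≤ Real.log ((n : ℝ) * U + 16) := by
  have h₁ : Real.log 16 ≤ Real.log ((n : ℝ) * U + 16) := by
    have : (0 : ℝ) ≤ (n : ℝ) * U := by positivity
    exact Real.log_le_log (by norm_num) (by linarith)
  have h₂ : Real.log 16 = 4 * Real.log 2 := by
    rw [show (16 : ℝ) = 2 ^ 4 by norm_num, Real.log_pow]; norm_num
  have := Real.log_two_gt_d9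
  linarith

theorem half_le_log_log (n U : ℕ) : 1 / 2 ≤ Real.log (Real.log ((n : ℝ) * U + 16)) := by
  have := Real.log_le_log (by norm_num) (two_le_log_add_sixteen n U)
  have := Real.log_two_gt_d9
  linarith

theorem mul_add_sixteen_le (n U : ℕ) : n * U + 16 ≤ (n + U + 2) ^ 20 := by
  have h₁ : n * U + 4 ≤ (n + U + 2) ^ 2 := by nlinarith [Nat.zero_le (n * U)]
  have h₂ : 4 ≤ (n + U + 2) ^ 18 :=
    le_trans (by norm_num) (Nat.pow_le_pow_left (by omega : 2 ≤ n + U + 2) 18)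
  rw [show (20 : ℕ) = 2 + 18 from rfl, pow_add]
  have h₃ := Nat.mul_le_mul h₁ h₂
  omega

/-- As a word has at least `log (n * U)` bits, the operations of the queue are fast enough. -/
theorem vebTime_le {n U b : ℕ} {ε : ℝ} (hε : 0 < ε) (hn : 0 < n)
    (hb : (n + U + 2) ^ 20 ≤ 2 ^ b) :
    vebTime b U ε ≤
      2 * Real.log (2 + Real.log (1 + 1 / ε) / Real.log (Real.log ((n : ℝ) * U + 16))) := by
  have hlogb : ∀ x : ℕ, 0 < x → x ≤ 2 ^ b → Real.log x ≤ b := by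
    intro x hx h
    have h₁ : Real.log x ≤ Real.log ((2 : ℝ) ^ b) :=
      Real.log_le_log (by exact_mod_cast hx) (by exact_mod_cast h)
    rw [Real.log_pow] at h₁
    have := Real.log_two_lt_d9
    nlinarith [Nat.cast_nonneg (α := ℝ) b]
  have hU : Real.log (2 + U) ≤ b := by
    have := hlogb (2 + U) (by omega) (le_trans (by omega)
      ((Nat.le_self_pow (by norm_num) (n + U + 2)).trans hb))
    push_cast at this
    exact this
  have hnU : Real.log ((n : ℝ) * U + 16) ≤ b := by
    have := hlogb (n * U + 16) (by omega) ((mul_add_sixteen_le n U).trans hb)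
    push_cast at this
    exact this
  have hL := two_le_log_add_sixteen n U
  have hLL := half_le_log_log n U
  have hb0 : (0 : ℝ) ≤ b := Nat.cast_nonneg b
  have hℓ : 0 ≤ Real.log (2 + U) := Real.log_nonneg (by linarith [Nat.cast_nonneg (α := ℝ) U])
  have hbb : Real.log (Real.log ((n : ℝ) * U + 16)) ≤ Real.log (2 + b) :=
    Real.log_le_log (by linarith) (by linarith)
  have he : 0 ≤ Real.log (1 + 1 / ε) := Real.log_nonneg (by
    have : 0 < 1 / ε := by positivity
    linarith)
  set y := Real.log (1 + 1 / ε) / Real.log (Real.log ((n : ℝ) * U + 16)) with hy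
  have hy0 : 0 ≤ y := div_nonneg he (by linarith)
  -- The part of the numerator that depends on `U` is at most the denominator.
  have h₁ : Real.log (2 + Real.log (2 + U) / ε) ≤
      Real.log (2 + b) + Real.log (1 + 1 / ε) := by
    have hε' : 0 < 1 / ε := by positivity
    rw [← Real.log_mul (by positivity) (by positivity)]
    refine Real.log_le_log (by positivity) ?_
    rw [div_eq_mul_one_div]
    nlinarith
  have h₂ : Real.log (2 + Real.log (2 + U) / ε) / Real.log (2 + b) ≤ 1 + y := by
    have hpos : 0 < Real.log (2 + b) := by linarith
    rw [div_le_iff₀ hpos]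
    refine h₁.trans ?_
    have : Real.log (1 + 1 / ε) ≤ y * Real.log (2 + b) := by
      rw [hy, div_mul_eq_mul_div, le_div_iff₀ (by linarith)]
      exact mul_le_mul_of_nonneg_left hbb he
    linarith
  have h₃ : 0 ≤ Real.log (2 + Real.log (2 + U) / ε) / Real.log (2 + b) :=
    div_nonneg (Real.log_nonneg (by
      have : 0 ≤ Real.log (2 + U) / ε := by positivity
      linarith)) (by linarith)
  rw [vebTime, show (2 : ℝ) * Real.log (2 + y) = Real.log ((2 + y) ^ 2) by
    rw [Real.log_pow]; norm_num]
  exact Real.log_le_log (by linarith) (by nlinarith)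

theorem time_le {n U b m : ℕ} {ε C : ℝ} (hC : 0 ≤ C) (hε : 0 < ε) (hn : 0 < n)
    (hb : (n + U + 2) ^ 20 ≤ 2 ^ b) :
    500 * (C * vebTime b U ε + 1) * ((n : ℝ) + m) ≤ 1500 * (C + 1) * ((n : ℝ) + m) *
      Real.log (2 + Real.log (1 + 1 / ε) / Real.log (Real.log ((n : ℝ) * U + 16))) := by
  have h := vebTime_le hε hn hb
  have h₂ := log_two_le_vebTime (b := b) (U := U) hε
  have h₃ := Real.log_two_gt_d9
  set t := Real.log (2 + Real.log (1 + 1 / ε) / Real.log (Real.log ((n : ℝ) * U + 16)))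
  have hnm : (0 : ℝ) ≤ (n : ℝ) + m := by positivity
  have h₄ : 500 * (C * vebTime b U ε + 1) ≤ 1500 * (C + 1) * t := by
    nlinarith [mul_le_mul_of_nonneg_left h hC]
  calc _ ≤ 1500 * (C + 1) * t * ((n : ℝ) + m) := mul_le_mul_of_nonneg_right h₄ hnm
    _ = _ := by ring

/-- If `1 / ε` is polylogarithmic in `n * U`, the time per edge is bounded. -/
theorem log_le_of_polylog {n U c : ℕ} {ε : ℝ} (hε : 0 < ε)
    (h : 1 / ε ≤ c * (1 + Real.log ((n : ℝ) * U + 1)) ^ c) :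
    Real.log (2 + Real.log (1 + 1 / ε) / Real.log (Real.log ((n : ℝ) * U + 16))) ≤
      Real.log (2 + 4 * c) := by
  have hL := two_le_log_add_sixteen n U
  have hLL := half_le_log_log n U
  have hnU : (0 : ℝ) ≤ (n : ℝ) * U := by positivity
  have h₁ : Real.log ((n : ℝ) * U + 1) ≤ Real.log ((n : ℝ) * U + 16) :=
    Real.log_le_log (by linarith) (by linarith)
  have h₀ : 0 ≤ Real.log ((n : ℝ) * U + 1) := Real.log_nonneg (by linarith)
  set L := Real.log ((n : ℝ) * U + 16)
  have hε' : 0 < 1 / ε := by positivity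
  have hc : (0 : ℝ) ≤ c := Nat.cast_nonneg c
  have h₂ : 1 + 1 / ε ≤ (1 + c) * (L ^ 2) ^ c := by
    have h₃ : (1 + Real.log ((n : ℝ) * U + 1)) ^ c ≤ (L ^ 2) ^ c :=
      pow_le_pow_left₀ (by linarith) (by nlinarith) c
    have h₄ : 1 ≤ (L ^ 2) ^ c := one_le_pow₀ (by nlinarith)
    nlinarith [mul_le_mul_of_nonneg_left h₃ hc]
  have h₅ : Real.log (1 + 1 / ε) ≤ c + c * (2 * Real.log L) := by
    refine (Real.log_le_log (by linarith) h₂).trans ?_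
    rw [Real.log_mul (by positivity) (by positivity), Real.log_pow, Real.log_pow]
    have := Real.log_le_sub_one_of_pos (show (0 : ℝ) < 1 + c by linarith)
    push_cast
    linarith
  have h₆ : Real.log (1 + 1 / ε) / Real.log L ≤ 4 * c := by
    rw [div_le_iff₀ (by linarith)]
    nlinarith
  have h₇ : 0 ≤ Real.log (1 + 1 / ε) / Real.log L :=
    div_nonneg (Real.log_nonneg (by linarith)) (by linarith)
  exact Real.log_le_log (by linarith) (by linarith)

end WordRAM

theorem theorem1 :
    ∃ (V : VEBCode) (κ : ℕ) (C : ℝ), IsApproxVEB V κ C ∧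
      (∀ (n U b : ℕ) (ε : ℝ) (G : SimpleGraph (Fin n)) (w : Sym2 (Fin n) → ℕ)
        (es : List (Fin n × Fin n)),
        0 < ε → (n + U + 2) ^ κ ≤ 2 ^ b → G.Connected → (∀ e ∈ G.edgeSet, w e ≤ U) →
        IsEdgeList G es →
        PrimSolves V b G w es U ε (C * ((n : ℝ) + es.length) *
          Real.log (2 + Real.log (1 + 1 / ε) / Real.log (Real.log ((n : ℝ) * U + 16))))) ∧
      (∀ c : ℕ, ∃ C' : ℝ, ∀ (n U b : ℕ) (ε : ℝ) (G : SimpleGraph (Fin n))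
        (w : Sym2 (Fin n) → ℕ) (es : List (Fin n × Fin n)),
        0 < ε → (n + U + 2) ^ κ ≤ 2 ^ b → G.Connected → (∀ e ∈ G.edgeSet, w e ≤ U) →
        IsEdgeList G es → 1 / ε ≤ c * (1 + Real.log ((n : ℝ) * U + 1)) ^ c →
        PrimSolves V b G w es U ε (C' * ((n : ℝ) + es.length))) := by
  have hC : 0 ≤ vebConst := by unfold vebConst; positivity
  have solves : ∀ (n U b : ℕ) (ε : ℝ) (G : SimpleGraph (Fin n)) (w : Sym2 (Fin n) → ℕ)
      (es : List (Fin n × Fin n)), 0 < ε → (n + U + 2) ^ 20 ≤ 2 ^ b → G.Connected →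
      (∀ e ∈ G.edgeSet, w e ≤ U) → IsEdgeList G es →
      PrimSolves vebCode b G w es U ε (1500 * (vebConst + 1) * ((n : ℝ) + es.length) *
        Real.log (2 + Real.log (1 + 1 / ε) / Real.log (Real.log ((n : ℝ) * U + 16)))) := by
    intro n U b ε G w es hε hb hG hw hes
    obtain ⟨t, s, h₁, h₂, h₃⟩ := primSolves isApproxVEB_vebCode hε hb hG hw hes
    exact ⟨t, s, h₁, h₂.trans (time_le hC hε (Fin.pos_iff_nonempty.2 hG.nonempty) hb), h₃⟩
  refine ⟨vebCode, 20, 1500 * (vebConst + 1), isApproxVEB_vebCode.mono (by linarith), solves,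
    fun c => ⟨1500 * (vebConst + 1) * Real.log (2 + 4 * c), ?_⟩⟩
  intro n U b ε G w es hε hb hG hw hes hc
  obtain ⟨t, s, h₁, h₂, h₃⟩ := solves n U b ε G w es hε hb hG hw hes
  refine ⟨t, s, h₁, h₂.trans ?_, h₃⟩
  rw [mul_right_comm]
  have hlog := log_le_of_polylog hε hc
  gcongr
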